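/- Let $(M,\sigma)$ be a compact connected Klein surface, that is, a compact connected Riemann surface $M$ with an anti-holomorphic involution $\sigma$, and let $\Sigma=\mathrm{Gal}(\mathbb{C}/\mathbb{R})=\{1,\sigma\}$ act on $M$ through $\sigma$. Let $E$ be a smooth Hermitian vector bundle of rank $r\ge 1$ and degree $d$ on $M$, and let $\tau:E\to E$ be a smooth fibrewise $\mathbb{C}$-antilinear isometry covering $\sigma$ with $\tau^2=c\,\mathrm{Id}_E$, where $c=+1$ (Real case) or $c=-1$ (Quaternionic case). Let $(L,\tau_L)$ be any smooth Real line bundle of degree $d$ on $(M,\sigma)$ with a $\tau_L$-invariant Hermitian metric, let $q:S(L)\to M$ be its unit circle bundle, on which $\Sigma$ acts through $\tau_L$, and let $\pi_1(S(L)_\Sigma)$ be the fundamental group of the homotopy quotient $S(L)_\Sigma=S(L)\times_\Sigma E\Sigma$, based at the image of a point $(\bar x,e)\in S(L)\times E\Sigma$; put $x=q(\bar x)$. A path from $(\bar x,e)$ to $\lambda^{-1}(\bar x,e)$ in $S(L)\times E\Sigma$, with $\lambda\in\Sigma$, defines an element of $\pi_1(S(L)_\Sigma)$, every element is of this form, and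 $\lambda$ is its image under the augmentation $\pi_1(S(L)_\Sigma)\to\Sigma$. Let $\mathbb{Z}\to\pi_1(S(L)_\Sigma)$ be the map induced by the loop $t\mapsto e^{2\pi i t}\bar x$ in the fibre of $S(L)$. Let $\mathbf{U}(r)\times_c\Sigma$ be the set $\mathbf{U}(r)\times\Sigma$ with the group law $(g_1,\lambda_1)(g_2,\lambda_2)=(c(\lambda_1,\lambda_2)^{-1}g_1\lambda_1(g_2),\lambda_1\lambda_2)$, where $\sigma(g)=\overline{g}$, $c(\sigma,\sigma)=c$ and $c(\lambda_1,\lambda_2)=1$ otherwise. Call a unitary connection $A$ on $E$ Galois-invariant if its covariant derivative commutes with the action of $\tau$ on sections and $1$-forms, and projectively flat if $F_A=\kappa\,\mathrm{Id}_E$ for a $2$-form $\kappa$ on $M$. Given a unitary frame $E_x\simeq\mathbb{C}^r$, a piecewise $C^1$ path $\gamma$ in $M$ from $x$ to $\lambda^{-1}(x)$ and a Galois-invariant $A$, the extended holonomy of $A$ along $(\gamma,\lambda)$ is $(g_\gamma,\lambda)\in\mathbf{U}(r)\times_c\Sigma$, where $g_\gamma$ is the matrix with $(\tau_\lambda\circ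 T^A_\gamma)(v)=g_\gamma v$ if $\lambda=1$ and $(\tau_\lambda\circ T^A_\gamma)(v)=g_\gamma\overline{v}$ if $\lambda=\sigma$; here $T^A_\gamma$ is the parallel transport, $\tau_1=\mathrm{Id}$ and $\tau_\sigma=\tau$. Then, for every $\kappa$, the extended holonomy induces, for each unitary frame of $E_x$ and each Galois-invariant unitary connection $A$ with $F_A=\kappa\,\mathrm{Id}_E$, a group homomorphism $\chi_A:\pi_1(S(L)_\Sigma)\to\mathbf{U}(r)\times_c\Sigma$ as follows. There is a function $z$ with values in $S^1$ on the set of paths from $(\bar x,e)$ to a point $\lambda^{-1}(\bar x,e)$, $\lambda\in\Sigma$, which does not depend on $A$ or on the frame, such that for all $A$ and all frames: (1) $\chi_A$ is a homomorphism of $\Sigma$-augmentations, i.e. it is compatible with the projections to $\Sigma$; (2) $\chi_A(n)=(\exp(\tfrac{2\pi i n}{r})I_r,1)$ for all $n\in\mathbb{Z}$; (3) for each such path $\eta$ whose projection $\gamma$ to $M$ is piecewise $C^1$, $\chi_A([\eta])=(z(\eta)\,g_\gamma,\lambda)$, where $(g_\gamma,\lambda)$ is the extended holonomy of $A$ along $(\gamma,\lambda)$.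 Moreover the $\mathbf{U}(r)$-conjugacy class of $\chi_A$ depends only on the $\tau$-unitary gauge orbit of $A$: if $A'=u\cdot A$ for a smooth unitary automorphism $u$ of $E$ commuting with $\tau$, then, whatever the unitary frames used for $A$ and $A'$, there is $h\in\mathbf{U}(r)$ with $\chi_{A'}=(h,1)\,\chi_A\,(h,1)^{-1}$. -/

import Mathlib

open scoped Manifold ContDiff
open Bundle Set

noncomputable section

namespace RealNS

/-! ### The extended unitary group

The group `Σ = Gal(ℂ/ℝ)` is written as `ℤˣ = {1, -1}`, with `-1` for complex conjugation `σ`. -/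

/-- The unitary group `U(r)`. -/
abbrev U (r : ℕ) : Type := Matrix.unitaryGroup (Fin r) ℂ

/-- Entrywise complex conjugation on `U(r)`. -/
def conjU (r : ℕ) : U r →* U r where
  toFun u := ⟨(u : Matrix (Fin r) (Fin r) ℂ).map (starRingEnd ℂ), by
    have h := Matrix.mem_unitaryGroup_iff.1 u.2
    rw [Matrix.mem_unitaryGroup_iff]
    have h2 := congrArg (fun m => m.map (starRingEnd ℂ)) h
    simp only [Matrix.map_mul] at h2
    rw [Matrix.map_one _ (map_zero _) (map_one _)] at h2
    rw [← h2]
    rfl⟩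
  map_one' := Subtype.ext (by
    exact Matrix.map_one (starRingEnd ℂ) (map_zero _) (map_one _))
  map_mul' u v := Subtype.ext (Matrix.map_mul (f := starRingEnd ℂ))

theorem conjU_conjU (r : ℕ) (u : U r) : conjU r (conjU r u) = u := by
  ext i j
  simp [conjU]

theorem conjU_neg (r : ℕ) (u : U r) : conjU r (-u) = -conjU r u := by
  apply Subtype.ext
  ext i j
  exact map_neg (starRingEnd ℂ) ((u : Matrix (Fin r) (Fin r) ℂ) i j)

/-- The action of `Σ` on `U(r)`: `σ(u)` is the complex conjugate of `u`. -/
def galU (r : ℕ) (s : ℤˣ) : U r →* U r := if s = 1 then MonoidHom.id _ else conjU r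

/-- The normalized `2`-cocycle `Σ × Σ → {±1} ⊂ Z(U(r))` with value `c` at `(σ, σ)`. -/
def cocycle (r : ℕ) (c s t : ℤˣ) : U r := if s = -1 ∧ t = -1 ∧ c = -1 then -1 else 1

/-- The underlying set `U(r) × Σ` of the extended unitary group `U(r) ×_c Σ`. -/
@[ext]
structure ExtUnitary (r : ℕ) (c : ℤˣ) where
  /-- the unitary component -/
  mat : U r
  /-- the augmentation, i.e. the component in `Σ` -/
  sgn : ℤˣ

namespace ExtUnitary

variable {r : ℕ} {c : ℤˣ}

/-- `(c(s,t), 1) (g, s) (h, t) = (g s(h), s t)`. -/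
instance : Mul (ExtUnitary r c) :=
  ⟨fun a b => ⟨(cocycle r c a.sgn b.sgn)⁻¹ * (a.mat * galU r a.sgn b.mat), a.sgn * b.sgn⟩⟩

instance : One (ExtUnitary r c) := ⟨⟨1, 1⟩⟩

instance : Inv (ExtUnitary r c) :=
  ⟨fun a => ⟨cocycle r c a.sgn a.sgn * galU r a.sgn a.mat⁻¹, a.sgn⟩⟩

theorem mul_def (a b : ExtUnitary r c) :
    a * b = ⟨(cocycle r c a.sgn b.sgn)⁻¹ * (a.mat * galU r a.sgn b.mat), a.sgn * b.sgn⟩ := rfl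

theorem one_def : (1 : ExtUnitary r c) = ⟨1, 1⟩ := rfl

theorem inv_def (a : ExtUnitary r c) :
    a⁻¹ = ⟨cocycle r c a.sgn a.sgn * galU r a.sgn a.mat⁻¹, a.sgn⟩ := rfl

instance : Group (ExtUnitary r c) :=
  Group.ofLeftAxioms
    (by
      rintro ⟨x, s⟩ ⟨y, t⟩ ⟨z, w⟩
      have hn : (-1 : U r)⁻¹ = -1 := by rw [inv_eq_iff_mul_eq_one]; simp
      rcases Int.units_eq_one_or c with rfl | rfl <;>
      rcases Int.units_eq_one_or s with rfl | rfl <;>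
      rcases Int.units_eq_one_or t with rfl | rfl <;>
      rcases Int.units_eq_one_or w with rfl | rfl <;>
      simp [mul_def, cocycle, galU, mul_assoc, conjU_conjU, hn, conjU_neg])
    (by
      rintro ⟨x, s⟩
      simp [mul_def, one_def, cocycle, galU])
    (by
      rintro ⟨x, s⟩
      have hn : (-1 : U r)⁻¹ = -1 := by rw [inv_eq_iff_mul_eq_one]; simp
      rcases Int.units_eq_one_or c with rfl | rfl <;>
      rcases Int.units_eq_one_or s with rfl | rfl <;>
      simp [mul_def, one_def, inv_def, cocycle, galU, hn])

end ExtUnitary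

/-- The scalar matrix `z I_r`. -/
def scalarU (r : ℕ) (z : Circle) : U r :=
  ⟨(z : ℂ) • (1 : Matrix (Fin r) (Fin r) ℂ), by
    rw [Matrix.mem_unitaryGroup_iff]
    simp [smul_smul, ← Circle.coe_inv_eq_conj]⟩

/-! ### Homotopy quotients and orbifold fundamental groups -/

/-- The infinite sphere, as a model of the contractible free `Σ`-space `EΣ`; the group `Σ` acts
by multiplication by `±1`. -/
abbrev SInf : Type := Metric.sphere (0 : lp (fun _ : ℕ => ℝ) 2) 1

section HomotopyQuotient

variable {X : Type*} (τ : X → X) (hτ : Function.Involutive τ)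

/-- The diagonal action of `Σ` on `X × EΣ`, for the action on `X` given by the involution `τ`. -/
def diagAct (s : ℤˣ) (p : X × SInf) : X × SInf := if s = 1 then p else (τ p.1, -p.2)

/-- The orbit relation of the diagonal action of `Σ` on `X × EΣ`. -/
def orbitSetoid : Setoid (X × SInf) where
  r p q := ∃ s : ℤˣ, diagAct τ s p = q
  iseqv :=
    { refl := fun p => ⟨1, by simp [diagAct]⟩
      symm := by
        rintro p q ⟨s, rfl⟩
        refine ⟨s, ?_⟩
        rcases Int.units_eq_one_or s with rfl | rfl <;> simp [diagAct, hτ p.1]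
      trans := by
        rintro p q w ⟨s, rfl⟩ ⟨t, rfl⟩
        refine ⟨t * s, ?_⟩
        rcases Int.units_eq_one_or s with rfl | rfl <;>
        rcases Int.units_eq_one_or t with rfl | rfl <;> simp [diagAct, hτ p.1] }

/-- The homotopy quotient `X_Σ = X ×_Σ EΣ`. -/
def HomotopyQuotient : Type _ := Quotient (orbitSetoid τ hτ)

variable [TopologicalSpace X]

instance : TopologicalSpace (HomotopyQuotient τ hτ) :=
  inferInstanceAs (TopologicalSpace (Quotient (orbitSetoid τ hτ)))

/-- The projection `X × EΣ → X_Σ`. -/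
def toQuot : C(X × SInf, HomotopyQuotient τ hτ) where
  toFun p := Quotient.mk (orbitSetoid τ hτ) p
  continuous_toFun := continuous_quotient_mk'

theorem toQuot_diagAct (s : ℤˣ) (p : X × SInf) :
    toQuot τ hτ (diagAct τ s p) = toQuot τ hτ p :=
  (Quotient.sound (s := orbitSetoid τ hτ) ⟨s, rfl⟩ :
    Quotient.mk (orbitSetoid τ hτ) p = Quotient.mk (orbitSetoid τ hτ) (diagAct τ s p)).symm

/-- The orbifold fundamental group `π₁(X_Σ)`, based at the image of a point of `X × EΣ`. The
product `a * b` is the class of the loop `b` followed by `a`. -/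
abbrev OrbPi1 (p : X × SInf) : Type _ :=
  FundamentalGroup (HomotopyQuotient τ hτ) (toQuot τ hτ p)

/-- A path in `X × EΣ` from `p` to `s p`, with `s ∈ Σ`, defines an element of `π₁(X_Σ)`. -/
def orbClass {p : X × SInf} {s : ℤˣ} (η : Path p (diagAct τ s p)) : OrbPi1 τ hτ p :=
  FundamentalGroup.fromPath (Path.Homotopic.Quotient.mk
    ((η.map (toQuot τ hτ).continuous).cast rfl (toQuot_diagAct τ hτ s p).symm))

open Classical in
/-- The augmentation `π₁(X_Σ) → Σ`: a class is sent to `1` exactly when it lifts to a loop in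
the double covering `X × EΣ` of `X_Σ`. -/
def augmentation {p : X × SInf} (a : OrbPi1 τ hτ p) : ℤˣ :=
  if ∃ η : Path p (diagAct τ 1 p), orbClass τ hτ η = a then 1 else -1

end HomotopyQuotient

/-! ### Klein surfaces -/

section Surface

variable {M : Type*} [TopologicalSpace M] [ChartedSpace ℂ M]

/-- A Riemann surface is a smooth real surface, with the same charts. -/
instance isManifold_real [IsManifold 𝓘(ℂ, ℂ) ω M] : IsManifold 𝓘(ℝ, ℂ) ∞ M := by
  apply isManifold_of_contDiffOn
  intro e e' he he'
  have h := (contDiffGroupoid ω 𝓘(ℂ, ℂ)).compatible he he'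
  rw [contDiffGroupoid, mem_groupoid_of_pregroupoid] at h
  exact (ContDiffOn.restrict_scalars ℝ h.1).of_le le_top

/-- `σ` is an anti-holomorphic involution (a Real structure) of the Riemann surface `M`. The
tangent space at `x` is identified with `ℂ` through the holomorphic chart at `x`. -/
structure IsRealStructure (σ : M → M) : Prop where
  involutive : Function.Involutive σ
  smooth : ContMDiff 𝓘(ℝ, ℂ) 𝓘(ℝ, ℂ) ∞ σ
  antiholomorphic : ∀ (x : M) (v : ℂ),
    (show ℂ from mfderiv 𝓘(ℝ, ℂ) 𝓘(ℝ, ℂ) σ x (Complex.I * v : ℂ)) =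
      -(Complex.I * (show ℂ from mfderiv 𝓘(ℝ, ℂ) 𝓘(ℝ, ℂ) σ x v))

/-- The coefficient of `dx ∧ dy` of a complex-valued `2`-form `η` in the chart at `c`. -/
def chartDensity (η : ∀ x : M, TangentSpace 𝓘(ℝ, ℂ) x → TangentSpace 𝓘(ℝ, ℂ) x → ℂ)
    (c : M) (z : ℂ) : ℂ :=
  η ((chartAt ℂ c).symm z)
    (mfderiv 𝓘(ℝ, ℂ) 𝓘(ℝ, ℂ) (chartAt ℂ c).symm z (1 : ℂ))
    (mfderiv 𝓘(ℝ, ℂ) 𝓘(ℝ, ℂ) (chartAt ℂ c).symm z Complex.I)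

/-- The integral of a `2`-form over the (compact, oriented) surface `M`, computed with a
partition of unity subordinate to the charts. -/
def surfaceIntegral (ρ : SmoothPartitionOfUnity M 𝓘(ℝ, ℂ) M univ)
    (η : ∀ x : M, TangentSpace 𝓘(ℝ, ℂ) x → TangentSpace 𝓘(ℝ, ℂ) x → ℂ) : ℂ :=
  ∑ᶠ c : M, ∫ z in (chartAt ℂ c).target, (ρ c ((chartAt ℂ c).symm z) : ℂ) * chartDensity η c z

end Surface

/-! ### Hermitian bundles, Real and Quaternionic structures, unitary connections -/

/-- The model fibre `ℂ^r` with its standard Hermitian product. -/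
abbrev Cn (r : ℕ) : Type := EuclideanSpace ℂ (Fin r)

/-- The Hermitian product on the fibres of `E` depends smoothly on the base point. -/
class IsSmoothHermitian {M : Type*} [TopologicalSpace M] [ChartedSpace ℂ M] (r : ℕ)
    (E : M → Type*) [TopologicalSpace (TotalSpace (Cn r) E)]
    [∀ x, NormedAddCommGroup (E x)] [∀ x, InnerProductSpace ℂ (E x)] [FiberBundle (Cn r) E] :
    Prop where
  smooth : ∀ (e : Trivialization (Cn r) (π (Cn r) E)) [MemTrivializationAtlas e] (v w : Cn r),
    ContMDiffOn 𝓘(ℝ, ℂ) 𝓘(ℝ, ℂ) ∞ (fun x => inner ℂ (e.symm x v) (e.symm x w)) e.baseSet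

section Bundles

variable {M : Type*} [TopologicalSpace M] [ChartedSpace ℂ M] [IsManifold 𝓘(ℂ, ℂ) ω M]
  {r : ℕ} {E : M → Type*} [TopologicalSpace (TotalSpace (Cn r) E)]
  [∀ x, NormedAddCommGroup (E x)] [∀ x, InnerProductSpace ℂ (E x)]
  [FiberBundle (Cn r) E] [VectorBundle ℂ (Cn r) E] [VectorBundle ℝ (Cn r) E]
  [ContMDiffVectorBundle ∞ (Cn r) E 𝓘(ℝ, ℂ)]

variable (r E) in
/-- A Real (`c = 1`) or Quaternionic (`c = -1`) structure on the Hermitian vector bundle `E`: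
a smooth fibrewise antilinear isometry covering `σ`, with square `c`. -/
structure RealQuatStructure (σ : M → M) (c : ℤˣ) where
  /-- the map on fibres -/
  map : ∀ x, E x →ₛₗᵢ[starRingEnd ℂ] E (σ x)
  smooth : ContMDiff (𝓘(ℝ, ℂ).prod 𝓘(ℝ, Cn r)) (𝓘(ℝ, ℂ).prod 𝓘(ℝ, Cn r)) ∞
    (fun p : TotalSpace (Cn r) E => TotalSpace.mk' (Cn r) (σ p.1) (map p.1 p.2))
  square : ∀ (x : M) (v : E x), TotalSpace.mk' (Cn r) (σ (σ x)) (map (σ x) (map x v)) =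
    TotalSpace.mk' (Cn r) x (((c : ℤ) : ℂ) • v)

/-- The maps `τ_1 = id` and `τ_σ = τ` on the total space of `E`. -/
def RealQuatStructure.act {σ : M → M} {c : ℤˣ} (τ : RealQuatStructure r E σ c) (s : ℤˣ)
    (p : TotalSpace (Cn r) E) : TotalSpace (Cn r) E :=
  if s = 1 then p else TotalSpace.mk' (Cn r) (σ p.1) (τ.map p.1 p.2)

/-- The section `s` of `E` is differentiable at `x`. -/
def DiffAt (s : ∀ x, E x) (x : M) : Prop :=
  MDifferentiableAt 𝓘(ℝ, ℂ) (𝓘(ℝ, ℂ).prod 𝓘(ℝ, Cn r)) (fun y => TotalSpace.mk' (Cn r) y (s y)) x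

variable (r E) in
/-- A smooth unitary connection on the Hermitian vector bundle `E`, given by its covariant
derivative `d_A` on sections. -/
structure UnitaryConnection where
  /-- the covariant derivative `d_A`; `cov s x v` is the derivative of `s` at `x` along `v` -/
  cov : CovariantDerivative 𝓘(ℝ, ℂ) (Cn r) E
  smooth : CovariantDerivative.ContMDiffCovariantDerivative cov ∞
  complexLinear : ∀ (s : ∀ x, E x) (x : M), DiffAt (r := r) s x →
    ∀ v : TangentSpace 𝓘(ℝ, ℂ) x, cov (fun y => Complex.I • s y) x v = Complex.I • cov s x v
  unitary : ∀ (s t : ∀ x, E x) (x : M), DiffAt (r := r) s x → DiffAt (r := r) t x →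
    ∀ v : TangentSpace 𝓘(ℝ, ℂ) x,
      (show ℂ from mfderiv 𝓘(ℝ, ℂ) 𝓘(ℝ, ℂ) (fun y => inner ℂ (s y) (t y)) x v) =
        inner ℂ (cov s x v) (t x) + inner ℂ (s x) (cov t x v)

namespace UnitaryConnection

variable (A : UnitaryConnection r E)

/-- The curvature `F_A(X, Y) s = ∇_X ∇_Y s - ∇_Y ∇_X s - ∇_[X,Y] s`. -/
def curvature (X Y : ∀ x : M, TangentSpace 𝓘(ℝ, ℂ) x) (s : ∀ x, E x) (x : M) : E x :=
  A.cov (fun y => A.cov s y (Y y)) x (X x) - A.cov (fun y => A.cov s y (X y)) x (Y x) -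
    A.cov s x (VectorField.mlieBracket 𝓘(ℝ, ℂ) X Y x)

/-- The curvature tensor at `x`, evaluated on two tangent vectors and a vector of the fibre
(all three are extended to sections which are smooth near `x`). -/
def curvatureAt (x : M) (v w : TangentSpace 𝓘(ℝ, ℂ) x) (u : E x) : E x :=
  A.curvature (fun y => FiberBundle.extend ℂ v y) (fun y => FiberBundle.extend ℂ w y)
    (fun y => FiberBundle.extend (Cn r) u y) x

/-- The `2`-form `tr F_A`. -/
def traceCurvature (x : M) (v w : TangentSpace 𝓘(ℝ, ℂ) x) : ℂ :=
  ∑ k : Fin r, (trivializationAt (Cn r) E x (TotalSpace.mk' (Cn r) x (A.curvatureAt x v w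
    ((trivializationAt (Cn r) E x).symm x (EuclideanSpace.single k 1))))).2 k

/-- `A` is projectively flat, with curvature `F_A = κ Id_E`. -/
def HasCentralCurvature
    (κ : ∀ x : M, TangentSpace 𝓘(ℝ, ℂ) x → TangentSpace 𝓘(ℝ, ℂ) x → ℂ) : Prop :=
  ∀ (x : M) (v w : TangentSpace 𝓘(ℝ, ℂ) x) (u : E x), A.curvatureAt x v w u = κ x v w • u

/-- `A` is Galois-invariant: `d_A` commutes with the action of `τ` on sections and `1`-forms.
Here `s'` is the section `τ ∘ s ∘ σ⁻¹`. -/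
def IsGaloisInvariant {σ : M → M} {c : ℤˣ} (τ : RealQuatStructure r E σ c) : Prop :=
  ∀ (s s' : ∀ x, E x), (∀ y, s' (σ y) = τ.map y (s y)) → ∀ x, DiffAt (r := r) s x →
    ∀ v : TangentSpace 𝓘(ℝ, ℂ) x,
      A.cov s' (σ x) (mfderiv 𝓘(ℝ, ℂ) 𝓘(ℝ, ℂ) σ x v) = τ.map x (A.cov s x v)

/-- The curve `s` in the total space of `E` is `A`-horizontal at time `t`. -/
def IsHorizontalAt (s : ℝ → TotalSpace (Cn r) E) (t : ℝ) : Prop :=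
  ∃ f' : Cn r, HasDerivAt (fun t' => (trivializationAt (Cn r) E (s t).proj (s t')).2) f' t ∧
    (trivializationAt (Cn r) E (s t).proj).symm (s t).proj f' +
      A.cov (fun y => FiberBundle.extend (Cn r) (s t).2 y) (s t).proj
        (mfderiv 𝓘(ℝ, ℝ) 𝓘(ℝ, ℂ) (fun t' => (s t').proj) t (1 : ℝ)) = 0

/-- `s` is an `A`-horizontal lift of the piecewise `C¹` curve `γ : [0,1] → M`. -/
def IsHorizontalLift (γ : ℝ → M) (s : ℝ → TotalSpace (Cn r) E) : Prop :=
  ContinuousOn s (Icc 0 1) ∧ (∀ t ∈ Icc (0 : ℝ) 1, (s t).proj = γ t) ∧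
    ∃ S : Finset ℝ, ∀ t ∈ Ioo (0 : ℝ) 1, t ∉ S → A.IsHorizontalAt s t

/-- `g` is the matrix, in the unitary frame `b` of `E_x`, of the extended holonomy
`τ_λ ∘ T_γ^A : E_x → E_x` of the pair `(γ, λ)`, where `γ` is a curve from `x` to `λ⁻¹(x)`:
`(τ_λ ∘ T_γ^A)(v) = g ε_λ(v)`, where `ε_λ` is the identity or the complex conjugation. -/
def IsExtendedHolonomy {σ : M → M} {c : ℤˣ} (τ : RealQuatStructure r E σ c) {x : M}
    (b : E x ≃ₗᵢ[ℂ] Cn r) (γ : ℝ → M) (s : ℤˣ) (g : U r) : Prop :=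
  ∀ v : E x, ∃ l : ℝ → TotalSpace (Cn r) E, A.IsHorizontalLift γ l ∧
    l 0 = TotalSpace.mk' (Cn r) x v ∧
    τ.act s (l 1) = TotalSpace.mk' (Cn r) x (b.symm (WithLp.toLp 2
      ((g : Matrix (Fin r) (Fin r) ℂ).mulVec
        (fun i => if s = 1 then b v i else starRingEnd ℂ (b v i)))))

end UnitaryConnection

/-- `A'` lies in the `τ`-unitary gauge orbit of `A`: one has `d_{A'} (u s) = u (d_A s)` for a
smooth unitary automorphism `u` of `E` commuting with `τ`. -/
def GaugeEquivalent {σ : M → M} {c : ℤˣ} (τ : RealQuatStructure r E σ c)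
    (A A' : UnitaryConnection r E) : Prop :=
  ∃ u : ∀ x, E x ≃ₗᵢ[ℂ] E x,
    ContMDiff (𝓘(ℝ, ℂ).prod 𝓘(ℝ, Cn r)) (𝓘(ℝ, ℂ).prod 𝓘(ℝ, Cn r)) ∞
      (fun p : TotalSpace (Cn r) E => TotalSpace.mk' (Cn r) p.1 (u p.1 p.2)) ∧
    (∀ x (v : E x), u (σ x) (τ.map x v) = τ.map x (u x v)) ∧
    ∀ (s : ∀ x, E x) (x : M), DiffAt (r := r) s x → ∀ v : TangentSpace 𝓘(ℝ, ℂ) x,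
      A'.cov (fun y => u y (s y)) x v = u x (A.cov s x v)

variable (r E) in
/-- The degree of `E` is `d = ∫_M c_1(E)`, with `c_1(E)` represented by `(i / 2π) tr F` for a
unitary connection on `E`. -/
def HasDegree (d : ℤ) : Prop :=
  ∃ (A : UnitaryConnection r E) (ρ : SmoothPartitionOfUnity M 𝓘(ℝ, ℂ) M univ),
    ρ.IsSubordinate (fun c => (chartAt ℂ c).source) ∧
    Complex.I / (2 * Real.pi) * surfaceIntegral ρ A.traceCurvature = d

end Bundles

/-! ### Real Seifert manifolds -/

section Seifert

variable {M : Type*} [TopologicalSpace M] [ChartedSpace ℂ M]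
  {L : M → Type*} [TopologicalSpace (TotalSpace (Cn 1) L)]
  [∀ x, NormedAddCommGroup (L x)] [∀ x, InnerProductSpace ℂ (L x)]
  [FiberBundle (Cn 1) L]

variable (L) in
/-- The unit circle bundle `S(L)` of the Hermitian line bundle `L`. -/
abbrev Seifert : Type _ := {p : TotalSpace (Cn 1) L // ‖p.2‖ = 1}

/-- The involution of `S(L)` induced by the Real structure `τ_L`. -/
def seifertInv {σ : M → M} (τL : RealQuatStructure 1 L σ 1) (p : Seifert L) : Seifert L :=
  ⟨TotalSpace.mk' (Cn 1) (σ p.1.1) (τL.map p.1.1 p.1.2), by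
    have h := (τL.map p.1.1).norm_map p.1.2
    exact h.trans p.2⟩

theorem seifertInv_involutive {σ : M → M} (τL : RealQuatStructure 1 L σ 1) :
    Function.Involutive (seifertInv τL) := by
  intro p
  apply Subtype.ext
  refine (τL.square p.1.1 p.1.2).trans ?_
  simp

/-- The fibre loop `t ↦ e^{2πit} p` of `S(L)`, paired with the constant path at `e` in `EΣ`. -/
def fibreLoop {σ : M → M} (τL : RealQuatStructure 1 L σ 1) (p : Seifert L) (e : SInf) :
    Path (p, e) (diagAct (seifertInv τL) 1 (p, e)) where
  toFun t := (⟨TotalSpace.mk' (Cn 1) p.1.1 ((Circle.exp (2 * Real.pi * t) : ℂ) • p.1.2), by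
    have h : ‖((Circle.exp (2 * Real.pi * t) : ℂ) • p.1.2)‖ = 1 := by
      rw [norm_smul, Circle.norm_coe, p.2, one_mul]
    exact h⟩, e)
  continuous_toFun := by
    refine Continuous.prodMk (Continuous.subtype_mk ?_ _) continuous_const
    refine (FiberBundle.continuous_totalSpaceMk (Cn 1) L p.1.1).comp ?_
    fun_prop
  source' := by
    refine Prod.ext (Subtype.ext ?_) rfl
    simp
  target' := by
    refine Prod.ext (Subtype.ext ?_) ?_ <;> simp [diagAct]

/-- The curve in `M` below a path in `S(L) × EΣ`. -/
def baseCurve {p q : Seifert L × SInf} (η : Path p q) : ℝ → M := fun t => (η.extend t).1.1.proj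

/-- The curve `γ` is piecewise `C¹` on `[0,1]`: it is `C¹` on every closed subinterval whose
interior avoids a suitable finite set. -/
def IsPiecewiseC1 (γ : ℝ → M) : Prop :=
  ContinuousOn γ (Icc 0 1) ∧ ∃ S : Finset ℝ, ∀ a b : ℝ, 0 ≤ a → a < b → b ≤ 1 →
    (∀ t ∈ Ioo a b, t ∉ S) → ContMDiffOn 𝓘(ℝ, ℝ) 𝓘(ℝ, ℂ) 1 γ (Icc a b)

end Seifert

end RealNS

end

open RealNS

open scoped Manifold ContDiff Topology ComplexConjugate
open Bundle Set

set_option linter.unusedSectionVars false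

noncomputable section

/-! The class of the fibre makes `χ_A` a holonomy on `S(L)` rather than on `M`. Suppose `B` is a
connection on `L` with curvature `r κ`. On `S(L)` the pull-back of `L` has a tautological unit
section, so it is trivialized and `q^*B` becomes `d + θ` for a global imaginary `1`-form `θ`. The
connection `q^*A - (θ/r) Id`, that is `q^*A ⊗ (q^*B)^{-1/r}`, is then flat and unitary on `q^*E`.
Turning once around a circle fibre rotates the tautological section by `2π`, so the holonomy of that
loop is `exp(2πi/r)`. If `B` is compatible with `τ_L`, then `τ` maps flat sections to flat sections,
and transport followed by `τ_λ` gives a homomorphism on `π₁(S(L)_Σ)` with values in `U(r) ×_c Σ`;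
the cocycle records `τ² = c`.

Flatness is never expressed by differentiating along `S(L)`. A `FlatPair` over an open set of `M` is
a unit section `s` of `L` and a unitary frame `f` of `E` such that `A` has in `f` the scalar
connection form `B.form s / r`. Over a point `y` of `S(L)`, flat sections are locally `ε f(u)` with
`u` constant and `ε` continuous with `ε ^ r = a ⟨s, y⟩` for a constant `a ≠ 0` (`IsFlatAt`). Two
flat pairs differ by a constant and a branch of an `r`-th root (`FlatPair.eventually_eq`), so these
local frames have locally constant transition maps and form a covering of `S(L)` with discrete fibre
`ℂ^r` (`FlatAtlas.core`). Path and homotopy lifting in this covering give transport along merely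
continuous paths, its invariance under homotopy and its multiplicativity (`Transports.homotopic`,
`Transports.trans`).

Three analytic points remain. Flat pairs exist locally when curvatures match, by a Frobenius theorem
(`exists_flat_solution`, `exists_flatPair`). A suitable `B` exists because `E` and `L` have the same
degree: integration is injective on the second de Rham cohomology of a compact connected surface
(`exists_generator`, `cohomologous_of_surfInt_eq`), so a unitary connection on `L` acquires
curvature `r κ` after adding an imaginary `1`-form, and averaging with its conjugate makes it Real
while flat pairs persist (`FlatPair.exists_average`, `exists_auxiliary_connection`). Finally, if the
projection `γ` of a path `h` in `S(L)` is piecewise `C¹`, an imaginary phase `μ` makes `exp(μ) h` a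
`B`-horizontal curve in `L`; then `exp(μ/r) V` is `A`-horizontal for every flat `V`, so flat
transport is parallel transport along `γ` times `exp(-μ(1)/r)`, a number depending on `B` and `h`
but not on `A` (`exists_transport_phase`). This is the function `z`, up to the conjugation caused by
the antilinearity of `τ`.

The connection `B` is chosen once for all `A` with curvature `κ`, which is possible since `tr F_A =
r κ`. A gauge transformation carries flat pairs for `A` to flat pairs for `u · A` with the same
section of `L`, whence the conjugacy statement. -/

namespace RealNS

/-! ### Metric connections: locality, Leibniz rules, local coordinates -/

section Connections

variable {M : Type*} [TopologicalSpace M] [ChartedSpace ℂ M] [IsManifold 𝓘(ℂ, ℂ) ω M]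
  {r : ℕ} {E : M → Type*} [TopologicalSpace (TotalSpace (Cn r) E)]
  [∀ x, NormedAddCommGroup (E x)] [∀ x, InnerProductSpace ℂ (E x)]
  [FiberBundle (Cn r) E] [VectorBundle ℂ (Cn r) E] [VectorBundle ℝ (Cn r) E]
  [ContMDiffVectorBundle ∞ (Cn r) E 𝓘(ℝ, ℂ)]

variable (r E) in
/-- A metric connection, without any regularity requirement. -/
structure MetricConnection where
  /-- the covariant derivative -/
  cov : CovariantDerivative 𝓘(ℝ, ℂ) (Cn r) E
  complexLinear : ∀ (s : ∀ x, E x) (x : M), DiffAt (r := r) s x →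
    ∀ v : TangentSpace 𝓘(ℝ, ℂ) x, cov (fun y => Complex.I • s y) x v = Complex.I • cov s x v
  unitary : ∀ (s t : ∀ x, E x) (x : M), DiffAt (r := r) s x → DiffAt (r := r) t x →
    ∀ v : TangentSpace 𝓘(ℝ, ℂ) x,
      (show ℂ from mfderiv 𝓘(ℝ, ℂ) 𝓘(ℝ, ℂ) (fun y => inner ℂ (s y) (t y)) x v) =
        inner ℂ (cov s x v) (t x) + inner ℂ (s x) (cov t x v)

/-- The metric connection underlying a smooth unitary connection. -/
def UnitaryConnection.toMetric (A : UnitaryConnection r E) : MetricConnection r E :=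
  ⟨A.cov, A.complexLinear, A.unitary⟩

instance contMDiffVectorBundle_one : ContMDiffVectorBundle 1 (Cn r) E 𝓘(ℝ, ℂ) :=
  ContMDiffVectorBundle.of_le (n := ∞) (by norm_num)

instance isManifold_real_one : IsManifold 𝓘(ℝ, ℂ) 1 M :=
  IsManifold.of_le (n := ∞) (by norm_num)

theorem diffAt_iff (e : Trivialization (Cn r) (π (Cn r) E)) [MemTrivializationAtlas e]
    {s : ∀ x, E x} {x : M} (hx : x ∈ e.baseSet) :
    DiffAt (r := r) s x ↔
      MDifferentiableAt 𝓘(ℝ, ℂ) 𝓘(ℝ, Cn r) (fun y => (e ⟨y, s y⟩).2) x :=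
  e.mdifferentiableAt_section_iff _ _ hx

theorem DiffAt.congr {s t : ∀ x, E x} {x : M} (hs : DiffAt (r := r) s x)
    (h : ∀ᶠ y in 𝓝 x, s y = t y) : DiffAt (r := r) t x := by
  refine MDifferentiableAt.congr_of_eventuallyEq hs ?_
  filter_upwards [h] with y hy
  rw [hy]

theorem DiffAt.sum {ι : Type*} {J : Finset ι} {s : ι → ∀ x, E x} {x : M}
    (hs : ∀ i ∈ J, DiffAt (r := r) (s i) x) : DiffAt (r := r) (fun y => ∑ i ∈ J, s i y) x :=
  MDifferentiableAt.sum_section hs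

theorem DiffAt.real_smul {s : ∀ x, E x} {x : M} {g : M → ℝ}
    (hg : MDifferentiableAt 𝓘(ℝ, ℂ) 𝓘(ℝ, ℝ) g x) (hs : DiffAt (r := r) s x) :
    DiffAt (r := r) (fun y => g y • s y) x :=
  MDifferentiableAt.smul_section hg hs

/-- Differentiability is that of a real bundle, so a complex factor enters through the real-linear
operator `lsmul` acting on fibre coordinates. -/
theorem DiffAt.smul {s : ∀ x, E x} {x : M} {g : M → ℂ}
    (hg : MDifferentiableAt 𝓘(ℝ, ℂ) 𝓘(ℝ, ℂ) g x) (hs : DiffAt (r := r) s x) :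
    DiffAt (r := r) (fun y => g y • s y) x := by
  have hx := FiberBundle.mem_baseSet_trivializationAt' (F := Cn r) (E := E) x
  rw [diffAt_iff (trivializationAt (Cn r) E x) hx] at hs ⊢
  have hl : MDifferentiableAt 𝓘(ℝ, ℂ) 𝓘(ℝ, Cn r →L[ℝ] Cn r)
      (fun y => ContinuousLinearMap.lsmul ℝ ℂ (g y)) x :=
    (ContinuousLinearMap.lsmul ℝ ℂ (E := Cn r)).mdifferentiableAt.comp x hg
  refine MDifferentiableAt.congr_of_eventuallyEq (hl.clm_apply hs) ?_
  filter_upwards [(trivializationAt (Cn r) E x).open_baseSet.mem_nhds hx] with y hy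
  exact ((trivializationAt (Cn r) E x).linear ℂ hy).2 _ _

theorem DiffAt.const_smul {s : ∀ x, E x} {x : M} (a : ℂ) (hs : DiffAt (r := r) s x) :
    DiffAt (r := r) (fun y => a • s y) x :=
  DiffAt.smul (g := fun _ => a) mdifferentiableAt_const hs

theorem diffAt_symm_const (e : Trivialization (Cn r) (π (Cn r) E)) [MemTrivializationAtlas e]
    {x : M} (hx : x ∈ e.baseSet) (u : Cn r) : DiffAt (r := r) (fun y => e.symm y u) x := by
  rw [diffAt_iff e hx]
  refine MDifferentiableAt.congr_of_eventuallyEq (f := fun _ => u) mdifferentiableAt_const ?_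
  filter_upwards [e.open_baseSet.mem_nhds hx] with y hy
  rw [e.apply_mk_symm hy]

theorem symm_apply_coord (e : Trivialization (Cn r) (π (Cn r) E))
    {x : M} (hx : x ∈ e.baseSet) (v : E x) : e.symm x (e ⟨x, v⟩).2 = v :=
  e.symm_apply_apply_mk hx v

namespace MetricConnection

variable (A : MetricConnection r E)

theorem cov_congr {s t : ∀ x, E x} {x : M} (hs : DiffAt (r := r) s x)
    (h : ∀ᶠ y in 𝓝 x, s y = t y) : A.cov s x = A.cov t x :=
  A.cov.isCovariantDerivativeOnUniv.congr_of_eventuallyEq hs (hs.congr h) Filter.univ_mem h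

theorem cov_add {s t : ∀ x, E x} {x : M} (hs : DiffAt (r := r) s x) (ht : DiffAt (r := r) t x) :
    A.cov (fun y => s y + t y) x = A.cov s x + A.cov t x :=
  A.cov.isCovariantDerivativeOnUniv.add hs ht (mem_univ x)

theorem cov_zero (x : M) : A.cov (fun _ => 0) x = 0 :=
  A.cov.isCovariantDerivativeOnUniv.zero (mem_univ x)

theorem cov_sum {ι : Type*} {J : Finset ι} {s : ι → ∀ x, E x} {x : M}
    (hs : ∀ i ∈ J, DiffAt (r := r) (s i) x) :
    A.cov (fun y => ∑ i ∈ J, s i y) x = ∑ i ∈ J, A.cov (s i) x := by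
  classical
  induction J using Finset.induction_on with
  | empty => simpa using A.cov_zero x
  | insert i J hi ih =>
    simp only [Finset.mem_insert, forall_eq_or_imp] at hs
    simp only [Finset.sum_insert hi]
    rw [A.cov_add hs.1 (DiffAt.sum hs.2), ih hs.2]

theorem cov_real_smul {s : ∀ x, E x} {x : M} {g : M → ℝ}
    (hg : MDifferentiableAt 𝓘(ℝ, ℂ) 𝓘(ℝ, ℝ) g x) (hs : DiffAt (r := r) s x)
    (v : TangentSpace 𝓘(ℝ, ℂ) x) :
    A.cov (fun y => g y • s y) x v =
      g x • A.cov s x v + (show ℝ from mfderiv 𝓘(ℝ, ℂ) 𝓘(ℝ, ℝ) g x v) • s x := by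
  have h := A.cov.isCovariantDerivativeOnUniv.leibniz hs hg (mem_univ x)
  exact congrArg (fun T => T v) h

theorem cov_real_const_smul {s : ∀ x, E x} {x : M} (a : ℝ) (hs : DiffAt (r := r) s x) :
    A.cov (fun y => a • s y) x = a • A.cov s x :=
  A.cov.isCovariantDerivativeOnUniv.smul_const a hs (mem_univ x)

/-- The Leibniz rule for complex-valued functions. -/
theorem cov_smul {s : ∀ x, E x} {x : M} {g : M → ℂ}
    (hg : MDifferentiableAt 𝓘(ℝ, ℂ) 𝓘(ℝ, ℂ) g x) (hs : DiffAt (r := r) s x)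
    (v : TangentSpace 𝓘(ℝ, ℂ) x) :
    A.cov (fun y => g y • s y) x v =
      g x • A.cov s x v + (show ℂ from mfderiv 𝓘(ℝ, ℂ) 𝓘(ℝ, ℂ) g x v) • s x := by
  have hre : HasMFDerivAt 𝓘(ℝ, ℂ) 𝓘(ℝ, ℝ) (fun y => (g y).re) x
      (Complex.reCLM.comp (mfderiv 𝓘(ℝ, ℂ) 𝓘(ℝ, ℂ) g x)) :=
    Complex.reCLM.hasMFDerivAt.comp x hg.hasMFDerivAt
  have him : HasMFDerivAt 𝓘(ℝ, ℂ) 𝓘(ℝ, ℝ) (fun y => (g y).im) x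
      (Complex.imCLM.comp (mfderiv 𝓘(ℝ, ℂ) 𝓘(ℝ, ℂ) g x)) :=
    Complex.imCLM.hasMFDerivAt.comp x hg.hasMFDerivAt
  have hI : DiffAt (r := r) (fun y => Complex.I • s y) x := hs.const_smul _
  -- Splitting `g` into real and imaginary parts reduces the claim to the real Leibniz rule for `s`
  -- and `I • s`.
  have h1 : (fun y => g y • s y) =
      fun y => (g y).re • s y + (g y).im • (Complex.I • s y) := by
    funext y
    conv_lhs => rw [← Complex.re_add_im (g y), add_smul, mul_smul]
    rfl
  rw [h1, A.cov_add (hs.real_smul hre.mdifferentiableAt) (hI.real_smul him.mdifferentiableAt),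
    add_apply, A.cov_real_smul hre.mdifferentiableAt hs,
    A.cov_real_smul him.mdifferentiableAt hI, A.complexLinear s x hs, hre.mfderiv, him.mfderiv]
  set a : ℂ := g x
  set b : ℂ := (show ℂ from mfderiv 𝓘(ℝ, ℂ) 𝓘(ℝ, ℂ) g x v)
  have hr : ∀ (w : ℂ) (y : E x), w • y = w.re • y + w.im • (Complex.I • y) := by
    intro w y
    conv_lhs => rw [← Complex.re_add_im w, add_smul, mul_smul]
    rfl
  rw [hr a, hr b]
  change a.re • A.cov s x v + b.re • s x + (a.im • Complex.I • A.cov s x v +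
    b.im • Complex.I • s x) = _
  abel

theorem cov_const_smul {s : ∀ x, E x} {x : M} (a : ℂ) (hs : DiffAt (r := r) s x)
    (v : TangentSpace 𝓘(ℝ, ℂ) x) : A.cov (fun y => a • s y) x v = a • A.cov s x v := by
  rw [A.cov_smul (g := fun _ => a) mdifferentiableAt_const hs, mfderiv_const]
  change _ + (0 : ℂ) • s x = _
  rw [zero_smul, add_zero]

/-- The covariant derivative in a local trivialization. -/
theorem cov_coord (e : Trivialization (Cn r) (π (Cn r) E)) [MemTrivializationAtlas e]
    {s : ∀ x, E x} {x : M} (hx : x ∈ e.baseSet) (hs : DiffAt (r := r) s x)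
    (v : TangentSpace 𝓘(ℝ, ℂ) x) :
    A.cov s x v = e.symm x (show Cn r from
        mfderiv 𝓘(ℝ, ℂ) 𝓘(ℝ, Cn r) (fun y => (e ⟨y, s y⟩).2) x v) +
      A.cov (fun y => e.symm y (e ⟨x, s x⟩).2) x v := by
  set g : M → Cn r := fun y => (e ⟨y, s y⟩).2 with hgdef
  have hg : MDifferentiableAt 𝓘(ℝ, ℂ) 𝓘(ℝ, Cn r) g x := (diffAt_iff e hx).1 hs
  -- The section is expanded in the frame `e.symm y (b i)` for a real basis of `ℂ^r`, so that all
  -- coefficients are real functions and the real Leibniz rule applies.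
  let b := Module.finBasis ℝ (Cn r)
  let l : Fin _ → Cn r →L[ℝ] ℝ := fun i => (b.coord i).toContinuousLinearMap
  have hl : ∀ w : Cn r, ∑ i, l i w • b i = w := fun w => b.sum_repr w
  have hsymm : ∀ y ∈ e.baseSet, ∀ w : Cn r, ∑ i, l i w • e.symm y (b i) = e.symm y w := by
    intro y hy w
    have := congrArg (e.symmL ℝ y) (hl w)
    simp only [map_sum, map_smul] at this
    simpa only [e.symmL_apply hy] using this
  have hli : ∀ i, HasMFDerivAt 𝓘(ℝ, ℂ) 𝓘(ℝ, ℝ) (fun y => l i (g y)) x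
      ((l i).comp (mfderiv 𝓘(ℝ, ℂ) 𝓘(ℝ, Cn r) g x)) := fun i =>
    (l i).hasMFDerivAt.comp x hg.hasMFDerivAt
  have hb : ∀ i, DiffAt (r := r) (fun y => e.symm y (b i)) x := fun i => diffAt_symm_const e hx _
  have h1 : ∀ᶠ y in 𝓝 x, s y = ∑ i, l i (g y) • e.symm y (b i) := by
    filter_upwards [e.open_baseSet.mem_nhds hx] with y hy
    rw [hsymm y hy]
    exact (symm_apply_coord e hy _).symm
  have h2 : ∀ᶠ y in 𝓝 x, e.symm y (g x) = ∑ i, l i (g x) • e.symm y (b i) := by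
    filter_upwards [e.open_baseSet.mem_nhds hx] with y hy
    rw [hsymm y hy]
  rw [A.cov_congr hs h1, A.cov_congr (diffAt_symm_const e hx _) h2,
    A.cov_sum fun i _ => (hb i).real_smul (hli i).mdifferentiableAt,
    A.cov_sum fun i _ => (hb i).real_smul mdifferentiableAt_const]
  rw [← hsymm x hx]
  simp only [sum_apply]
  rw [← Finset.sum_add_distrib]
  refine Finset.sum_congr rfl fun i _ => ?_
  rw [A.cov_real_smul (hli i).mdifferentiableAt (hb i), (hli i).mfderiv,
    A.cov_real_const_smul _ (hb i), add_comm]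
  rfl

end MetricConnection

end Connections

/-! ### The Frobenius theorem for flat linear systems -/

section FlatSystems

variable {V 𝔤 : Type*} [NormedAddCommGroup V] [NormedSpace ℝ V] [NormedRing 𝔤]
  [NormedAlgebra ℝ 𝔤] [CompleteSpace 𝔤]

/-- A linear differential equation on `[0, 1]` with small continuous coefficients has a solution
with initial value `1`. -/
theorem exists_linear_ode_solution {a : ℝ → 𝔤} {C : ℝ} (ha : ContinuousOn a (Icc 0 1))
    (hC : ∀ t ∈ Icc (0 : ℝ) 1, ‖a t‖ ≤ C) (hC1 : C * (‖(1 : 𝔤)‖ + 1) ≤ 1) :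
    ∃ F : ℝ → 𝔤, F 0 = 1 ∧
      ∀ t ∈ Icc (0 : ℝ) 1, HasDerivWithinAt F (-(a t * F t)) (Icc 0 1) t := by
  have hC0 : 0 ≤ C := (norm_nonneg _).trans (hC 0 (by simp))
  -- On the ball of radius `1` about `1` the speed is at most `C (‖1‖ + 1) ≤ 1`, so a solution
  -- cannot leave it in unit time; this is the role of the smallness hypothesis.
  have hpl : IsPicardLindelof (fun t (y : 𝔤) => -(a t * y)) (tmin := 0) (tmax := 1)
      ⟨0, by simp⟩ (1 : 𝔤) 1 0 1 ⟨C, hC0⟩ := by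
    refine ⟨fun t ht => ?_, fun x _ => ?_, fun t ht x hx => ?_, by simp⟩
    · refine LipschitzWith.lipschitzOnWith (LipschitzWith.of_dist_le_mul fun x y => ?_)
      rw [dist_neg_neg, dist_eq_norm, dist_eq_norm, ← mul_sub]
      exact (norm_mul_le _ _).trans (mul_le_mul_of_nonneg_right (hC t ht) (norm_nonneg _))
    · exact (ha.mul continuousOn_const).neg
    · rw [norm_neg]
      have hx' : ‖x‖ ≤ ‖(1 : 𝔤)‖ + 1 := by
        have := mem_closedBall_iff_norm.1 hx
        have h2 := norm_add_le (1 : 𝔤) (x - 1)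
        rw [add_sub_cancel] at h2
        simp only [NNReal.coe_one] at this
        linarith
      calc ‖a t * x‖ ≤ ‖a t‖ * ‖x‖ := norm_mul_le _ _
        _ ≤ C * (‖(1 : 𝔤)‖ + 1) :=
          mul_le_mul (hC t ht) hx' (norm_nonneg _) hC0
        _ ≤ 1 := hC1
  obtain ⟨F, h0, hF⟩ := hpl.exists_eq_forall_mem_Icc_hasDerivWithinAt₀
  exact ⟨F, h0, hF⟩

set_option synthInstance.maxHeartbeats 200000 in
set_option maxHeartbeats 1600000 in
/-- The Frobenius theorem for flat linear systems `df = -ω f`. -/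
theorem exists_flat_solution {w : V → V →L[ℝ] 𝔤} {O : Set V} (hO : IsOpen O) {z₀ : V}
    (hz₀ : z₀ ∈ O) (hw : ContDiffOn ℝ 2 w O)
    (hflat : ∀ z ∈ O, ∀ u v, fderiv ℝ w z u v - fderiv ℝ w z v u +
      (w z u * w z v - w z v * w z u) = 0) :
    ∃ ε > 0, Metric.ball z₀ ε ⊆ O ∧ ∃ f : V → 𝔤, f z₀ = 1 ∧ ∀ z ∈ Metric.ball z₀ ε,
      ∃ f' : V →L[ℝ] 𝔤, HasFDerivAt f f' z ∧ ∀ v, f' v = -(w z v * f z) := by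
  have hwz : ContDiffAt ℝ 2 w z₀ := hw.contDiffAt (hO.mem_nhds hz₀)
  have hdw : ContDiffAt ℝ 1 (fderiv ℝ w) z₀ := hwz.fderiv_right (by norm_num)
  obtain ⟨K, T, hT, hK⟩ := hdw.exists_lipschitzOnWith
  obtain ⟨C, hC⟩ : ∃ C : ℝ, ∀ᶠ z in 𝓝 z₀, ‖w z‖ ≤ C :=
    ⟨‖w z₀‖ + 1, (hwz.continuousAt.norm.eventually_lt_const (lt_add_one _)).mono fun _ h => h.le⟩
  obtain ⟨C₁, hC₁⟩ : ∃ C : ℝ, ∀ᶠ z in 𝓝 z₀, ‖fderiv ℝ w z‖ ≤ C :=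
    have hn : ContinuousAt (fun z => ‖fderiv ℝ w z‖) z₀ :=
      (continuous_norm (E := V →L[ℝ] V →L[ℝ] 𝔤)).continuousAt.comp hdw.continuousAt
    ⟨‖fderiv ℝ w z₀‖ + 1, (hn.eventually_lt_const (lt_add_one _)).mono fun _ h => h.le⟩
  obtain ⟨ε₀, hε₀, hball⟩ := Metric.mem_nhds_iff.1
    (Filter.inter_mem (Filter.inter_mem (hO.mem_nhds hz₀) hT) (hC.and hC₁))
  have hC0 : 0 ≤ C := (norm_nonneg _).trans (hball (Metric.mem_ball_self hε₀)).2.1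
  have hC₁0 : 0 ≤ C₁ := (norm_nonneg (fderiv ℝ w z₀)).trans (hball (Metric.mem_ball_self hε₀)).2.2
  set N : ℝ := ‖(1 : 𝔤)‖ + 1 with hN
  have hN0 : 0 < N := by positivity
  -- `ε₀` gives the bounds on `w` and its derivative, `1` gives `‖p + h‖ ≤ 1`, and the last term
  -- makes the radial coefficient `w(p)`, of norm at most `C ε`, small enough for
  -- `exists_linear_ode_solution`.
  set ε : ℝ := min (min ε₀ 1) (1 / (C * N + 1)) with hε
  have hε0 : 0 < ε := by positivity
  have hε1 : ε ≤ 1 := (min_le_left _ _).trans (min_le_right _ _)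
  have hεε : ε ≤ ε₀ := (min_le_left _ _).trans (min_le_left _ _)
  have hεC : ε * (C * N) ≤ 1 := by
    have h1 : ε ≤ 1 / (C * N + 1) := min_le_right _ _
    have h2 : 0 < C * N + 1 := by positivity
    rw [le_div_iff₀ h2] at h1
    nlinarith
  have hsub : Metric.ball z₀ ε ⊆ Metric.ball z₀ ε₀ := Metric.ball_subset_ball hεε
  have hmem : ∀ {p : V}, ‖p‖ < ε → ∀ {t : ℝ}, t ∈ Icc (0 : ℝ) 1 →
      z₀ + t • p ∈ Metric.ball z₀ ε := by
    intro p hp t ht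
    rw [mem_ball_iff_norm, add_sub_cancel_left, norm_smul, Real.norm_eq_abs, abs_of_nonneg ht.1]
    exact (mul_le_of_le_one_left (norm_nonneg _) ht.2).trans_lt hp
  have hdiff : ∀ z ∈ Metric.ball z₀ ε, HasFDerivAt w (fderiv ℝ w z) z := fun z hz =>
    ((hw.contDiffAt (hO.mem_nhds (hball (hsub hz)).1.1)).differentiableAt
      (by norm_num)).hasFDerivAt
  have hpath : ∀ p : V, ‖p‖ < ε → ∀ t ∈ Icc (0 : ℝ) 1,
      HasDerivAt (fun t : ℝ => w (z₀ + t • p)) (fderiv ℝ w (z₀ + t • p) p) t := by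
    intro p hp t ht
    have h1 : HasDerivAt (fun t : ℝ => z₀ + t • p) p t := by
      simpa using ((hasDerivAt_id t).smul_const p).const_add z₀
    exact (hdiff _ (hmem hp ht)).comp_hasDerivAt t h1
  -- The system is solved along each ray from `z₀`; the value of `f` at `z₀ + p` is the value at
  -- time `1` of the solution along `p`.
  have hsol : ∀ p : V, ‖p‖ < ε → ∃ F : ℝ → 𝔤, F 0 = 1 ∧ ∀ t ∈ Icc (0 : ℝ) 1,
      HasDerivWithinAt F (-(w (z₀ + t • p) p * F t)) (Icc 0 1) t := by
    intro p hp
    refine exists_linear_ode_solution (C := C * ε) (fun t ht => ?_) (fun t ht => ?_) (by linarith)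
    · exact ((hpath p hp t ht).continuousAt.clm_apply continuousAt_const).continuousWithinAt
    · exact ((w _).le_opNorm p).trans
        (mul_le_mul (hball (hsub (hmem hp ht))).2.1 hp.le (norm_nonneg _) hC0)
  choose! F hF0 hF using hsol
  refine ⟨ε, hε0, fun z hz => (hball (hsub hz)).1.1, fun z => F (z - z₀) 1, ?_, ?_⟩
  · have h0 : ‖(0 : V)‖ < ε := by simpa using hε0
    have hd : ∀ t ∈ Ico (0 : ℝ) 1, HasDerivWithinAt (F 0) 0 (Ici t) t := by
      intro t ht
      have h := hF 0 h0 t ⟨ht.1, ht.2.le⟩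
      rw [map_zero, zero_mul, neg_zero] at h
      exact h.mono_of_mem_nhdsWithin (Icc_mem_nhdsGE_of_mem ht)
    have := constant_of_has_deriv_right_zero
      (fun t ht => (hF 0 h0 t ht).continuousWithinAt) hd 1 (by simp)
    simp only [sub_self]
    rw [this, hF0 0 h0]
  intro z hz
  obtain ⟨p, rfl⟩ : ∃ p, z = z₀ + p := ⟨z - z₀, by abel⟩
  have hp : ‖p‖ < ε := by simpa [mem_ball_iff_norm] using hz
  have hFc : ContinuousOn (F p) (Icc 0 1) := fun t ht => (hF p hp t ht).continuousWithinAt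
  obtain ⟨D, hD⟩ := isCompact_Icc.exists_bound_of_continuousOn hFc
  have hD0 : 0 ≤ D := (norm_nonneg _).trans (hD 0 (by simp))
  refine ⟨-((ContinuousLinearMap.mul ℝ 𝔤).flip (F p 1)).comp (w (z₀ + p)), ?_, fun v => by simp⟩
  set B : ℝ := (K + C₁ + (C₁ + C) * C) * D with hB
  have hB0 : 0 ≤ B := by positivity
  -- The quadratic estimate to be proved says that `-w(h) F` is the derivative of `f`, also in
  -- non-radial directions.
  have key : ∀ h : V, ‖p + h‖ < ε →
      ‖F (p + h) 1 - F p 1 + w (z₀ + p) h * F p 1‖ ≤ gronwallBound 0 C B 1 * ‖h‖ ^ 2 := by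
    intro h hph
    -- At time `t` the base points of the two rays differ by `t h`, so `-t w(h) F` is the expected
    -- first-order difference, and `δ` is the error.
    set δ : ℝ → 𝔤 := fun t => F (p + h) t - F p t + t • (w (z₀ + t • p) h * F p t) with hδ
    set δ' : ℝ → 𝔤 := fun t => -(w (z₀ + t • (p + h)) (p + h) * F (p + h) t) -
      -(w (z₀ + t • p) p * F p t) + (t • (fderiv ℝ w (z₀ + t • p) p h * F p t +
        w (z₀ + t • p) h * -(w (z₀ + t • p) p * F p t)) +
        (1 : ℝ) • (w (z₀ + t • p) h * F p t)) with hδ'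
    have hder : ∀ t ∈ Icc (0 : ℝ) 1, HasDerivWithinAt δ (δ' t) (Icc 0 1) t := by
      intro t ht
      refine HasDerivWithinAt.add ((hF _ hph t ht).sub (hF p hp t ht)) ?_
      refine HasDerivWithinAt.smul (hasDerivWithinAt_id t _) ?_
      refine HasDerivWithinAt.mul ?_ (hF p hp t ht)
      exact ((hpath p hp t ht).clm_apply (hasDerivAt_const t h)).hasDerivWithinAt.congr_deriv
        (by simp)
    have hbound : ∀ t ∈ Ico (0 : ℝ) 1, ‖δ' t‖ ≤ C * ‖δ t‖ + B * ‖h‖ ^ 2 := by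
      intro t ht
      have ht' : t ∈ Icc (0 : ℝ) 1 := ⟨ht.1, ht.2.le⟩
      set q := z₀ + t • p with hq
      have hqm : q ∈ Metric.ball z₀ ε := hmem hp ht'
      have hqm' : z₀ + t • (p + h) ∈ Metric.ball z₀ ε := hmem hph ht'
      have hq' : z₀ + t • (p + h) = q + t • h := by rw [hq, smul_add]; abel
      set q' := z₀ + t • (p + h) with hq'd
      have hseg : segment ℝ q q' ⊆ Metric.ball z₀ ε := (convex_ball _ _).segment_subset hqm hqm'
      have hth : ‖t • h‖ ≤ ‖h‖ := by
        rw [norm_smul, Real.norm_eq_abs, abs_of_nonneg ht.1]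
        exact mul_le_of_le_one_left (norm_nonneg _) ht.2.le
      have hqq : q' - q = t • h := by rw [hq']; abel
      have hT2 : ‖w q' - w q - fderiv ℝ w q (t • h)‖ ≤ K * ‖h‖ ^ 2 := by
        have := Convex.norm_image_sub_le_of_norm_hasFDerivWithin_le' (𝕜 := ℝ) (f := w)
          (f' := fderiv ℝ w) (φ := fderiv ℝ w q) (C := K * ‖h‖) (s := segment ℝ q q')
          (fun x hx => (hdiff x (hseg hx)).hasFDerivWithinAt) (fun x hx => ?_)
          (convex_segment _ _) (left_mem_segment ℝ q q') (right_mem_segment ℝ q q')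
        · rw [hqq] at this
          refine this.trans ?_
          rw [pow_two, ← mul_assoc]
          exact mul_le_mul_of_nonneg_left hth (by positivity)
        · have h1 := hK.norm_sub_le (hball (hsub (hseg hx))).1.2 (hball (hsub hqm)).1.2
          refine h1.trans (mul_le_mul_of_nonneg_left ?_ K.2)
          have h2 := norm_sub_le_of_mem_segment hx
          rw [hqq] at h2
          exact h2.trans hth
      have hT1 : ‖w q' - w q‖ ≤ C₁ * ‖h‖ := by
        have := Convex.norm_image_sub_le_of_norm_hasFDerivWithin_le (𝕜 := ℝ) (f := w)
          (f' := fderiv ℝ w) (C := C₁) (s := segment ℝ q q')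
          (fun x hx => (hdiff x (hseg hx)).hasFDerivWithinAt)
          (fun x hx => (hball (hsub (hseg hx))).2.2)
          (convex_segment _ _) (left_mem_segment ℝ q q') (right_mem_segment ℝ q q')
        rw [hqq] at this
        exact this.trans (mul_le_mul_of_nonneg_left hth hC₁0)
      -- Flatness exchanges `p` and `h` in the derivative of `w`. The terms of first order in `h` in
      -- `δ'` then combine into `-w δ`, up to quadratic terms, and Gronwall's inequality applies.
      have hfl : fderiv ℝ w q p h = fderiv ℝ w q h p - (w q p * w q h - w q h * w q p) := by
        have := hflat q (hball (hsub hqm)).1.1 p h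
        rw [sub_add, sub_eq_zero] at this
        exact this
      have hδ'eq : δ' t = -(w q' (p + h) * δ t) +
          ((-((w q' - w q - fderiv ℝ w q (t • h)) (p + h)) - t • fderiv ℝ w q h h +
            t • (((w q' - w q) (p + h) + w q h) * w q h)) * F p t) := by
        simp only [hδ', hδ]
        simp only [← hq, ← hq'd]
        simp only [hfl, map_add, map_smul, sub_apply, smul_apply,
          one_smul, add_mul, sub_mul, mul_add, mul_sub, neg_mul, mul_neg, smul_add, smul_sub,
          smul_neg, mul_smul_comm, smul_mul_assoc, mul_assoc]
        abel
      have hph1 : ‖p + h‖ ≤ 1 := hph.le.trans hε1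
      have ht1 : ‖t‖ ≤ 1 := by rw [Real.norm_eq_abs, abs_of_nonneg ht.1]; exact ht.2.le
      have e0 : ‖w q' (p + h) * δ t‖ ≤ C * ‖δ t‖ := by
        refine (norm_mul_le _ _).trans (mul_le_mul_of_nonneg_right ?_ (norm_nonneg _))
        refine ((w q').le_opNorm _).trans ?_
        calc ‖w q'‖ * ‖p + h‖ ≤ C * 1 :=
              mul_le_mul (hball (hsub hqm')).2.1 hph1 (norm_nonneg _) hC0
          _ = C := mul_one _
      have hwh : ‖w q h‖ ≤ C * ‖h‖ := ((w q).le_opNorm _).trans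
        (mul_le_mul_of_nonneg_right (hball (hsub hqm)).2.1 (norm_nonneg _))
      have e1 : ‖(w q' - w q - fderiv ℝ w q (t • h)) (p + h)‖ ≤ K * ‖h‖ ^ 2 := by
        refine (ContinuousLinearMap.le_opNorm _ _).trans ?_
        calc _ ≤ K * ‖h‖ ^ 2 * 1 := mul_le_mul hT2 hph1 (norm_nonneg _) (by positivity)
          _ = _ := mul_one _
      have e2 : ‖t • fderiv ℝ w q h h‖ ≤ C₁ * ‖h‖ ^ 2 := by
        rw [norm_smul]
        refine (mul_le_of_le_one_left (norm_nonneg _) ht1).trans ?_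
        refine ((fderiv ℝ w q).le_opNorm₂ h h).trans ?_
        rw [pow_two, ← mul_assoc]
        gcongr
        exact (hball (hsub hqm)).2.2
      have e3 : ‖t • (((w q' - w q) (p + h) + w q h) * w q h)‖ ≤ (C₁ + C) * C * ‖h‖ ^ 2 := by
        rw [norm_smul]
        refine (mul_le_of_le_one_left (norm_nonneg _) ht1).trans ?_
        refine (norm_mul_le _ _).trans ?_
        have e4 : ‖(w q' - w q) (p + h)‖ ≤ C₁ * ‖h‖ := by
          refine (ContinuousLinearMap.le_opNorm _ _).trans ?_
          calc _ ≤ C₁ * ‖h‖ * 1 := mul_le_mul hT1 hph1 (norm_nonneg _) (by positivity)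
            _ = _ := mul_one _
        calc _ ≤ (C₁ * ‖h‖ + C * ‖h‖) * (C * ‖h‖) :=
              mul_le_mul ((norm_add_le _ _).trans (add_le_add e4 hwh)) hwh (norm_nonneg _)
                (by positivity)
          _ = _ := by ring
      rw [hδ'eq]
      refine (norm_add_le _ _).trans (add_le_add ?_ ?_)
      · rw [norm_neg]; exact e0
      · refine (norm_mul_le _ _).trans ?_
        rw [← norm_neg] at e1
        have e5 := (norm_add_le _ _).trans (add_le_add ((norm_sub_le
          (-((w q' - w q - fderiv ℝ w q (t • h)) (p + h))) (t • fderiv ℝ w q h h)).trans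
            (add_le_add e1 e2)) e3)
        calc _ ≤ (K * ‖h‖ ^ 2 + C₁ * ‖h‖ ^ 2 + (C₁ + C) * C * ‖h‖ ^ 2) * D :=
              mul_le_mul e5 (hD t ht') (norm_nonneg _) (by positivity)
          _ = _ := by rw [hB]; ring
    have hg := norm_le_gronwallBound_of_norm_deriv_right_le (f := δ) (f' := δ') (δ := 0) (K := C)
      (ε := B * ‖h‖ ^ 2) (a := 0) (b := 1)
      (fun t ht => (hder t ht).continuousWithinAt)
      (fun t ht => (hder t ⟨ht.1, ht.2.le⟩).mono_of_mem_nhdsWithin (Icc_mem_nhdsGE_of_mem ht))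
      (by simp [hδ, hF0 p hp, hF0 _ hph]) hbound 1 (by simp)
    have hlin : gronwallBound 0 C (B * ‖h‖ ^ 2) (1 - 0) = gronwallBound 0 C B 1 * ‖h‖ ^ 2 := by
      rw [sub_zero]
      by_cases hC' : C = 0
      · rw [hC', gronwallBound_K0, gronwallBound_K0]; ring
      · rw [gronwallBound_of_K_ne_0 hC', gronwallBound_of_K_ne_0 hC']; ring
    rw [hlin] at hg
    simpa [hδ] using hg
  rw [hasFDerivAt_iff_isLittleO_nhds_zero]
  have hO2 : (fun h : V => F (z₀ + p + h - z₀) 1 - F (z₀ + p - z₀) 1 -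
      (-((ContinuousLinearMap.mul ℝ 𝔤).flip (F p 1)).comp (w (z₀ + p))) h) =O[𝓝 0]
      fun h => ‖h‖ ^ 2 := by
    refine Asymptotics.IsBigO.of_bound (gronwallBound 0 C B 1) ?_
    have hev : ∀ᶠ h : V in 𝓝 0, ‖p + h‖ < ε := by
      have : ContinuousAt (fun h : V => ‖p + h‖) 0 := by fun_prop
      exact this.eventually_lt_const (by simpa using hp)
    filter_upwards [hev] with h hh
    have h1 := key h hh
    have h2 : z₀ + p + h - z₀ = p + h := by abel
    have h3 : z₀ + p - z₀ = p := by abel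
    rw [h2, h3]
    simpa using h1
  refine hO2.trans_isLittleO ?_
  exact (Asymptotics.isLittleO_norm_pow_id one_lt_two)

end FlatSystems

/-! ### Charts and coordinate vector fields -/

section Charts

variable {M : Type*} [TopologicalSpace M] [ChartedSpace ℂ M] [IsManifold 𝓘(ℂ, ℂ) ω M]

/-- The derivative at `z` of the inverse of the chart at `x₀`. -/
def dchart (x₀ : M) (z : ℂ) : ℂ →L[ℝ] ℂ :=
  mfderiv 𝓘(ℝ, ℂ) 𝓘(ℝ, ℂ) (chartAt ℂ x₀).symm z

theorem mdifferentiableAt_chart_symm (x₀ : M) {z : ℂ} (hz : z ∈ (chartAt ℂ x₀).target) :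
    MDifferentiableAt 𝓘(ℝ, ℂ) 𝓘(ℝ, ℂ) (chartAt ℂ x₀).symm z :=
  mdifferentiableAt_atlas_symm (chart_mem_atlas ℂ x₀) hz

theorem contMDiffAt_chart_symm (x₀ : M) {z : ℂ} (hz : z ∈ (chartAt ℂ x₀).target) :
    ContMDiffAt 𝓘(ℝ, ℂ) 𝓘(ℝ, ℂ) ∞ (chartAt ℂ x₀).symm z :=
  contMDiffOn_chart_symm.contMDiffAt ((chartAt ℂ x₀).open_target.mem_nhds hz)

theorem isInvertible_dchart (x₀ : M) {z : ℂ} (hz : z ∈ (chartAt ℂ x₀).target) :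
    (dchart x₀ z).IsInvertible := by
  have h1 := isInvertible_mfderivWithin_extChartAt_symm (I := 𝓘(ℝ, ℂ)) (x := x₀) (y := z)
    (by simpa using hz)
  have h2 : mfderivWithin 𝓘(ℝ, ℂ) 𝓘(ℝ, ℂ) (extChartAt 𝓘(ℝ, ℂ) x₀).symm (range 𝓘(ℝ, ℂ)) z =
      dchart x₀ z := by
    simp only [modelWithCornersSelf_coe, range_id, mfderivWithin_univ]
    rfl
  rw [h2] at h1
  exact h1

theorem hasFDerivAt_comp_chart_symm {F : Type*} [NormedAddCommGroup F] [NormedSpace ℝ F]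
    (x₀ : M) {z : ℂ} (hz : z ∈ (chartAt ℂ x₀).target) {g : M → F}
    (hg : MDifferentiableAt 𝓘(ℝ, ℂ) 𝓘(ℝ, F) g ((chartAt ℂ x₀).symm z)) :
    HasFDerivAt (fun z => g ((chartAt ℂ x₀).symm z))
      (ContinuousLinearMap.comp (show ℂ →L[ℝ] F from
        mfderiv 𝓘(ℝ, ℂ) 𝓘(ℝ, F) g ((chartAt ℂ x₀).symm z)) (dchart x₀ z)) z :=
  (hg.hasMFDerivAt.comp z (mdifferentiableAt_chart_symm x₀ hz).hasMFDerivAt).hasFDerivAt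

theorem mdifferentiableAt_chart (x₀ : M) {x : M} (hx : x ∈ (chartAt ℂ x₀).source) :
    MDifferentiableAt 𝓘(ℝ, ℂ) 𝓘(ℝ, ℂ) (chartAt ℂ x₀) x :=
  mdifferentiableAt_atlas (chart_mem_atlas ℂ x₀) hx

/-- A function is differentiable at `x` if it is so in a chart. -/
theorem mdifferentiableAt_of_comp_chart_symm {F : Type*} [NormedAddCommGroup F]
    [NormedSpace ℝ F] (x₀ : M) {x : M} (hx : x ∈ (chartAt ℂ x₀).source) {g : M → F}
    (hg : DifferentiableAt ℝ (fun z => g ((chartAt ℂ x₀).symm z)) (chartAt ℂ x₀ x)) :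
    MDifferentiableAt 𝓘(ℝ, ℂ) 𝓘(ℝ, F) g x := by
  have h := hg.mdifferentiableAt.comp x (mdifferentiableAt_chart x₀ hx)
  refine h.congr_of_eventuallyEq ?_
  filter_upwards [(chartAt ℂ x₀).open_source.mem_nhds hx] with y hy
  simp [(chartAt ℂ x₀).left_inv hy]

/-- The coordinate vector field `v` of the chart at `x₀`. -/
def chartField (x₀ : M) (v : ℂ) (x : M) : TangentSpace 𝓘(ℝ, ℂ) x :=
  dchart x₀ (chartAt ℂ x₀ x) v

/-- In the trivialization of the tangent bundle at `x₀` this field is the constant `v`. -/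
theorem contMDiffAt_chartField (x₀ : M) {x : M} (hx : x ∈ (chartAt ℂ x₀).source) (v : ℂ) :
    ContMDiffAt 𝓘(ℝ, ℂ) (𝓘(ℝ, ℂ).prod 𝓘(ℝ, ℂ)) ∞
      (fun y => TotalSpace.mk' ℂ (E := fun y : M => TangentSpace 𝓘(ℝ, ℂ) y) y
        (chartField x₀ v y)) x := by
  set e := trivializationAt ℂ (TangentSpace 𝓘(ℝ, ℂ) : M → Type _) x₀ with he
  have hb : e.baseSet = (chartAt ℂ x₀).source := rfl
  refine (e.contMDiffAt_section_iff (s := chartField x₀ v) (hb ▸ hx)).2 ?_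
  refine (contMDiffAt_const (c := v)).congr_of_eventuallyEq ?_
  filter_upwards [(chartAt ℂ x₀).open_source.mem_nhds hx] with y hy
  have h1 := TangentBundle.symmL_trivializationAt (I := 𝓘(ℝ, ℂ)) hy
  have h2 : mfderivWithin 𝓘(ℝ, ℂ) 𝓘(ℝ, ℂ) (extChartAt 𝓘(ℝ, ℂ) x₀).symm (range 𝓘(ℝ, ℂ))
      (extChartAt 𝓘(ℝ, ℂ) x₀ y) = dchart x₀ (chartAt ℂ x₀ y) := by
    simp only [modelWithCornersSelf_coe, range_id, mfderivWithin_univ]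
    rfl
  rw [h2] at h1
  have h3 : chartField x₀ v y = e.symm y v := by
    rw [← e.symmL_apply (R := ℝ) (hb ▸ hy), h1]
    rfl
  rw [h3, e.apply_mk_symm (hb ▸ hy)]

end Charts

/-! ### Smoothness of covariant derivatives of local sections -/

section Smoothness

variable {M : Type*} [TopologicalSpace M] [ChartedSpace ℂ M] [IsManifold 𝓘(ℂ, ℂ) ω M]
  [T2Space M]
  {r : ℕ} {E : M → Type*} [TopologicalSpace (TotalSpace (Cn r) E)]
  [∀ x, NormedAddCommGroup (E x)] [∀ x, InnerProductSpace ℂ (E x)]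
  [FiberBundle (Cn r) E] [VectorBundle ℂ (Cn r) E] [VectorBundle ℝ (Cn r) E]
  [ContMDiffVectorBundle ∞ (Cn r) E 𝓘(ℝ, ℂ)]

variable (r E) in
/-- Smoothness of a local section. -/
def SmoothOn (s : ∀ x, E x) (V : Set M) : Prop :=
  ContMDiffOn 𝓘(ℝ, ℂ) (𝓘(ℝ, ℂ).prod 𝓘(ℝ, Cn r)) ∞ (fun y => TotalSpace.mk' (Cn r) y (s y)) V

theorem SmoothOn.diffAt {s : ∀ x, E x} {V : Set M} (hs : SmoothOn r E s V) (hV : IsOpen V)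
    {x : M} (hx : x ∈ V) : DiffAt (r := r) s x :=
  (hs.contMDiffAt (hV.mem_nhds hx)).mdifferentiableAt (by simp)

theorem smoothOn_symm_const (e : Trivialization (Cn r) (π (Cn r) E)) [MemTrivializationAtlas e]
    (u : Cn r) : SmoothOn r E (fun y => e.symm y u) e.baseSet := by
  rw [SmoothOn, e.contMDiffOn_section_baseSet_iff]
  refine (contMDiffOn_const (c := u)).congr fun y hy => ?_
  rw [e.apply_mk_symm hy]

/-- The regularity of `A` is applied to global sections, so the local section is first multiplied by
a bump function; locality of `A` shows that nothing changes near the point. -/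
theorem UnitaryConnection.smoothOn_cov (A : UnitaryConnection r E) {s : ∀ x, E x} {V : Set M}
    (hV : IsOpen V) (hs : SmoothOn r E s V) {X : ∀ x : M, TangentSpace 𝓘(ℝ, ℂ) x}
    (hX : ContMDiffOn 𝓘(ℝ, ℂ) (𝓘(ℝ, ℂ).prod 𝓘(ℝ, ℂ)) ∞
      (fun y => TotalSpace.mk' ℂ (E := fun y : M => TangentSpace 𝓘(ℝ, ℂ) y) y (X y)) V) :
    SmoothOn r E (fun y => A.cov s y (X y)) V := by
  intro x hx
  apply ContMDiffAt.contMDiffWithinAt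
  obtain ⟨f, -, hf⟩ := (SmoothBumpFunction.nhds_basis_tsupport (I := 𝓘(ℝ, ℂ)) x).mem_iff.1
    (hV.mem_nhds hx)
  have hσ : SmoothOn r E (fun y => f y • s y) univ := by
    have h1 : ContMDiffOn 𝓘(ℝ, ℂ) 𝓘(ℝ, ℝ) ∞ f V := f.contMDiff.contMDiffOn
    exact (ContMDiffOn.smul_section_of_tsupport h1 hV hf hs).contMDiffOn
  have h1 := A.smooth.contMDiff.contMDiff (σ := fun y => f y • s y) (by
    simpa only [SmoothOn, show (∞ : WithTop ℕ∞) + 1 = ∞ from rfl] using hσ)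
  have h2 := (h1.contMDiffAt Filter.univ_mem).clm_bundle_apply
    (hX.contMDiffAt (hV.mem_nhds hx))
  refine ContMDiffAt.congr_of_eventuallyEq h2 ?_
  filter_upwards [f.eventuallyEq_one.eventually_nhds, hV.mem_nhds hx] with y hy hyV
  have h3 : A.cov s y = A.cov (fun y => f y • s y) y := by
    refine A.toMetric.cov_congr (hs.diffAt hV hyV) ?_
    filter_upwards [hy] with y' hy'
    rw [hy']
    simp
  rw [h3]

end Smoothness

/-- Real-linear endomorphisms of the model fibre. -/
abbrev EndR (r : ℕ) : Type := Cn r →L[ℝ] Cn r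

theorem endR_mul_apply {r : ℕ} (f g : EndR r) (u : Cn r) : (f * g) u = f (g u) := rfl

/-- The curvature `dw + w ∧ w` of a matrix-valued `1`-form on the plane. -/
def planarCurv {r : ℕ} (w : ℂ → ℂ →L[ℝ] EndR r) (z u v : ℂ) : EndR r :=
  fderiv ℝ w z u v - fderiv ℝ w z v u + (w z u * w z v - w z v * w z u)

/-! ### Connection forms in a chart and a trivialization -/

section LocalForm

variable {M : Type*} [TopologicalSpace M] [ChartedSpace ℂ M] [IsManifold 𝓘(ℂ, ℂ) ω M]
  {r : ℕ} {E : M → Type*} [TopologicalSpace (TotalSpace (Cn r) E)]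
  [∀ x, NormedAddCommGroup (E x)] [∀ x, InnerProductSpace ℂ (E x)]
  [FiberBundle (Cn r) E] [VectorBundle ℂ (Cn r) E] [VectorBundle ℝ (Cn r) E]
  [ContMDiffVectorBundle ∞ (Cn r) E 𝓘(ℝ, ℂ)]

theorem symm_add (e : Trivialization (Cn r) (π (Cn r) E)) [MemTrivializationAtlas e] {x : M}
    (hx : x ∈ e.baseSet) (u v : Cn r) : e.symm x (u + v) = e.symm x u + e.symm x v := by
  rw [← e.symmL_apply (R := ℝ) hx, map_add]
  simp only [e.symmL_apply hx]

theorem symm_smul (e : Trivialization (Cn r) (π (Cn r) E)) [MemTrivializationAtlas e] {x : M}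
    (hx : x ∈ e.baseSet) (a : ℂ) (u : Cn r) : e.symm x (a • u) = a • e.symm x u := by
  rw [← e.symmL_apply (R := ℂ) hx, map_smul]
  simp only [e.symmL_apply hx]

/-- The fibre coordinate of a vector in a trivialization. -/
def coord (e : Trivialization (Cn r) (π (Cn r) E)) {x : M} (v : E x) : Cn r := (e ⟨x, v⟩).2

theorem coord_add (e : Trivialization (Cn r) (π (Cn r) E)) [MemTrivializationAtlas e] {x : M}
    (hx : x ∈ e.baseSet) (u v : E x) : coord e (u + v) = coord e u + coord e v :=
  (e.linear ℝ hx).1 u v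

theorem coord_smul (e : Trivialization (Cn r) (π (Cn r) E)) [MemTrivializationAtlas e] {x : M}
    (hx : x ∈ e.baseSet) (a : ℂ) (u : E x) : coord e (a • u) = a • coord e u :=
  (e.linear ℂ hx).2 a u

theorem coord_real_smul (e : Trivialization (Cn r) (π (Cn r) E)) [MemTrivializationAtlas e]
    {x : M} (hx : x ∈ e.baseSet) (a : ℝ) (u : E x) : coord e (a • u) = a • coord e u :=
  (e.linear ℝ hx).2 a u

theorem coord_sub (e : Trivialization (Cn r) (π (Cn r) E)) [MemTrivializationAtlas e] {x : M}
    (hx : x ∈ e.baseSet) (u v : E x) : coord e (u - v) = coord e u - coord e v := by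
  have h := coord_add e hx (u - v) v
  rw [sub_add_cancel] at h
  rw [h, add_sub_cancel_right]

@[simp]
theorem coord_symm (e : Trivialization (Cn r) (π (Cn r) E)) {x : M}
    (hx : x ∈ e.baseSet) (u : Cn r) : coord e (e.symm x u) = u := by
  rw [coord, e.apply_mk_symm hx]

@[simp]
theorem symm_coord (e : Trivialization (Cn r) (π (Cn r) E)) {x : M}
    (hx : x ∈ e.baseSet) (v : E x) : e.symm x (coord e v) = v :=
  e.symm_apply_apply_mk hx v

/-- The domain, in the chart at `x₀`, of the trivialization `e`. -/
def chartDom (x₀ : M) (e : Trivialization (Cn r) (π (Cn r) E)) : Set ℂ :=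
  (chartAt ℂ x₀).target ∩ (chartAt ℂ x₀).symm ⁻¹' e.baseSet

theorem isOpen_chartDom (x₀ : M) (e : Trivialization (Cn r) (π (Cn r) E)) :
    IsOpen (chartDom x₀ e) :=
  (chartAt ℂ x₀).isOpen_inter_preimage_symm e.open_baseSet

/-- The derivative of a function on `M`, as a linear map on the model `ℂ` of the tangent space. -/
def mfd {F : Type*} [NormedAddCommGroup F] [NormedSpace ℝ F] (g : M → F) (x : M) : ℂ →L[ℝ] F :=
  mfderiv 𝓘(ℝ, ℂ) 𝓘(ℝ, F) g x

theorem mfd_const {F : Type*} [NormedAddCommGroup F] [NormedSpace ℝ F] (a : F) (x : M) :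
    mfd (fun _ => a) x = 0 :=
  mfderiv_const

theorem hasFDerivAt_mfd {F : Type*} [NormedAddCommGroup F] [NormedSpace ℝ F]
    (x₀ : M) {z : ℂ} (hz : z ∈ (chartAt ℂ x₀).target) {g : M → F}
    (hg : MDifferentiableAt 𝓘(ℝ, ℂ) 𝓘(ℝ, F) g ((chartAt ℂ x₀).symm z)) :
    HasFDerivAt (fun z => g ((chartAt ℂ x₀).symm z))
      ((mfd g ((chartAt ℂ x₀).symm z)).comp (dchart x₀ z)) z :=
  hasFDerivAt_comp_chart_symm x₀ hz hg

namespace MetricConnection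

variable (A : MetricConnection r E)

/-- The covariant derivative, with the tangent space identified with `ℂ`. -/
def D (s : ∀ x, E x) (x : M) : ℂ →L[ℝ] E x := A.cov s x

theorem D_congr {s t : ∀ x, E x} {x : M} (hs : DiffAt (r := r) s x)
    (h : ∀ᶠ y in 𝓝 x, s y = t y) : A.D s x = A.D t x := A.cov_congr hs h

theorem D_add {s t : ∀ x, E x} {x : M} (hs : DiffAt (r := r) s x) (ht : DiffAt (r := r) t x) :
    A.D (fun y => s y + t y) x = A.D s x + A.D t x := A.cov_add hs ht

theorem D_smul {s : ∀ x, E x} {x : M} {g : M → ℂ}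
    (hg : MDifferentiableAt 𝓘(ℝ, ℂ) 𝓘(ℝ, ℂ) g x) (hs : DiffAt (r := r) s x) (v : ℂ) :
    A.D (fun y => g y • s y) x v = g x • A.D s x v + mfd g x v • s x := A.cov_smul hg hs v

theorem D_const_smul {s : ∀ x, E x} {x : M} (a : ℂ) (hs : DiffAt (r := r) s x) (v : ℂ) :
    A.D (fun y => a • s y) x v = a • A.D s x v := A.cov_const_smul a hs v

theorem D_coord (e : Trivialization (Cn r) (π (Cn r) E)) [MemTrivializationAtlas e]
    {s : ∀ x, E x} {x : M} (hx : x ∈ e.baseSet) (hs : DiffAt (r := r) s x) (v : ℂ) :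
    A.D s x v = e.symm x (mfd (fun y => coord e (s y)) x v) +
      A.D (fun y => e.symm y (coord e (s x))) x v := A.cov_coord e hx hs v

theorem mfd_inner {s t : ∀ x, E x} {x : M} (hs : DiffAt (r := r) s x) (ht : DiffAt (r := r) t x)
    (v : ℂ) : mfd (fun y => inner ℂ (s y) (t y)) x v =
      inner ℂ (A.D s x v) (t x) + inner ℂ (s x) (A.D t x v) := A.unitary s t x hs ht v

theorem D_symm_add (e : Trivialization (Cn r) (π (Cn r) E)) [MemTrivializationAtlas e] {x : M}
    (hx : x ∈ e.baseSet) (u u' : Cn r) (v : ℂ) :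
    A.D (fun y => e.symm y (u + u')) x v =
      A.D (fun y => e.symm y u) x v + A.D (fun y => e.symm y u') x v := by
  have h : ∀ᶠ y in 𝓝 x, e.symm y (u + u') = e.symm y u + e.symm y u' := by
    filter_upwards [e.open_baseSet.mem_nhds hx] with y hy using symm_add e hy _ _
  rw [A.D_congr (diffAt_symm_const e hx _) h,
    A.D_add (diffAt_symm_const e hx _) (diffAt_symm_const e hx _), add_apply]

theorem D_symm_smul (e : Trivialization (Cn r) (π (Cn r) E)) [MemTrivializationAtlas e] {x : M}
    (hx : x ∈ e.baseSet) (a : ℂ) (u : Cn r) (v : ℂ) :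
    A.D (fun y => e.symm y (a • u)) x v = a • A.D (fun y => e.symm y u) x v := by
  have h : ∀ᶠ y in 𝓝 x, e.symm y (a • u) = a • e.symm y u := by
    filter_upwards [e.open_baseSet.mem_nhds hx] with y hy using symm_smul e hy _ _
  rw [A.D_congr (diffAt_symm_const e hx _) h, A.D_const_smul _ (diffAt_symm_const e hx _)]

open Classical in
/-- The connection form of `A` in the chart at `x₀` and in the trivialization `e`. -/
def connForm (x₀ : M) (e : Trivialization (Cn r) (π (Cn r) E)) [MemTrivializationAtlas e]
    (z : ℂ) : ℂ →L[ℝ] EndR r :=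
  if hz : (chartAt ℂ x₀).symm z ∈ e.baseSet then
    LinearMap.toContinuousLinearMap
      { toFun := fun v => LinearMap.toContinuousLinearMap
          { toFun := fun u => coord e (A.D (fun y => e.symm y u) ((chartAt ℂ x₀).symm z)
              (dchart x₀ z v))
            map_add' := fun u u' => by rw [A.D_symm_add e hz, coord_add e hz]
            map_smul' := fun a u => by
              have h := A.D_symm_smul e hz a u (dchart x₀ z v)
              rw [← coord_real_smul e hz]
              exact congrArg _ h }
        map_add' := fun v v' => by
          ext1 u
          change coord e (A.D _ _ (dchart x₀ z (v + v'))) = coord e (A.D _ _ (dchart x₀ z v)) +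
            coord e (A.D _ _ (dchart x₀ z v'))
          rw [← coord_add e hz, map_add, map_add]
        map_smul' := fun a v => by
          ext1 u
          change coord e (A.D _ _ (dchart x₀ z (a • v))) = a • coord e (A.D _ _ (dchart x₀ z v))
          rw [← coord_real_smul e hz, map_smul, map_smul] }
  else 0

theorem connForm_apply (x₀ : M) (e : Trivialization (Cn r) (π (Cn r) E))
    [MemTrivializationAtlas e] {z : ℂ} (hz : z ∈ chartDom x₀ e) (v : ℂ) (u : Cn r) :
    A.connForm x₀ e z v u =
      coord e (A.D (fun y => e.symm y u) ((chartAt ℂ x₀).symm z) (dchart x₀ z v)) := by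
  have hz2 : (chartAt ℂ x₀).symm z ∈ e.baseSet := hz.2
  rw [connForm, dif_pos hz2]
  rfl

theorem connForm_complex_smul (x₀ : M) (e : Trivialization (Cn r) (π (Cn r) E))
    [MemTrivializationAtlas e] {z : ℂ} (hz : z ∈ chartDom x₀ e) (v a : ℂ) (u : Cn r) :
    A.connForm x₀ e z v (a • u) = a • A.connForm x₀ e z v u := by
  rw [A.connForm_apply x₀ e hz, A.connForm_apply x₀ e hz, A.D_symm_smul e hz.2,
    coord_smul e hz.2]

theorem hasFDerivAt_coord (x₀ : M) (e : Trivialization (Cn r) (π (Cn r) E))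
    [MemTrivializationAtlas e] {z : ℂ} (hz : z ∈ chartDom x₀ e) {s : ∀ x, E x}
    (hs : DiffAt (r := r) s ((chartAt ℂ x₀).symm z)) :
    HasFDerivAt (fun z => coord e (s ((chartAt ℂ x₀).symm z)))
      ((mfd (fun y => coord e (s y)) ((chartAt ℂ x₀).symm z)).comp (dchart x₀ z)) z :=
  hasFDerivAt_mfd x₀ hz.1 ((diffAt_iff e hz.2).1 hs)

/-- The covariant derivative in a chart and a trivialization. -/
theorem coord_D (x₀ : M) (e : Trivialization (Cn r) (π (Cn r) E))
    [MemTrivializationAtlas e] {z : ℂ} (hz : z ∈ chartDom x₀ e) {s : ∀ x, E x}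
    (hs : DiffAt (r := r) s ((chartAt ℂ x₀).symm z)) (v : ℂ) :
    coord e (A.D s ((chartAt ℂ x₀).symm z) (dchart x₀ z v)) =
      fderiv ℝ (fun z => coord e (s ((chartAt ℂ x₀).symm z))) z v +
        A.connForm x₀ e z v (coord e (s ((chartAt ℂ x₀).symm z))) := by
  rw [A.D_coord e hz.2 hs, coord_add e hz.2, coord_symm e hz.2, A.connForm_apply x₀ e hz,
    (hasFDerivAt_coord x₀ e hz hs).fderiv]
  rfl

end MetricConnection

/-- The planar computation behind the tensoriality of the curvature. -/
theorem planar_curvature {w : ℂ → ℂ →L[ℝ] EndR r} {s : ℂ → Cn r} {X Y : ℂ → ℂ} {z : ℂ}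
    (hw : DifferentiableAt ℝ w z) (hs : ContDiffAt ℝ 2 s z) (hX : DifferentiableAt ℝ X z)
    (hY : DifferentiableAt ℝ Y z) :
    (fderiv ℝ (fun z => fderiv ℝ s z (Y z) + w z (Y z) (s z)) z (X z) +
        w z (X z) (fderiv ℝ s z (Y z) + w z (Y z) (s z))) -
      (fderiv ℝ (fun z => fderiv ℝ s z (X z) + w z (X z) (s z)) z (Y z) +
        w z (Y z) (fderiv ℝ s z (X z) + w z (X z) (s z))) -
      (fderiv ℝ s z (VectorField.lieBracket ℝ X Y z) +
        w z (VectorField.lieBracket ℝ X Y z) (s z)) =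
      planarCurv w z (X z) (Y z) (s z) := by
  have hds : HasFDerivAt (fderiv ℝ s) (fderiv ℝ (fderiv ℝ s) z) z :=
    ((hs.fderiv_right (m := 1) (by norm_num)).differentiableAt (by norm_num)).hasFDerivAt
  have hs1 : HasFDerivAt s (fderiv ℝ s z) z := (hs.differentiableAt (by norm_num)).hasFDerivAt
  -- Second derivatives of `s` cancel by this symmetry, derivatives of `X` and `Y` are absorbed by
  -- the bracket, and mixed terms `w · ds` cancel in pairs; only `dw + w ∧ w` survives.
  have hsymm : ∀ u v, fderiv ℝ (fderiv ℝ s) z u v = fderiv ℝ (fderiv ℝ s) z v u := fun u v =>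
    (hs.isSymmSndFDerivAt (by simp)) u v
  have key : ∀ (Y : ℂ → ℂ), DifferentiableAt ℝ Y z → ∀ u,
      fderiv ℝ (fun z => fderiv ℝ s z (Y z) + w z (Y z) (s z)) z u =
        fderiv ℝ (fderiv ℝ s) z u (Y z) + fderiv ℝ s z (fderiv ℝ Y z u) +
        (fderiv ℝ w z u (Y z) (s z) + w z (fderiv ℝ Y z u) (s z) + w z (Y z) (fderiv ℝ s z u)) := by
    intro Y hY u
    have h := (hds.clm_apply hY.hasFDerivAt).fun_add
      ((hw.hasFDerivAt.clm_apply hY.hasFDerivAt).clm_apply hs1)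
    rw [h.fderiv]
    simp only [add_apply, ContinuousLinearMap.comp_apply, ContinuousLinearMap.flip_apply]
    abel
  rw [key Y hY, key X hX, VectorField.lieBracket, hsymm (Y z) (X z), planarCurv]
  simp only [map_add, map_sub, add_apply, sub_apply, endR_mul_apply]
  abel

end LocalForm

/-! ### The curvature tensor in local coordinates -/

section Curvature

variable {M : Type*} [TopologicalSpace M] [ChartedSpace ℂ M] [IsManifold 𝓘(ℂ, ℂ) ω M]
  [T2Space M]
  {r : ℕ} {E : M → Type*} [TopologicalSpace (TotalSpace (Cn r) E)]
  [∀ x, NormedAddCommGroup (E x)] [∀ x, InnerProductSpace ℂ (E x)]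
  [FiberBundle (Cn r) E] [VectorBundle ℂ (Cn r) E] [VectorBundle ℝ (Cn r) E]
  [ContMDiffVectorBundle ∞ (Cn r) E 𝓘(ℝ, ℂ)]

theorem SmoothOn.contDiffOn_coord {s : ∀ x, E x} {V : Set M} (hV : IsOpen V)
    (hs : SmoothOn r E s V) (x₀ : M) (e : Trivialization (Cn r) (π (Cn r) E))
    [MemTrivializationAtlas e] :
    ContDiffOn ℝ ∞ (fun z => coord e (s ((chartAt ℂ x₀).symm z)))
      (chartDom x₀ e ∩ (chartAt ℂ x₀).symm ⁻¹' V) := by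
  intro z hz
  have h1 := (e.contMDiffAt_section_iff hz.1.2).1 (hs.contMDiffAt (hV.mem_nhds hz.2))
  have h2 := h1.comp z (contMDiffAt_chart_symm x₀ hz.1.1)
  exact h2.contDiffAt.contDiffWithinAt

namespace UnitaryConnection

variable (A : UnitaryConnection r E)

/-- Its entries are the coordinates of the derivatives of constant frame vectors along coordinate
vector fields, which `smoothOn_cov` controls. -/
theorem contDiffOn_connForm (x₀ : M) (e : Trivialization (Cn r) (π (Cn r) E))
    [MemTrivializationAtlas e] :
    ContDiffOn ℝ ∞ (A.toMetric.connForm x₀ e) (chartDom x₀ e) := by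
  rw [contDiffOn_clm_apply]
  intro v
  rw [contDiffOn_clm_apply]
  intro u
  have hV : IsOpen (e.baseSet ∩ (chartAt ℂ x₀).source) :=
    e.open_baseSet.inter (chartAt ℂ x₀).open_source
  have h := A.smoothOn_cov hV ((smoothOn_symm_const e u).mono inter_subset_left)
    (X := chartField x₀ v) (fun x hx => (contMDiffAt_chartField x₀ hx.2 v).contMDiffWithinAt)
  refine ((h.contDiffOn_coord hV x₀ e).mono fun z hz => ?_).congr fun z hz => ?_
  · exact ⟨hz, hz.2, (chartAt ℂ x₀).map_target hz.1⟩
  · rw [A.toMetric.connForm_apply x₀ e hz, chartField, (chartAt ℂ x₀).right_inv hz.1]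
    rfl

/-- The curvature in a chart and a trivialization. -/
theorem coord_curvature (x₀ : M) (e : Trivialization (Cn r) (π (Cn r) E))
    [MemTrivializationAtlas e] {z : ℂ} (hz : z ∈ chartDom x₀ e) {V : Set M} (hV : IsOpen V)
    (hzV : (chartAt ℂ x₀).symm z ∈ V) {s : ∀ x, E x} (hs : SmoothOn r E s V)
    {X Y : ∀ x : M, TangentSpace 𝓘(ℝ, ℂ) x}
    (hX : ContMDiffOn 𝓘(ℝ, ℂ) (𝓘(ℝ, ℂ).prod 𝓘(ℝ, ℂ)) ∞
      (fun y => TotalSpace.mk' ℂ (E := fun y : M => TangentSpace 𝓘(ℝ, ℂ) y) y (X y)) V)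
    (hY : ContMDiffOn 𝓘(ℝ, ℂ) (𝓘(ℝ, ℂ).prod 𝓘(ℝ, ℂ)) ∞
      (fun y => TotalSpace.mk' ℂ (E := fun y : M => TangentSpace 𝓘(ℝ, ℂ) y) y (Y y)) V)
    {a b : ℂ} (ha : X ((chartAt ℂ x₀).symm z) = dchart x₀ z a)
    (hb : Y ((chartAt ℂ x₀).symm z) = dchart x₀ z b) :
    coord e (A.curvature X Y s ((chartAt ℂ x₀).symm z)) =
      planarCurv (A.toMetric.connForm x₀ e) z a b (coord e (s ((chartAt ℂ x₀).symm z))) := by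
  set W : Set ℂ := chartDom x₀ e ∩ (chartAt ℂ x₀).symm ⁻¹' V with hW
  have hWo : IsOpen W := by
    have : W = chartDom x₀ e ∩ ((chartAt ℂ x₀).target ∩ (chartAt ℂ x₀).symm ⁻¹' V) := by
      ext y; simp only [hW, chartDom, mem_inter_iff, mem_preimage]; tauto
    rw [this]
    exact (isOpen_chartDom x₀ e).inter ((chartAt ℂ x₀).isOpen_inter_preimage_symm hV)
  have hzW : z ∈ W := ⟨hz, hzV⟩
  set st : ℂ → Cn r := fun z => coord e (s ((chartAt ℂ x₀).symm z)) with hst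
  set w := A.toMetric.connForm x₀ e with hw
  have hstC : ContDiffOn ℝ ∞ st W := hs.contDiffOn_coord hV x₀ e
  have hwd : DifferentiableAt ℝ w z :=
    ((A.contDiffOn_connForm x₀ e).contDiffAt ((isOpen_chartDom x₀ e).mem_nhds hz)).differentiableAt
      (by simp)
  -- coordinates of vector fields
  have hpull : ∀ (X : ∀ x : M, TangentSpace 𝓘(ℝ, ℂ) x),
      ContMDiffOn 𝓘(ℝ, ℂ) (𝓘(ℝ, ℂ).prod 𝓘(ℝ, ℂ)) ∞
        (fun y => TotalSpace.mk' ℂ (E := fun y : M => TangentSpace 𝓘(ℝ, ℂ) y) y (X y)) V →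
      ∃ Xt : ℂ → ℂ, Xt = VectorField.mpullback 𝓘(ℝ, ℂ) 𝓘(ℝ, ℂ) (chartAt ℂ x₀).symm X ∧
        (∀ y ∈ W, X ((chartAt ℂ x₀).symm y) = dchart x₀ y (Xt y)) ∧ DifferentiableAt ℝ Xt z := by
    intro X hX
    refine ⟨_, rfl, fun y hy => ?_, ?_⟩
    · have h := (isInvertible_dchart x₀ hy.1.1).self_comp_inverse
      exact (congrArg (fun T : ℂ →L[ℝ] ℂ => T (X ((chartAt ℂ x₀).symm y))) h).symm
    · have h2 := (hX.contMDiffAt (hV.mem_nhds hzV)).mpullback_vectorField_preimage (m := ∞)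
        (n := ∞) (f := (chartAt ℂ x₀).symm) (x₀ := z) (contMDiffAt_chart_symm x₀ hz.1)
        (isInvertible_dchart x₀ hz.1) le_rfl
      exact (contMDiffAt_vectorSpace_iff_contDiffAt.1 h2).differentiableAt (by simp)
  obtain ⟨Xt, hXt, hX1, hX2⟩ := hpull X hX
  obtain ⟨Yt, hYt, hY1, hY2⟩ := hpull Y hY
  have hinj : ∀ u v : ℂ, dchart x₀ z u = dchart x₀ z v → u = v := by
    intro u v h
    obtain ⟨L, hL⟩ := isInvertible_dchart x₀ hz.1
    rw [← hL] at h
    exact L.injective h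
  have hXa : Xt z = a := hinj _ _ ((hX1 z hzW).symm.trans ha)
  have hYb : Yt z = b := hinj _ _ ((hY1 z hzW).symm.trans hb)
  -- The bracket on `M` is compared with the planar one by naturality of brackets under pull-back by
  -- the inverse chart.
  have hbr : VectorField.mlieBracket 𝓘(ℝ, ℂ) X Y ((chartAt ℂ x₀).symm z) =
      dchart x₀ z (VectorField.lieBracket ℝ Xt Yt z) := by
    have : IsManifold 𝓘(ℝ, ℂ) (minSmoothness ℝ 2) M :=
      IsManifold.of_le (n := ∞) (by rw [minSmoothness_of_isRCLikeNormedField]; norm_cast)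
    have h := VectorField.mpullback_mlieBracket (I := 𝓘(ℝ, ℂ)) (I' := 𝓘(ℝ, ℂ)) (n := ∞)
      (V := X) (W := Y) (x₀ := z) (f := (chartAt ℂ x₀).symm)
      ((hX.contMDiffAt (hV.mem_nhds hzV)).mdifferentiableAt (by simp))
      ((hY.contMDiffAt (hV.mem_nhds hzV)).mdifferentiableAt (by simp))
      (contMDiffAt_chart_symm x₀ hz.1)
      (by rw [minSmoothness_of_isRCLikeNormedField]; norm_cast)
    have h' : VectorField.mlieBracket 𝓘(ℝ, ℂ) Xt Yt z = VectorField.lieBracket ℝ Xt Yt z :=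
      (congrFun (VectorField.mlieBracketWithin_eq_lieBracketWithin (V := Xt) (W := Yt)
        (s := univ)) z).trans (congrFun VectorField.lieBracketWithin_univ z)
    rw [← hXt, ← hYt] at h
    replace h := h.trans h'
    have h3 := (isInvertible_dchart x₀ hz.1).self_comp_inverse
    rw [← h]
    exact (congrArg (fun T : ℂ →L[ℝ] ℂ => T (VectorField.mlieBracket 𝓘(ℝ, ℂ) X Y
      ((chartAt ℂ x₀).symm z))) h3).symm
  have key : ∀ (X : ∀ x : M, TangentSpace 𝓘(ℝ, ℂ) x) (Xt : ℂ → ℂ) (u : ℂ),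
      ContMDiffOn 𝓘(ℝ, ℂ) (𝓘(ℝ, ℂ).prod 𝓘(ℝ, ℂ)) ∞
        (fun y => TotalSpace.mk' ℂ (E := fun y : M => TangentSpace 𝓘(ℝ, ℂ) y) y (X y)) V →
      (∀ y ∈ W, X ((chartAt ℂ x₀).symm y) = dchart x₀ y (Xt y)) →
      coord e (A.toMetric.D (fun y => A.toMetric.D s y (X y)) ((chartAt ℂ x₀).symm z)
        (dchart x₀ z u)) = fderiv ℝ (fun z => fderiv ℝ st z (Xt z) + w z (Xt z) (st z)) z u +
          w z u (fderiv ℝ st z (Xt z) + w z (Xt z) (st z)) := by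
    intro X Xt u hX hX1
    have h1 : DiffAt (r := r) (fun y => A.toMetric.D s y (X y)) ((chartAt ℂ x₀).symm z) :=
      (A.smoothOn_cov hV hs hX).diffAt hV hzV
    have h2 : ∀ y ∈ W, coord e (A.toMetric.D s ((chartAt ℂ x₀).symm y)
        (X ((chartAt ℂ x₀).symm y))) = fderiv ℝ st y (Xt y) + w y (Xt y) (st y) := by
      intro y hy
      have h3 := A.toMetric.coord_D x₀ e hy.1 (hs.diffAt hV hy.2) (Xt y)
      rw [← hX1 y hy] at h3
      exact h3
    rw [A.toMetric.coord_D x₀ e hz h1, h2 z hzW]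
    congr 2
    refine Filter.EventuallyEq.fderiv_eq ?_
    filter_upwards [hWo.mem_nhds hzW] with y hy using h2 y hy
  have hcur : A.curvature X Y s ((chartAt ℂ x₀).symm z) =
      A.toMetric.D (fun y => A.toMetric.D s y (Y y)) ((chartAt ℂ x₀).symm z) (dchart x₀ z a) -
      A.toMetric.D (fun y => A.toMetric.D s y (X y)) ((chartAt ℂ x₀).symm z) (dchart x₀ z b) -
      A.toMetric.D s ((chartAt ℂ x₀).symm z)
        (dchart x₀ z (VectorField.lieBracket ℝ Xt Yt z)) := by
    rw [← hbr, ← ha, ← hb]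
    rfl
  have hst2 : ContDiffAt ℝ 2 st z :=
    (hstC.contDiffAt (hWo.mem_nhds hzW)).of_le (by norm_cast)
  have hpc := planar_curvature hwd hst2 hX2 hY2
  rw [hXa, hYb] at hpc
  rw [hcur, coord_sub e hz.2, coord_sub e hz.2, key Y Yt a hY hY1, key X Xt b hX hX1,
    A.toMetric.coord_D x₀ e hz (hs.diffAt hV hzV), hXa, hYb, ← hpc]

/-- The curvature tensor in a chart and a trivialization. -/
theorem coord_curvatureAt (x₀ : M) (e : Trivialization (Cn r) (π (Cn r) E))
    [MemTrivializationAtlas e] {z : ℂ} (hz : z ∈ chartDom x₀ e) (a b : ℂ)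
    (u : E ((chartAt ℂ x₀).symm z)) :
    coord e (A.curvatureAt ((chartAt ℂ x₀).symm z) (dchart x₀ z a) (dchart x₀ z b) u) =
      planarCurv (A.toMetric.connForm x₀ e) z a b (coord e u) := by
  set eE := trivializationAt (Cn r) E ((chartAt ℂ x₀).symm z)
  set eT := trivializationAt ℂ (TangentSpace 𝓘(ℝ, ℂ) : M → Type _) ((chartAt ℂ x₀).symm z)
  have hxE : (chartAt ℂ x₀).symm z ∈ eE.baseSet := FiberBundle.mem_baseSet_trivializationAt' _
  have hxT : (chartAt ℂ x₀).symm z ∈ eT.baseSet := FiberBundle.mem_baseSet_trivializationAt' _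
  have hT : ∀ v : TangentSpace 𝓘(ℝ, ℂ) ((chartAt ℂ x₀).symm z), ContMDiffOn 𝓘(ℝ, ℂ) (𝓘(ℝ, ℂ).prod 𝓘(ℝ, ℂ)) ∞
      (fun y => TotalSpace.mk' ℂ (E := fun y : M => TangentSpace 𝓘(ℝ, ℂ) y) y
        (FiberBundle.extend ℂ v y)) (eE.baseSet ∩ eT.baseSet) := by
    intro v
    refine ContMDiffOn.mono ?_ inter_subset_right
    rw [eT.contMDiffOn_section_baseSet_iff]
    refine (contMDiffOn_const (c := (eT ⟨_, v⟩).2)).congr fun y hy => ?_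
    change (eT ⟨y, eT.symm y (eT ⟨_, v⟩).2⟩).2 = _
    rw [eT.apply_mk_symm hy]
  -- The extensions used by `curvatureAt` are constant in the trivializations centred at the point,
  -- hence smooth on this neighbourhood; `coord_curvature` shows that only their values at the point
  -- matter.
  have h := A.coord_curvature x₀ e hz (eE.open_baseSet.inter eT.open_baseSet) ⟨hxE, hxT⟩
    (s := fun y => FiberBundle.extend (Cn r) u y)
    ((smoothOn_symm_const eE (eE ⟨_, u⟩).2).mono inter_subset_left)
    (hT (dchart x₀ z a)) (hT (dchart x₀ z b)) (a := a) (b := b)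
    (FiberBundle.extend_apply_self ..) (FiberBundle.extend_apply_self ..)
  refine h.trans ?_
  congr 2
  exact FiberBundle.extend_apply_self ..

theorem HasCentralCurvature.planarCurv_apply {A : UnitaryConnection r E}
    {κ : ∀ x : M, TangentSpace 𝓘(ℝ, ℂ) x → TangentSpace 𝓘(ℝ, ℂ) x → ℂ}
    (hA : A.HasCentralCurvature κ) (x₀ : M) (e : Trivialization (Cn r) (π (Cn r) E))
    [MemTrivializationAtlas e] {z : ℂ} (hz : z ∈ chartDom x₀ e) (a b : ℂ) (u : Cn r) :
    planarCurv (A.toMetric.connForm x₀ e) z a b u =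
      κ ((chartAt ℂ x₀).symm z) (dchart x₀ z a) (dchart x₀ z b) • u := by
  have h := A.coord_curvatureAt x₀ e hz a b (e.symm _ u)
  rw [coord_symm e hz.2] at h
  refine h.symm.trans ((congrArg (coord e) (hA _ _ _ _)).trans ?_)
  rw [coord_smul e hz.2, coord_symm e hz.2]

/-- The connection form is complex-linear on the fibre at every point of an open set, so its
derivative is too. -/
theorem planarCurv_complex_smul (x₀ : M) (e : Trivialization (Cn r) (π (Cn r) E))
    [MemTrivializationAtlas e] {z : ℂ} (hz : z ∈ chartDom x₀ e) (a b k : ℂ) (u : Cn r) :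
    planarCurv (A.toMetric.connForm x₀ e) z a b (k • u) =
      k • planarCurv (A.toMetric.connForm x₀ e) z a b u := by
  have hwd : DifferentiableAt ℝ (A.toMetric.connForm x₀ e) z :=
    ((A.contDiffOn_connForm x₀ e).contDiffAt ((isOpen_chartDom x₀ e).mem_nhds hz)).differentiableAt
      (by simp)
  have h1 : ∀ a b : ℂ, fderiv ℝ (A.toMetric.connForm x₀ e) z a b (k • u) =
      k • fderiv ℝ (A.toMetric.connForm x₀ e) z a b u := by
    intro a b
    have h2 : ∀ u : Cn r, HasFDerivAt (fun z => A.toMetric.connForm x₀ e z b u)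
        (((fderiv ℝ (A.toMetric.connForm x₀ e) z).flip b).flip u) z := by
      intro u
      have h3 := (hwd.hasFDerivAt.clm_apply (hasFDerivAt_const b z)).clm_apply
        (hasFDerivAt_const u z)
      refine h3.congr_fderiv ?_
      ext1 v
      simp
    have h4 : HasFDerivAt (fun z => A.toMetric.connForm x₀ e z b (k • u))
        (k • ((fderiv ℝ (A.toMetric.connForm x₀ e) z).flip b).flip u) z := by
      refine ((h2 u).const_smul k).congr_of_eventuallyEq ?_
      filter_upwards [(isOpen_chartDom x₀ e).mem_nhds hz] with y hy
      exact A.toMetric.connForm_complex_smul x₀ e hy b k u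
    exact congrArg (fun T : ℂ →L[ℝ] Cn r => T a) ((h2 (k • u)).unique h4)
  simp only [planarCurv, add_apply, sub_apply, endR_mul_apply, h1,
    A.toMetric.connForm_complex_smul x₀ e hz, smul_add, smul_sub]

end UnitaryConnection

end Curvature

/-! ### Alternating forms and curls in the plane -/

instance (r : ℕ) : NormedAddCommGroup (EndR r) := ContinuousLinearMap.toNormedAddCommGroup

instance (r : ℕ) : NormedSpace ℝ (EndR r) := ContinuousLinearMap.toNormedSpace

instance (r : ℕ) : NormedAddCommGroup (ℂ →L[ℝ] EndR r) :=
  ContinuousLinearMap.toNormedAddCommGroup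

instance (r : ℕ) : NormedSpace ℝ (ℂ →L[ℝ] EndR r) := ContinuousLinearMap.toNormedSpace

/-- The standard area form of the plane. -/
def area (v w : ℂ) : ℝ := v.re * w.im - v.im * w.re

/-- The coefficient of the exterior derivative of a `1`-form on the plane. -/
def curl (h : ℂ → ℂ →L[ℝ] ℂ) (z : ℂ) : ℂ := fderiv ℝ h z 1 Complex.I - fderiv ℝ h z Complex.I 1

/-- Alternating forms on a plane form a one-dimensional space: expand both arguments in the basis
`1, I`. -/
theorem eq_area_smul_of_alternating {F : Type*} [AddCommGroup F] [Module ℝ F] (T : ℂ → ℂ → F)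
    (hadd : ∀ u v w, T (u + v) w = T u w + T v w) (hsmul : ∀ (a : ℝ) u w, T (a • u) w = a • T u w)
    (halt : ∀ u v, T u v = -T v u) (u v : ℂ) : T u v = area u v • T 1 Complex.I := by
  have h0 : ∀ u : ℂ, T u u = 0 := by
    intro u
    have h : T u u + T u u = 0 := by
      nth_rewrite 1 [halt u u]
      exact neg_add_cancel _
    have h2 : (2 : ℝ) • T u u = 0 := by rw [two_smul, h]
    exact (smul_eq_zero.1 h2).resolve_left (by norm_num)
  have hd : ∀ u : ℂ, u = u.re • (1 : ℂ) + u.im • Complex.I := by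
    intro u
    apply Complex.ext <;> simp
  have hl : ∀ w, T u w = u.re • T 1 w + u.im • T Complex.I w := by
    intro w
    conv_lhs => rw [hd u, hadd, hsmul, hsmul]
  have hr : ∀ u, T u v = v.re • T u 1 + v.im • T u Complex.I := by
    intro u
    rw [halt u v, halt u 1, halt u Complex.I]
    conv_lhs => rw [hd v, hadd, hsmul, hsmul]
    simp only [smul_neg]
    abel
  rw [hl, hr 1, hr Complex.I, h0, h0, halt Complex.I 1, area]
  simp only [smul_zero, zero_add, add_zero, smul_neg, smul_smul, sub_smul]
  abel

theorem fderiv_antisymm_eq_area (h : ℂ → ℂ →L[ℝ] ℂ) (z u v : ℂ) :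
    fderiv ℝ h z u v - fderiv ℝ h z v u = area u v • curl h z := by
  refine eq_area_smul_of_alternating (fun u v => fderiv ℝ h z u v - fderiv ℝ h z v u)
    ?_ ?_ ?_ u v
  · intro u v w
    simp only [map_add, add_apply]
    abel
  · intro a u w
    simp only [map_smul, smul_apply, smul_sub]
  · intro u v
    abel

-- Flatness thus has to be checked only on the pair `(1, I)`.
set_option synthInstance.maxHeartbeats 200000 in
theorem planarCurv_eq_area {r : ℕ} (w : ℂ → ℂ →L[ℝ] EndR r) (z u v : ℂ) :
    planarCurv w z u v = area u v • planarCurv w z 1 Complex.I := by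
  refine eq_area_smul_of_alternating (planarCurv w z) ?_ ?_ ?_ u v
  · intro u v x
    simp only [planarCurv, map_add, add_apply, add_mul, mul_add]
    abel
  · intro a u x
    have h1 : ∀ S T : EndR r, (a • S) * T = a • (S * T) := fun _ _ => rfl
    have h2 : ∀ S T : EndR r, S * (a • T) = a • (S * T) := fun S T => by
      ext1 y
      exact map_smul S a (T y)
    simp only [planarCurv, map_smul, smul_apply, smul_sub, smul_add, h1, h2]
  · intro u v
    simp only [planarCurv]
    abel

/-! ### Traces of fibre endomorphisms -/

section Trace

variable {r : ℕ}

/-- The trace of (the matrix of) an endomorphism of `ℂ^r`. -/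
def trR (r : ℕ) : EndR r →L[ℝ] ℂ :=
  ∑ k : Fin r, (((EuclideanSpace.proj k : Cn r →L[ℂ] ℂ).restrictScalars ℝ).comp
    (ContinuousLinearMap.apply ℝ (Cn r) (EuclideanSpace.single k (1 : ℂ))))

theorem trR_apply (T : EndR r) : trR r T = ∑ k : Fin r, T (EuclideanSpace.single k 1) k := by
  simp [trR, sum_apply]

theorem apply_eq_sum_single (S : EndR r) (hS : ∀ (a : ℂ) u, S (a • u) = a • S u) (u : Cn r)
    (k : Fin r) : S u k = ∑ j, u j * S (EuclideanSpace.single j 1) k := by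
  have h : u = ∑ j, u j • (EuclideanSpace.single j 1 : Cn r) := by
    ext i
    simp [Finset.sum_apply, Pi.single_apply]
  conv_lhs => rw [h, map_sum]
  simp [hS]

/-- Complex linearity is essential: `trR` reads only the entries on the complex basis vectors and is
cyclic only on complex matrices. -/
theorem trR_mul_comm (S T : EndR r) (hS : ∀ (a : ℂ) u, S (a • u) = a • S u)
    (hT : ∀ (a : ℂ) u, T (a • u) = a • T u) : trR r (S * T) = trR r (T * S) := by
  simp only [trR_apply, endR_mul_apply]
  have h1 : ∀ k, S (T (EuclideanSpace.single k 1)) k = ∑ j, T (EuclideanSpace.single k 1) j *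
      S (EuclideanSpace.single j 1) k := fun k => apply_eq_sum_single S hS _ _
  have h2 : ∀ k, T (S (EuclideanSpace.single k 1)) k = ∑ j, S (EuclideanSpace.single k 1) j *
      T (EuclideanSpace.single j 1) k := fun k => apply_eq_sum_single T hT _ _
  simp only [h1, h2]
  rw [Finset.sum_comm]
  exact Finset.sum_congr rfl fun j _ => Finset.sum_congr rfl fun k _ => mul_comm _ _

variable {M : Type*} [TopologicalSpace M] [ChartedSpace ℂ M] [IsManifold 𝓘(ℂ, ℂ) ω M]
  {E : M → Type*} [TopologicalSpace (TotalSpace (Cn r) E)]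
  [∀ x, NormedAddCommGroup (E x)] [∀ x, InnerProductSpace ℂ (E x)]
  [FiberBundle (Cn r) E] [VectorBundle ℂ (Cn r) E] [VectorBundle ℝ (Cn r) E]
  [ContMDiffVectorBundle ∞ (Cn r) E 𝓘(ℝ, ℂ)]

/-- The diagonal sum does not depend on the trivialization. This permits replacing the preferred
trivialization at each point, which need not vary continuously with the point, by a fixed one. -/
theorem sum_coord_eq_trace (e : Trivialization (Cn r) (π (Cn r) E)) [MemTrivializationAtlas e]
    {x : M} (hx : x ∈ e.baseSet) (T : E x →ₗ[ℂ] E x) :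
    ∑ k : Fin r, coord e (T (e.symm x (EuclideanSpace.single k 1))) k =
      LinearMap.trace ℂ (E x) T := by
  let ℓ : E x ≃ₗ[ℂ] (Fin r → ℂ) := (e.linearEquivAt ℂ x hx).trans (WithLp.linearEquiv 2 ℂ _)
  let b : Module.Basis (Fin r) ℂ (E x) := Module.Basis.ofEquivFun ℓ
  rw [LinearMap.trace_eq_matrix_trace ℂ b T, Matrix.trace]
  refine Finset.sum_congr rfl fun k _ => ?_
  rw [Matrix.diag_apply, LinearMap.toMatrix_apply]
  have hb : b k = e.symm x (EuclideanSpace.single k 1) := by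
    rw [Module.Basis.coe_ofEquivFun]
    rfl
  rw [hb]
  rfl

end Trace

/-! ### The trace of the curvature and its dependence on the connection -/

section CurvatureTrace

variable {M : Type*} [TopologicalSpace M] [ChartedSpace ℂ M] [IsManifold 𝓘(ℂ, ℂ) ω M]
  [T2Space M]
  {r : ℕ} {E : M → Type*} [TopologicalSpace (TotalSpace (Cn r) E)]
  [∀ x, NormedAddCommGroup (E x)] [∀ x, InnerProductSpace ℂ (E x)]
  [FiberBundle (Cn r) E] [VectorBundle ℂ (Cn r) E] [VectorBundle ℝ (Cn r) E]
  [ContMDiffVectorBundle ∞ (Cn r) E 𝓘(ℝ, ℂ)]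

/-- The pullback of a `1`-form by the inverse of the chart at `c`. -/
def pull (β : M → ℂ →L[ℝ] ℂ) (c : M) (z : ℂ) : ℂ →L[ℝ] ℂ :=
  (β ((chartAt ℂ c).symm z)).comp (dchart c z)

/-- Smooth complex-valued `1`-forms. -/
def SmoothForm (β : M → ℂ →L[ℝ] ℂ) : Prop :=
  ∀ c : M, ContDiffOn ℝ ∞ (pull β c) (chartAt ℂ c).target

namespace UnitaryConnection

variable (A : UnitaryConnection r E)

theorem traceCurvature_eq (x₀ : M) (e : Trivialization (Cn r) (π (Cn r) E))
    [MemTrivializationAtlas e] {z : ℂ} (hz : z ∈ chartDom x₀ e) (a b : ℂ) :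
    A.traceCurvature ((chartAt ℂ x₀).symm z) (dchart x₀ z a) (dchart x₀ z b) =
      trR r (planarCurv (A.toMetric.connForm x₀ e) z a b) := by
  let T : E ((chartAt ℂ x₀).symm z) →ₗ[ℂ] E ((chartAt ℂ x₀).symm z) :=
    { toFun := fun u => e.symm _ (planarCurv (A.toMetric.connForm x₀ e) z a b (coord e u))
      map_add' := fun u v => by rw [coord_add e hz.2, map_add, symm_add e hz.2]
      map_smul' := fun k u => by
        rw [coord_smul e hz.2, A.planarCurv_complex_smul x₀ e hz, symm_smul e hz.2]
        rfl }
  have hT : ∀ u, A.curvatureAt ((chartAt ℂ x₀).symm z) (dchart x₀ z a) (dchart x₀ z b) u = T u := by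
    intro u
    exact (symm_coord e hz.2 (A.curvatureAt _ _ _ u)).symm.trans
      (congrArg (e.symm _) (A.coord_curvatureAt x₀ e hz a b u))
  have h1 := sum_coord_eq_trace (trivializationAt (Cn r) E ((chartAt ℂ x₀).symm z))
    (FiberBundle.mem_baseSet_trivializationAt' _) T
  have h2 := sum_coord_eq_trace e hz.2 T
  rw [trR_apply]
  refine Eq.trans ?_ ((h1.trans h2.symm).trans ?_)
  · exact Finset.sum_congr rfl fun k _ => congrArg
      (fun v => coord (trivializationAt (Cn r) E ((chartAt ℂ x₀).symm z)) v k) (hT _)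
  · refine Finset.sum_congr rfl fun k _ => ?_
    change coord e (e.symm _ (planarCurv (A.toMetric.connForm x₀ e) z a b (coord e _))) k = _
    rw [coord_symm e hz.2, coord_symm e hz.2]

theorem differentiableAt_connForm (x₀ : M) (e : Trivialization (Cn r) (π (Cn r) E))
    [MemTrivializationAtlas e] {z : ℂ} (hz : z ∈ chartDom x₀ e) :
    DifferentiableAt ℝ (A.toMetric.connForm x₀ e) z :=
  ((A.contDiffOn_connForm x₀ e).contDiffAt ((isOpen_chartDom x₀ e).mem_nhds hz)).differentiableAt
    (by simp)

-- The trace kills the commutator `w ∧ w`, so the trace of the curvature is the exterior derivative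
-- of the trace of the connection form.
set_option synthInstance.maxHeartbeats 200000 in
theorem trR_planarCurv (x₀ : M) (e : Trivialization (Cn r) (π (Cn r) E))
    [MemTrivializationAtlas e] {z : ℂ} (hz : z ∈ chartDom x₀ e) :
    trR r (planarCurv (A.toMetric.connForm x₀ e) z 1 Complex.I) =
      curl (fun z => (trR r).comp (A.toMetric.connForm x₀ e z)) z := by
  have h : HasFDerivAt (fun z => (trR r).comp (A.toMetric.connForm x₀ e z)) _ z :=
    ((hasFDerivAt_const (trR r) z).clm_comp (A.differentiableAt_connForm x₀ e hz).hasFDerivAt)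
  rw [curl, h.fderiv, planarCurv, map_add, map_sub, map_sub,
    trR_mul_comm _ _ (A.toMetric.connForm_complex_smul x₀ e hz 1)
      (A.toMetric.connForm_complex_smul x₀ e hz Complex.I)]
  simp

/-- The `1`-form `tr (A - A')`. -/
def traceDiff (A A' : UnitaryConnection r E) (x : M) : ℂ →L[ℝ] ℂ :=
  LinearMap.toContinuousLinearMap
    { toFun := fun v => ∑ k : Fin r, coord (trivializationAt (Cn r) E x)
        (A.toMetric.D (fun y => (trivializationAt (Cn r) E x).symm y (EuclideanSpace.single k 1))
            x v -
          A'.toMetric.D (fun y => (trivializationAt (Cn r) E x).symm y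
            (EuclideanSpace.single k 1)) x v) k
      map_add' := fun v w => by
        have hx := FiberBundle.mem_baseSet_trivializationAt' (F := Cn r) (E := E) x
        rw [← Finset.sum_add_distrib]
        refine Finset.sum_congr rfl fun k _ => ?_
        rw [map_add, map_add, add_sub_add_comm, coord_add _ hx]
        rfl
      map_smul' := fun a v => by
        have hx := FiberBundle.mem_baseSet_trivializationAt' (F := Cn r) (E := E) x
        rw [RingHom.id_apply, Finset.smul_sum]
        refine Finset.sum_congr rfl fun k _ => ?_
        rw [map_smul, map_smul, ← smul_sub, coord_real_smul _ hx]
        rfl }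

/-- The derivative terms cancel in a difference of connections, which is therefore an
endomorphism-valued form; its trace can be computed in any trivialization. -/
theorem pull_traceDiff (A A' : UnitaryConnection r E) (x₀ : M)
    (e : Trivialization (Cn r) (π (Cn r) E)) [MemTrivializationAtlas e] {z : ℂ}
    (hz : z ∈ chartDom x₀ e) :
    pull (traceDiff A A') x₀ z = (trR r).comp (A.toMetric.connForm x₀ e z) -
      (trR r).comp (A'.toMetric.connForm x₀ e z) := by
  ext1 a
  let T : E ((chartAt ℂ x₀).symm z) →ₗ[ℂ] E ((chartAt ℂ x₀).symm z) :=
    { toFun := fun u => A.toMetric.D (fun y => e.symm y (coord e u)) _ (dchart x₀ z a) -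
        A'.toMetric.D (fun y => e.symm y (coord e u)) _ (dchart x₀ z a)
      map_add' := fun u v => by
        rw [coord_add e hz.2, A.toMetric.D_symm_add e hz.2, A'.toMetric.D_symm_add e hz.2,
          add_sub_add_comm]
      map_smul' := fun k u => by
        rw [coord_smul e hz.2, A.toMetric.D_symm_smul e hz.2, A'.toMetric.D_symm_smul e hz.2,
          RingHom.id_apply, smul_sub] }
  have h1 := sum_coord_eq_trace (trivializationAt (Cn r) E ((chartAt ℂ x₀).symm z))
    (FiberBundle.mem_baseSet_trivializationAt' _) T
  have h2 := sum_coord_eq_trace e hz.2 T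
  have hx := FiberBundle.mem_baseSet_trivializationAt' (F := Cn r) (E := E)
    ((chartAt ℂ x₀).symm z)
  refine Eq.trans ?_ ((h1.trans h2.symm).trans ?_)
  · change ∑ k : Fin r, coord (trivializationAt (Cn r) E ((chartAt ℂ x₀).symm z))
      (A.toMetric.D (fun y => (trivializationAt (Cn r) E ((chartAt ℂ x₀).symm z)).symm y
        (EuclideanSpace.single k 1)) _ (dchart x₀ z a) -
      A'.toMetric.D (fun y => (trivializationAt (Cn r) E ((chartAt ℂ x₀).symm z)).symm y
        (EuclideanSpace.single k 1)) _ (dchart x₀ z a)) k = _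
    refine Finset.sum_congr rfl fun k _ => ?_
    refine congrArg (fun v => coord (trivializationAt (Cn r) E ((chartAt ℂ x₀).symm z)) v k) ?_
    have hs := diffAt_symm_const (trivializationAt (Cn r) E ((chartAt ℂ x₀).symm z)) hx
      (EuclideanSpace.single k (1 : ℂ))
    rw [A.toMetric.D_coord e hz.2 hs, A'.toMetric.D_coord e hz.2 hs, add_sub_add_left_eq_sub]
    rfl
  · rw [sub_apply, ContinuousLinearMap.comp_apply, ContinuousLinearMap.comp_apply, trR_apply,
      trR_apply, ← Finset.sum_sub_distrib]
    refine Finset.sum_congr rfl fun k _ => ?_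
    change coord e (A.toMetric.D (fun y => e.symm y (coord e _)) _ (dchart x₀ z a) -
        A'.toMetric.D (fun y => e.symm y (coord e _)) _ (dchart x₀ z a)) k = _
    rw [coord_symm e hz.2, coord_sub e hz.2, A.toMetric.connForm_apply x₀ e hz,
      A'.toMetric.connForm_apply x₀ e hz]
    rfl

theorem contDiffOn_trR_connForm (x₀ : M) (e : Trivialization (Cn r) (π (Cn r) E))
    [MemTrivializationAtlas e] :
    ContDiffOn ℝ ∞ (fun z => (trR r).comp (A.toMetric.connForm x₀ e z)) (chartDom x₀ e) :=
  contDiffOn_const.clm_comp (A.contDiffOn_connForm x₀ e)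

theorem mem_chartDom_trivializationAt (E : M → Type*) [TopologicalSpace (TotalSpace (Cn r) E)]
    [∀ x, TopologicalSpace (E x)] [FiberBundle (Cn r) E] (x₀ : M) {z : ℂ}
    (hz : z ∈ (chartAt ℂ x₀).target) :
    z ∈ (chartAt ℂ x₀).target ∩ (chartAt ℂ x₀).symm ⁻¹'
      (trivializationAt (Cn r) E ((chartAt ℂ x₀).symm z)).baseSet :=
  ⟨hz, FiberBundle.mem_baseSet_trivializationAt' _⟩

theorem smoothForm_traceDiff (A A' : UnitaryConnection r E) : SmoothForm (traceDiff A A') := by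
  intro c z hz
  have hz' : z ∈ chartDom c (trivializationAt (Cn r) E ((chartAt ℂ c).symm z)) :=
    mem_chartDom_trivializationAt E c hz
  have hn := (isOpen_chartDom c (trivializationAt (Cn r) E ((chartAt ℂ c).symm z))).mem_nhds hz'
  refine ContDiffAt.contDiffWithinAt ?_
  refine (((A.contDiffOn_trR_connForm c _).contDiffAt hn).sub
    ((A'.contDiffOn_trR_connForm c _).contDiffAt hn)).congr_of_eventuallyEq ?_
  filter_upwards [hn] with y hy using pull_traceDiff A A' c _ hy

theorem chartDensity_traceCurvature_eq (x₀ : M) (e : Trivialization (Cn r) (π (Cn r) E))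
    [MemTrivializationAtlas e] {z : ℂ} (hz : z ∈ chartDom x₀ e) :
    chartDensity A.traceCurvature x₀ z =
      curl (fun z => (trR r).comp (A.toMetric.connForm x₀ e z)) z :=
  (A.traceCurvature_eq x₀ e hz 1 Complex.I).trans (A.trR_planarCurv x₀ e hz)

/-- Transgression: changing the connection changes `tr F` by the exact form `d tr (A - A')`, the
form `tr (A - A')` being globally defined. -/
theorem chartDensity_traceCurvature_sub (A A' : UnitaryConnection r E) (x₀ : M) {z : ℂ}
    (hz : z ∈ (chartAt ℂ x₀).target) :
    chartDensity A.traceCurvature x₀ z - chartDensity A'.traceCurvature x₀ z =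
      curl (pull (traceDiff A A') x₀) z := by
  set e := trivializationAt (Cn r) E ((chartAt ℂ x₀).symm z)
  have hz' : z ∈ chartDom x₀ e := mem_chartDom_trivializationAt E x₀ hz
  have hn := (isOpen_chartDom x₀ e).mem_nhds hz'
  have h1 : fderiv ℝ (pull (traceDiff A A') x₀) z =
      fderiv ℝ (fun z => (trR r).comp (A.toMetric.connForm x₀ e z)) z -
        fderiv ℝ (fun z => (trR r).comp (A'.toMetric.connForm x₀ e z)) z := by
    rw [← fderiv_fun_sub]
    · refine Filter.EventuallyEq.fderiv_eq ?_
      filter_upwards [hn] with y hy using pull_traceDiff A A' x₀ e hy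
    · exact ((A.contDiffOn_trR_connForm x₀ e).contDiffAt hn).differentiableAt (by simp)
    · exact ((A'.contDiffOn_trR_connForm x₀ e).contDiffAt hn).differentiableAt (by simp)
  rw [A.chartDensity_traceCurvature_eq x₀ e hz', A'.chartDensity_traceCurvature_eq x₀ e hz',
    curl, curl, curl, h1]
  simp only [sub_apply]
  abel

theorem HasCentralCurvature.traceCurvature_eq {A : UnitaryConnection r E}
    {κ : ∀ x : M, TangentSpace 𝓘(ℝ, ℂ) x → TangentSpace 𝓘(ℝ, ℂ) x → ℂ}
    (hA : A.HasCentralCurvature κ) (x : M) (v w : TangentSpace 𝓘(ℝ, ℂ) x) :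
    A.traceCurvature x v w = r * κ x v w := by
  have hx := FiberBundle.mem_baseSet_trivializationAt' (F := Cn r) (E := E) x
  have h : ∀ k : Fin r, coord (trivializationAt (Cn r) E x) (A.curvatureAt x v w
      ((trivializationAt (Cn r) E x).symm x (EuclideanSpace.single k 1))) k = κ x v w := by
    intro k
    rw [hA, coord_smul _ hx, coord_symm _ hx]
    simp
  exact (Finset.sum_congr rfl fun k _ => h k).trans (by simp)

/-- A connection on a line bundle has central curvature. -/
theorem hasCentralCurvature_of_rank_one {L : M → Type*} [TopologicalSpace (TotalSpace (Cn 1) L)]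
    [∀ x, NormedAddCommGroup (L x)] [∀ x, InnerProductSpace ℂ (L x)]
    [FiberBundle (Cn 1) L] [VectorBundle ℂ (Cn 1) L] [VectorBundle ℝ (Cn 1) L]
    [ContMDiffVectorBundle ∞ (Cn 1) L 𝓘(ℝ, ℂ)] (B : UnitaryConnection 1 L) (x₀ : M)
    (e : Trivialization (Cn 1) (π (Cn 1) L)) [MemTrivializationAtlas e] {z : ℂ}
    (hz : z ∈ chartDom x₀ e) (u : Cn 1) :
    planarCurv (B.toMetric.connForm x₀ e) z 1 Complex.I u =
      chartDensity B.traceCurvature x₀ z • u := by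
  have h : chartDensity B.traceCurvature x₀ z =
      trR 1 (planarCurv (B.toMetric.connForm x₀ e) z 1 Complex.I) :=
    B.traceCurvature_eq x₀ e hz 1 Complex.I
  rw [h, trR_apply]
  ext k
  rw [apply_eq_sum_single _ (B.planarCurv_complex_smul x₀ e hz 1 Complex.I)]
  fin_cases k
  simp [mul_comm]

end UnitaryConnection

end CurvatureTrace

/-! ### Hermitian products and imaginary curvature -/

section Hermitian

variable {M : Type*} [TopologicalSpace M] [ChartedSpace ℂ M] [IsManifold 𝓘(ℂ, ℂ) ω M]
  {r : ℕ} {E : M → Type*} [TopologicalSpace (TotalSpace (Cn r) E)]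
  [∀ x, NormedAddCommGroup (E x)] [∀ x, InnerProductSpace ℂ (E x)]
  [FiberBundle (Cn r) E] [VectorBundle ℂ (Cn r) E] [VectorBundle ℝ (Cn r) E]
  [ContMDiffVectorBundle ∞ (Cn r) E 𝓘(ℝ, ℂ)]

theorem eq_sum_coord (e : Trivialization (Cn r) (π (Cn r) E)) [MemTrivializationAtlas e]
    {x : M} (hx : x ∈ e.baseSet) (v : E x) :
    v = ∑ i, coord e v i • e.symm x (EuclideanSpace.single i 1) := by
  have h : coord e v = ∑ j, coord e v j • (EuclideanSpace.single j 1 : Cn r) := by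
    ext i
    simp [Finset.sum_apply, Pi.single_apply]
  have h2 := congrArg (e.symmL ℂ x) h
  simp only [map_sum, map_smul] at h2
  simp only [e.symmL_apply hx] at h2
  rwa [symm_coord e hx] at h2

theorem mdifferentiableAt_mul {f g : M → ℂ} {x : M}
    (hf : MDifferentiableAt 𝓘(ℝ, ℂ) 𝓘(ℝ, ℂ) f x) (hg : MDifferentiableAt 𝓘(ℝ, ℂ) 𝓘(ℝ, ℂ) g x) :
    MDifferentiableAt 𝓘(ℝ, ℂ) 𝓘(ℝ, ℂ) (fun y => f y * g y) x :=
  MDifferentiableAt.mul hf hg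

theorem mdifferentiableAt_coord (e : Trivialization (Cn r) (π (Cn r) E))
    [MemTrivializationAtlas e] {s : ∀ x, E x} {x : M} (hx : x ∈ e.baseSet)
    (hs : DiffAt (r := r) s x) (i : Fin r) :
    MDifferentiableAt 𝓘(ℝ, ℂ) 𝓘(ℝ, ℂ) (fun y => coord e (s y) i) x :=
  ((EuclideanSpace.proj i : Cn r →L[ℂ] ℂ).restrictScalars ℝ).mdifferentiableAt.comp x
    ((diffAt_iff e hx).1 hs)

/-- The Hermitian product of two differentiable sections is differentiable. -/
theorem mdifferentiableAt_inner [IsSmoothHermitian r E] {s t : ∀ x, E x} {x : M}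
    (hs : DiffAt (r := r) s x) (ht : DiffAt (r := r) t x) :
    MDifferentiableAt 𝓘(ℝ, ℂ) 𝓘(ℝ, ℂ) (fun y => inner ℂ (s y) (t y)) x := by
  set e := trivializationAt (Cn r) E x
  have hx : x ∈ e.baseSet := FiberBundle.mem_baseSet_trivializationAt' x
  have h : ∀ᶠ y in 𝓝 x, inner ℂ (s y) (t y) = ∑ i, ∑ j, conj (coord e (s y) i) *
      (coord e (t y) j * inner ℂ (e.symm y (EuclideanSpace.single i 1))
        (e.symm y (EuclideanSpace.single j 1))) := by
    filter_upwards [e.open_baseSet.mem_nhds hx] with y hy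
    conv_lhs => rw [eq_sum_coord e hy (s y), eq_sum_coord e hy (t y)]
    rw [sum_inner]
    refine Finset.sum_congr rfl fun i _ => ?_
    rw [inner_sum]
    refine Finset.sum_congr rfl fun j _ => ?_
    rw [inner_smul_left, inner_smul_right]
  have hsum : ∀ {g : Fin r → M → ℂ}, (∀ i, MDifferentiableAt 𝓘(ℝ, ℂ) 𝓘(ℝ, ℂ) (g i) x) →
      MDifferentiableAt 𝓘(ℝ, ℂ) 𝓘(ℝ, ℂ) (fun y => ∑ i, g i y) x := by
    intro g hg
    have hz := (chartAt ℂ x).map_source (mem_chart_source ℂ x)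
    refine mdifferentiableAt_of_comp_chart_symm x (mem_chart_source ℂ x) ?_
    refine DifferentiableAt.fun_sum fun i _ => ?_
    refine (hasFDerivAt_mfd x hz (g := g i) ?_).differentiableAt
    rw [(chartAt ℂ x).left_inv (mem_chart_source ℂ x)]
    exact hg i
  refine MDifferentiableAt.congr_of_eventuallyEq ?_ h
  refine hsum fun i => hsum fun j => ?_
  refine mdifferentiableAt_mul ?_ (mdifferentiableAt_mul (mdifferentiableAt_coord e hx ht j) ?_)
  · exact Complex.conjCLE.toContinuousLinearMap.mdifferentiableAt.comp x
      (mdifferentiableAt_coord e hx hs i)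
  · exact ((IsSmoothHermitian.smooth e _ _).contMDiffAt
      (e.open_baseSet.mem_nhds hx)).mdifferentiableAt (by simp)

theorem MetricConnection.hasFDerivAt_inner [IsSmoothHermitian r E] (A : MetricConnection r E)
    (x₀ : M) {z : ℂ} (hz : z ∈ (chartAt ℂ x₀).target) {s t : ∀ x, E x}
    (hs : DiffAt (r := r) s ((chartAt ℂ x₀).symm z))
    (ht : DiffAt (r := r) t ((chartAt ℂ x₀).symm z)) :
    ∃ T : ℂ →L[ℝ] ℂ, HasFDerivAt (fun z => inner ℂ (s ((chartAt ℂ x₀).symm z))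
      (t ((chartAt ℂ x₀).symm z))) T z ∧ ∀ a, T a =
        inner ℂ (A.D s _ (dchart x₀ z a)) (t ((chartAt ℂ x₀).symm z)) +
          inner ℂ (s ((chartAt ℂ x₀).symm z)) (A.D t _ (dchart x₀ z a)) :=
  ⟨_, hasFDerivAt_mfd x₀ hz (mdifferentiableAt_inner hs ht),
    fun a => A.mfd_inner hs ht (dchart x₀ z a)⟩

variable [T2Space M]

/-- The central curvature of a unitary connection is purely imaginary. -/
theorem UnitaryConnection.re_eq_zero_of_central [IsSmoothHermitian r E] (hr : 0 < r)
    (A : UnitaryConnection r E) (x₀ : M) (e : Trivialization (Cn r) (π (Cn r) E))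
    [MemTrivializationAtlas e] {z : ℂ} (hz : z ∈ chartDom x₀ e) {k : ℂ}
    (hk : ∀ u, planarCurv (A.toMetric.connForm x₀ e) z 1 Complex.I u = k • u) : k.re = 0 := by
  set u : Cn r := EuclideanSpace.single ⟨0, hr⟩ 1 with hu
  have hu0 : u ≠ 0 := by simp [hu]
  set s : ∀ x, E x := fun y => e.symm y u with hs
  set w := A.toMetric.connForm x₀ e with hw
  have hV : IsOpen (e.baseSet ∩ (chartAt ℂ x₀).source) :=
    e.open_baseSet.inter (chartAt ℂ x₀).open_source
  have hdom : ∀ y ∈ chartDom x₀ e, (chartAt ℂ x₀).symm y ∈ e.baseSet ∩ (chartAt ℂ x₀).source :=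
    fun y hy => ⟨hy.2, (chartAt ℂ x₀).map_target hy.1⟩
  -- Covariant derivatives of the constant section `s` along the coordinate fields, which commute;
  -- no bracket term appears.
  let X : ℂ → ∀ x, E x := fun a y => A.toMetric.D s y (chartField x₀ a y)
  have hX : ∀ a, SmoothOn r E (X a) (e.baseSet ∩ (chartAt ℂ x₀).source) := fun a =>
    A.smoothOn_cov hV ((smoothOn_symm_const e u).mono inter_subset_left)
      (X := chartField x₀ a) (fun x hx => (contMDiffAt_chartField x₀ hx.2 a).contMDiffWithinAt)
  have hXd : ∀ a, ∀ y ∈ chartDom x₀ e, DiffAt (r := r) (X a) ((chartAt ℂ x₀).symm y) :=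
    fun a y hy => (hX a).diffAt hV (hdom y hy)
  have hsd : ∀ y ∈ chartDom x₀ e, DiffAt (r := r) s ((chartAt ℂ x₀).symm y) :=
    fun y hy => diffAt_symm_const e hy.2 u
  have hXv : ∀ a, ∀ y ∈ chartDom x₀ e, X a ((chartAt ℂ x₀).symm y) =
      A.toMetric.D s ((chartAt ℂ x₀).symm y) (dchart x₀ y a) := by
    intro a y hy
    change A.toMetric.D s _ (dchart x₀ (chartAt ℂ x₀ ((chartAt ℂ x₀).symm y)) a) = _
    rw [(chartAt ℂ x₀).right_inv hy.1]
  have hnhds := (isOpen_chartDom x₀ e).mem_nhds hz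
  -- second covariant derivatives
  have hXX : ∀ a b, coord e (A.toMetric.D (X b) ((chartAt ℂ x₀).symm z) (dchart x₀ z a)) =
      fderiv ℝ w z a b u + w z a (w z b u) := by
    intro a b
    have h1 : ∀ y ∈ chartDom x₀ e, coord e (X b ((chartAt ℂ x₀).symm y)) = w y b u := by
      intro y hy
      rw [hXv b y hy, hw, A.toMetric.connForm_apply x₀ e hy]
    have h3 := ((A.differentiableAt_connForm x₀ e hz).hasFDerivAt.clm_apply
      (hasFDerivAt_const b z)).clm_apply (hasFDerivAt_const u z)
    have h4 : (fun y => coord e (X b ((chartAt ℂ x₀).symm y))) =ᶠ[𝓝 z] fun y => w y b u := by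
      filter_upwards [hnhds] with y hy using h1 y hy
    rw [A.toMetric.coord_D x₀ e hz (hXd b z hz), h1 z hz, h4.fderiv_eq, h3.fderiv]
    simp [hw]
  have hcurv : A.toMetric.D (X Complex.I) ((chartAt ℂ x₀).symm z) (dchart x₀ z 1) -
      A.toMetric.D (X 1) ((chartAt ℂ x₀).symm z) (dchart x₀ z Complex.I) =
      k • s ((chartAt ℂ x₀).symm z) := by
    rw [← symm_coord e hz.2 (_ - _), coord_sub e hz.2, hXX, hXX, hs, ← symm_smul e hz.2, ← hk u,
      planarCurv]
    congr 1
    simp only [add_apply, sub_apply, endR_mul_apply]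
    abel
  set G : ℂ → ℂ := fun y => inner ℂ (s ((chartAt ℂ x₀).symm y)) (s ((chartAt ℂ x₀).symm y))
    with hG
  have hGs : ContDiffAt ℝ 2 G z := by
    have h1 : ContMDiffAt 𝓘(ℝ, ℂ) 𝓘(ℝ, ℂ) ∞ (fun x => inner ℂ (e.symm x u) (e.symm x u))
        ((chartAt ℂ x₀).symm z) :=
      (IsSmoothHermitian.smooth e u u).contMDiffAt (e.open_baseSet.mem_nhds hz.2)
    exact ((h1.comp z (contMDiffAt_chart_symm x₀ hz.1)).contDiffAt).of_le (by norm_cast)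
  have hG1 : ∀ b, ∀ y ∈ chartDom x₀ e, fderiv ℝ G y b =
      inner ℂ (X b ((chartAt ℂ x₀).symm y)) (s ((chartAt ℂ x₀).symm y)) +
        inner ℂ (s ((chartAt ℂ x₀).symm y)) (X b ((chartAt ℂ x₀).symm y)) := by
    intro b y hy
    obtain ⟨T, hT, hT2⟩ := A.toMetric.hasFDerivAt_inner x₀ hy.1 (hsd y hy) (hsd y hy)
    rw [hG, hT.fderiv, hT2, hXv b y hy]
  have hG2 : ∀ a b, fderiv ℝ (fderiv ℝ G) z a b =
      (inner ℂ (A.toMetric.D (X b) ((chartAt ℂ x₀).symm z) (dchart x₀ z a))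
          (s ((chartAt ℂ x₀).symm z)) +
        inner ℂ (X b ((chartAt ℂ x₀).symm z)) (X a ((chartAt ℂ x₀).symm z))) +
      (inner ℂ (X a ((chartAt ℂ x₀).symm z)) (X b ((chartAt ℂ x₀).symm z)) +
        inner ℂ (s ((chartAt ℂ x₀).symm z))
          (A.toMetric.D (X b) ((chartAt ℂ x₀).symm z) (dchart x₀ z a))) := by
    intro a b
    obtain ⟨T, hT, hT2⟩ := A.toMetric.hasFDerivAt_inner x₀ hz.1 (hXd b z hz) (hsd z hz)
    obtain ⟨T', hT', hT2'⟩ := A.toMetric.hasFDerivAt_inner x₀ hz.1 (hsd z hz) (hXd b z hz)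
    have h1 : (fun y => fderiv ℝ G y b) =ᶠ[𝓝 z] fun y =>
        inner ℂ (X b ((chartAt ℂ x₀).symm y)) (s ((chartAt ℂ x₀).symm y)) +
        inner ℂ (s ((chartAt ℂ x₀).symm y)) (X b ((chartAt ℂ x₀).symm y)) := by
      filter_upwards [hnhds] with y hy using hG1 b y hy
    have h2 : HasFDerivAt (fun y => fderiv ℝ G y b) ((fderiv ℝ (fderiv ℝ G) z).flip b) z := by
      have h3 := (((hGs.fderiv_right (m := 1) (by norm_num)).differentiableAt
        (by norm_num)).hasFDerivAt).clm_apply (hasFDerivAt_const b z)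
      refine h3.congr_fderiv ?_
      ext1 v
      simp
    have h4 := (hT.fun_add hT').congr_of_eventuallyEq h1
    have h5 := congrArg (fun T : ℂ →L[ℝ] ℂ => T a) (h2.unique h4)
    simp only [ContinuousLinearMap.flip_apply, add_apply, hT2, hT2'] at h5
    rw [h5, hXv a z hz]
  -- Antisymmetrizing the second derivative of `⟨s, s⟩` leaves `⟨F s, s⟩ + ⟨s, F s⟩ = 0`.
  have hsym := (hGs.isSymmSndFDerivAt (by simp)) (1 : ℂ) Complex.I
  rw [hG2, hG2] at hsym
  have h6 : inner ℂ (k • s ((chartAt ℂ x₀).symm z)) (s ((chartAt ℂ x₀).symm z)) +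
      inner ℂ (s ((chartAt ℂ x₀).symm z)) (k • s ((chartAt ℂ x₀).symm z)) = (0 : ℂ) := by
    rw [← hcurv, inner_sub_left, inner_sub_right]
    linear_combination hsym
  rw [inner_smul_left, inner_smul_right, ← add_mul] at h6
  have h7 : s ((chartAt ℂ x₀).symm z) ≠ 0 := by
    intro h0
    apply hu0
    have h8 := congrArg (coord e) h0
    rw [hs, coord_symm e hz.2] at h8
    have h9 := coord_smul e hz.2 0 (0 : E ((chartAt ℂ x₀).symm z))
    rw [zero_smul, zero_smul] at h9
    rw [h8, h9]
  have h10 := (mul_eq_zero.1 h6).resolve_right (inner_self_ne_zero.2 h7)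
  have h11 := congrArg Complex.re h10
  simp only [Complex.add_re, Complex.conj_re, Complex.zero_re] at h11
  linarith

end Hermitian

/-! ### Fibres, constructions of connections, flat pairs -/

section Fibres

variable {M : Type*} [TopologicalSpace M] [ChartedSpace ℂ M] [IsManifold 𝓘(ℂ, ℂ) ω M]
  {r : ℕ} {E : M → Type*} [TopologicalSpace (TotalSpace (Cn r) E)]
  [∀ x, NormedAddCommGroup (E x)] [∀ x, InnerProductSpace ℂ (E x)]
  [FiberBundle (Cn r) E] [VectorBundle ℂ (Cn r) E] [VectorBundle ℝ (Cn r) E]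
  [ContMDiffVectorBundle ∞ (Cn r) E 𝓘(ℝ, ℂ)]
  {L : M → Type*} [TopologicalSpace (TotalSpace (Cn 1) L)]
  [∀ x, NormedAddCommGroup (L x)] [∀ x, InnerProductSpace ℂ (L x)]
  [FiberBundle (Cn 1) L] [VectorBundle ℂ (Cn 1) L] [VectorBundle ℝ (Cn 1) L]
  [ContMDiffVectorBundle ∞ (Cn 1) L 𝓘(ℝ, ℂ)]

/-- A linear identification of a fibre with the model fibre. -/
def fibreEquiv (r : ℕ) (E : M → Type*) [TopologicalSpace (TotalSpace (Cn r) E)]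
    [∀ x, NormedAddCommGroup (E x)] [∀ x, InnerProductSpace ℂ (E x)]
    [FiberBundle (Cn r) E] [VectorBundle ℂ (Cn r) E] (x : M) : E x ≃ₗ[ℂ] Cn r :=
  (trivializationAt (Cn r) E x).linearEquivAt ℂ x (FiberBundle.mem_baseSet_trivializationAt' x)

theorem finrank_fibre (r : ℕ) (E : M → Type*) [TopologicalSpace (TotalSpace (Cn r) E)]
    [∀ x, NormedAddCommGroup (E x)] [∀ x, InnerProductSpace ℂ (E x)]
    [FiberBundle (Cn r) E] [VectorBundle ℂ (Cn r) E] (x : M) : Module.finrank ℂ (E x) = r := by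
  rw [(fibreEquiv r E x).finrank_eq, finrank_euclideanSpace_fin]

/-- A unitary frame of a fibre. -/
def stdFrame (r : ℕ) (E : M → Type*) [TopologicalSpace (TotalSpace (Cn r) E)]
    [∀ x, NormedAddCommGroup (E x)] [∀ x, InnerProductSpace ℂ (E x)]
    [FiberBundle (Cn r) E] [VectorBundle ℂ (Cn r) E] (x : M) : Cn r ≃ₗᵢ[ℂ] E x :=
  haveI : FiniteDimensional ℂ (E x) := (fibreEquiv r E x).symm.finiteDimensional
  ((stdOrthonormalBasis ℂ (E x)).reindex (finCongr (finrank_fibre r E x))).repr.symm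

theorem eq_inner_smul_of_norm_eq_one {x : M} {s : L x} (hs : ‖s‖ = 1) (v : L x) :
    v = inner ℂ s v • s := by
  have hs0 : s ≠ 0 := by
    intro h
    rw [h, norm_zero] at hs
    exact zero_ne_one hs
  obtain ⟨a, rfl⟩ := (finrank_eq_one_iff_of_nonzero' s hs0).1 (finrank_fibre 1 L x) v
  rw [inner_smul_right, inner_self_eq_norm_sq_to_K, hs]
  simp

theorem mfd_comp_chart {F : Type*} [NormedAddCommGroup F] [NormedSpace ℝ F] (x₀ : M) {z : ℂ}
    (hz : z ∈ (chartAt ℂ x₀).target) {g : ℂ → F} {g' : ℂ →L[ℝ] F} (hg : HasFDerivAt g g' z) :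
    MDifferentiableAt 𝓘(ℝ, ℂ) 𝓘(ℝ, F) (fun y => g (chartAt ℂ x₀ y)) ((chartAt ℂ x₀).symm z) ∧
      ∀ a, mfd (fun y => g (chartAt ℂ x₀ y)) ((chartAt ℂ x₀).symm z) (dchart x₀ z a) = g' a := by
  have h0 : (fun y => g (chartAt ℂ x₀ ((chartAt ℂ x₀).symm y))) =ᶠ[𝓝 z] g := by
    filter_upwards [(chartAt ℂ x₀).open_target.mem_nhds hz] with y hy
    rw [(chartAt ℂ x₀).right_inv hy]
  have h1 : MDifferentiableAt 𝓘(ℝ, ℂ) 𝓘(ℝ, F) (fun y => g (chartAt ℂ x₀ y))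
      ((chartAt ℂ x₀).symm z) := by
    refine mdifferentiableAt_of_comp_chart_symm x₀ ((chartAt ℂ x₀).map_target hz) ?_
    rw [(chartAt ℂ x₀).right_inv hz]
    exact (hg.congr_of_eventuallyEq h0).differentiableAt
  refine ⟨h1, fun a => ?_⟩
  have h2 := hasFDerivAt_mfd x₀ hz h1
  exact congrArg (fun T : ℂ →L[ℝ] F => T a) (h2.unique (hg.congr_of_eventuallyEq h0))

theorem exists_dchart_eq (x₀ : M) {z : ℂ} (hz : z ∈ (chartAt ℂ x₀).target) (v : ℂ) :
    ∃ a, dchart x₀ z a = v := by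
  obtain ⟨T, hT⟩ := isInvertible_dchart x₀ hz
  refine ⟨T.symm v, ?_⟩
  rw [← hT]
  exact T.apply_symm_apply v

namespace MetricConnection

/-- Construct a metric connection from its covariant derivative, the tangent spaces being
identified with `ℂ`. -/
def ofD (D : (∀ x, E x) → ∀ x, ℂ →L[ℝ] E x)
    (hadd : ∀ (s t : ∀ x, E x) (x : M), DiffAt (r := r) s x → DiffAt (r := r) t x →
      D (fun y => s y + t y) x = D s x + D t x)
    (hsmul : ∀ (s : ∀ x, E x) (g : M → ℝ) (x : M), DiffAt (r := r) s x →
      MDifferentiableAt 𝓘(ℝ, ℂ) 𝓘(ℝ, ℝ) g x → ∀ v,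
      D (fun y => g y • s y) x v = g x • D s x v + mfd g x v • s x)
    (hI : ∀ (s : ∀ x, E x) (x : M), DiffAt (r := r) s x → ∀ v,
      D (fun y => Complex.I • s y) x v = Complex.I • D s x v)
    (hinner : ∀ (s t : ∀ x, E x) (x : M), DiffAt (r := r) s x → DiffAt (r := r) t x → ∀ v,
      mfd (fun y => inner ℂ (s y) (t y)) x v =
        inner ℂ (D s x v) (t x) + inner ℂ (s x) (D t x v)) : MetricConnection r E where
  cov :=
    { toFun := D
      isCovariantDerivativeOnUniv :=
        { add := fun {s t x} hs ht _ => hadd s t x hs ht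
          leibniz := fun {s g x} hs hg _ => by
            refine ContinuousLinearMap.ext fun v => ?_
            exact hsmul s g x hs hg v } }
  complexLinear := fun s x hs v => hI s x hs v
  unitary := fun s t x hs ht v => hinner s t x hs ht v

theorem D_real_smul (A : MetricConnection r E) {s : ∀ x, E x} {x : M} {g : M → ℝ}
    (hg : MDifferentiableAt 𝓘(ℝ, ℂ) 𝓘(ℝ, ℝ) g x) (hs : DiffAt (r := r) s x) (v : ℂ) :
    A.D (fun y => g y • s y) x v = g x • A.D s x v + mfd g x v • s x :=
  A.cov_real_smul hg hs v

/-- The connection `A + β`, for an imaginary `1`-form `β`. -/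
def addForm (A : MetricConnection r E) (β : M → ℂ →L[ℝ] ℂ) (hβ : ∀ x v, (β x v).re = 0) :
    MetricConnection r E :=
  ofD (fun s x => A.D s x +
      ((ContinuousLinearMap.toSpanSingleton ℂ (s x)).restrictScalars ℝ).comp (β x))
    (fun s t x hs ht => by
      ext1 v
      rw [A.D_add hs ht]
      change _ + _ + β x v • (s x + t x) = _ + β x v • s x + (_ + β x v • t x)
      rw [smul_add]
      abel)
    (fun s g x hs hg v => by
      change A.D _ x v + β x v • (g x • s x) = g x • (A.D s x v + β x v • s x) + _
      rw [A.D_real_smul hg hs, smul_add, smul_comm (β x v)]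
      abel)
    (fun s x hs v => by
      change A.D _ x v + β x v • (Complex.I • s x) = Complex.I • (A.D s x v + β x v • s x)
      rw [A.D_const_smul _ hs, smul_add, smul_comm (β x v)])
    (fun s t x hs ht v => by
      change _ = inner ℂ (A.D s x v + β x v • s x) (t x) +
        inner ℂ (s x) (A.D t x v + β x v • t x)
      have h : conj (β x v) = -β x v := by
        apply Complex.ext <;> simp [hβ]
      rw [A.mfd_inner hs ht, inner_add_left, inner_add_right, inner_smul_left, inner_smul_right, h]
      ring)

theorem addForm_D (A : MetricConnection r E) (β : M → ℂ →L[ℝ] ℂ) (hβ : ∀ x v, (β x v).re = 0)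
    (s : ∀ x, E x) (x : M) (v : ℂ) : (A.addForm β hβ).D s x v = A.D s x v + β x v • s x := rfl

/-- The connection form of a connection on a line bundle, in a unit frame. -/
def form (B : MetricConnection 1 L) (s : ∀ x, L x) (x : M) (v : ℂ) : ℂ :=
  inner ℂ (s x) (B.D s x v)

theorem D_eq_form_smul (B : MetricConnection 1 L) {s : ∀ x, L x} {x : M} (hs : ‖s x‖ = 1)
    (v : ℂ) : B.D s x v = B.form s x v • s x :=
  eq_inner_smul_of_norm_eq_one hs _

theorem form_eq (B : MetricConnection 1 L) {s : ∀ x, L x} {x : M} (hs : ‖s x‖ = 1)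
    {v k : ℂ} (h : B.D s x v = k • s x) : B.form s x v = k := by
  rw [form, h, inner_smul_right, inner_self_eq_norm_sq_to_K, hs]
  simp

/-- Differentiate `⟨s, s⟩ = 1`. -/
theorem conj_form (B : MetricConnection 1 L) {s : ∀ x, L x} {x : M} (hd : DiffAt (r := 1) s x)
    (hs : ∀ᶠ y in 𝓝 x, ‖s y‖ = 1) (v : ℂ) : conj (B.form s x v) = -B.form s x v := by
  have h1 := B.mfd_inner hd hd v
  have h2 : (fun y => inner ℂ (s y) (s y)) =ᶠ[𝓝 x] fun _ => (1 : ℂ) := by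
    filter_upwards [hs] with y hy
    rw [inner_self_eq_norm_sq_to_K, hy]
    simp
  have h3 : mfd (fun y => inner ℂ (s y) (s y)) x = mfd (fun _ => (1 : ℂ)) x :=
    Filter.EventuallyEq.mfderiv_eq h2
  rw [h3, mfd_const, ← inner_conj_symm] at h1
  exact (neg_eq_of_add_eq_zero_left h1.symm).symm

end MetricConnection

/-- A unit section of `L` and a unitary frame of `E`, over `O`, with the same connection form, up to
the factor `r`. -/
structure FlatPair (A : MetricConnection r E) (B : MetricConnection 1 L) (O : Set M) where
  /-- the frame of `E` -/
  f : ∀ x, Cn r ≃ₗᵢ[ℂ] E x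
  /-- the section of `L` -/
  s : ∀ x, L x
  norm_s : ∀ x ∈ O, ‖s x‖ = 1
  diff_f : ∀ x ∈ O, ∀ u, DiffAt (r := r) (fun y => f y u) x
  diff_s : ∀ x ∈ O, DiffAt (r := 1) s x
  cov_f : ∀ x ∈ O, ∀ u v, A.D (fun y => f y u) x v = (B.form s x v / r) • f x u

end Fibres

/-! ### Complex-linear solutions of flat systems -/

section Planar

variable {r : ℕ}

/-- Scalar endomorphisms. -/
def scal (r : ℕ) : ℂ →L[ℝ] EndR r := ContinuousLinearMap.lsmul ℝ ℂ

theorem scal_apply (a : ℂ) (u : Cn r) : scal r a u = a • u := rfl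

-- A scalar form commutes with `w`, so it contributes to the curvature through its exterior
-- derivative only.
set_option synthInstance.maxHeartbeats 200000 in
theorem planarCurv_sub_scal {w : ℂ → ℂ →L[ℝ] EndR r} {l : ℂ → ℂ →L[ℝ] ℂ} {z : ℂ}
    (hw : DifferentiableAt ℝ w z) (hl : DifferentiableAt ℝ l z)
    (hc : ∀ v (a : ℂ) u, w z v (a • u) = a • w z v u) (u : Cn r) :
    planarCurv (fun z => w z - (scal r).comp (l z)) z 1 Complex.I u =
      planarCurv w z 1 Complex.I u - curl l z • u := by
  have h : HasFDerivAt (fun z => w z - (scal r).comp (l z)) _ z :=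
    hw.hasFDerivAt.fun_sub ((hasFDerivAt_const (scal r) z).clm_comp hl.hasFDerivAt)
  simp only [planarCurv]
  rw [h.fderiv]
  simp only [curl, endR_mul_apply, sub_apply, add_apply, ContinuousLinearMap.comp_apply,
    map_sub, scal_apply, hc, ContinuousLinearMap.compL_apply, ContinuousLinearMap.flip_apply,
    map_zero, add_zero, zero_apply, sub_smul, smul_sub, smul_smul, zero_add]
  rw [mul_comm (l z 1) (l z Complex.I)]
  abel

set_option synthInstance.maxHeartbeats 200000 in
/-- A flat complex-linear system has a complex-linear local solution. -/
theorem exists_complex_flat_solution {w : ℂ → ℂ →L[ℝ] EndR r} {O : Set ℂ} (hO : IsOpen O)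
    {z₀ : ℂ} (hz₀ : z₀ ∈ O) (hw : ContDiffOn ℝ 2 w O)
    (hc : ∀ z ∈ O, ∀ v (a : ℂ) u, w z v (a • u) = a • w z v u)
    (hflat : ∀ z ∈ O, ∀ u, planarCurv w z 1 Complex.I u = 0) :
    ∃ ε > 0, Metric.ball z₀ ε ⊆ O ∧ ∃ F : ℂ → EndR r, F z₀ = 1 ∧
      (∀ z (a : ℂ) u, F z (a • u) = a • F z u) ∧ ∀ z ∈ Metric.ball z₀ ε,
        ∃ F' : ℂ →L[ℝ] EndR r, HasFDerivAt F F' z ∧ ∀ v, F' v = -(w z v * F z) := by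
  obtain ⟨ε, hε, hball, f, hf0, hf⟩ := exists_flat_solution hO hz₀ hw (fun z hz u v => by
    have h1 : planarCurv w z 1 Complex.I = 0 := by
      ext1 u
      exact hflat z hz u
    have h2 := planarCurv_eq_area w z u v
    rw [h1, smul_zero] at h2
    exact h2)
  set J : EndR r := scal r Complex.I with hJ
  have hJJ : J * J = -1 := by
    ext1 u
    rw [endR_mul_apply, hJ, scal_apply, scal_apply, smul_smul, Complex.I_mul_I, neg_one_smul]
    rfl
  -- The complex-linear part of the real solution. It solves the same equation because `w` commutes
  -- with `J`, and it still equals `1` at `z₀` because `J² = -1`.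
  refine ⟨ε, hε, hball, fun z => (2⁻¹ : ℝ) • (f z - J * f z * J), ?_, ?_, ?_⟩
  · simp only [hf0, mul_one, hJJ]
    ext1 u
    change (2⁻¹ : ℝ) • (u - -u) = u
    rw [sub_neg_eq_add, ← two_smul ℝ u, smul_smul]
    norm_num
  · intro z a u
    have hI : ∀ u, ((2⁻¹ : ℝ) • (f z - J * f z * J)) (Complex.I • u) =
        Complex.I • ((2⁻¹ : ℝ) • (f z - J * f z * J)) u := by
      intro u
      change (2⁻¹ : ℝ) • (f z (Complex.I • u) - Complex.I • f z (Complex.I • Complex.I • u)) =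
        Complex.I • ((2⁻¹ : ℝ) • (f z u - Complex.I • f z (Complex.I • u)))
      rw [smul_smul Complex.I Complex.I u, Complex.I_mul_I, neg_one_smul, map_neg,
        smul_comm Complex.I (2⁻¹ : ℝ), smul_sub Complex.I, smul_smul Complex.I Complex.I,
        Complex.I_mul_I, neg_one_smul, smul_neg]
      congr 1
      abel
    have hr : ∀ (a : ℂ) (u : Cn r), a • u = a.re • u + a.im • (Complex.I • u) := by
      intro a u
      conv_lhs => rw [← Complex.re_add_im a, add_smul, mul_smul]
      rfl
    rw [hr a u, map_add, map_smul, map_smul, hI, ← hr]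
  · intro z hz
    obtain ⟨f', hf', hfv⟩ := hf z hz
    let Q : EndR r →L[ℝ] EndR r := (2⁻¹ : ℝ) • (ContinuousLinearMap.id ℝ (EndR r) -
      (ContinuousLinearMap.compL ℝ (Cn r) (Cn r) (Cn r) J).comp
        ((ContinuousLinearMap.compL ℝ (Cn r) (Cn r) (Cn r)).flip J))
    have hQ : ∀ T, Q T = (2⁻¹ : ℝ) • (T - J * T * J) := fun T => rfl
    have hd : HasFDerivAt (fun z => Q (f z)) (Q.comp f') z := Q.hasFDerivAt.comp z hf'
    refine ⟨_, hd, fun v => ?_⟩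
    have hwJ : w z v * J = J * w z v := by
      ext1 u
      exact hc z (hball hz) v Complex.I u
    have h3 : -(w z v * ((2⁻¹ : ℝ) • (f z - J * f z * J))) =
        (2⁻¹ : ℝ) • (-(w z v * f z) - J * -(w z v * f z) * J) := by
      ext1 u
      change -(w z v ((2⁻¹ : ℝ) • (f z u - J (f z (J u))))) =
        (2⁻¹ : ℝ) • (-(w z v (f z u)) - J (-(w z v (f z (J u)))))
      have h4 := congrArg (fun T : EndR r => T (f z (J u))) hwJ
      change w z v (J (f z (J u))) = J (w z v (f z (J u))) at h4
      rw [map_smul, map_sub, h4, map_neg, ← smul_neg]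
      congr 1
      abel
    rw [h3, ← hfv v]
    exact hQ (f' v)

end Planar

/-! ### Local existence of flat pairs -/

section Existence

variable {M : Type*} [TopologicalSpace M] [ChartedSpace ℂ M] [IsManifold 𝓘(ℂ, ℂ) ω M]
  [T2Space M]
  {r : ℕ} {E : M → Type*} [TopologicalSpace (TotalSpace (Cn r) E)]
  [∀ x, NormedAddCommGroup (E x)] [∀ x, InnerProductSpace ℂ (E x)]
  [FiberBundle (Cn r) E] [VectorBundle ℂ (Cn r) E] [VectorBundle ℝ (Cn r) E]
  [ContMDiffVectorBundle ∞ (Cn r) E 𝓘(ℝ, ℂ)] [IsSmoothHermitian r E]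
  {L : M → Type*} [TopologicalSpace (TotalSpace (Cn 1) L)]
  [∀ x, NormedAddCommGroup (L x)] [∀ x, InnerProductSpace ℂ (L x)]
  [FiberBundle (Cn 1) L] [VectorBundle ℂ (Cn 1) L] [VectorBundle ℝ (Cn 1) L]
  [ContMDiffVectorBundle ∞ (Cn 1) L 𝓘(ℝ, ℂ)] [IsSmoothHermitian 1 L]

theorem diffAt_chart (x₀ : M) (e : Trivialization (Cn r) (π (Cn r) E))
    [MemTrivializationAtlas e] {z : ℂ} (hz : z ∈ chartDom x₀ e) {g : ℂ → Cn r}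
    (hg : DifferentiableAt ℝ g z) :
    DiffAt (r := r) (fun y => e.symm y (g (chartAt ℂ x₀ y))) ((chartAt ℂ x₀).symm z) := by
  rw [diffAt_iff e hz.2]
  refine MDifferentiableAt.congr_of_eventuallyEq (mfd_comp_chart x₀ hz.1 hg.hasFDerivAt).1 ?_
  filter_upwards [e.open_baseSet.mem_nhds hz.2] with y hy
  rw [e.apply_mk_symm hy]

theorem MetricConnection.D_chart (A : MetricConnection r E) (x₀ : M)
    (e : Trivialization (Cn r) (π (Cn r) E)) [MemTrivializationAtlas e] {z : ℂ}
    (hz : z ∈ chartDom x₀ e) {g : ℂ → Cn r} {g' : ℂ →L[ℝ] Cn r} (hg : HasFDerivAt g g' z) (a : ℂ) :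
    A.D (fun y => e.symm y (g (chartAt ℂ x₀ y))) ((chartAt ℂ x₀).symm z) (dchart x₀ z a) =
      e.symm _ (g' a + A.connForm x₀ e z a (g z)) := by
  have h0 : (fun z => coord e (e.symm ((chartAt ℂ x₀).symm z)
      (g (chartAt ℂ x₀ ((chartAt ℂ x₀).symm z))))) =ᶠ[𝓝 z] g := by
    filter_upwards [(isOpen_chartDom x₀ e).mem_nhds hz] with y hy
    rw [(chartAt ℂ x₀).right_inv hy.1, coord_symm e hy.2]
  have h := A.coord_D x₀ e hz (diffAt_chart x₀ e hz hg.differentiableAt) a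
  rw [h0.fderiv_eq, hg.fderiv, coord_symm e hz.2, (chartAt ℂ x₀).right_inv hz.1] at h
  rw [← h, symm_coord e hz.2]

/-- Local flat pairs exist as soon as the curvatures match. -/
theorem exists_flatPair (hr : 0 < r) (A : UnitaryConnection r E) (B : UnitaryConnection 1 L)
    {β : M → ℂ →L[ℝ] ℂ} (hβs : SmoothForm β) (hβ : ∀ x v, (β x v).re = 0) (x₀ : M)
    (hcurv : ∀ z ∈ chartDom x₀ (trivializationAt (Cn r) E x₀), ∀ u,
      planarCurv (A.toMetric.connForm x₀ (trivializationAt (Cn r) E x₀)) z 1 Complex.I u =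
        ((chartDensity B.traceCurvature x₀ z + curl (pull β x₀) z) / r) • u) :
    ∃ O : Set M, IsOpen O ∧ x₀ ∈ O ∧ O ⊆ (chartAt ℂ x₀).source ∧
      ∃ P : FlatPair A.toMetric (B.toMetric.addForm β hβ) O, ∃ Θ : ℂ → ℂ →L[ℝ] ℂ,
        ContinuousOn Θ ((chartAt ℂ x₀).target ∩ (chartAt ℂ x₀).symm ⁻¹' O) ∧
        ∀ z ∈ (chartAt ℂ x₀).target ∩ (chartAt ℂ x₀).symm ⁻¹' O, ∀ a,
          (B.toMetric.addForm β hβ).form P.s ((chartAt ℂ x₀).symm z) (dchart x₀ z a) = Θ z a := by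
  set e := trivializationAt (Cn r) E x₀ with he
  set eL := trivializationAt (Cn 1) L x₀ with heL
  set B' := B.toMetric.addForm β hβ with hB'
  set wA := A.toMetric.connForm x₀ e with hwA
  set z₀ := (chartAt ℂ x₀) x₀ with hz₀
  have hxs : x₀ ∈ (chartAt ℂ x₀).source := mem_chart_source ℂ x₀
  have hcz₀ : (chartAt ℂ x₀).symm z₀ = x₀ := (chartAt ℂ x₀).left_inv hxs
  have hrC : (r : ℂ) ≠ 0 := by exact_mod_cast hr.ne'
  set O₁ : Set ℂ := chartDom x₀ e ∩ chartDom x₀ eL with hO₁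
  have hO₁o : IsOpen O₁ := (isOpen_chartDom x₀ e).inter (isOpen_chartDom x₀ eL)
  have hz₀O : z₀ ∈ O₁ := by
    refine ⟨⟨(chartAt ℂ x₀).map_source hxs, ?_⟩, ⟨(chartAt ℂ x₀).map_source hxs, ?_⟩⟩
    · change (chartAt ℂ x₀).symm z₀ ∈ e.baseSet
      rw [hcz₀]
      exact FiberBundle.mem_baseSet_trivializationAt' x₀
    · change (chartAt ℂ x₀).symm z₀ ∈ eL.baseSet
      rw [hcz₀]
      exact FiberBundle.mem_baseSet_trivializationAt' x₀
  -- the connection form of `B'` in the trivialization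
  set l : ℂ → ℂ →L[ℝ] ℂ := fun z => (trR 1).comp (B.toMetric.connForm x₀ eL z) + pull β x₀ z
    with hl
  have hls : ContDiffOn ℝ ∞ l O₁ :=
    ((B.contDiffOn_trR_connForm x₀ eL).mono inter_subset_right).add
      ((hβs x₀).mono fun z hz => hz.1.1)
  have hlcurl : ∀ z ∈ O₁, curl l z = chartDensity B.traceCurvature x₀ z + curl (pull β x₀) z := by
    intro z hz
    have h1 := ((B.contDiffOn_trR_connForm x₀ eL).contDiffAt
      ((isOpen_chartDom x₀ eL).mem_nhds hz.2)).differentiableAt (by simp)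
    have h2 := ((hβs x₀).contDiffAt ((chartAt ℂ x₀).open_target.mem_nhds hz.1.1)).differentiableAt (by simp)
    rw [B.chartDensity_traceCurvature_eq x₀ eL hz.2, curl, curl, curl, hl,
      fderiv_fun_add h1 h2]
    simp only [add_apply]
    ring
  -- the flat system
  set l' : ℂ → ℂ →L[ℝ] ℂ := fun z => (r : ℝ)⁻¹ • l z with hl'
  have hl's : ContDiffOn ℝ ∞ l' O₁ := hls.const_smul _
  have hwl : ContDiffOn ℝ ∞ (fun z => wA z - (scal r).comp (l' z)) O₁ :=
    ((A.contDiffOn_connForm x₀ e).mono inter_subset_left).sub (contDiffOn_const.clm_comp hl's)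
  -- The form `wA - l/r` is flat: its curvature is the central curvature of `A` minus `curl l / r`,
  -- and these agree by `hcurv` and `hlcurl`.
  obtain ⟨ε, hε, hball, F, hF0, hFc, hF⟩ := exists_complex_flat_solution hO₁o hz₀O
    (hwl.of_le (by norm_cast)) (fun z hz v a u => by
      simp only [sub_apply, ContinuousLinearMap.comp_apply, scal_apply]
      rw [hwA, A.toMetric.connForm_complex_smul x₀ e hz.1, smul_sub, smul_comm a])
    (fun z hz u => by
      have h1 := ((hls.contDiffAt (hO₁o.mem_nhds hz)).differentiableAt (by simp))
      have h2 := ((hl's.contDiffAt (hO₁o.mem_nhds hz)).differentiableAt (by simp))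
      rw [planarCurv_sub_scal (A.differentiableAt_connForm x₀ e hz.1) h2
        (A.toMetric.connForm_complex_smul x₀ e hz.1), hcurv z hz.1, ← hlcurl z hz,
        show curl l' z = curl l z / r by
          rw [curl, curl, hl', fderiv_fun_const_smul h1, smul_apply, smul_apply, smul_apply,
            smul_apply, ← smul_sub, Complex.real_smul, div_eq_inv_mul]
          push_cast
          rfl, sub_self])
  -- normalisation
  set u₁ : Cn 1 := EuclideanSpace.single 0 1 with hu₁
  set G : ℂ → ℝ := fun z => ‖eL.symm ((chartAt ℂ x₀).symm z) u₁‖ ^ 2 with hG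
  have hGpos : ∀ z ∈ O₁, 0 < G z := by
    intro z hz
    have h1 : eL.symm ((chartAt ℂ x₀).symm z) u₁ ≠ 0 := by
      intro h0
      have h8 := congrArg (coord eL) h0
      rw [coord_symm eL hz.2.2] at h8
      have h9 := coord_smul eL hz.2.2 0 (0 : L ((chartAt ℂ x₀).symm z))
      rw [zero_smul, zero_smul] at h9
      rw [h9] at h8
      simp [hu₁] at h8
    positivity
  have hGs : ContDiffOn ℝ ∞ G O₁ := by
    intro z hz
    have h1 : ContMDiffAt 𝓘(ℝ, ℂ) 𝓘(ℝ, ℂ) ∞ (fun x => inner ℂ (eL.symm x u₁) (eL.symm x u₁))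
        ((chartAt ℂ x₀).symm z) :=
      (IsSmoothHermitian.smooth eL u₁ u₁).contMDiffAt (eL.open_baseSet.mem_nhds hz.2.2)
    have h2 : ContDiffAt ℝ ∞ (fun y => inner ℂ (eL.symm ((chartAt ℂ x₀).symm y) u₁) (eL.symm ((chartAt ℂ x₀).symm y) u₁)) z :=
      (h1.comp z (contMDiffAt_chart_symm x₀ hz.1.1)).contDiffAt
    have h3 := (Complex.reCLM.contDiff (n := ∞)).contDiffAt.comp z h2
    refine ContDiffAt.contDiffWithinAt (h3.congr_of_eventuallyEq (Filter.Eventually.of_forall ?_))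
    intro y
    exact norm_sq_eq_re_inner (𝕜 := ℂ) _
  -- `exp ρ` is the inverse of the norm of the frame of `L`, so multiplication by it produces a unit
  -- section.
  set ρ : ℂ → ℝ := fun z => -(2⁻¹ * Real.log (G z)) with hρ
  have hρs : ContDiffOn ℝ ∞ ρ O₁ :=
    (contDiffOn_const.mul (hGs.log fun z hz => (hGpos z hz).ne')).neg
  have hρd : ∀ z ∈ O₁, HasFDerivAt ρ (fderiv ℝ ρ z) z := fun z hz =>
    ((hρs.contDiffAt (hO₁o.mem_nhds hz)).differentiableAt (by simp)).hasFDerivAt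
  -- the exponential of a multiple of `ρ`
  have hexp : ∀ (k : ℝ), ∀ z ∈ O₁, ∃ T : ℂ →L[ℝ] ℂ,
      HasFDerivAt (fun z => ((Real.exp (k * ρ z) : ℝ) : ℂ)) T z ∧
        ∀ a, T a = (k * fderiv ℝ ρ z a : ℝ) * ((Real.exp (k * ρ z) : ℝ) : ℂ) := by
    intro k z hz
    refine ⟨_, Complex.ofRealCLM.hasFDerivAt.comp z (((hρd z hz).const_mul k).exp), fun a => ?_⟩
    simp only [ContinuousLinearMap.comp_apply, smul_apply, Complex.ofRealCLM_apply, smul_eq_mul]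
    push_cast
    ring
  -- the section of `L`
  set s : ∀ x, L x := fun y => ((Real.exp (1 * ρ ((chartAt ℂ x₀) y)) : ℝ) : ℂ) • eL.symm y u₁ with hs
  have hsd : ∀ z ∈ O₁, DiffAt (r := 1) s ((chartAt ℂ x₀).symm z) := by
    intro z hz
    obtain ⟨T, hT, -⟩ := hexp 1 z hz
    exact DiffAt.smul (mfd_comp_chart x₀ hz.1.1 hT).1 (diffAt_symm_const eL hz.2.2 u₁)
  have hsn : ∀ z ∈ O₁, ‖s ((chartAt ℂ x₀).symm z)‖ = 1 := by
    intro z hz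
    have h1 : (0 : ℝ) < ‖eL.symm ((chartAt ℂ x₀).symm z) u₁‖ := by
      have := hGpos z hz
      by_contra h
      have h0 : ‖eL.symm ((chartAt ℂ x₀).symm z) u₁‖ = 0 := le_antisymm (not_lt.1 h) (norm_nonneg _)
      rw [hG] at this
      simp [h0] at this
    rw [hs, norm_smul, (chartAt ℂ x₀).right_inv hz.1.1, Complex.norm_real, Real.norm_eq_abs, Real.abs_exp,
      one_mul]
    simp only [hρ, hG]
    rw [Real.log_pow, Real.exp_neg]
    push_cast
    rw [← mul_assoc, inv_mul_cancel₀ two_ne_zero, one_mul, Real.exp_log h1,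
      inv_mul_cancel₀ h1.ne']
  have hBe : ∀ z ∈ O₁, ∀ a, B'.D (fun y => eL.symm y u₁) ((chartAt ℂ x₀).symm z) (dchart x₀ z a) =
      l z a • eL.symm ((chartAt ℂ x₀).symm z) u₁ := by
    intro z hz a
    rw [hB', MetricConnection.addForm_D, hl, add_apply, add_smul]
    congr 1
    rw [← symm_coord eL hz.2.2 (B.toMetric.D _ _ _), ← B.toMetric.connForm_apply x₀ eL hz.2,
      ← symm_smul eL hz.2.2]
    congr 1
    ext k
    fin_cases k
    simp [trR_apply, hu₁]
  -- Normalizing the frame of `L` by `exp ρ` adds `dρ` to its connection form.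
  set Θ : ℂ → ℂ →L[ℝ] ℂ := fun z => l z + Complex.ofRealCLM.comp (fderiv ℝ ρ z) with hΘ
  have hBs : ∀ z ∈ O₁, ∀ a, B'.D s ((chartAt ℂ x₀).symm z) (dchart x₀ z a) = Θ z a • s ((chartAt ℂ x₀).symm z) := by
    intro z hz a
    obtain ⟨T, hT, hT2⟩ := hexp 1 z hz
    obtain ⟨h1, h2⟩ := mfd_comp_chart x₀ hz.1.1 hT
    have h3 := B'.D_smul h1 (diffAt_symm_const eL hz.2.2 u₁) (dchart x₀ z a)
    refine h3.trans ?_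
    rw [hBe z hz, h2, hT2]
    simp only [hs, hΘ, (chartAt ℂ x₀).right_inv hz.1.1, smul_smul, ← add_smul]
    congr 1
    simp only [add_apply, ContinuousLinearMap.comp_apply, Complex.ofRealCLM_apply]
    push_cast
    ring
  have hBform : ∀ z ∈ O₁, ∀ a, B'.form s ((chartAt ℂ x₀).symm z) (dchart x₀ z a) = Θ z a :=
    fun z hz a => B'.form_eq (hsn z hz) (hBs z hz a)
  -- the frame of `E`
  set b₀ := stdFrame r E x₀ with hb₀
  -- The initial value is chosen so that the frame below equals the unitary frame `b₀` at `x₀`; the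
  -- exponential undoes the scaling built into that frame.
  set N : Cn r → Cn r := fun u => ((Real.exp (-((r : ℝ)⁻¹ * ρ z₀)) : ℝ) : ℂ) • coord e (b₀ u)
    with hN
  have hx₀e : x₀ ∈ e.baseSet := FiberBundle.mem_baseSet_trivializationAt' x₀
  -- The factor `exp (ρ/r)` adds `dρ/r`, so the frame has connection form `Θ/r` to match the unit
  -- section.
  set φ : ∀ x, Cn r → E x := fun y u =>
    ((Real.exp ((r : ℝ)⁻¹ * ρ ((chartAt ℂ x₀) y)) : ℝ) : ℂ) • e.symm y (F ((chartAt ℂ x₀) y) (N u)) with hφ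
  have hFd : ∀ z ∈ Metric.ball z₀ ε, ∀ u, ∃ T : ℂ →L[ℝ] Cn r, HasFDerivAt (fun z => F z u) T z ∧
      ∀ a, T a = l' z a • F z u - wA z a (F z u) := by
    intro z hz u
    obtain ⟨F', hF', hF2⟩ := hF z hz
    refine ⟨_, hF'.clm_apply (hasFDerivAt_const u z), fun a => ?_⟩
    simp only [ContinuousLinearMap.comp_zero, zero_add, ContinuousLinearMap.flip_apply, hF2]
    change -((wA z a - scal r (l' z a)) (F z u)) = _
    rw [sub_apply, scal_apply]
    abel
  have hφd : ∀ z ∈ Metric.ball z₀ ε, ∀ u, DiffAt (r := r) (fun y => φ y u) ((chartAt ℂ x₀).symm z) := by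
    intro z hz u
    obtain ⟨T, hT, -⟩ := hexp (r : ℝ)⁻¹ z (hball hz)
    obtain ⟨T', hT', -⟩ := hFd z hz (N u)
    exact DiffAt.smul (mfd_comp_chart x₀ (hball hz).1.1 hT).1
      (diffAt_chart x₀ e (hball hz).1 hT'.differentiableAt)
  have hφA : ∀ z ∈ Metric.ball z₀ ε, ∀ u a, A.toMetric.D (fun y => φ y u) ((chartAt ℂ x₀).symm z)
      (dchart x₀ z a) = (Θ z a / r) • φ ((chartAt ℂ x₀).symm z) u := by
    intro z hz u a
    obtain ⟨T, hT, hT2⟩ := hexp (r : ℝ)⁻¹ z (hball hz)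
    obtain ⟨T', hT', hT2'⟩ := hFd z hz (N u)
    obtain ⟨h1, h2⟩ := mfd_comp_chart x₀ (hball hz).1.1 hT
    have h3 := A.toMetric.D_smul h1 (diffAt_chart x₀ e (hball hz).1 hT'.differentiableAt)
      (dchart x₀ z a)
    refine h3.trans ?_
    rw [A.toMetric.D_chart x₀ e (hball hz).1 hT', hT2', sub_add_cancel, h2, hT2,
      symm_smul e (hball hz).1.2]
    simp only [hφ, hΘ, (chartAt ℂ x₀).right_inv (hball hz).1.1, smul_smul, ← add_smul]
    congr 1
    simp only [add_apply, ContinuousLinearMap.comp_apply, Complex.ofRealCLM_apply, hl',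
      smul_apply, Complex.real_smul]
    push_cast
    field_simp
  -- the frame is unitary
  have hΘim : ∀ z ∈ O₁, ∀ a, conj (Θ z a) = -Θ z a := by
    intro z hz a
    rw [← hBform z hz a]
    refine B'.conj_form (hsd z hz) ?_ _
    have hzs : (chartAt ℂ x₀).symm z ∈ (chartAt ℂ x₀).source := (chartAt ℂ x₀).map_target hz.1.1
    have h1 : (chartAt ℂ x₀) ⁻¹' O₁ ∈ 𝓝 ((chartAt ℂ x₀).symm z) := by
      refine ((chartAt ℂ x₀).continuousAt hzs).preimage_mem_nhds (hO₁o.mem_nhds ?_)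
      rw [(chartAt ℂ x₀).right_inv hz.1.1]
      exact hz
    filter_upwards [h1, (chartAt ℂ x₀).open_source.mem_nhds hzs] with y hy hys
    have := hsn ((chartAt ℂ x₀) y) hy
    rwa [(chartAt ℂ x₀).left_inv hys] at this
  have hNl : ∀ u v, N (u + v) = N u + N v := by
    intro u v
    rw [hN]
    simp only
    rw [map_add, coord_add e hx₀e, smul_add]
  have hNs : ∀ (a : ℂ) u, N (a • u) = a • N u := by
    intro a u
    rw [hN]
    simp only
    rw [map_smul, coord_smul e hx₀e, smul_comm]
  have hφ₀' : ∀ x, x = x₀ → ∃ b : Cn r ≃ₗᵢ[ℂ] E x, ∀ u, φ x u = b u := by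
    intro x hx
    rw [hx]
    refine ⟨b₀, fun u => ?_⟩
    change ((Real.exp ((r : ℝ)⁻¹ * ρ ((chartAt ℂ x₀) x₀)) : ℝ) : ℂ) • e.symm x₀ (F ((chartAt ℂ x₀) x₀) (N u)) = b₀ u
    rw [← hz₀, hF0]
    change _ • e.symm x₀ (N u) = _
    rw [hN]
    simp only
    rw [symm_smul e hx₀e, symm_coord e hx₀e, smul_smul, ← Complex.ofReal_mul, ← Real.exp_add,
      add_neg_cancel, Real.exp_zero, Complex.ofReal_one, one_smul]
  obtain ⟨b₁, hφ₀⟩ := hφ₀' _ hcz₀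
  -- Since `Θ` is imaginary, the derivatives of these products vanish; a frame which is unitary at
  -- the centre is then unitary on the ball.
  have hφin : ∀ z ∈ Metric.ball z₀ ε, ∀ u v, inner ℂ (φ ((chartAt ℂ x₀).symm z) u) (φ ((chartAt ℂ x₀).symm z) v) =
      inner ℂ u v := by
    intro z hz u v
    have hd : ∀ y ∈ Metric.ball z₀ ε, HasFDerivAt
        (fun z => inner ℂ (φ ((chartAt ℂ x₀).symm z) u) (φ ((chartAt ℂ x₀).symm z) v)) (0 : ℂ →L[ℝ] ℂ) y := by
      intro y hy
      obtain ⟨T, hT, hT2⟩ := A.toMetric.hasFDerivAt_inner x₀ (hball hy).1.1 (hφd y hy u)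
        (hφd y hy v)
      refine hT.congr_fderiv ?_
      ext1 a
      rw [hT2, hφA y hy, hφA y hy]
      generalize φ ((chartAt ℂ x₀).symm y) u = p
      generalize φ ((chartAt ℂ x₀).symm y) v = q
      rw [inner_smul_left, inner_smul_right, map_div₀,
        hΘim y (hball hy), Complex.conj_natCast, zero_apply]
      ring
    have h1 := Metric.isOpen_ball.is_const_of_fderiv_eq_zero (𝕜 := ℝ)
      (convex_ball z₀ ε).isPreconnected
      (fun y hy => (hd y hy).differentiableAt.differentiableWithinAt)
      (fun y hy => (hd y hy).fderiv) hz (Metric.mem_ball_self hε)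
    rw [h1, hφ₀, hφ₀, LinearIsometryEquiv.inner_map_map]
  classical
  set O : Set M := (chartAt ℂ x₀).source ∩ (chartAt ℂ x₀) ⁻¹' Metric.ball z₀ ε with hO
  have hOo : IsOpen O := (chartAt ℂ x₀).isOpen_inter_preimage Metric.isOpen_ball
  have hfex : ∀ x, ∃ f : Cn r ≃ₗᵢ[ℂ] E x, x ∈ O → ∀ u, f u = φ x u := by
    intro x
    by_cases hx : x ∈ O
    · have hxe : x ∈ e.baseSet := by
        have := (hball hx.2).1.2
        change (chartAt ℂ x₀).symm ((chartAt ℂ x₀) x) ∈ e.baseSet at this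
        rwa [(chartAt ℂ x₀).left_inv hx.1] at this
      let fl : Cn r →ₗ[ℂ] E x :=
        { toFun := φ x
          map_add' := fun u v => by
            rw [hφ]
            simp only
            rw [hNl, map_add, symm_add e hxe, smul_add]
          map_smul' := fun a u => by
            rw [hφ]
            simp only
            rw [hNs, hFc, symm_smul e hxe, smul_comm]
            rfl }
      haveI : FiniteDimensional ℂ (E x) := (fibreEquiv r E x).symm.finiteDimensional
      let fi : Cn r →ₗᵢ[ℂ] E x := fl.isometryOfInner fun u v => by
        have := hφin ((chartAt ℂ x₀) x) hx.2 u v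
        rwa [(chartAt ℂ x₀).left_inv hx.1] at this
      refine ⟨fi.toLinearIsometryEquiv (by rw [finrank_fibre r E x, finrank_euclideanSpace_fin]),
        fun _ u => rfl⟩
    · exact ⟨stdFrame r E x, fun h => absurd h hx⟩
  choose f hf using hfex
  have hOz : ∀ x ∈ O, ∃ z ∈ Metric.ball z₀ ε, (chartAt ℂ x₀).symm z = x := fun x hx =>
    ⟨(chartAt ℂ x₀) x, hx.2, (chartAt ℂ x₀).left_inv hx.1⟩
  have hfev : ∀ x ∈ O, ∀ u, ∀ᶠ y in 𝓝 x, φ y u = f y u := by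
    intro x hx u
    filter_upwards [hOo.mem_nhds hx] with y hy
    exact (hf y hy u).symm
  refine ⟨O, hOo, ⟨hxs, Metric.mem_ball_self hε⟩, inter_subset_left, ⟨f, s, ?_, ?_, ?_, ?_⟩,
    Θ, ?_, ?_⟩
  · intro x hx
    obtain ⟨z, hz, rfl⟩ := hOz x hx
    exact hsn z (hball hz)
  · intro x hx u
    refine DiffAt.congr ?_ (hfev x hx u)
    obtain ⟨z, hz, rfl⟩ := hOz x hx
    exact hφd z hz u
  · intro x hx
    obtain ⟨z, hz, rfl⟩ := hOz x hx
    exact hsd z (hball hz)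
  · intro x hx u v
    have hfx := hf x hx u
    have hev := hfev x hx u
    obtain ⟨z, hz, rfl⟩ := hOz x hx
    obtain ⟨a, rfl⟩ := exists_dchart_eq x₀ (hball hz).1.1 v
    rw [← A.toMetric.D_congr (hφd z hz u) hev, hφA z hz, hBform z (hball hz), hfx]
  · have hsub : (chartAt ℂ x₀).target ∩ (chartAt ℂ x₀).symm ⁻¹' O ⊆ O₁ := by
      intro z hz
      have := hball hz.2.2
      change (chartAt ℂ x₀) ((chartAt ℂ x₀).symm z) ∈ O₁ at this
      rwa [(chartAt ℂ x₀).right_inv hz.1] at this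
    refine ContinuousOn.mono ?_ hsub
    refine hls.continuousOn.add (continuousOn_const.clm_comp ?_)
    exact (hρs.continuousOn_fderiv_of_isOpen hO₁o (by simp))
  · intro z hz a
    refine hBform z ?_ a
    have := hball hz.2.2
    change (chartAt ℂ x₀) ((chartAt ℂ x₀).symm z) ∈ O₁ at this
    rwa [(chartAt ℂ x₀).right_inv hz.1] at this

end Existence

/-! ### Fibres over equal points and antilinear isometries -/

section Casts

variable {M : Type*} {r : ℕ} {E : M → Type*} [∀ x, NormedAddCommGroup (E x)]
  [∀ x, InnerProductSpace ℂ (E x)]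

variable (E) in
/-- The identification of the fibres over equal points. -/
def castE {y x : M} (h : y = x) : E y ≃ₗᵢ[ℂ] E x := h ▸ LinearIsometryEquiv.refl ℂ (E y)

theorem mk_castE (r : ℕ) {y x : M} (h : y = x) (v : E y) :
    TotalSpace.mk' (Cn r) x (castE E h v) = TotalSpace.mk' (Cn r) y v := by
  subst h
  rfl

theorem totalSpace_mk_inj (r : ℕ) {x : M} {v w : E x}
    (h : TotalSpace.mk' (Cn r) x v = TotalSpace.mk' (Cn r) x w) : v = w := by
  injection h

/-- Polarization: norms are preserved while `I` is sent to `-I`. -/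
theorem inner_antilinear {V W : Type*} [NormedAddCommGroup V] [InnerProductSpace ℂ V]
    [NormedAddCommGroup W] [InnerProductSpace ℂ W] (T : V →ₛₗᵢ[starRingEnd ℂ] W) (v w : V) :
    inner ℂ (T v) (T w) = conj (inner ℂ v w : ℂ) := by
  have hI : ∀ w, T (Complex.I • w) = -(Complex.I • T w) := by
    intro w
    rw [map_smulₛₗ, Complex.conj_I, neg_smul]
  rw [inner_eq_sum_norm_sq_div_four, inner_eq_sum_norm_sq_div_four, ← T.norm_map (v + w),
    ← T.norm_map (v - w), ← T.norm_map (v - _), ← T.norm_map (v + _)]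
  simp only [map_add, map_sub, map_div₀, map_mul, map_pow, Complex.conj_I, RCLike.I_to_complex,
    hI, sub_neg_eq_add, ← sub_eq_add_neg, Complex.coe_algebraMap, Complex.conj_ofReal,
    map_ofNat]
  ring

end Casts

/-! ### Conjugation of sections, connections and flat pairs -/

section Conjugation

variable {M : Type*} [TopologicalSpace M] [ChartedSpace ℂ M] [IsManifold 𝓘(ℂ, ℂ) ω M]
  {r : ℕ} {E : M → Type*} [TopologicalSpace (TotalSpace (Cn r) E)]
  [∀ x, NormedAddCommGroup (E x)] [∀ x, InnerProductSpace ℂ (E x)]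
  [FiberBundle (Cn r) E] [VectorBundle ℂ (Cn r) E] [VectorBundle ℝ (Cn r) E]
  [ContMDiffVectorBundle ∞ (Cn r) E 𝓘(ℝ, ℂ)]
  {L : M → Type*} [TopologicalSpace (TotalSpace (Cn 1) L)]
  [∀ x, NormedAddCommGroup (L x)] [∀ x, InnerProductSpace ℂ (L x)]
  [FiberBundle (Cn 1) L] [VectorBundle ℂ (Cn 1) L] [VectorBundle ℝ (Cn 1) L]
  [ContMDiffVectorBundle ∞ (Cn 1) L 𝓘(ℝ, ℂ)]
  {σ : M → M} (hσ : IsRealStructure σ) {c : ℤˣ} (τ : RealQuatStructure r E σ c)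

/-- The derivative of `σ`. -/
def dsig (σ : M → M) (x : M) : ℂ →L[ℝ] ℂ := mfderiv 𝓘(ℝ, ℂ) 𝓘(ℝ, ℂ) σ x

theorem IsRealStructure.mdifferentiableAt {σ : M → M} (hσ : IsRealStructure σ) (x : M) :
    MDifferentiableAt 𝓘(ℝ, ℂ) 𝓘(ℝ, ℂ) σ x := hσ.smooth.mdifferentiable (by simp) x

theorem dsig_dsig (hσ : IsRealStructure σ) (x : M) (v : ℂ) :
    dsig σ (σ x) (dsig σ x v) = v := by
  have h1 := mfderiv_comp x (hσ.mdifferentiableAt (σ x)) (hσ.mdifferentiableAt x)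
  have h2 : σ ∘ σ = id := funext hσ.involutive
  have h3 : mfderiv 𝓘(ℝ, ℂ) 𝓘(ℝ, ℂ) (σ ∘ σ) x = ContinuousLinearMap.id ℝ ℂ := by
    rw [h2]
    exact mfderiv_id
  exact (congrArg (fun T : ℂ →L[ℝ] ℂ => T v) (h1.symm.trans h3))

theorem mfd_comp_sigma (hσ : IsRealStructure σ) {F : Type*} [NormedAddCommGroup F] [NormedSpace ℝ F] {g : M → F} {x : M}
    (hg : MDifferentiableAt 𝓘(ℝ, ℂ) 𝓘(ℝ, F) g (σ x)) (v : ℂ) :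
    MDifferentiableAt 𝓘(ℝ, ℂ) 𝓘(ℝ, F) (fun y => g (σ y)) x ∧
      mfd (fun y => g (σ y)) x v = mfd g (σ x) (dsig σ x v) :=
  ⟨hg.comp x (hσ.mdifferentiableAt x),
    congrArg (fun T : ℂ →L[ℝ] F => T v) (mfderiv_comp x hg (hσ.mdifferentiableAt x))⟩

/-- The map on the total space given by `τ`. -/
def totalMap (p : TotalSpace (Cn r) E) : TotalSpace (Cn r) E :=
  TotalSpace.mk' (Cn r) (σ p.1) (τ.map p.1 p.2)

theorem totalMap_totalMap (x : M) (v : E x) :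
    totalMap τ (totalMap τ (TotalSpace.mk' (Cn r) x v)) =
      TotalSpace.mk' (Cn r) x (((c : ℤ) : ℂ) • v) := τ.square x v

/-- The antilinear map `E_{σ x} → E_x` given by `τ`. -/
def backMap (x : M) (w : E (σ x)) : E x := castE E (hσ.involutive x) (τ.map (σ x) w)

theorem mk_backMap (x : M) (w : E (σ x)) :
    TotalSpace.mk' (Cn r) x (backMap hσ τ x w) = totalMap τ (TotalSpace.mk' (Cn r) (σ x) w) :=
  mk_castE r (hσ.involutive x) (τ.map (σ x) w)

theorem backMap_add (x : M) (v w : E (σ x)) :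
    backMap hσ τ x (v + w) = backMap hσ τ x v + backMap hσ τ x w := by
  simp [backMap]

theorem backMap_smul (x : M) (a : ℂ) (w : E (σ x)) :
    backMap hσ τ x (a • w) = conj a • backMap hσ τ x w := by
  rw [backMap, backMap, map_smulₛₗ, map_smul]

theorem backMap_real_smul (x : M) (a : ℝ) (w : E (σ x)) :
    backMap hσ τ x (a • w) = a • backMap hσ τ x w := by
  have h := backMap_smul hσ τ x (a : ℂ) w
  rw [Complex.conj_ofReal] at h
  exact h

theorem norm_backMap (x : M) (w : E (σ x)) : ‖backMap hσ τ x w‖ = ‖w‖ := by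
  rw [backMap, LinearIsometryEquiv.norm_map, LinearIsometry.norm_map]

theorem inner_backMap (x : M) (v w : E (σ x)) :
    inner ℂ (backMap hσ τ x v) (backMap hσ τ x w) = conj (inner ℂ v w : ℂ) := by
  rw [backMap, backMap, LinearIsometryEquiv.inner_map_map, inner_antilinear]

/-- The section `τ ∘ s ∘ σ⁻¹`. -/
def conjSec (s : ∀ x, E x) (x : M) : E x := backMap hσ τ x (s (σ x))

theorem mk_conjSec (s : ∀ x, E x) (x : M) :
    TotalSpace.mk' (Cn r) x (conjSec hσ τ s x) = totalMap τ (TotalSpace.mk' (Cn r) (σ x) (s (σ x))) :=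
  mk_backMap hσ τ x _

theorem mk_section_congr (r : ℕ) (s : ∀ x, E x) {x y : M} (h : x = y) :
    TotalSpace.mk' (Cn r) x (s x) = TotalSpace.mk' (Cn r) y (s y) := by
  rw [h]

theorem conjSec_sigma (s : ∀ x, E x) (y : M) : conjSec hσ τ s (σ y) = τ.map y (s y) := by
  apply totalSpace_mk_inj r
  rw [mk_conjSec, mk_section_congr r s (hσ.involutive y)]
  rfl

theorem conjSec_conjSec (τ : RealQuatStructure r E σ 1) (s : ∀ x, E x) :
    conjSec hσ τ (conjSec hσ τ s) = s := by
  funext x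
  apply totalSpace_mk_inj r
  rw [mk_conjSec, mk_conjSec, mk_section_congr r s (hσ.involutive x), totalMap_totalMap]
  simp

theorem diffAt_sigma (hσ : IsRealStructure σ) {s : ∀ x, E x} {x : M} (hs : DiffAt (r := r) s x) :
    DiffAt (r := r) s (σ (σ x)) := by
  rw [hσ.involutive x]
  exact hs

theorem diffAt_conjSec {s : ∀ x, E x} {x : M} (hs : DiffAt (r := r) s (σ x)) :
    DiffAt (r := r) (conjSec hσ τ s) x := by
  have h1 : MDifferentiableAt 𝓘(ℝ, ℂ) (𝓘(ℝ, ℂ).prod 𝓘(ℝ, Cn r))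
      (fun y => TotalSpace.mk' (Cn r) (σ y) (s (σ y))) x :=
    MDifferentiableAt.comp x (f := σ) hs (hσ.mdifferentiableAt x)
  have h2 : MDifferentiableAt (𝓘(ℝ, ℂ).prod 𝓘(ℝ, Cn r)) (𝓘(ℝ, ℂ).prod 𝓘(ℝ, Cn r))
      (totalMap τ) (TotalSpace.mk' (Cn r) (σ x) (s (σ x))) :=
    τ.smooth.mdifferentiable (by simp) _
  have h3 := MDifferentiableAt.comp x (f := fun y => TotalSpace.mk' (Cn r) (σ y) (s (σ y))) h2 h1
  refine MDifferentiableAt.congr_of_eventuallyEq h3 (Filter.Eventually.of_forall fun y => ?_)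
  exact mk_conjSec hσ τ s y

/-- `A₂` is the conjugate of `A₁` under `τ`. -/
def ConjRel (A₁ A₂ : MetricConnection r E) : Prop :=
  ∀ (t : ∀ x, E x) (x : M), DiffAt (r := r) t (σ x) → ∀ v,
    A₂.D (conjSec hσ τ t) x v = backMap hσ τ x (A₁.D t (σ x) (dsig σ x v))

theorem UnitaryConnection.IsGaloisInvariant.conjRel {A : UnitaryConnection r E}
    (hA : A.IsGaloisInvariant τ) : ConjRel hσ τ A.toMetric A.toMetric := by
  intro t x ht v
  have h := hA t (conjSec hσ τ t) (conjSec_sigma hσ τ t) (σ x) ht (dsig σ x v)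
  have h2 : A.toMetric.D (conjSec hσ τ t) (σ (σ x)) (dsig σ (σ x) (dsig σ x v)) =
      τ.map (σ x) (A.toMetric.D t (σ x) (dsig σ x v)) := h
  rw [dsig_dsig hσ x v] at h2
  apply totalSpace_mk_inj r
  rw [mk_backMap, ← mk_section_congr r (fun y => A.toMetric.D (conjSec hσ τ t) y v)
    (hσ.involutive x), h2]
  rfl

/-- The average of two metric connections. -/
def MetricConnection.average (A₁ A₂ : MetricConnection r E) : MetricConnection r E :=
  .ofD (fun s x => (2⁻¹ : ℝ) • (A₁.D s x + A₂.D s x))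
    (fun s t x hs ht => by
      rw [A₁.D_add hs ht, A₂.D_add hs ht, ← smul_add]
      congr 1
      abel)
    (fun s g x hs hg v => by
      rw [smul_apply, add_apply, smul_apply, add_apply, A₁.D_real_smul hg hs,
        A₂.D_real_smul hg hs]
      module)
    (fun s x hs v => by
      rw [smul_apply, add_apply, smul_apply, add_apply, A₁.D_const_smul _ hs,
        A₂.D_const_smul _ hs, ← smul_add, smul_comm])
    (fun s t x hs ht v => by
      have h1 := A₁.mfd_inner hs ht v
      have h2 := A₂.mfd_inner hs ht v
      have h3 : ∀ (p q : E x), inner ℂ ((2⁻¹ : ℝ) • p) q = (2⁻¹ : ℂ) * inner ℂ p q := by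
        intro p q
        rw [show ((2⁻¹ : ℝ) • p : E x) = ((2⁻¹ : ℝ) : ℂ) • p from rfl, inner_smul_left,
          Complex.conj_ofReal]
        push_cast
        rfl
      have h4 : ∀ (p q : E x), inner ℂ p ((2⁻¹ : ℝ) • q) = (2⁻¹ : ℂ) * inner ℂ p q := by
        intro p q
        rw [show ((2⁻¹ : ℝ) • q : E x) = ((2⁻¹ : ℝ) : ℂ) • q from rfl, inner_smul_right]
        push_cast
        rfl
      rw [smul_apply, add_apply, smul_apply, add_apply, h3, h4, inner_add_left, inner_add_right]
      linear_combination (2⁻¹ : ℂ) * h1 + (2⁻¹ : ℂ) * h2)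

theorem MetricConnection.average_D (A₁ A₂ : MetricConnection r E) (s : ∀ x, E x) (x : M) (v : ℂ) :
    (A₁.average A₂).D s x v = (2⁻¹ : ℝ) • (A₁.D s x v + A₂.D s x v) := rfl

/-- The conjugate of a metric connection under a Real structure. -/
def MetricConnection.conjugate [IsSmoothHermitian r E] (τ : RealQuatStructure r E σ 1)
    (B : MetricConnection r E) : MetricConnection r E :=
  .ofD (fun s x => LinearMap.toContinuousLinearMap
      { toFun := fun v => backMap hσ τ x (B.D (conjSec hσ τ s) (σ x) (dsig σ x v))
        map_add' := fun v w => by rw [map_add, map_add, backMap_add]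
        map_smul' := fun a v => by rw [map_smul, map_smul, backMap_real_smul]; rfl })
    (fun s t x hs ht => by
      ext1 v
      have h : (fun y => conjSec hσ τ s y + conjSec hσ τ t y) =
          conjSec hσ τ (fun y => s y + t y) := by
        funext y
        exact (backMap_add hσ τ y _ _).symm
      change backMap hσ τ x (B.D (conjSec hσ τ fun y => s y + t y) (σ x) (dsig σ x v)) =
        backMap hσ τ x (B.D (conjSec hσ τ s) (σ x) (dsig σ x v)) +
        backMap hσ τ x (B.D (conjSec hσ τ t) (σ x) (dsig σ x v))
      rw [← h, B.D_add (diffAt_conjSec hσ τ (diffAt_sigma hσ hs))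
        (diffAt_conjSec hσ τ (diffAt_sigma hσ ht)), add_apply, backMap_add])
    (fun s g x hs hg v => by
      have h : (fun y => g (σ y) • conjSec hσ τ s y) = conjSec hσ τ (fun y => g y • s y) := by
        funext y
        exact (backMap_real_smul hσ τ y _ _).symm
      have hg' : MDifferentiableAt 𝓘(ℝ, ℂ) 𝓘(ℝ, ℝ) g (σ (σ x)) := by
        rw [hσ.involutive x]
        exact hg
      have h1 := (mfd_comp_sigma hσ hg' 0).1
      have h2 := (mfd_comp_sigma hσ h1 v).2
      have h3 : (fun y => g (σ (σ y))) = g := by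
        funext y
        rw [hσ.involutive y]
      rw [h3] at h2
      change backMap hσ τ x (B.D (conjSec hσ τ fun y => g y • s y) (σ x) (dsig σ x v)) =
        g x • backMap hσ τ x (B.D (conjSec hσ τ s) (σ x) (dsig σ x v)) + _
      rw [← h, B.D_real_smul h1 (diffAt_conjSec hσ τ (diffAt_sigma hσ hs)), backMap_add,
        backMap_real_smul, backMap_real_smul, hσ.involutive x, h2]
      congr 2
      exact congrFun (conjSec_conjSec hσ τ s) x)
    (fun s x hs v => by
      -- Antilinearity turns `I` into `-I`; the second application of `backMap` restores the sign.
      have h : (fun y => (-Complex.I) • conjSec hσ τ s y) =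
          conjSec hσ τ (fun y => Complex.I • s y) := by
        funext y
        rw [conjSec, conjSec, backMap_smul, Complex.conj_I]
      change backMap hσ τ x (B.D (conjSec hσ τ fun y => Complex.I • s y) (σ x) (dsig σ x v)) =
        Complex.I • backMap hσ τ x (B.D (conjSec hσ τ s) (σ x) (dsig σ x v))
      rw [← h, B.D_const_smul _ (diffAt_conjSec hσ τ (diffAt_sigma hσ hs)), backMap_smul,
        map_neg, Complex.conj_I, neg_neg])
    (fun s t x hs ht v => by
      have hs' := diffAt_conjSec hσ τ (diffAt_sigma hσ hs)
      have ht' := diffAt_conjSec hσ τ (diffAt_sigma hσ ht)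
      have h1 := B.mfd_inner hs' ht' (dsig σ x v)
      have h2 := mfd_comp_sigma hσ (mdifferentiableAt_inner hs' ht') v
      have hc : HasMFDerivAt 𝓘(ℝ, ℂ) 𝓘(ℝ, ℂ) (fun y => conj (inner ℂ (conjSec hσ τ s (σ y))
          (conjSec hσ τ t (σ y)) : ℂ)) x (Complex.conjCLE.toContinuousLinearMap.comp
            (mfderiv 𝓘(ℝ, ℂ) 𝓘(ℝ, ℂ) (fun y => (inner ℂ (conjSec hσ τ s (σ y))
          (conjSec hσ τ t (σ y)) : ℂ)) x)) :=
        Complex.conjCLE.toContinuousLinearMap.hasMFDerivAt.comp x h2.1.hasMFDerivAt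
      have h4 : (fun y => (inner ℂ (s y) (t y) : ℂ)) = fun y => conj (inner ℂ
          (conjSec hσ τ s (σ y)) (conjSec hσ τ t (σ y)) : ℂ) := by
        funext y
        rw [conjSec_sigma, conjSec_sigma, inner_antilinear, Complex.conj_conj]
      have h5 : mfd (fun y => (inner ℂ (s y) (t y) : ℂ)) x v =
          conj (mfd (fun y => (inner ℂ (conjSec hσ τ s (σ y))
            (conjSec hσ τ t (σ y)) : ℂ)) x v) := by
        rw [h4]
        exact congrArg (fun T : ℂ →L[ℝ] ℂ => T v) hc.mfderiv
      have h6 : ∀ s : ∀ x, E x, s x = backMap hσ τ x (conjSec hσ τ s (σ x)) := fun s =>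
        (congrFun (conjSec_conjSec hσ τ s) x).symm
      rw [h5, h2.2, h1, map_add]
      change _ = inner ℂ (backMap hσ τ x (B.D (conjSec hσ τ s) (σ x) (dsig σ x v))) (t x) +
        inner ℂ (s x) (backMap hσ τ x (B.D (conjSec hσ τ t) (σ x) (dsig σ x v)))
      rw [h6 s, h6 t, inner_backMap, inner_backMap])

theorem MetricConnection.conjRel_conjugate [IsSmoothHermitian r E]
    (τ : RealQuatStructure r E σ 1) (B : MetricConnection r E) :
    ConjRel hσ τ B (B.conjugate hσ τ) := by
  intro t x ht v
  change backMap hσ τ x (B.D (conjSec hσ τ (conjSec hσ τ t)) (σ x) (dsig σ x v)) = _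
  rw [conjSec_conjSec]

/-- Conjugation is an involution on connections, because `τ² = 1` here, and so exchanges the two
terms of the average. -/
theorem MetricConnection.conjRel_average [IsSmoothHermitian r E]
    (τ : RealQuatStructure r E σ 1) (B : MetricConnection r E) :
    ConjRel hσ τ (B.average (B.conjugate hσ τ)) (B.average (B.conjugate hσ τ)) := by
  intro t x ht v
  rw [average_D, average_D, backMap_real_smul, backMap_add, B.conjRel_conjugate hσ τ t x ht v,
    add_comm]
  congr 2
  change _ = backMap hσ τ x (backMap hσ τ (σ x) (B.D (conjSec hσ τ t) (σ (σ x))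
    (dsig σ (σ x) (dsig σ x v))))
  rw [dsig_dsig hσ x v]
  apply totalSpace_mk_inj r
  rw [mk_backMap, mk_backMap, mk_section_congr r (fun y => B.D (conjSec hσ τ t) y v)
    (hσ.involutive x), totalMap_totalMap]
  simp

/-- Complex conjugation on `ℂ^r`. -/
def conjV {r : ℕ} (u : Cn r) : Cn r := WithLp.toLp 2 fun i => conj (u i)

theorem conjV_add (u v : Cn r) : conjV (u + v) = conjV u + conjV v := by
  ext i
  simp [conjV]

theorem conjV_smul (a : ℂ) (u : Cn r) : conjV (a • u) = conj a • conjV u := by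
  ext i
  simp [conjV]

theorem norm_conjV (u : Cn r) : ‖conjV u‖ = ‖u‖ := by
  simp [conjV, EuclideanSpace.norm_eq]

theorem conjV_conjV (u : Cn r) : conjV (conjV u) = u := by
  ext i
  simp [conjV]

/-- The unitary frame conjugate to a unitary frame. -/
def conjFrame (x : M) (f : Cn r ≃ₗᵢ[ℂ] E (σ x)) : Cn r ≃ₗᵢ[ℂ] E x :=
  haveI : FiniteDimensional ℂ (E x) := (fibreEquiv r E x).symm.finiteDimensional
  LinearIsometry.toLinearIsometryEquiv
    { toFun := fun u => backMap hσ τ x (f (conjV u))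
      map_add' := fun u v => by rw [conjV_add, map_add, backMap_add]
      map_smul' := fun a u => by
        rw [conjV_smul, map_smul, backMap_smul, Complex.conj_conj]
        rfl
      norm_map' := fun u => by
        change ‖backMap hσ τ x (f (conjV u))‖ = _
        rw [norm_backMap, LinearIsometryEquiv.norm_map, norm_conjV] }
    (by rw [finrank_fibre r E x, finrank_euclideanSpace_fin])

theorem conjFrame_apply (x : M) (f : Cn r ≃ₗᵢ[ℂ] E (σ x)) (u : Cn r) :
    conjFrame hσ τ x f u = backMap hσ τ x (f (conjV u)) := rfl

/-- The flat pair conjugate to a flat pair. -/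
def FlatPair.conjugate (τL : RealQuatStructure 1 L σ 1) {A : MetricConnection r E}
    {B₁ B₂ : MetricConnection 1 L} (hA : ConjRel hσ τ A A) (hB : ConjRel hσ τL B₁ B₂)
    {O : Set M} (P : FlatPair A B₁ O) : FlatPair A B₂ (σ ⁻¹' O) where
  f x := conjFrame hσ τ x (P.f (σ x))
  s := conjSec hσ τL P.s
  norm_s x hx := (norm_backMap hσ τL x _).trans (P.norm_s _ hx)
  diff_f x hx u := diffAt_conjSec hσ τ (P.diff_f (σ x) hx (conjV u))
  diff_s x hx := diffAt_conjSec hσ τL (P.diff_s (σ x) hx)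
  cov_f x hx u v := by
    have h := hA (fun y => P.f y (conjV u)) x (P.diff_f (σ x) hx (conjV u)) v
    refine h.trans ?_
    -- Both connection forms are conjugated and pulled back by `σ`, and the factor `1/r` is real, so
    -- the relation defining a flat pair persists.
    have h2 : B₂.form (conjSec hσ τL P.s) x v = conj (B₁.form P.s (σ x) (dsig σ x v)) := by
      rw [MetricConnection.form, hB P.s x (P.diff_s _ hx) v]
      exact inner_backMap hσ τL x _ _
    rw [P.cov_f (σ x) hx, backMap_smul, h2, map_div₀, Complex.conj_natCast, conjFrame_apply]

end Conjugation

/-- The branch of `(w / w₀) ^ k` with value `1` at `w₀`. -/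
def branch (k w₀ w : ℂ) : ℂ := Complex.exp (k * Complex.log (w / w₀))

theorem branch_self (k : ℂ) {w : ℂ} (hw : w ≠ 0) : branch k w w = 1 := by
  rw [branch, div_self hw, Complex.log_one, mul_zero, Complex.exp_zero]

theorem branch_ne_zero (k w₀ w : ℂ) : branch k w₀ w ≠ 0 := Complex.exp_ne_zero _

theorem branch_neg (k w₀ w : ℂ) : branch (-k) w₀ w = (branch k w₀ w)⁻¹ := by
  rw [branch, branch, neg_mul, Complex.exp_neg]

theorem branch_pow {r : ℕ} (hr : 0 < r) {w₀ w : ℂ} (h : w / w₀ ≠ 0) :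
    branch (1 / r) w₀ w ^ r = w / w₀ := by
  have hr' : (r : ℂ) ≠ 0 := by exact_mod_cast hr.ne'
  rw [branch, ← Complex.exp_nat_mul, ← mul_assoc, mul_one_div_cancel hr', one_mul,
    Complex.exp_log h]

theorem hasDerivAt_branch (k : ℂ) {w₀ w : ℂ} (h : w / w₀ ∈ Complex.slitPlane) :
    HasDerivAt (branch k w₀) (k / w * branch k w₀ w) w := by
  have h0 : w / w₀ ≠ 0 := Complex.slitPlane_ne_zero h
  have hw : w ≠ 0 := fun h1 => h0 (by rw [h1, zero_div])
  have hw₀ : w₀ ≠ 0 := fun h1 => h0 (by rw [h1, div_zero])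
  have h1 : HasDerivAt (fun w => w / w₀) (1 / w₀) w := (hasDerivAt_id w).div_const w₀
  have h2 : HasDerivAt (branch k w₀) _ w := ((h1.clog h).const_mul k).cexp
  refine h2.congr_deriv ?_
  change branch k w₀ w * _ = _
  field_simp

/-! ### Derivatives of functions on the surface -/

section Calculus

variable {M : Type*} [TopologicalSpace M] [ChartedSpace ℂ M] [IsManifold 𝓘(ℂ, ℂ) ω M]

theorem mfd_comp_hasDerivAt {g : M → ℂ} {x : M} {h : ℂ → ℂ} {h' : ℂ}
    (hg : MDifferentiableAt 𝓘(ℝ, ℂ) 𝓘(ℝ, ℂ) g x) (hh : HasDerivAt h h' (g x)) :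
    MDifferentiableAt 𝓘(ℝ, ℂ) 𝓘(ℝ, ℂ) (fun y => h (g y)) x ∧
      ∀ v, mfd (fun y => h (g y)) x v = mfd g x v * h' := by
  have h1 : HasFDerivAt h ((ContinuousLinearMap.toSpanSingleton ℂ h').restrictScalars ℝ) (g x) :=
    hh.hasFDerivAt.restrictScalars ℝ
  have h2 := h1.hasMFDerivAt.comp x hg.hasMFDerivAt
  exact ⟨h2.mdifferentiableAt, fun v => congrArg (fun T : ℂ →L[ℝ] ℂ => T v) h2.mfderiv⟩

theorem mfd_mul {f g : M → ℂ} {x : M} (hf : MDifferentiableAt 𝓘(ℝ, ℂ) 𝓘(ℝ, ℂ) f x)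
    (hg : MDifferentiableAt 𝓘(ℝ, ℂ) 𝓘(ℝ, ℂ) g x) (v : ℂ) :
    mfd (fun y => f y * g y) x v = f x * mfd g x v + g x * mfd f x v := by
  have h := hf.hasMFDerivAt.mul hg.hasMFDerivAt
  exact congrArg (fun T : ℂ →L[ℝ] ℂ => T v) h.mfderiv

/-- Functions with vanishing derivative are constant on small neighbourhoods. -/
theorem exists_nhds_const {x : M} {N₀ : Set M} (hN₀ : N₀ ∈ 𝓝 x) :
    ∃ N, IsOpen N ∧ x ∈ N ∧ N ⊆ N₀ ∧ ∀ g : M → ℂ,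
      (∀ y ∈ N, MDifferentiableAt 𝓘(ℝ, ℂ) 𝓘(ℝ, ℂ) g y ∧ ∀ v, mfd g y v = 0) →
        ∀ y ∈ N, g y = g x := by
  set c := chartAt ℂ x
  have hxs : x ∈ c.source := mem_chart_source ℂ x
  have h1 : c.target ∩ c.symm ⁻¹' N₀ ∈ 𝓝 (c x) := by
    refine Filter.inter_mem (c.open_target.mem_nhds (c.map_source hxs)) ?_
    refine (c.continuousAt_symm (c.map_source hxs)).preimage_mem_nhds ?_
    rwa [c.left_inv hxs]
  obtain ⟨ε, hε, hb⟩ := Metric.mem_nhds_iff.1 h1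
  refine ⟨c.source ∩ c ⁻¹' Metric.ball (c x) ε, c.isOpen_inter_preimage Metric.isOpen_ball,
    ⟨hxs, Metric.mem_ball_self hε⟩, fun y hy => ?_, fun g hg y hy => ?_⟩
  · have := (hb hy.2).2
    rwa [mem_preimage, c.left_inv hy.1] at this
  · have hd : ∀ z ∈ Metric.ball (c x) ε, HasFDerivAt (fun z => g (c.symm z)) (0 : ℂ →L[ℝ] ℂ) z := by
      intro z hz
      have hz' := hb hz
      have hm : c.symm z ∈ c.source ∩ c ⁻¹' Metric.ball (c x) ε := by
        refine ⟨c.map_target hz'.1, ?_⟩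
        rwa [mem_preimage, c.right_inv hz'.1]
      refine (hasFDerivAt_mfd x hz'.1 (hg _ hm).1).congr_fderiv ?_
      ext1 a
      exact (hg _ hm).2 _
    have h2 := Metric.isOpen_ball.is_const_of_fderiv_eq_zero (𝕜 := ℝ)
      (convex_ball (c x) ε).isPreconnected
      (fun y hy => (hd y hy).differentiableAt.differentiableWithinAt)
      (fun y hy => (hd y hy).fderiv) hy.2 (Metric.mem_ball_self hε)
    simpa only [c.left_inv hy.1, c.left_inv hxs] using h2

end Calculus

/-! ### Comparison and averaging of flat pairs -/

section Uniqueness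

variable {M : Type*} [TopologicalSpace M] [ChartedSpace ℂ M] [IsManifold 𝓘(ℂ, ℂ) ω M]
  {r : ℕ} {E : M → Type*} [TopologicalSpace (TotalSpace (Cn r) E)]
  [∀ x, NormedAddCommGroup (E x)] [∀ x, InnerProductSpace ℂ (E x)]
  [FiberBundle (Cn r) E] [VectorBundle ℂ (Cn r) E] [VectorBundle ℝ (Cn r) E]
  [ContMDiffVectorBundle ∞ (Cn r) E 𝓘(ℝ, ℂ)] [IsSmoothHermitian r E]
  {L : M → Type*} [TopologicalSpace (TotalSpace (Cn 1) L)]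
  [∀ x, NormedAddCommGroup (L x)] [∀ x, InnerProductSpace ℂ (L x)]
  [FiberBundle (Cn 1) L] [VectorBundle ℂ (Cn 1) L] [VectorBundle ℝ (Cn 1) L]
  [ContMDiffVectorBundle ∞ (Cn 1) L 𝓘(ℝ, ℂ)] [IsSmoothHermitian 1 L]

theorem norm_inner_eq_one {x : M} {s t : L x} (hs : ‖s‖ = 1) (ht : ‖t‖ = 1) :
    ‖(inner ℂ s t : ℂ)‖ = 1 := by
  have h := congrArg norm (eq_inner_smul_of_norm_eq_one hs t)
  rw [norm_smul, hs, ht, mul_one] at h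
  exact h.symm

theorem inner_ne_zero_of_norm_eq_one {x : M} {s t : L x} (hs : ‖s‖ = 1) (ht : ‖t‖ = 1) :
    (inner ℂ s t : ℂ) ≠ 0 := by
  intro h
  have := norm_inner_eq_one hs ht
  rw [h, norm_zero] at this
  exact zero_ne_one this

variable {A : MetricConnection r E} {B B₁ B₂ : MetricConnection 1 L} {O O₁ O₂ : Set M}

theorem FlatPair.conj_form (P : FlatPair A B O) (hO : IsOpen O) {y : M} (hy : y ∈ O) (v : ℂ) :
    conj (B.form P.s y v) = -B.form P.s y v := by
  refine B.conj_form (P.diff_s y hy) ?_ v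
  filter_upwards [hO.mem_nhds hy] with y' hy' using P.norm_s y' hy'

/-- Matrix entries between the frames all have the same logarithmic derivative. The two connections
on `L` may differ; this is needed for averaging. -/
theorem FlatPair.mfd_inner_frames (P₁ : FlatPair A B₁ O₁) (P₂ : FlatPair A B₂ O₂) (hO₁ : IsOpen O₁)
    {y : M} (hy₁ : y ∈ O₁) (hy₂ : y ∈ O₂) (u w : Cn r) (v : ℂ) :
    mfd (fun y => (inner ℂ (P₁.f y u) (P₂.f y w) : ℂ)) y v =
      ((B₂.form P₂.s y v - B₁.form P₁.s y v) / r) * inner ℂ (P₁.f y u) (P₂.f y w) := by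
  rw [A.mfd_inner (P₁.diff_f y hy₁ u) (P₂.diff_f y hy₂ w), P₁.cov_f y hy₁, P₂.cov_f y hy₂,
    inner_smul_left, inner_smul_right, map_div₀, P₁.conj_form hO₁ hy₁, Complex.conj_natCast]
  ring

/-- The transition function between two unit sections has the difference of the connection forms as
its logarithmic derivative. -/
theorem mfd_inner_sections {s t : ∀ x, L x} {y : M} (hs : DiffAt (r := 1) s y)
    (ht : DiffAt (r := 1) t y) (hsn : ∀ᶠ x in 𝓝 y, ‖s x‖ = 1) (htn : ‖t y‖ = 1) (v : ℂ) :
    mfd (fun y => (inner ℂ (s y) (t y) : ℂ)) y v =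
      (B.form t y v - B.form s y v) * inner ℂ (s y) (t y) := by
  rw [B.mfd_inner hs ht, B.D_eq_form_smul hsn.self_of_nhds, B.D_eq_form_smul htn,
    inner_smul_left, inner_smul_right, B.conj_form hs hsn]
  ring

/-- Two flat pairs for the same connections differ locally by a constant and by the branch of an
`r`-th root. -/
theorem FlatPair.eventually_eq (hr : 0 < r) (P₁ : FlatPair A B O₁) (P₂ : FlatPair A B O₂)
    (hO₁ : IsOpen O₁) (hO₂ : IsOpen O₂) {x : M} (hx₁ : x ∈ O₁) (hx₂ : x ∈ O₂) :
    ∀ᶠ y in 𝓝 x, ∀ u, P₂.f y u =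
      branch (1 / r) (inner ℂ (P₁.s x) (P₂.s x)) (inner ℂ (P₁.s y) (P₂.s y)) •
        P₁.f y ((P₁.f x).symm (P₂.f x u)) := by
  set g : M → ℂ := fun y => inner ℂ (P₁.s y) (P₂.s y) with hg
  have hr' : (r : ℂ) ≠ 0 := by exact_mod_cast hr.ne'
  have hgd : ∀ y ∈ O₁ ∩ O₂, MDifferentiableAt 𝓘(ℝ, ℂ) 𝓘(ℝ, ℂ) g y := fun y hy =>
    mdifferentiableAt_inner (P₁.diff_s y hy.1) (P₂.diff_s y hy.2)
  have hg0 : g x ≠ 0 := inner_ne_zero_of_norm_eq_one (P₁.norm_s x hx₁) (P₂.norm_s x hx₂)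
  have hN₀ : O₁ ∩ O₂ ∩ {y | g y / g x ∈ Complex.slitPlane} ∈ 𝓝 x := by
    refine Filter.inter_mem ((hO₁.inter hO₂).mem_nhds ⟨hx₁, hx₂⟩) ?_
    refine ((hgd x ⟨hx₁, hx₂⟩).continuousAt.div_const (g x)).preimage_mem_nhds
      (Complex.isOpen_slitPlane.mem_nhds ?_)
    rw [div_self hg0]
    exact Complex.one_mem_slitPlane
  obtain ⟨N, hNo, hxN, hNN, hconst⟩ := exists_nhds_const hN₀
  filter_upwards [hNo.mem_nhds hxN] with y hy u
  -- The logarithmic derivative of the matrix entry is `1/r` times that of `g`, so the branch of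
  -- `g^{-1/r}` compensates it and the product is locally constant.
  have key : ∀ w, branch (-(1 / r)) (g x) (g y) * inner ℂ (P₁.f y w) (P₂.f y u) =
      inner ℂ (P₁.f x w) (P₂.f x u) := by
    intro w
    have h := hconst (fun y => branch (-(1 / r)) (g x) (g y) * inner ℂ (P₁.f y w) (P₂.f y u))
      (fun y hy => ?_) y hy
    · simp only [branch_self _ hg0, one_mul] at h
      exact h
    · have hy' := hNN hy
      obtain ⟨h1, h2⟩ := mfd_comp_hasDerivAt (hgd y hy'.1) (hasDerivAt_branch (-(1 / r)) hy'.2)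
      have h3 : MDifferentiableAt 𝓘(ℝ, ℂ) 𝓘(ℝ, ℂ)
          (fun y => (inner ℂ (P₁.f y w) (P₂.f y u) : ℂ)) y :=
        mdifferentiableAt_inner (P₁.diff_f y hy'.1.1 w) (P₂.diff_f y hy'.1.2 u)
      refine ⟨mdifferentiableAt_mul h1 h3, fun v => ?_⟩
      have hg1 : g y ≠ 0 := fun h0 => Complex.slitPlane_ne_zero hy'.2 (by rw [h0, zero_div])
      rw [mfd_mul h1 h3, h2, P₁.mfd_inner_frames P₂ hO₁ hy'.1.1 hy'.1.2,
        mfd_inner_sections (B := B) (P₁.diff_s y hy'.1.1) (P₂.diff_s y hy'.1.2)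
        (by filter_upwards [hO₁.mem_nhds hy'.1.1] with y' hy' using P₁.norm_s y' hy')
        (P₂.norm_s y hy'.1.2)]
      change _ + _ * (_ * g y * _) = _
      field_simp
      ring
  have key2 : branch (-(1 / r)) (g x) (g y) • P₂.f y u =
      P₁.f y ((P₁.f x).symm (P₂.f x u)) := by
    refine ext_inner_left ℂ fun p => ?_
    obtain ⟨w, rfl⟩ := (P₁.f y).surjective p
    rw [inner_smul_right, key, LinearIsometryEquiv.inner_map_map]
    conv_lhs => rw [← (P₁.f x).apply_symm_apply (P₂.f x u)]
    rw [LinearIsometryEquiv.inner_map_map]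
  rw [← key2, branch_neg, smul_smul, mul_inv_cancel₀ (branch_ne_zero _ _ _), one_smul]

/-- Flat pairs for the average of two connections. -/
theorem FlatPair.exists_average (hr : 0 < r) (P₁ : FlatPair A B₁ O₁) (P₂ : FlatPair A B₂ O₂)
    (hO₁ : IsOpen O₁) (hO₂ : IsOpen O₂) {x : M} (hx₁ : x ∈ O₁) (hx₂ : x ∈ O₂) :
    ∃ O, IsOpen O ∧ x ∈ O ∧ O ⊆ O₁ ∧ ∃ P : FlatPair A (B₁.average B₂) O,
      ∀ y ∈ O, ∀ v, (B₁.average B₂).form P.s y v = B₁.form P₁.s y v := by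
  set g : M → ℂ := fun y => inner ℂ (P₁.s y) (P₂.s y) with hg
  have hr' : (r : ℂ) ≠ 0 := by exact_mod_cast hr.ne'
  have hgd : ∀ y ∈ O₁ ∩ O₂, MDifferentiableAt 𝓘(ℝ, ℂ) 𝓘(ℝ, ℂ) g y := fun y hy =>
    mdifferentiableAt_inner (P₁.diff_s y hy.1) (P₂.diff_s y hy.2)
  have hg0 : g x ≠ 0 := inner_ne_zero_of_norm_eq_one (P₁.norm_s x hx₁) (P₂.norm_s x hx₂)
  set u : Cn r := EuclideanSpace.single ⟨0, hr⟩ 1 with hu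
  -- This choice makes `m x = 1`, so that branches of powers of `m` are defined near `x`.
  set w : Cn r := (P₁.f x).symm (P₂.f x u) with hw
  set m : M → ℂ := fun y => inner ℂ (P₁.f y w) (P₂.f y u) with hm
  have hmd : ∀ y ∈ O₁ ∩ O₂, MDifferentiableAt 𝓘(ℝ, ℂ) 𝓘(ℝ, ℂ) m y := fun y hy =>
    mdifferentiableAt_inner (P₁.diff_f y hy.1 w) (P₂.diff_f y hy.2 u)
  have hmx : m x = 1 := by
    rw [hm]
    simp only [hw, LinearIsometryEquiv.apply_symm_apply, LinearIsometryEquiv.inner_map_map]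
    simp [hu]
  have hm0 : m x ≠ 0 := by rw [hmx]; exact one_ne_zero
  have hN₀ : O₁ ∩ O₂ ∩ ({y | g y / g x ∈ Complex.slitPlane} ∩
      {y | m y / m x ∈ Complex.slitPlane}) ∈ 𝓝 x := by
    refine Filter.inter_mem ((hO₁.inter hO₂).mem_nhds ⟨hx₁, hx₂⟩) (Filter.inter_mem ?_ ?_)
    · refine ((hgd x ⟨hx₁, hx₂⟩).continuousAt.div_const (g x)).preimage_mem_nhds
        (Complex.isOpen_slitPlane.mem_nhds ?_)
      rw [div_self hg0]
      exact Complex.one_mem_slitPlane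
    · refine ((hmd x ⟨hx₁, hx₂⟩).continuousAt.div_const (m x)).preimage_mem_nhds
        (Complex.isOpen_slitPlane.mem_nhds ?_)
      rw [div_self hm0]
      exact Complex.one_mem_slitPlane
  obtain ⟨N, hNo, hxN, hNN, hconst⟩ := exists_nhds_const hN₀
  -- Write `θᵢ(s)` for the form of `Bᵢ` in `s`. The frame is kept, so `k s₁` must have average form
  -- `θ₁(s₁)`, i.e. `dk/k = (θ₁(s₁) - θ₂(s₁))/2`. As `dg/g = θ₂(s₂) - θ₂(s₁)` and `dm/m = (θ₂(s₂) -
  -- θ₁(s₁))/r`, the function `g^{1/2} m^{-r/2}` works.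
  set k : M → ℂ := fun y => branch (1 / 2) (g x) (g y) * branch (-(r / 2)) (m x) (m y) with hk
  have hkx : k x = 1 := by
    rw [hk]
    simp only [branch_self _ hg0, branch_self _ hm0, mul_one]
  have hns : ∀ y ∈ N, ∀ᶠ y' in 𝓝 y, ‖P₁.s y'‖ = 1 := by
    intro y hy
    filter_upwards [hO₁.mem_nhds (hNN hy).1.1] with y' hy' using P₁.norm_s y' hy'
  have hkd : ∀ y ∈ N, MDifferentiableAt 𝓘(ℝ, ℂ) 𝓘(ℝ, ℂ) k y ∧ ∀ v, mfd k y v =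
      (2⁻¹ * (B₁.form P₁.s y v - B₂.form P₁.s y v)) * k y := by
    intro y hy
    have hy' := hNN hy
    obtain ⟨h1, h2⟩ := mfd_comp_hasDerivAt (hgd y hy'.1) (hasDerivAt_branch (1 / 2) hy'.2.1)
    obtain ⟨h3, h4⟩ := mfd_comp_hasDerivAt (hmd y hy'.1) (hasDerivAt_branch (-(r / 2)) hy'.2.2)
    refine ⟨mdifferentiableAt_mul h1 h3, fun v => ?_⟩
    have hg1 : g y ≠ 0 := fun h0 => Complex.slitPlane_ne_zero hy'.2.1 (by rw [h0, zero_div])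
    have hm1 : m y ≠ 0 := fun h0 => Complex.slitPlane_ne_zero hy'.2.2 (by rw [h0, zero_div])
    rw [hk, mfd_mul h1 h3, h2, h4, P₁.mfd_inner_frames P₂ hO₁ hy'.1.1 hy'.1.2,
      mfd_inner_sections (B := B₂) (P₁.diff_s y hy'.1.1) (P₂.diff_s y hy'.1.2) (hns y hy)
        (P₂.norm_s y hy'.1.2)]
    change _ * (_ * m y * _) + _ * (_ * g y * _) = _
    field_simp
    ring
  set s : ∀ y, L y := fun y => k y • P₁.s y with hs
  have hsd : ∀ y ∈ N, DiffAt (r := 1) s y := fun y hy =>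
    DiffAt.smul (hkd y hy).1 (P₁.diff_s y (hNN hy).1.1)
  have hsD : ∀ y ∈ N, ∀ v, (B₁.average B₂).D s y v = B₁.form P₁.s y v • s y := by
    intro y hy v
    have hd := P₁.diff_s y (hNN hy).1.1
    refine ((B₁.average B₂).D_smul (hkd y hy).1 hd v).trans ?_
    rw [MetricConnection.average_D, B₁.D_eq_form_smul (hns y hy).self_of_nhds,
      B₂.D_eq_form_smul (hns y hy).self_of_nhds, (hkd y hy).2, hs, ← add_smul,
      show ∀ (a : ℂ) (p : L y), (2⁻¹ : ℝ) • (a • p) = ((2⁻¹ : ℂ) * a) • p from fun a p => by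
        rw [mul_smul, show (2⁻¹ : ℂ) = ((2⁻¹ : ℝ) : ℂ) by push_cast; rfl]
        rfl, smul_smul, smul_smul, ← add_smul]
    congr 1
    ring
  -- The norm is constant because the connection form is imaginary, and it is `1` at `x`, where `k =
  -- 1`.
  have hsn : ∀ y ∈ N, ‖s y‖ = 1 := by
    intro y hy
    have h := hconst (fun y => inner ℂ (s y) (s y)) (fun y hy => ?_) y hy
    · have h2 : ‖s x‖ = 1 := by
        rw [hs]
        simp only [hkx, one_smul]
        exact P₁.norm_s x hx₁
      rw [inner_self_eq_norm_sq_to_K, inner_self_eq_norm_sq_to_K, h2] at h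
      have h3 : ‖s y‖ ^ 2 = 1 := by
        have h4 : ((‖s y‖ ^ 2 : ℝ) : ℂ) = ((1 : ℝ) : ℂ) := by
          push_cast
          refine h.trans ?_
          simp
        exact_mod_cast h4
      nlinarith [norm_nonneg (s y)]
    · refine ⟨mdifferentiableAt_inner (hsd y hy) (hsd y hy), fun v => ?_⟩
      rw [(B₁.average B₂).mfd_inner (hsd y hy) (hsd y hy), hsD y hy]
      generalize s y = p
      rw [inner_smul_left, inner_smul_right, P₁.conj_form hO₁ (hNN hy).1.1]
      ring
  have hform : ∀ y ∈ N, ∀ v, (B₁.average B₂).form s y v = B₁.form P₁.s y v := fun y hy v =>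
    (B₁.average B₂).form_eq (hsn y hy) (hsD y hy v)
  exact ⟨N, hNo, hxN, fun y hy => (hNN hy).1.1,
    ⟨P₁.f, s, hsn, fun y hy u => P₁.diff_f y (hNN hy).1.1 u, hsd, fun y hy u v => by
      rw [P₁.cov_f y (hNN hy).1.1, hform y hy]⟩, hform⟩

end Uniqueness

/-- A function which is continuous at a point, and whose `r`-th power is constant near this point,
is constant near this point. -/
theorem eventually_eq_of_pow_eq {K : Type*} [TopologicalSpace K] {f : K → ℂ} {k₀ : K} {r : ℕ}
    (hr : 0 < r) {b : ℂ} (hf : ContinuousAt f k₀) (hb : ∀ᶠ k in 𝓝 k₀, f k ^ r = b) :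
    ∀ᶠ k in 𝓝 k₀, f k = f k₀ := by
  have hfin : {w : ℂ | w ^ r = b}.Finite := by
    have h : {w : ℂ | w ^ r = b} ⊆ ((Polynomial.nthRoots r b).toFinset : Set ℂ) := by
      intro w hw
      simp only [Finset.mem_coe, Multiset.mem_toFinset]
      exact (Polynomial.mem_nthRoots hr).2 hw
    exact (Finset.finite_toSet _).subset h
  -- There are finitely many `r`-th roots, so the roots other than `f k₀` are bounded away from it.
  have hcl : IsClosed ({w : ℂ | w ^ r = b} \ {f k₀}) := (hfin.subset sdiff_subset).isClosed
  have h1 : ∀ᶠ k in 𝓝 k₀, f k ∈ ({w : ℂ | w ^ r = b} \ {f k₀})ᶜ :=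
    hf (hcl.isOpen_compl.mem_nhds fun h => h.2 rfl)
  filter_upwards [h1, hb] with k h2 h3
  by_contra h4
  exact h2 ⟨h3, h4⟩

/-! ### Flat sections over `S(L)` and the associated covering -/

section Flat

variable {M : Type*} [TopologicalSpace M] [ChartedSpace ℂ M] [IsManifold 𝓘(ℂ, ℂ) ω M]
  {r : ℕ} {E : M → Type*} [TopologicalSpace (TotalSpace (Cn r) E)]
  [∀ x, NormedAddCommGroup (E x)] [∀ x, InnerProductSpace ℂ (E x)]
  [FiberBundle (Cn r) E] [VectorBundle ℂ (Cn r) E] [VectorBundle ℝ (Cn r) E]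
  [ContMDiffVectorBundle ∞ (Cn r) E 𝓘(ℝ, ℂ)] [IsSmoothHermitian r E]
  {L : M → Type*} [TopologicalSpace (TotalSpace (Cn 1) L)]
  [∀ x, NormedAddCommGroup (L x)] [∀ x, InnerProductSpace ℂ (L x)]
  [FiberBundle (Cn 1) L] [VectorBundle ℂ (Cn 1) L] [VectorBundle ℝ (Cn 1) L]
  [ContMDiffVectorBundle ∞ (Cn 1) L 𝓘(ℝ, ℂ)] [IsSmoothHermitian 1 L]

/-- The Hermitian product of a differentiable section with a varying vector is continuous. -/
theorem continuousAt_inner_section {s : ∀ x, L x} {y : TotalSpace (Cn 1) L}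
    (hs : DiffAt (r := 1) s y.1) :
    ContinuousAt (fun y : TotalSpace (Cn 1) L => (inner ℂ (s y.1) y.2 : ℂ)) y := by
  set e := trivializationAt (Cn 1) L y.1
  have hx : y.1 ∈ e.baseSet := FiberBundle.mem_baseSet_trivializationAt' y.1
  have hq : ContinuousAt (fun y : TotalSpace (Cn 1) L => y.1) y :=
    (FiberBundle.continuous_proj (Cn 1) L).continuousAt
  have h : (fun y : TotalSpace (Cn 1) L => (inner ℂ (s y.1) y.2 : ℂ)) =ᶠ[𝓝 y] fun y =>
      ∑ i, (e y).2 i * inner ℂ (s y.1) (e.symm y.1 (EuclideanSpace.single i 1)) := by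
    filter_upwards [hq (e.open_baseSet.mem_nhds hx)] with y' hy'
    rw [eq_sum_coord e hy' y'.2, inner_sum]
    refine Finset.sum_congr rfl fun i _ => ?_
    rw [inner_smul_right]
    rfl
  refine ContinuousAt.congr ?_ h.symm
  have he : ContinuousAt (fun y => (e y).2) y :=
    (e.continuousAt (e.mem_source.2 hx)).snd
  refine tendsto_finsetSum _ fun i _ => ContinuousAt.mul ?_ ?_
  · exact ((EuclideanSpace.proj i : Cn 1 →L[ℂ] ℂ).continuous.continuousAt).comp he
  · exact ContinuousAt.comp (f := fun y : TotalSpace (Cn 1) L => y.1)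
      (g := fun x => (inner ℂ (s x) (e.symm x (EuclideanSpace.single i 1)) : ℂ))
      (mdifferentiableAt_inner hs (diffAt_symm_const e hx _)).continuousAt hq

theorem continuous_seifert_proj : Continuous fun y : Seifert L => y.1.1 :=
  (FiberBundle.continuous_proj (Cn 1) L).comp continuous_subtype_val

theorem continuousAt_inner_seifert {s : ∀ x, L x} {y : Seifert L} (hs : DiffAt (r := 1) s y.1.1) :
    ContinuousAt (fun y : Seifert L => (inner ℂ (s y.1.1) y.1.2 : ℂ)) y :=
  ContinuousAt.comp (f := fun y : Seifert L => y.1) (continuousAt_inner_section hs)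
    continuous_subtype_val.continuousAt

variable (A : MetricConnection r E) (B : MetricConnection 1 L)

/-- The section `V` of the pull-back of `E` under `q ∘ h` is flat at `k₀`, for the flat connection
`q^* A ⊗ (q^* B)^{-1/r}` on `S(L)`. -/
def IsFlatAt {K : Type*} [TopologicalSpace K] (h : K → Seifert L) (V : ∀ k, E (h k).1.1)
    (k₀ : K) : Prop :=
  ∃ O : Set M, IsOpen O ∧ (h k₀).1.1 ∈ O ∧ ∃ (P : FlatPair A B O) (ε : K → ℂ) (a : ℂ) (u : Cn r),
    a ≠ 0 ∧ ContinuousAt ε k₀ ∧ ∀ᶠ k in 𝓝 k₀,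
      ε k ^ r = a * inner ℂ (P.s (h k).1.1) (h k).1.2 ∧ V k = ε k • P.f (h k).1.1 u

variable {A B} {K : Type*} [TopologicalSpace K]

/-- The scalar relating the two local frames is a continuous function whose `r`-th power is
constant, hence it is locally constant. Changing the flat pair therefore only changes the constant
vector. -/
theorem FlatPair.exists_smul_eq (hr : 0 < r) {O O' : Set M} (hO : IsOpen O) (hO' : IsOpen O')
    (P : FlatPair A B O) (P' : FlatPair A B O') {h : K → Seifert L} {k₀ : K}
    (hh : ContinuousAt h k₀) (hk : (h k₀).1.1 ∈ O) (hk' : (h k₀).1.1 ∈ O') {ε ε' : K → ℂ}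
    {a a' : ℂ} (ha : a ≠ 0) (hε : ContinuousAt ε k₀) (hε' : ContinuousAt ε' k₀)
    (hp : ∀ᶠ k in 𝓝 k₀, ε k ^ r = a * inner ℂ (P.s (h k).1.1) (h k).1.2)
    (hp' : ∀ᶠ k in 𝓝 k₀, ε' k ^ r = a' * inner ℂ (P'.s (h k).1.1) (h k).1.2) (u' : Cn r) :
    ∃ u, ∀ᶠ k in 𝓝 k₀, ε' k • P'.f (h k).1.1 u' = ε k • P.f (h k).1.1 u := by
  have hq : ContinuousAt (fun k => (h k).1.1) k₀ := continuous_seifert_proj.continuousAt.comp hh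
  set g : M → ℂ := fun y => inner ℂ (P.s y) (P'.s y) with hg
  have hg0 : g (h k₀).1.1 ≠ 0 := inner_ne_zero_of_norm_eq_one (P.norm_s _ hk) (P'.norm_s _ hk')
  have hgc : ContinuousAt g (h k₀).1.1 :=
    (mdifferentiableAt_inner (P.diff_s _ hk) (P'.diff_s _ hk')).continuousAt
  have hε0 : ∀ᶠ k in 𝓝 k₀, ε k ≠ 0 := by
    filter_upwards [hp, hq (hO.mem_nhds hk)] with k h1 h2 h3
    rw [h3, zero_pow hr.ne'] at h1
    exact mul_ne_zero ha (inner_ne_zero_of_norm_eq_one (P.norm_s _ h2) (h k).2) h1.symm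
  set br : K → ℂ := fun k => branch (1 / r) (g (h k₀).1.1) (g (h k).1.1) with hbr
  have hbrc : ContinuousAt br k₀ := by
    have h1 : ContinuousAt (branch (1 / r) (g (h k₀).1.1)) (g (h k₀).1.1) :=
      (hasDerivAt_branch _ (by rw [div_self hg0]; exact Complex.one_mem_slitPlane)).continuousAt
    exact ContinuousAt.comp (f := fun k => g (h k).1.1) h1
      (ContinuousAt.comp (f := fun k => (h k).1.1) hgc hq)
  -- By `branch_pow` and `⟨s, y⟩ = ⟨s', y⟩ ⟨s, s'⟩`, all dependence on `k` cancels in the `r`-th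
  -- power.
  have hμ : ∀ᶠ k in 𝓝 k₀, (ε' k * br k / ε k) ^ r = a' / (a * g (h k₀).1.1) := by
    filter_upwards [hp, hp', hε0, hq (hO.mem_nhds hk), hq (hO'.mem_nhds hk')]
      with k h1 h2 h3 h4 h5
    have hgk : g (h k).1.1 ≠ 0 := inner_ne_zero_of_norm_eq_one (P.norm_s _ h4) (P'.norm_s _ h5)
    have hin := inner_ne_zero_of_norm_eq_one (P'.norm_s _ h5) (h k).2
    have h6 : (inner ℂ (P.s (h k).1.1) (h k).1.2 : ℂ) =
        inner ℂ (P'.s (h k).1.1) (h k).1.2 * g (h k).1.1 := by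
      rw [hg]
      conv_lhs => rw [eq_inner_smul_of_norm_eq_one (P'.norm_s _ h5) (h k).1.2]
      rw [inner_smul_right]
    rw [div_pow, mul_pow, h1, h2, h6, hbr, branch_pow hr (div_ne_zero hgk hg0)]
    field_simp
  have hμc : ContinuousAt (fun k => ε' k * br k / ε k) k₀ :=
    (hε'.mul hbrc).div hε hε0.self_of_nhds
  refine ⟨(ε' k₀ * br k₀ / ε k₀) • (P.f (h k₀).1.1).symm (P'.f (h k₀).1.1 u'), ?_⟩
  filter_upwards [eventually_eq_of_pow_eq hr hμc hμ, hε0,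
    hq (P.eventually_eq hr P' hO hO' hk hk')] with k h1 h2 h3
  rw [h3 u', map_smul, ← h1, smul_smul, smul_smul]
  congr 1
  field_simp
  rfl

/-- Two flat sections are, near a given point, the images of constant vectors under the same
frame. -/
theorem IsFlatAt.exists_common (hr : 0 < r) {h : K → Seifert L} {V V' : ∀ k, E (h k).1.1} {k₀ : K}
    (hh : ContinuousAt h k₀) (hV : IsFlatAt A B h V k₀) (hV' : IsFlatAt A B h V' k₀) :
    ∃ O : Set M, IsOpen O ∧ (h k₀).1.1 ∈ O ∧ ∃ (P : FlatPair A B O) (ε : K → ℂ) (a : ℂ)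
      (u u' : Cn r), a ≠ 0 ∧ ContinuousAt ε k₀ ∧ ∀ᶠ k in 𝓝 k₀,
      ε k ≠ 0 ∧ ‖ε k‖ = ‖ε k₀‖ ∧
      ε k ^ r = a * inner ℂ (P.s (h k).1.1) (h k).1.2 ∧ V k = ε k • P.f (h k).1.1 u ∧
        V' k = ε k • P.f (h k).1.1 u' := by
  obtain ⟨O, hO, hk, P, ε, a, u, ha, hε, h1⟩ := hV
  obtain ⟨O', hO', hk', P', ε', a', u', ha', hε', h1'⟩ := hV'
  obtain ⟨w, hw⟩ := P.exists_smul_eq hr hO hO' P' hh hk hk' ha hε hε' (h1.mono fun k h => h.1)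
    (h1'.mono fun k h => h.1) u'
  have hn : ∀ᶠ k in 𝓝 k₀, ‖ε k‖ ^ r = ‖a‖ := by
    filter_upwards [h1, (continuous_seifert_proj.continuousAt.comp hh) (hO.mem_nhds hk)]
      with k h2 h3
    have h4 := norm_inner_eq_one (P.norm_s (h k).1.1 h3) (h k).2
    rw [← norm_pow, h2.1, norm_mul, h4, mul_one]
  refine ⟨O, hO, hk, P, ε, a, u, w, ha, hε, ?_⟩
  filter_upwards [h1, h1', hw, hn] with k h2 h3 h4 h5
  refine ⟨?_, ?_, h2.1, h2.2, h3.2.trans h4⟩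
  · intro h0
    rw [h0, norm_zero, zero_pow hr.ne'] at h5
    exact ha (norm_eq_zero.1 h5.symm)
  · exact (pow_left_inj₀ (norm_nonneg _) (norm_nonneg _) hr.ne').1
      (h5.trans hn.self_of_nhds.symm)

theorem IsFlatAt.add_smul (hr : 0 < r) {h : K → Seifert L} {V V' : ∀ k, E (h k).1.1} {k₀ : K}
    (hh : ContinuousAt h k₀) (hV : IsFlatAt A B h V k₀) (hV' : IsFlatAt A B h V' k₀) (b : ℂ) :
    IsFlatAt A B h (fun k => V k + b • V' k) k₀ := by
  obtain ⟨O, hO, hk, P, ε, a, u, u', ha, hε, h1⟩ := hV.exists_common hr hh hV'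
  refine ⟨O, hO, hk, P, ε, a, u + b • u', ha, hε, ?_⟩
  filter_upwards [h1] with k h2
  refine ⟨h2.2.2.1, ?_⟩
  rw [h2.2.2.2.1, h2.2.2.2.2, map_add, map_smul, smul_add, smul_comm b]

/-- In a common frame both sections are given by constant vectors, so whether they agree does not
depend on the nearby point. -/
theorem IsFlatAt.eventually_eq_iff (hr : 0 < r) {h : K → Seifert L} {V V' : ∀ k, E (h k).1.1}
    {k₀ : K} (hh : ContinuousAt h k₀) (hV : IsFlatAt A B h V k₀) (hV' : IsFlatAt A B h V' k₀) :
    ∀ᶠ k in 𝓝 k₀, (V k = V' k ↔ V k₀ = V' k₀) := by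
  obtain ⟨O, hO, hk, P, ε, a, u, u', ha, hε, h1⟩ := hV.exists_common hr hh hV'
  have h0 : ∀ᶠ k in 𝓝 k₀, (V k = V' k ↔ u = u') := by
    filter_upwards [h1] with k h2
    rw [h2.2.2.2.1, h2.2.2.2.2, (smul_right_injective _ h2.1).eq_iff,
      (P.f (h k).1.1).injective.eq_iff]
  filter_upwards [h0] with k hk
  exact hk.trans h0.self_of_nhds.symm

theorem IsFlatAt.eventually_norm_eq (hr : 0 < r) {h : K → Seifert L} {V : ∀ k, E (h k).1.1}
    {k₀ : K} (hh : ContinuousAt h k₀) (hV : IsFlatAt A B h V k₀) :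
    ∀ᶠ k in 𝓝 k₀, ‖V k‖ = ‖V k₀‖ := by
  obtain ⟨O, hO, hk, P, ε, a, u, u', ha, hε, h1⟩ := hV.exists_common hr hh hV
  have h0 : ∀ᶠ k in 𝓝 k₀, ‖V k‖ = ‖ε k₀‖ * ‖u‖ := by
    filter_upwards [h1] with k h2
    rw [h2.2.2.2.1, norm_smul, h2.2.1, LinearIsometryEquiv.norm_map]
  filter_upwards [h0] with k hk
  exact hk.trans h0.self_of_nhds.symm

/-- Agreement is a locally constant property. No derivative along `h` is taken, which matters since
`h` is only continuous. -/
theorem eq_of_isFlatAt [PreconnectedSpace K] (hr : 0 < r) {h : K → Seifert L}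
    {V V' : ∀ k, E (h k).1.1} (hh : Continuous h) (hV : ∀ k, IsFlatAt A B h V k)
    (hV' : ∀ k, IsFlatAt A B h V' k) {k₀ : K} (h0 : V k₀ = V' k₀) (k : K) : V k = V' k := by
  have hl : IsLocallyConstant fun k => V k = V' k := by
    rw [IsLocallyConstant.iff_eventually_eq]
    intro k₁
    filter_upwards [(hV k₁).eventually_eq_iff hr hh.continuousAt (hV' k₁)] with k hk
    exact propext hk
  exact (hl.apply_eq_of_preconnectedSpace k k₀).mpr h0

theorem norm_eq_of_isFlatAt [PreconnectedSpace K] (hr : 0 < r) {h : K → Seifert L}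
    {V : ∀ k, E (h k).1.1} (hh : Continuous h) (hV : ∀ k, IsFlatAt A B h V k) (k k' : K) :
    ‖V k‖ = ‖V k'‖ := by
  have hl : IsLocallyConstant fun k => ‖V k‖ := by
    rw [IsLocallyConstant.iff_eventually_eq]
    exact fun k₁ => (hV k₁).eventually_norm_eq hr hh.continuousAt
  exact hl.apply_eq_of_preconnectedSpace k k'

/-- Flatness is stable under pull-back. -/
theorem IsFlatAt.comp {K' : Type*} [TopologicalSpace K'] {h : K → Seifert L}
    {V : ∀ k, E (h k).1.1} {φ : K' → K} {k₀ : K'} (hφ : ContinuousAt φ k₀)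
    (hV : IsFlatAt A B h V (φ k₀)) : IsFlatAt A B (fun k => h (φ k)) (fun k => V (φ k)) k₀ := by
  obtain ⟨O, hO, hk, P, ε, a, u, ha, hε, h1⟩ := hV
  exact ⟨O, hO, hk, P, fun k => ε (φ k), a, u, ha, hε.comp hφ, hφ.eventually h1⟩

variable (A B)

/-- A family of flat pairs over open sets which cover `M`. -/
structure FlatAtlas where
  /-- the open sets -/
  O : M → Set M
  isOpen : ∀ x, IsOpen (O x)
  mem : ∀ x, x ∈ O x
  /-- the flat pairs -/
  P : ∀ x, FlatPair A B (O x)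

variable {A B} (D : FlatAtlas A B)

namespace FlatAtlas

/-- The coefficient of a point of `S(L)` in the local frame of `L`. -/
def coef (i y : Seifert L) : ℂ := inner ℂ ((D.P i.1.1).s y.1.1) y.1.2

/-- The scalar factor of the local flat frames over `S(L)`. -/
def root (i y : Seifert L) : ℂ := branch (1 / r) (D.coef i i) (D.coef i y)

/-- The domains of the local flat frames over `S(L)`. -/
def dom (i : Seifert L) : Set (Seifert L) :=
  {y | y.1.1 ∈ D.O i.1.1 ∧ D.coef i y / D.coef i i ∈ Complex.slitPlane}

theorem coef_self_ne_zero (i : Seifert L) : D.coef i i ≠ 0 :=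
  inner_ne_zero_of_norm_eq_one ((D.P i.1.1).norm_s _ (D.mem _)) i.2

theorem mem_dom (i : Seifert L) : i ∈ D.dom i :=
  ⟨D.mem _, by rw [div_self (D.coef_self_ne_zero i)]; exact Complex.one_mem_slitPlane⟩

theorem continuousAt_coef {i y : Seifert L} (hy : y.1.1 ∈ D.O i.1.1) :
    ContinuousAt (D.coef i) y := continuousAt_inner_seifert ((D.P i.1.1).diff_s _ hy)

theorem isOpen_dom (i : Seifert L) : IsOpen (D.dom i) := by
  rw [isOpen_iff_mem_nhds]
  intro y hy
  exact Filter.inter_mem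
    (continuous_seifert_proj.continuousAt ((D.isOpen i.1.1).mem_nhds hy.1))
    (((D.continuousAt_coef hy.1).div_const (D.coef i i))
      (Complex.isOpen_slitPlane.mem_nhds hy.2))

theorem continuousAt_root {i y : Seifert L} (hy : y ∈ D.dom i) : ContinuousAt (D.root i) y :=
  ContinuousAt.comp (g := branch (1 / r) (D.coef i i)) (hasDerivAt_branch _ hy.2).continuousAt
    (D.continuousAt_coef hy.1)

theorem root_ne_zero (i y : Seifert L) : D.root i y ≠ 0 := branch_ne_zero _ _ _

theorem root_pow (hr : 0 < r) {i y : Seifert L} (hy : y ∈ D.dom i) : D.root i y ^ r =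
    (D.coef i i)⁻¹ * inner ℂ ((D.P i.1.1).s y.1.1) y.1.2 := by
  rw [root, branch_pow hr (Complex.slitPlane_ne_zero hy.2), div_eq_inv_mul]
  rfl

/-- The local flat frames over `S(L)`. -/
def frame (i y : Seifert L) : Cn r ≃ₗ[ℂ] E y.1.1 :=
  (D.P i.1.1).f y.1.1 |>.toLinearEquiv.trans (LinearEquiv.smulOfNeZero ℂ _ _ (D.root_ne_zero i y))

theorem isFlatAt_frame (hr : 0 < r) {i y : Seifert L} (hy : y ∈ D.dom i) (u : Cn r) :
    IsFlatAt A B id (fun y => D.frame i y u) y := by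
  refine ⟨D.O i.1.1, D.isOpen _, hy.1, D.P i.1.1, D.root i, (D.coef i i)⁻¹, u,
    inv_ne_zero (D.coef_self_ne_zero i), D.continuousAt_root hy, ?_⟩
  filter_upwards [(D.isOpen_dom i).mem_nhds hy] with y' hy'
  exact ⟨D.root_pow hr hy', rfl⟩

/-- The coordinate changes between local flat frames are locally constant. -/
theorem exists_frame_eq (hr : 0 < r) {i j y : Seifert L} (hi : y ∈ D.dom i) (hj : y ∈ D.dom j)
    (u : Cn r) : ∃ u', ∀ᶠ y' in 𝓝 y, D.frame i y' u = D.frame j y' u' := by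
  refine (D.P j.1.1).exists_smul_eq hr (D.isOpen _) (D.isOpen _) (D.P i.1.1) (h := id)
    continuousAt_id hj.1 hi.1 (inv_ne_zero (D.coef_self_ne_zero j)) (D.continuousAt_root hj)
    (D.continuousAt_root hi) ?_ (a' := (D.coef i i)⁻¹) ?_ u
  · filter_upwards [(D.isOpen_dom j).mem_nhds hj] with y' hy' using D.root_pow hr hy'
  · filter_upwards [(D.isOpen_dom i).mem_nhds hi] with y' hy' using D.root_pow hr hy'

end FlatAtlas

/-- The vector space `ℂ^r` with the discrete topology. -/
def DiscreteCn (r : ℕ) : Type := Cn r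

instance : TopologicalSpace (DiscreteCn r) := ⊥

instance : DiscreteTopology (DiscreteCn r) := ⟨rfl⟩

namespace FlatAtlas

/-- The covering of `S(L)` whose sections are the flat sections of `E`. -/
def core (hr : 0 < r) : FiberBundleCore (Seifert L) (Seifert L) (DiscreteCn r) where
  baseSet := D.dom
  isOpen_baseSet := D.isOpen_dom
  indexAt := id
  mem_baseSet_at := D.mem_dom
  coordChange i j y u := (D.frame j y).symm (D.frame i y u)
  coordChange_self i y _ u := (D.frame i y).symm_apply_apply u
  continuousOn_coordChange i j := by
    rintro ⟨y, u⟩ ⟨⟨hi, hj⟩, -⟩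
    apply ContinuousAt.continuousWithinAt
    obtain ⟨u', hu'⟩ := D.exists_frame_eq hr hi hj u
    -- The second factor is discrete, so near `(y, u)` the vector is `u` itself and the transition
    -- map is constant by `exists_frame_eq`.
    have h1 : ∀ᶠ p : Seifert L × DiscreteCn r in 𝓝 (y, u),
        ((D.frame j p.1).symm (D.frame i p.1 p.2) : DiscreteCn r) = u' := by
      have h5 : ContinuousAt (Prod.snd : Seifert L × DiscreteCn r → DiscreteCn r) (y, u) :=
        continuousAt_snd
      have h2 : ∀ᶠ p : Seifert L × DiscreteCn r in 𝓝 (y, u), p.2 = u :=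
        h5 (IsOpen.mem_nhds (isOpen_discrete {u}) (mem_singleton u))
      filter_upwards [continuousAt_fst.eventually hu', h2] with p h3 h4
      rw [h4]
      exact (LinearEquiv.symm_apply_eq _).2 h3
    exact ContinuousAt.congr continuousAt_const (h1.mono fun p hp => hp.symm)
  coordChange_comp i j k y _ u := by
    change (D.frame k y).symm (D.frame j y ((D.frame j y).symm (D.frame i y u))) = _
    rw [LinearEquiv.apply_symm_apply]

/-- Continuous maps to the covering are flat sections. -/
theorem isFlatAt_of_continuous (hr : 0 < r) {Γ : K → (D.core hr).TotalSpace} (hΓ : Continuous Γ)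
    (k₀ : K) : IsFlatAt A B (fun k => (Γ k).1)
      (fun k => D.frame (Γ k).1 (Γ k).1 (Γ k).2) k₀ := by
  set i := (Γ k₀).1
  have hd : i ∈ D.dom i := D.mem_dom i
  have hq : Continuous fun k => (Γ k).1 := (FiberBundle.continuous_proj (DiscreteCn r) _).comp hΓ
  have hc : ContinuousAt (fun k => (((D.core hr).localTriv i) (Γ k)).2) k₀ := by
    have h1 : ContinuousAt ((D.core hr).localTriv i) (Γ k₀) :=
      ((D.core hr).localTriv i).continuousAt (((D.core hr).localTriv i).mem_source.2 hd)
    exact (ContinuousAt.comp (f := Γ) h1 hΓ.continuousAt).snd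
  set u : DiscreteCn r := (((D.core hr).localTriv i) (Γ k₀)).2
  have hu : ∀ᶠ k in 𝓝 k₀, (((D.core hr).localTriv i) (Γ k)).2 = u :=
    hc (IsOpen.mem_nhds (isOpen_discrete {u}) rfl)
  obtain ⟨O, hO, hk, P, ε, a, w, ha, hε, h1⟩ := (D.isFlatAt_frame hr hd u).comp
    (φ := fun k => (Γ k).1) hq.continuousAt
  refine ⟨O, hO, hk, P, ε, a, w, ha, hε, ?_⟩
  filter_upwards [h1, hu] with k h2 h3
  refine ⟨h2.1, ?_⟩
  refine Eq.trans ?_ h2.2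
  rw [← h3]
  exact ((D.frame i (Γ k).1).apply_symm_apply _).symm

theorem isCoveringMap (hr : 0 < r) : IsCoveringMap (D.core hr).proj :=
  FiberBundle.isCoveringMap (F := DiscreteCn r) (E := (D.core hr).Fiber)

end FlatAtlas

end Flat

/-! ### Transport along continuous paths -/

section Transport

variable {M : Type*} [TopologicalSpace M] [ChartedSpace ℂ M] [IsManifold 𝓘(ℂ, ℂ) ω M]
  {r : ℕ} {E : M → Type*} [TopologicalSpace (TotalSpace (Cn r) E)]
  [∀ x, NormedAddCommGroup (E x)] [∀ x, InnerProductSpace ℂ (E x)]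
  [FiberBundle (Cn r) E] [VectorBundle ℂ (Cn r) E] [VectorBundle ℝ (Cn r) E]
  [ContMDiffVectorBundle ∞ (Cn r) E 𝓘(ℝ, ℂ)] [IsSmoothHermitian r E]
  {L : M → Type*} [TopologicalSpace (TotalSpace (Cn 1) L)]
  [∀ x, NormedAddCommGroup (L x)] [∀ x, InnerProductSpace ℂ (L x)]
  [FiberBundle (Cn 1) L] [VectorBundle ℂ (Cn 1) L] [VectorBundle ℝ (Cn 1) L]
  [ContMDiffVectorBundle ∞ (Cn 1) L 𝓘(ℝ, ℂ)] [IsSmoothHermitian 1 L]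

/-- The parallel transport along the curve `h` in `S(L)`, for the flat connection
`q^* A ⊗ (q^* B)^{-1/r}`, maps `a` to `b`. -/
def Transports (A : MetricConnection r E) (B : MetricConnection 1 L)
    (h : unitInterval → Seifert L) (a b : TotalSpace (Cn r) E) : Prop :=
  ∃ V : ∀ t, E (h t).1.1, (∀ t, IsFlatAt A B h V t) ∧
    TotalSpace.mk' (Cn r) (h 0).1.1 (V 0) = a ∧ TotalSpace.mk' (Cn r) (h 1).1.1 (V 1) = b

variable {A A' : MetricConnection r E} {B : MetricConnection 1 L}

theorem Transports.unique (hr : 0 < r) {h : unitInterval → Seifert L} (hh : Continuous h)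
    {a b b' : TotalSpace (Cn r) E} (h1 : Transports A B h a b) (h2 : Transports A B h a b') :
    b = b' := by
  obtain ⟨V, hV, h0, rfl⟩ := h1
  obtain ⟨V', hV', h0', rfl⟩ := h2
  rw [eq_of_isFlatAt hr hh hV hV' (totalSpace_mk_inj r (h0.trans h0'.symm)) 1]

theorem Transports.add_smul (hr : 0 < r) {h : unitInterval → Seifert L} (hh : Continuous h)
    {x y : M} {v v' : E x} {w w' : E y}
    (h1 : Transports A B h (TotalSpace.mk' (Cn r) x v) (TotalSpace.mk' (Cn r) y w))
    (h2 : Transports A B h (TotalSpace.mk' (Cn r) x v') (TotalSpace.mk' (Cn r) y w')) (b : ℂ) :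
    Transports A B h (TotalSpace.mk' (Cn r) x (v + b • v'))
      (TotalSpace.mk' (Cn r) y (w + b • w')) := by
  obtain ⟨V, hV, h0, h1⟩ := h1
  obtain ⟨V', hV', h0', h1'⟩ := h2
  obtain rfl : (h 0).1.1 = x := congrArg TotalSpace.proj h0
  obtain rfl : (h 1).1.1 = y := congrArg TotalSpace.proj h1
  refine ⟨fun t => V t + b • V' t, fun t => (hV t).add_smul hr hh.continuousAt (hV' t) b, ?_, ?_⟩
  · beta_reduce
    rw [totalSpace_mk_inj r h0, totalSpace_mk_inj r h0']
  · beta_reduce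
    rw [totalSpace_mk_inj r h1, totalSpace_mk_inj r h1']

theorem Transports.norm_eq (hr : 0 < r) {h : unitInterval → Seifert L} (hh : Continuous h)
    {a b : TotalSpace (Cn r) E} (h1 : Transports A B h a b) : ‖a.2‖ = ‖b.2‖ := by
  obtain ⟨V, hV, rfl, rfl⟩ := h1
  exact norm_eq_of_isFlatAt hr hh hV 0 1

namespace FlatAtlas

variable (D : FlatAtlas A B) (hr : 0 < r)

/-- The vector of `E` defined by a point of the covering. -/
def toE (g : (D.core hr).TotalSpace) : TotalSpace (Cn r) E :=
  TotalSpace.mk' (Cn r) g.1.1.1 (D.frame g.1 g.1 g.2)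

theorem exists_toE_eq (y : Seifert L) (v : E y.1.1) :
    ∃ g : (D.core hr).TotalSpace, (D.core hr).proj g = y ∧
      D.toE hr g = TotalSpace.mk' (Cn r) y.1.1 v :=
  ⟨⟨y, (D.frame y y).symm v⟩, rfl, by
    change TotalSpace.mk' (Cn r) y.1.1 (D.frame y y ((D.frame y y).symm v)) = _
    rw [LinearEquiv.apply_symm_apply]⟩

theorem transports_lift {h : unitInterval → Seifert L}
    {Γ : unitInterval → (D.core hr).TotalSpace} (hΓ : Continuous Γ)
    (hp : (D.core hr).proj ∘ Γ = h) : Transports A B h (D.toE hr (Γ 0)) (D.toE hr (Γ 1)) := by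
  subst hp
  exact ⟨fun k => D.frame (Γ k).1 (Γ k).1 (Γ k).2, D.isFlatAt_of_continuous hr hΓ, rfl, rfl⟩

theorem transports_liftPath (h : C(unitInterval, Seifert L)) (g : (D.core hr).TotalSpace)
    (hg : h 0 = (D.core hr).proj g) :
    Transports A B h (D.toE hr g) (D.toE hr ((D.isCoveringMap hr).liftPath h g hg 1)) := by
  have h1 := D.transports_lift hr ((D.isCoveringMap hr).liftPath h g hg).continuous
    ((D.isCoveringMap hr).liftPath_lifts h g hg)
  rwa [(D.isCoveringMap hr).liftPath_zero] at h1

end FlatAtlas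

/-- Path lifting in the covering of flat sections. -/
theorem exists_transports (D : FlatAtlas A B) (hr : 0 < r) {h : unitInterval → Seifert L}
    (hh : Continuous h) (v : E (h 0).1.1) :
    ∃ w, Transports A B h (TotalSpace.mk' (Cn r) (h 0).1.1 v)
      (TotalSpace.mk' (Cn r) (h 1).1.1 w) := by
  obtain ⟨g, hg, hgv⟩ := D.exists_toE_eq hr (h 0) v
  have h1 := D.transports_liftPath hr ⟨h, hh⟩ g hg.symm
  rw [hgv] at h1
  obtain ⟨V, hV, h2, h3⟩ := h1
  exact ⟨V 1, V, hV, h2, rfl⟩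

/-- Homotopic paths have lifts with the same end point; by uniqueness of transport the lift computes
the given relation. -/
theorem Transports.homotopic (D : FlatAtlas A B) (hr : 0 < r) {y y' : Seifert L} {h h' : Path y y'}
    (H : h.Homotopic h') {a b : TotalSpace (Cn r) E} (h1 : Transports A B h a b) :
    Transports A B h' a b := by
  have h2 := h1
  obtain ⟨V, hV, rfl, h4⟩ := h2
  obtain ⟨g, hg, hgv⟩ := D.exists_toE_eq hr (h 0) (V 0)
  have h5 := D.transports_liftPath hr (h : C(unitInterval, Seifert L)) g hg.symm
  have hg' : h' 0 = (D.core hr).proj g := by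
    rw [hg, h.source, h'.source]
  have h6 := D.transports_liftPath hr (h' : C(unitInterval, Seifert L)) g hg'
  rw [hgv] at h5 h6
  have h7 := (D.isCoveringMap hr).liftPath_apply_one_eq_of_homotopicRel H g hg.symm hg'
  rw [h1.unique hr h.continuous h5]
  exact (congrArg (fun q => Transports A B h' _ (D.toE hr q)) h7).mpr h6

/-- The lift of a concatenation is the concatenation of lifts. Flatness of the glued section at the
junction is thereby obtained from the covering instead of by hand. -/
theorem Transports.trans (D : FlatAtlas A B) (hr : 0 < r) {y y' y'' : Seifert L} {h : Path y y'}
    {h' : Path y' y''} {a b c : TotalSpace (Cn r) E} (h1 : Transports A B h a b)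
    (h2 : Transports A B h' b c) : Transports A B (h.trans h') a c := by
  have h3 := h1
  obtain ⟨V, hV, rfl, h4⟩ := h3
  obtain ⟨g, hg, hgv⟩ := D.exists_toE_eq hr (h 0) (V 0)
  have hg1 : y = (D.core hr).proj g := by rw [hg, h.source]
  have h5 := D.transports_liftPath hr (h : C(unitInterval, Seifert L)) g (h.source.trans hg1)
  have h7 := D.transports_liftPath hr ((h.trans h' : Path y y'') : C(unitInterval, Seifert L)) g
    ((h.trans h').source.trans hg1)
  set Γ := (D.isCoveringMap hr).liftPath (h : C(unitInterval, Seifert L)) g (h.source.trans hg1)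
    with hΓ
  have hg2 : h' 0 = (D.core hr).proj (Γ 1) := by
    have h8 := congrFun ((D.isCoveringMap hr).liftPath_lifts
      (h : C(unitInterval, Seifert L)) g (h.source.trans hg1)) 1
    exact h'.source.trans (h8.trans h.target).symm
  have h6 := D.transports_liftPath hr (h' : C(unitInterval, Seifert L)) (Γ 1) hg2
  rw [hgv] at h5 h7
  have hb := h1.unique hr h.continuous h5
  rw [← hb] at h6
  rw [h2.unique hr h'.continuous h6]
  have h9 := (D.isCoveringMap hr).liftPath_trans hg1 h h'
  have h10 := congrArg (fun G : C(unitInterval, (D.core hr).TotalSpace) => G 1) h9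
  have h11 : (D.isCoveringMap hr).liftPath
      ((h.trans h' : Path y y'') : C(unitInterval, Seifert L)) g
      ((h.trans h').source.trans hg1) 1 =
      (D.isCoveringMap hr).liftPath (h' : C(unitInterval, Seifert L)) (Γ 1) hg2 1 :=
    h10.trans (Path.target _)
  rw [h11] at h7
  exact h7

/-- The fibre loop acts by a primitive root of unity. -/
theorem transports_fibre (D : FlatAtlas A B) (hr : 0 < r) (y : Seifert L)
    {h : unitInterval → Seifert L} (hh : ∀ t : unitInterval, (h t).1 =
      TotalSpace.mk' (Cn 1) y.1.1 ((Circle.exp (2 * Real.pi * t) : ℂ) • y.1.2)) (v : E y.1.1) :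
    Transports A B h (TotalSpace.mk' (Cn r) y.1.1 v)
      (TotalSpace.mk' (Cn r) y.1.1 ((Circle.exp (2 * Real.pi / r) : ℂ) • v)) := by
  have hr' : (r : ℂ) ≠ 0 := by exact_mod_cast hr.ne'
  obtain rfl : h = fun t : unitInterval => ⟨TotalSpace.mk' (Cn 1) y.1.1
      ((Circle.exp (2 * Real.pi * t) : ℂ) • y.1.2), (norm_smul _ _).trans (by
        rw [Circle.norm_coe, y.2, one_mul])⟩ :=
    funext fun t => Subtype.ext (hh t)
  -- Along the fibre the coefficient `⟨s, y⟩` is multiplied by `exp(2πit)`, so its continuous `r`-th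
  -- root is multiplied by `exp(2πit/r)` over a fixed frame vector.
  refine ⟨fun t => (Circle.exp (2 * Real.pi * t / r) : ℂ) • v, fun t => ?_, ?_, ?_⟩
  · refine ⟨D.O y.1.1, D.isOpen _, D.mem _, D.P y.1.1,
      fun t : unitInterval => (Circle.exp (2 * Real.pi * t / r) : ℂ), (D.coef y y)⁻¹,
      ((D.P y.1.1).f y.1.1).symm v, inv_ne_zero (D.coef_self_ne_zero y), ?_,
      Filter.Eventually.of_forall fun t => ⟨?_, ?_⟩⟩
    · apply Continuous.continuousAt
      fun_prop
    · change (Circle.exp (2 * Real.pi * t / r) : ℂ) ^ r =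
        _ * inner ℂ _ ((Circle.exp (2 * Real.pi * t) : ℂ) • y.1.2)
      rw [inner_smul_right]
      have h0 := D.coef_self_ne_zero y
      change (Circle.exp (2 * Real.pi * t / r) : ℂ) ^ r = (D.coef y y)⁻¹ * (_ * D.coef y y)
      rw [mul_comm _ (D.coef y y), inv_mul_cancel_left₀ h0, Circle.coe_exp, Circle.coe_exp,
        ← Complex.exp_nat_mul]
      congr 1
      push_cast
      field_simp
    · exact congrArg _ (((D.P y.1.1).f y.1.1).apply_symm_apply v).symm
  · simp
  · simp

section Conjugation

variable {σ : M → M} {c : ℤˣ} (hσ : IsRealStructure σ) (τ : RealQuatStructure r E σ c)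
  (τL : RealQuatStructure 1 L σ 1)

theorem continuous_seifertInv : Continuous (seifertInv τL) :=
  (τL.smooth.continuous.comp continuous_subtype_val).subtype_mk _

/-- The conjugate flat pair, with `ε`, `a` and `u` conjugated, describes `τ V` over the conjugate
curve; compatibility of `B` with `τ_L` ensures that this pair is again one for `B`. -/
theorem IsFlatAt.conjugate (hA : ConjRel hσ τ A A) (hB : ConjRel hσ τL B B) {K : Type*}
    [TopologicalSpace K] {h : K → Seifert L} {V : ∀ k, E (h k).1.1} {k₀ : K}
    (hV : IsFlatAt A B h V k₀) :
    IsFlatAt A B (fun k => seifertInv τL (h k)) (fun k => τ.map (h k).1.1 (V k)) k₀ := by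
  obtain ⟨O, hO, hk, P, ε, a, u, ha, hε, h1⟩ := hV
  have hs : ∀ x, (P.conjugate hσ τ τL hA hB).s (σ x) = τL.map x (P.s x) := fun x =>
    conjSec_sigma hσ τL P.s x
  have hf : ∀ x u, (P.conjugate hσ τ τL hA hB).f (σ x) u = τ.map x (P.f x (conjV u)) := fun x u =>
    conjSec_sigma hσ τ (fun x => P.f x (conjV u)) x
  refine ⟨σ ⁻¹' O, hO.preimage hσ.smooth.continuous, ?_, P.conjugate hσ τ τL hA hB,
    fun k => conj (ε k), conj a, conjV u, (map_ne_zero _).2 ha,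
    Complex.continuous_conj.continuousAt.comp hε, ?_⟩
  · change σ (σ (h k₀).1.1) ∈ O
    rwa [hσ.involutive]
  · filter_upwards [h1] with k h2
    constructor
    · change _ = _ * inner ℂ ((P.conjugate hσ τ τL hA hB).s (σ (h k).1.1))
        (τL.map (h k).1.1 (h k).1.2)
      rw [hs, inner_antilinear, ← map_pow, h2.1, map_mul]
    · change _ = _ • (P.conjugate hσ τ τL hA hB).f (σ (h k).1.1) (conjV u)
      rw [hf, conjV_conjV, h2.2, map_smulₛₗ]
      rfl

/-- The transport is compatible with the Real structures. -/
theorem Transports.conjugate (hA : ConjRel hσ τ A A) (hB : ConjRel hσ τL B B)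
    {h : unitInterval → Seifert L} {a b : TotalSpace (Cn r) E} (h1 : Transports A B h a b) :
    Transports A B (fun t => seifertInv τL (h t)) (totalMap τ a) (totalMap τ b) := by
  obtain ⟨V, hV, rfl, rfl⟩ := h1
  exact ⟨fun t => τ.map (h t).1.1 (V t), fun t => (hV t).conjugate hσ τ τL hA hB, rfl, rfl⟩

end Conjugation

section Gauge

variable {u : ∀ x, E x ≃ₗᵢ[ℂ] E x}

theorem diffAt_gauge (hu : ContMDiff (𝓘(ℝ, ℂ).prod 𝓘(ℝ, Cn r)) (𝓘(ℝ, ℂ).prod 𝓘(ℝ, Cn r)) ∞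
      (fun p : TotalSpace (Cn r) E => TotalSpace.mk' (Cn r) p.1 (u p.1 p.2)))
    {s : ∀ x, E x} {x : M} (hs : DiffAt (r := r) s x) :
    DiffAt (r := r) (fun y => u y (s y)) x := by
  have h2 : MDifferentiableAt (𝓘(ℝ, ℂ).prod 𝓘(ℝ, Cn r)) (𝓘(ℝ, ℂ).prod 𝓘(ℝ, Cn r))
      (fun p : TotalSpace (Cn r) E => TotalSpace.mk' (Cn r) p.1 (u p.1 p.2))
      (TotalSpace.mk' (Cn r) x (s x)) := hu.mdifferentiable (by simp) _
  exact MDifferentiableAt.comp x (f := fun y => TotalSpace.mk' (Cn r) y (s y)) h2 hs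

/-- The image of a flat pair under a gauge transformation. -/
def FlatPair.gauge (hu : ContMDiff (𝓘(ℝ, ℂ).prod 𝓘(ℝ, Cn r)) (𝓘(ℝ, ℂ).prod 𝓘(ℝ, Cn r)) ∞
      (fun p : TotalSpace (Cn r) E => TotalSpace.mk' (Cn r) p.1 (u p.1 p.2)))
    (hA : ∀ (s : ∀ x, E x) (x : M), DiffAt (r := r) s x → ∀ v : ℂ,
      A'.D (fun y => u y (s y)) x v = u x (A.D s x v)) {O : Set M} (P : FlatPair A B O) :
    FlatPair A' B O where
  f x := (P.f x).trans (u x)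
  s := P.s
  norm_s := P.norm_s
  diff_f x hx w := diffAt_gauge hu (P.diff_f x hx w)
  diff_s := P.diff_s
  cov_f x hx w v := by
    refine (hA _ x (P.diff_f x hx w) v).trans ?_
    rw [P.cov_f x hx, map_smul]
    rfl

/-- The transport is compatible with gauge transformations. -/
theorem Transports.gauge (hu : ContMDiff (𝓘(ℝ, ℂ).prod 𝓘(ℝ, Cn r)) (𝓘(ℝ, ℂ).prod 𝓘(ℝ, Cn r)) ∞
      (fun p : TotalSpace (Cn r) E => TotalSpace.mk' (Cn r) p.1 (u p.1 p.2)))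
    (hA : ∀ (s : ∀ x, E x) (x : M), DiffAt (r := r) s x → ∀ v : ℂ,
      A'.D (fun y => u y (s y)) x v = u x (A.D s x v)) {h : unitInterval → Seifert L}
    {a b : TotalSpace (Cn r) E} (h1 : Transports A B h a b) :
    Transports A' B h (TotalSpace.mk' (Cn r) a.1 (u a.1 a.2))
      (TotalSpace.mk' (Cn r) b.1 (u b.1 b.2)) := by
  obtain ⟨V, hV, rfl, rfl⟩ := h1
  refine ⟨fun t => u _ (V t), fun t => ?_, rfl, rfl⟩
  obtain ⟨O, hO, hk, P, ε, a, w, ha, hε, h1⟩ := hV t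
  refine ⟨O, hO, hk, P.gauge hu hA, ε, a, w, ha, hε, ?_⟩
  filter_upwards [h1] with k h2
  refine ⟨h2.1, ?_⟩
  rw [h2.2, map_smul]
  rfl

end Gauge

end Transport

/-! ### Horizontal phases along curves in `S(L)` -/

section Phase

variable {M : Type*} [TopologicalSpace M] [ChartedSpace ℂ M] [IsManifold 𝓘(ℂ, ℂ) ω M]

/-- The velocity of a curve. -/
def vel (γ : ℝ → M) (t : ℝ) : ℂ := mfderiv 𝓘(ℝ, ℝ) 𝓘(ℝ, ℂ) γ t (1 : ℝ)

theorem hasDerivAt_comp_curve {F : Type*} [NormedAddCommGroup F] [NormedSpace ℝ F] {g : M → F}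
    {γ : ℝ → M} {t : ℝ} (hγ : MDifferentiableAt 𝓘(ℝ, ℝ) 𝓘(ℝ, ℂ) γ t)
    (hg : MDifferentiableAt 𝓘(ℝ, ℂ) 𝓘(ℝ, F) g (γ t)) :
    HasDerivAt (fun t => g (γ t)) (mfd g (γ t) (vel γ t)) t := by
  have h1 : HasMFDerivAt 𝓘(ℝ, ℝ) 𝓘(ℝ, F) (fun t => g (γ t)) t _ :=
    hg.hasMFDerivAt.comp t hγ.hasMFDerivAt
  have h2 : HasFDerivAt (fun t => g (γ t)) ((mfd g (γ t)).comp
    (show ℝ →L[ℝ] ℂ from mfderiv 𝓘(ℝ, ℝ) 𝓘(ℝ, ℂ) γ t)) t := h1.hasFDerivAt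
  exact h2.hasDerivAt

theorem dchart_deriv (x₀ : M) {γ : ℝ → M} {t : ℝ} (hγ : MDifferentiableAt 𝓘(ℝ, ℝ) 𝓘(ℝ, ℂ) γ t)
    (hx : γ t ∈ (chartAt ℂ x₀).source) :
    dchart x₀ (chartAt ℂ x₀ (γ t)) (deriv (fun t => chartAt ℂ x₀ (γ t)) t) = vel γ t := by
  have h1 := hasDerivAt_comp_curve hγ (mdifferentiableAt_chart x₀ hx)
  have hz : chartAt ℂ x₀ (γ t) ∈ (chartAt ℂ x₀).target := (chartAt ℂ x₀).map_source hx
  have h2 : HasMFDerivAt 𝓘(ℝ, ℝ) 𝓘(ℝ, ℂ) (fun t => (chartAt ℂ x₀).symm (chartAt ℂ x₀ (γ t))) t _ :=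
    HasMFDerivAt.comp t (mdifferentiableAt_chart_symm x₀ hz).hasMFDerivAt
      h1.hasFDerivAt.hasMFDerivAt
  have h3 : γ =ᶠ[𝓝 t] fun t => (chartAt ℂ x₀).symm (chartAt ℂ x₀ (γ t)) := by
    filter_upwards [hγ.continuousAt ((chartAt ℂ x₀).open_source.mem_nhds hx)] with t' ht'
    exact ((chartAt ℂ x₀).left_inv ht').symm
  have h4 := (h2.congr_of_eventuallyEq h3).mfderiv
  have h5 : vel γ t = dchart x₀ (chartAt ℂ x₀ (γ t))
      ((1 : ℝ) • mfd (chartAt ℂ x₀) (γ t) (vel γ t)) :=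
    congrArg (fun T : ℝ →L[ℝ] ℂ => T 1) h4
  rw [one_smul] at h5
  rw [h1.deriv]
  exact h5.symm

variable {L : M → Type*} [TopologicalSpace (TotalSpace (Cn 1) L)]
  [∀ x, NormedAddCommGroup (L x)] [∀ x, InnerProductSpace ℂ (L x)]
  [FiberBundle (Cn 1) L] [VectorBundle ℂ (Cn 1) L] [VectorBundle ℝ (Cn 1) L]
  [ContMDiffVectorBundle ∞ (Cn 1) L 𝓘(ℝ, ℂ)] [IsSmoothHermitian 1 L]

/-- The curve `exp(μ) h` in `L` is `B`-horizontal at time `t`. -/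
def HorizontalPhaseAt (B : MetricConnection 1 L) (h : ℝ → Seifert L) (μ : ℝ → ℂ) (t : ℝ) : Prop :=
  MDifferentiableAt 𝓘(ℝ, ℝ) 𝓘(ℝ, ℂ) (fun t => (h t).1.1) t ∧ ∃ s : ∀ x, L x,
    DiffAt (r := 1) s (h t).1.1 ∧ (∀ᶠ y in 𝓝 (h t).1.1, ‖s y‖ = 1) ∧
    HasDerivAt (fun t' => Complex.exp (μ t') * inner ℂ (s (h t').1.1) (h t').1.2)
      (-B.form s (h t).1.1 (vel (fun t => (h t).1.1) t) *
        (Complex.exp (μ t) * inner ℂ (s (h t).1.1) (h t).1.2)) t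

variable {B : MetricConnection 1 L} {h : ℝ → Seifert L} {μ μ' : ℝ → ℂ} {t : ℝ}

/-- Horizontality is independent of the unit section: coefficient and connection form both change
through the logarithmic derivative of `⟨s', s⟩`. -/
theorem HorizontalPhaseAt.hasDerivAt (H : HorizontalPhaseAt B h μ t) (hh : Continuous h)
    {s' : ∀ x, L x} (hd' : DiffAt (r := 1) s' (h t).1.1)
    (hn' : ∀ᶠ y in 𝓝 (h t).1.1, ‖s' y‖ = 1) :
    HasDerivAt (fun t' => Complex.exp (μ t') * inner ℂ (s' (h t').1.1) (h t').1.2)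
      (-B.form s' (h t).1.1 (vel (fun t => (h t).1.1) t) *
        (Complex.exp (μ t) * inner ℂ (s' (h t).1.1) (h t).1.2)) t := by
  obtain ⟨hγ, s, hd, hn, h1⟩ := H
  have hq : ContinuousAt (fun t => (h t).1.1) t := (continuous_seifert_proj.comp hh).continuousAt
  have h2 := hasDerivAt_comp_curve hγ (mdifferentiableAt_inner hd' hd)
  rw [mfd_inner_sections (B := B) hd' hd hn' hn.self_of_nhds] at h2
  have hin : ∀ {y : Seifert L}, ‖s y.1.1‖ = 1 → (inner ℂ (s' y.1.1) y.1.2 : ℂ) =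
      inner ℂ (s y.1.1) y.1.2 * inner ℂ (s' y.1.1) (s y.1.1) := by
    intro y hy
    conv_lhs => rw [eq_inner_smul_of_norm_eq_one hy y.1.2]
    rw [inner_smul_right]
  refine ((h1.mul h2).congr_deriv ?_).congr_of_eventuallyEq ?_
  · rw [hin hn.self_of_nhds]
    ring
  · filter_upwards [hq.eventually hn] with t' ht'
    rw [hin ht']
    simp only [Pi.mul_apply]
    ring

theorem HorizontalPhaseAt.congr_add (H : HorizontalPhaseAt B h μ t) (b : ℂ)
    (hμ : ∀ᶠ t' in 𝓝 t, μ' t' = μ t' + b) : HorizontalPhaseAt B h μ' t := by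
  obtain ⟨hγ, s, hd, hn, h1⟩ := H
  refine ⟨hγ, s, hd, hn, ((h1.mul_const (Complex.exp b)).congr_deriv ?_).congr_of_eventuallyEq ?_⟩
  · rw [hμ.self_of_nhds, Complex.exp_add]
    ring
  · filter_upwards [hμ] with t' ht'
    rw [ht', Complex.exp_add]
    ring

/-- There is a continuous phase `μ` on `[a, b]` such that the curve `exp(μ) h` in `L` is
`B`-horizontal. -/
def HasHorizontalPhase (B : MetricConnection 1 L) (h : ℝ → Seifert L) (a b : ℝ) : Prop :=
  ∃ μ : ℝ → ℂ, ContinuousOn μ (Icc a b) ∧ μ a = 0 ∧ (∀ t ∈ Icc a b, (μ t).re = 0) ∧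
    ∃ S : Finset ℝ, ∀ t ∈ Ioo a b, t ∉ S → HorizontalPhaseAt B h μ t

theorem hasHorizontalPhase_self (a : ℝ) : HasHorizontalPhase B h a a :=
  ⟨fun _ => 0, continuousOn_const, rfl, fun _ _ => rfl, ∅, fun t ht => by simp at ht⟩

theorem HasHorizontalPhase.restrict {a b b' : ℝ} (H : HasHorizontalPhase B h a b) (hb : b' ≤ b) :
    HasHorizontalPhase B h a b' := by
  obtain ⟨μ, h1, h2, h3, S, h4⟩ := H
  exact ⟨μ, h1.mono (Icc_subset_Icc_right hb), h2, fun t ht => h3 t ⟨ht.1, ht.2.trans hb⟩, S,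
    fun t ht => h4 t ⟨ht.1, ht.2.trans_le hb⟩⟩

/-- The second phase is shifted by the final value of the first, which is harmless by `congr_add`;
the junction `b` joins the exceptional set. -/
theorem HasHorizontalPhase.trans {a b d : ℝ} (H : HasHorizontalPhase B h a b)
    (H' : HasHorizontalPhase B h b d) (hab : a ≤ b) : HasHorizontalPhase B h a d := by
  obtain ⟨μ, h1, h2, h3, S, h4⟩ := H
  obtain ⟨μ', h1', h2', h3', S', h4'⟩ := H'
  refine ⟨fun t => if t ≤ b then μ t else μ' t + μ b, ?_, ?_, ?_, insert b (S ∪ S'), ?_⟩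
  · refine ContinuousOn.if (fun t ht => ?_) (h1.mono fun t ht => ?_) ?_
    · rw [frontier_Iic_subset _ ht.2, h2', zero_add]
    · have h5 : t ≤ b := (isClosed_Iic (a := b)).closure_subset ht.2
      exact ⟨ht.1.1, h5⟩
    · refine (h1'.add continuousOn_const).mono fun t ht => ?_
      have h5 : b ≤ t := by
        have h6 := ht.2
        simp only [not_le] at h6
        exact closure_lt_subset_le continuous_const continuous_id h6
      exact ⟨h5, ht.1.2⟩
  · simp [hab, h2]
  · intro t ht
    by_cases htb : t ≤ b
    · simp only [htb, if_true]
      exact h3 t ⟨ht.1, htb⟩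
    · simp only [htb, if_false, Complex.add_re]
      rw [h3' t ⟨(not_le.1 htb).le, ht.2⟩, h3 b ⟨hab, le_rfl⟩, add_zero]
  · intro t ht htS
    simp only [Finset.mem_insert, Finset.mem_union, not_or] at htS
    rcases lt_or_gt_of_ne htS.1 with htb | htb
    · refine (h4 t ⟨ht.1, htb⟩ htS.2.1).congr_add 0 ?_
      filter_upwards [eventually_lt_nhds htb] with t' ht'
      simp [ht'.le]
    · refine (h4' t ⟨htb, ht.2⟩ htS.2.2).congr_add (μ b) ?_
      filter_upwards [eventually_gt_nhds htb] with t' ht'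
      simp [not_le.2 ht']

/-- The connection forms of `B` in suitable local unit frames are continuous in the charts. -/
def HasContinuousForms (B : MetricConnection 1 L) : Prop :=
  ∀ x₀ : M, ∃ O : Set M, IsOpen O ∧ x₀ ∈ O ∧ O ⊆ (chartAt ℂ x₀).source ∧ ∃ s : ∀ x, L x,
    (∀ x ∈ O, DiffAt (r := 1) s x) ∧ (∀ x ∈ O, ‖s x‖ = 1) ∧ ∃ Θ : ℂ → ℂ →L[ℝ] ℂ,
      ContinuousOn Θ ((chartAt ℂ x₀).target ∩ (chartAt ℂ x₀).symm ⁻¹' O) ∧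
      ∀ z ∈ (chartAt ℂ x₀).target ∩ (chartAt ℂ x₀).symm ⁻¹' O, ∀ a,
        B.form s ((chartAt ℂ x₀).symm z) (dchart x₀ z a) = Θ z a

/-- Phases exist over intervals whose image lies in the domain of a suitable unit frame. -/
theorem hasHorizontalPhase_of_chart (hh : Continuous h) {x₀ : M} {O : Set M} (hO : IsOpen O)
    (hOc : O ⊆ (chartAt ℂ x₀).source) {s : ∀ x, L x} (hd : ∀ x ∈ O, DiffAt (r := 1) s x)
    (hn : ∀ x ∈ O, ‖s x‖ = 1) {Θ : ℂ → ℂ →L[ℝ] ℂ}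
    (hΘ : ContinuousOn Θ ((chartAt ℂ x₀).target ∩ (chartAt ℂ x₀).symm ⁻¹' O))
    (hΘs : ∀ z ∈ (chartAt ℂ x₀).target ∩ (chartAt ℂ x₀).symm ⁻¹' O, ∀ a,
        B.form s ((chartAt ℂ x₀).symm z) (dchart x₀ z a) = Θ z a)
    {a b : ℝ} (hab : a < b) (hγ : ContMDiffOn 𝓘(ℝ, ℝ) 𝓘(ℝ, ℂ) 1 (fun t => (h t).1.1) (Icc a b))
    (hγO : ∀ t ∈ Icc a b, (h t).1.1 ∈ O) {ζ₀ : ℂ} (hζ₀ : ‖ζ₀‖ = 1)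
    (hζ : ∀ t ∈ Icc a b, inner ℂ (s (h t).1.1) (h t).1.2 / ζ₀ ∈ Complex.slitPlane) :
    HasHorizontalPhase B h a b := by
  set z : ℝ → ℂ := fun t => chartAt ℂ x₀ (h t).1.1 with hz
  set ζ : ℝ → ℂ := fun t => inner ℂ (s (h t).1.1) (h t).1.2 with hζdef
  have hzc : ContDiffOn ℝ 1 z (Icc a b) := by
    have h1 : ContMDiffOn 𝓘(ℝ, ℂ) 𝓘(ℝ, ℂ) 1 (chartAt ℂ x₀) (chartAt ℂ x₀).source :=
      contMDiffOn_chart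
    exact contMDiffOn_iff_contDiffOn.1 (h1.comp hγ fun t ht => hOc (hγO t ht))
  have hzO : ∀ t ∈ Icc a b, z t ∈ (chartAt ℂ x₀).target ∩ (chartAt ℂ x₀).symm ⁻¹' O := by
    intro t ht
    refine ⟨(chartAt ℂ x₀).map_source (hOc (hγO t ht)), ?_⟩
    change (chartAt ℂ x₀).symm (chartAt ℂ x₀ (h t).1.1) ∈ O
    rw [(chartAt ℂ x₀).left_inv (hOc (hγO t ht))]
    exact hγO t ht
  -- The connection form evaluated on the velocity of the projected curve, the one-sided derivative
  -- being used at the end points.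
  set w : ℝ → ℂ := fun t => Θ (z t) (derivWithin z (Icc a b) t) with hw
  have hwc : ContinuousOn w (Icc a b) :=
    (hΘ.comp hzc.continuousOn hzO).clm_apply
      (hzc.continuousOn_derivWithin (uniqueDiffOn_Icc hab) le_rfl)
  have hwre : ∀ t ∈ Icc a b, (w t).re = 0 := by
    intro t ht
    have h1 := B.conj_form (hd _ (hzO t ht).2)
      (Filter.eventually_of_mem (hO.mem_nhds (hzO t ht).2) hn)
      (dchart x₀ (z t) (derivWithin z (Icc a b) t))
    rw [hΘs _ (hzO t ht)] at h1
    have h2 := congrArg Complex.re h1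
    rw [Complex.conj_re, Complex.neg_re] at h2
    change (Θ (z t) (derivWithin z (Icc a b) t)).re = 0
    linarith
  -- Extended continuously to the line, so that its primitive is differentiable everywhere.
  set w' : ℝ → ℂ := IccExtend hab.le ((Icc a b).domRestrict w) with hw'
  have hwc' : Continuous w' := (continuousOn_iff_continuous_domRestrict.1 hwc).Icc_extend'
  have hww : ∀ t ∈ Icc a b, w' t = w t := fun t ht => IccExtend_of_mem hab.le _ ht
  set W : ℝ → ℂ := fun t => ∫ t' in a..t, w' t' with hW
  have hWd : ∀ t, HasDerivAt W (w' t) t := fun t => (hwc'.integral_hasStrictDerivAt a t).hasDerivAt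
  have hWre : ∀ t, (W t).re = 0 := by
    intro t
    have h1 : ∀ t, (w' t).re = 0 := fun t => hwre _ (projIcc a b hab.le t).2
    have h2 := Complex.reCLM.intervalIntegral_comp_comm
      (hwc'.intervalIntegrable (μ := MeasureTheory.volume) a t)
    have h3 : ∫ x in a..t, Complex.reCLM (w' x) = 0 := by
      simp only [Complex.reCLM_apply, h1, intervalIntegral.integral_zero]
    exact h2.symm.trans h3
  have hζ₀0 : ζ₀ ≠ 0 := by
    intro h0
    rw [h0, norm_zero] at hζ₀
    exact zero_ne_one hζ₀
  have hζn : ∀ t ∈ Icc a b, ‖ζ t / ζ₀‖ = 1 := by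
    intro t ht
    rw [norm_div, hζ₀, div_one]
    exact norm_inner_eq_one (hn _ (hγO t ht)) (h t).2
  have hζc : ContinuousOn ζ (Icc a b) := fun t ht =>
    (ContinuousAt.comp (f := h) (continuousAt_inner_seifert (hd _ (hγO t ht)))
      hh.continuousAt).continuousWithinAt
  have haI : a ∈ Icc a b := ⟨le_rfl, hab.le⟩
  -- Horizontality asks for `exp(μ) ζ` to be a multiple of `exp(-W)`. Since `ζ` is only continuous,
  -- `μ` absorbs a continuous logarithm of it, available because `ζ/ζ₀` stays in the slit plane.
  set μ : ℝ → ℂ := fun t => -W t - (Complex.log (ζ t / ζ₀) - Complex.log (ζ a / ζ₀)) with hμ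
  have hexp : ∀ t ∈ Icc a b, Complex.exp (μ t) * ζ t = Complex.exp (-W t) * ζ a := by
    intro t ht
    have h1 := Complex.slitPlane_ne_zero (hζ t ht)
    have h2 := Complex.slitPlane_ne_zero (hζ a haI)
    have h3 : ζ t ≠ 0 := fun h0 => h1 (by change ζ t / ζ₀ = 0; rw [h0, zero_div])
    rw [hμ]
    simp only
    rw [Complex.exp_sub, Complex.exp_sub, Complex.exp_log h1, Complex.exp_log h2]
    change _ / (ζ t / ζ₀ / (ζ a / ζ₀)) * ζ t = _
    have h4 : ζ a ≠ 0 := fun h0 => h2 (by change ζ a / ζ₀ = 0; rw [h0, zero_div])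
    field_simp
  refine ⟨μ, ?_, ?_, ?_, ∅, ?_⟩
  · refine ContinuousOn.sub (ContinuousOn.neg fun t _ => (hWd t).continuousAt.continuousWithinAt)
      (ContinuousOn.sub ?_ continuousOn_const)
    exact (hζc.div_const ζ₀).clog hζ
  · simp [hμ, hW]
  · intro t ht
    simp only [hμ, Complex.sub_re, Complex.neg_re, hWre, Complex.log_re, hζn t ht, hζn a haI]
    simp
  · intro t ht _
    have htI := Ioo_subset_Icc_self ht
    have hnhds : Icc a b ∈ 𝓝 t := Icc_mem_nhds ht.1 ht.2
    have hγt : MDifferentiableAt 𝓘(ℝ, ℝ) 𝓘(ℝ, ℂ) (fun t => (h t).1.1) t :=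
      (hγ.contMDiffAt hnhds).mdifferentiableAt (by simp)
    refine ⟨hγt, s, hd _ (hγO t htI), Filter.eventually_of_mem (hO.mem_nhds (hγO t htI)) hn, ?_⟩
    have h1 : HasDerivAt (fun t => Complex.exp (-W t) * ζ a)
        (Complex.exp (-W t) * -w' t * ζ a) t := (((hWd t).fun_neg).cexp).mul_const (ζ a)
    refine (h1.congr_deriv ?_).congr_of_eventuallyEq ?_
    · change _ = _ * (Complex.exp (μ t) * ζ t)
      rw [hexp t htI]
      have h2 := dchart_deriv x₀ hγt (hOc (hγO t htI))
      have h3 : B.form s (h t).1.1 (vel (fun t => (h t).1.1) t) = w' t := by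
        rw [hww t htI, ← h2]
        have h4 := hΘs _ (hzO t htI) (derivWithin z (Icc a b) t)
        rw [derivWithin_of_mem_nhds hnhds] at h4
        have h5 : (chartAt ℂ x₀).symm (z t) = (h t).1.1 :=
          (chartAt ℂ x₀).left_inv (hOc (hγO t htI))
        rw [h5] at h4
        change _ = Θ (z t) (derivWithin z (Icc a b) t)
        rw [derivWithin_of_mem_nhds hnhds]
        exact h4
      rw [h3]
      ring
    · filter_upwards [hnhds] with t' ht' using hexp t' ht'

/-- Every curve in `S(L)` with piecewise `C¹` projection has a horizontal phase. -/
theorem exists_horizontalPhase (hB : HasContinuousForms B) (hh : Continuous h)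
    (hγ : IsPiecewiseC1 fun t => (h t).1.1) : HasHorizontalPhase B h 0 1 := by
  obtain ⟨-, S, hS⟩ := hγ
  -- Only short intervals with `t₀` as an end point are treated: their interiors then avoid the
  -- exceptional set even if `t₀` belongs to it.
  have hloc : ∀ t₀ : ℝ, ∃ δ > 0, ∀ a b, t₀ - δ < a → b < t₀ + δ → 0 ≤ a → a ≤ b → b ≤ 1 →
      (a = t₀ ∨ b = t₀) → HasHorizontalPhase B h a b := by
    intro t₀
    obtain ⟨O, hO, hx, hOc, s, hd, hn, Θ, hΘ, hΘs⟩ := hB (h t₀).1.1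
    set ζ : ℝ → ℂ := fun t => inner ℂ (s (h t).1.1) (h t).1.2
    have h1 : ∀ᶠ t in 𝓝 t₀, (h t).1.1 ∈ O :=
      (continuous_seifert_proj.comp hh).continuousAt (hO.mem_nhds hx)
    have hζc : ContinuousAt ζ t₀ :=
      ContinuousAt.comp (f := h) (continuousAt_inner_seifert (hd _ hx)) hh.continuousAt
    have hζ0 : ζ t₀ ≠ 0 := inner_ne_zero_of_norm_eq_one (hn _ hx) (h t₀).2
    have h2 : ∀ᶠ t in 𝓝 t₀, ζ t / ζ t₀ ∈ Complex.slitPlane := by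
      refine (hζc.div_const (ζ t₀)) (Complex.isOpen_slitPlane.mem_nhds ?_)
      beta_reduce
      rw [div_self hζ0]
      exact Complex.one_mem_slitPlane
    have h3 : ∀ᶠ t in 𝓝 t₀, t ∉ S \ {t₀} := by
      have h4 : IsClosed ((S \ {t₀} : Finset ℝ) : Set ℝ) := (Finset.finite_toSet _).isClosed
      exact h4.isOpen_compl.mem_nhds (by simp)
    obtain ⟨δ, hδ, hball⟩ := Metric.eventually_nhds_iff_ball.1 (h1.and (h2.and h3))
    refine ⟨δ, hδ, fun a b ha hb h0a hab hb1 hor => ?_⟩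
    rcases hab.eq_or_lt with rfl | hab'
    · exact hasHorizontalPhase_self a
    have hI : ∀ t ∈ Icc a b, t ∈ Metric.ball t₀ δ := by
      intro t ht
      rw [Metric.mem_ball, Real.dist_eq, abs_lt]
      constructor <;> linarith [ht.1, ht.2]
    refine hasHorizontalPhase_of_chart hh hO hOc hd hn hΘ hΘs hab'
      (hS a b h0a hab' hb1 fun t ht htS => ?_) (fun t ht => (hball t (hI t ht)).1)
      (norm_inner_eq_one (hn _ hx) (h t₀).2) (fun t ht => (hball t (hI t ht)).2.1)
    refine (hball t (hI t (Ioo_subset_Icc_self ht))).2.2 ?_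
    rw [Finset.mem_sdiff, Finset.mem_singleton]
    refine ⟨htS, ?_⟩
    rintro rfl
    rcases hor with rfl | rfl
    · exact lt_irrefl _ ht.1
    · exact lt_irrefl _ ht.2
  -- Continuous induction: the set of reachable times is closed in `[0, 1]` and can be continued to
  -- the right.
  have hall : Icc (0 : ℝ) 1 ⊆ {t | HasHorizontalPhase B h 0 t} := by
    refine IsClosed.Icc_subset_of_forall_mem_nhdsWithin ?_ (hasHorizontalPhase_self 0) ?_
    · rw [← closure_eq_iff_isClosed]
      refine subset_antisymm (fun t₀ ht₀ => ?_) subset_closure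
      have hI : t₀ ∈ Icc (0 : ℝ) 1 := by
        have h1 := closure_mono inter_subset_right ht₀
        rwa [isClosed_Icc.closure_eq] at h1
      obtain ⟨δ, hδ, hl⟩ := hloc t₀
      obtain ⟨t, ⟨ht, htI⟩, htd⟩ := Metric.mem_closure_iff.1 ht₀ δ hδ
      rw [Real.dist_eq, abs_lt] at htd
      refine ⟨?_, hI⟩
      rcases le_total t t₀ with hle | hle
      · exact HasHorizontalPhase.trans ht
          (hl t t₀ (by linarith) (by linarith) htI.1 hle hI.2 (Or.inr rfl)) htI.1
      · exact HasHorizontalPhase.restrict ht hle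
    · rintro t₀ ⟨ht, hI⟩
      obtain ⟨δ, hδ, hl⟩ := hloc t₀
      have h1 : Ioo t₀ (min (t₀ + δ) 1) ∈ 𝓝[>] t₀ :=
        Ioo_mem_nhdsGT (lt_min (by linarith) hI.2)
      filter_upwards [h1] with t htm
      exact HasHorizontalPhase.trans ht
        (hl t₀ t (by linarith) (htm.2.trans_le (min_le_left _ _)) hI.1 htm.1.le
          (htm.2.le.trans (min_le_right _ _)) (Or.inl rfl)) hI.1
  exact hall ⟨zero_le_one, le_rfl⟩

end Phase

/-- The derivative of an `r`-th root. -/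
theorem hasDerivAt_of_pow {w : ℝ → ℂ} {t : ℝ} {r : ℕ} (hr : 0 < r) (hw : ContinuousAt w t)
    (hw0 : w t ≠ 0) {k : ℂ} {W : ℝ → ℂ} (hW : HasDerivAt W (k * W t) t)
    (hpow : ∀ᶠ t' in 𝓝 t, w t' ^ r = W t') : HasDerivAt w (k / r * w t) t := by
  have hr' : (r : ℂ) ≠ 0 := by exact_mod_cast hr.ne'
  have hWt : W t ≠ 0 := by
    rw [← hpow.self_of_nhds]
    exact pow_ne_zero _ hw0
  -- The explicit branch of `W^{1/r}` has the required derivative, and `w` is locally a constant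
  -- multiple of it.
  have hbr : HasDerivAt (fun t' => branch (1 / r) (W t) (W t')) (k / r) t := by
    have h1 := hasDerivAt_branch (1 / r) (w₀ := W t) (w := W t)
      (by rw [div_self hWt]; exact Complex.one_mem_slitPlane)
    rw [branch_self _ hWt] at h1
    refine (h1.comp t hW).congr_deriv ?_
    field_simp
  have hne : ∀ᶠ t' in 𝓝 t, W t' ≠ 0 := hW.continuousAt.eventually_ne hWt
  have hq : ∀ᶠ t' in 𝓝 t, w t' / branch (1 / r) (W t) (W t') =
      w t / branch (1 / r) (W t) (W t) := by
    refine eventually_eq_of_pow_eq hr (f := fun t' => w t' / branch (1 / r) (W t) (W t'))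
      (b := W t) (hw.div hbr.continuousAt (branch_ne_zero _ _ _)) ?_
    filter_upwards [hpow, hne] with t' h1 h2
    rw [div_pow, h1, branch_pow hr (div_ne_zero h2 hWt)]
    field_simp
  rw [branch_self _ hWt, div_one] at hq
  refine ((hbr.mul_const (w t)).congr_of_eventuallyEq ?_)
  filter_upwards [hq] with t' h1
  rw [div_eq_iff (branch_ne_zero _ _ _)] at h1
  rw [h1, mul_comm]

/-! ### From flat sections to horizontal lifts -/

section Lift

variable {M : Type*} [TopologicalSpace M] [ChartedSpace ℂ M] [IsManifold 𝓘(ℂ, ℂ) ω M]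
  {r : ℕ} {E : M → Type*} [TopologicalSpace (TotalSpace (Cn r) E)]
  [∀ x, NormedAddCommGroup (E x)] [∀ x, InnerProductSpace ℂ (E x)]
  [FiberBundle (Cn r) E] [VectorBundle ℂ (Cn r) E] [VectorBundle ℝ (Cn r) E]
  [ContMDiffVectorBundle ∞ (Cn r) E 𝓘(ℝ, ℂ)] [IsSmoothHermitian r E]
  {L : M → Type*} [TopologicalSpace (TotalSpace (Cn 1) L)]
  [∀ x, NormedAddCommGroup (L x)] [∀ x, InnerProductSpace ℂ (L x)]
  [FiberBundle (Cn 1) L] [VectorBundle ℂ (Cn 1) L] [VectorBundle ℝ (Cn 1) L]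
  [ContMDiffVectorBundle ∞ (Cn 1) L 𝓘(ℝ, ℂ)] [IsSmoothHermitian 1 L]
  {A : UnitaryConnection r E} {B : MetricConnection 1 L} {h : ℝ → Seifert L} {μ : ℝ → ℂ}
  {V : ∀ t, E (h t).1.1}

/-- The curve in `E` obtained from a flat section along `h` and a phase. -/
def phaseLift (V : ∀ t, E (h t).1.1) (μ : ℝ → ℂ) (t : ℝ) : TotalSpace (Cn r) E :=
  TotalSpace.mk' (Cn r) (h t).1.1 (Complex.exp (μ t / r) • V t)

theorem coord_smul_eventuallyEq {γ : ℝ → M} {t : ℝ} (hγ : ContinuousAt γ t)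
    {l : ℝ → TotalSpace (Cn r) E} {w : ℝ → ℂ} {s : ∀ x, E x}
    (hl : ∀ᶠ t' in 𝓝 t, l t' = TotalSpace.mk' (Cn r) (γ t') (w t' • s (γ t'))) :
    ∀ᶠ t' in 𝓝 t, (trivializationAt (Cn r) E (γ t) (l t')).2 =
      w t' • coord (trivializationAt (Cn r) E (γ t)) (s (γ t')) := by
  have hb := FiberBundle.mem_baseSet_trivializationAt' (F := Cn r) (E := E) (γ t)
  filter_upwards [hl, hγ ((trivializationAt (Cn r) E (γ t)).open_baseSet.mem_nhds hb)]
    with t' h1 h2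
  rw [h1]
  exact coord_smul _ h2 _ _

theorem phaseLift_eventuallyEq {t : ℝ} {O : Set M} {P : FlatPair A.toMetric B O} {ε : ℝ → ℂ}
    {u : Cn r} (h1 : ∀ᶠ t' in 𝓝 t, V t' = ε t' • P.f (h t').1.1 u) :
    ∀ᶠ t' in 𝓝 t, phaseLift V μ t' = TotalSpace.mk' (Cn r) (h t').1.1
      ((Complex.exp (μ t' / r) * ε t') • P.f (h t').1.1 u) := by
  filter_upwards [h1] with t' h2
  rw [phaseLift, h2, smul_smul]

theorem continuousWithinAt_phaseLift (hh : Continuous h) {t : ℝ}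
    (hV : IsFlatAt A.toMetric B h V t) {I : Set ℝ} (hμ : ContinuousWithinAt μ I t) :
    ContinuousWithinAt (phaseLift (r := r) V μ) I t := by
  obtain ⟨O, hO, hk, P, ε, a, u, ha, hε, h1⟩ := hV
  have hq : Continuous fun t => (h t).1.1 := continuous_seifert_proj.comp hh
  rw [FiberBundle.continuousWithinAt_totalSpace]
  refine ⟨hq.continuousWithinAt, ?_⟩
  have h2 := coord_smul_eventuallyEq (γ := fun t => (h t).1.1) (s := fun y => P.f y u)
    hq.continuousAt (phaseLift_eventuallyEq (μ := μ) (h1.mono fun t' h => h.2))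
  refine ContinuousWithinAt.congr_of_eventuallyEq ?_ (nhdsWithin_le_nhds h2) h2.self_of_nhds
  have hb := FiberBundle.mem_baseSet_trivializationAt' (F := Cn r) (E := E) (h t).1.1
  have h3 := ((diffAt_iff (trivializationAt (Cn r) E (h t).1.1) hb).1 (P.diff_f _ hk u)).continuousAt
  refine ContinuousWithinAt.smul (ContinuousWithinAt.mul ?_ hε.continuousWithinAt) ?_
  · exact Complex.continuous_exp.continuousAt.comp_continuousWithinAt (hμ.div_const _)
  · exact (ContinuousAt.comp (f := fun t => (h t).1.1) h3 hq.continuousAt).continuousWithinAt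

/-- The coefficient `exp(μ/r) ε` of the lift has `r`-th power `a exp(μ) ⟨s, h⟩`, whose logarithmic
derivative is minus the form of `B` in `s`. Its own logarithmic derivative is `1/r` of that and
cancels the connection form of `A` in the frame. -/
theorem isHorizontalAt_phaseLift (hr : 0 < r) (hh : Continuous h) {t : ℝ}
    (hV : IsFlatAt A.toMetric B h V t) (hμ : ContinuousAt μ t)
    (hH : HorizontalPhaseAt B h μ t) : A.IsHorizontalAt (phaseLift V μ) t := by
  have hV' := hV
  obtain ⟨O, hO, hk, P, ε, a, u, ha, hε, h1⟩ := hV'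
  have hr' : (r : ℂ) ≠ 0 := by exact_mod_cast hr.ne'
  have hq : Continuous fun t => (h t).1.1 := continuous_seifert_proj.comp hh
  set γ : ℝ → M := fun t => (h t).1.1 with hγ
  set e := trivializationAt (Cn r) E (γ t) with he
  have hb : γ t ∈ e.baseSet := FiberBundle.mem_baseSet_trivializationAt' (F := Cn r) (E := E) (γ t)
  set w : ℝ → ℂ := fun t' => Complex.exp (μ t' / r) * ε t' with hw
  have hlw := phaseLift_eventuallyEq (μ := μ) (h1.mono fun t' h => h.2)
  have h2 := coord_smul_eventuallyEq (γ := γ) (s := fun y => P.f y u) hq.continuousAt hlw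
  set k : ℂ := B.form P.s (γ t) (vel γ t) with hkdef
  have hε0 : ε t ≠ 0 := by
    intro h0
    have h3 := h1.self_of_nhds.1
    rw [h0, zero_pow hr.ne'] at h3
    exact mul_ne_zero ha (inner_ne_zero_of_norm_eq_one (P.norm_s _ hk) (h t).2) h3.symm
  have hwd : HasDerivAt w (-k / r * w t) t := by
    obtain ⟨W, hW⟩ : ∃ W : ℝ → ℂ, W = fun t' => a * (Complex.exp (μ t') *
      inner ℂ (P.s (h t').1.1) (h t').1.2) := ⟨_, rfl⟩
    have h3 : HasDerivAt W (-k * W t) t := by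
      have h4 := (hH.hasDerivAt hh (P.diff_s _ hk)
        (Filter.eventually_of_mem (hO.mem_nhds hk) P.norm_s)).const_mul a
      rw [mul_left_comm] at h4
      rw [hW]
      exact h4
    have hwt : w t ≠ 0 := mul_ne_zero (Complex.exp_ne_zero _) hε0
    refine hasDerivAt_of_pow hr (w := w) ?_ hwt h3 ?_
    · exact (Complex.continuous_exp.continuousAt.comp (hμ.div_const _)).mul hε
    · filter_upwards [h1] with t' h4
      rw [hw, hW]
      simp only
      rw [mul_pow, h4.1, ← Complex.exp_nat_mul, mul_div_cancel₀ _ hr']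
      ring
  have hFd := hasDerivAt_comp_curve hH.1 ((diffAt_iff e hb).1 (P.diff_f _ hk u))
  refine ⟨_, (hwd.smul hFd).congr_of_eventuallyEq h2, ?_⟩
  have hl : phaseLift (r := r) V μ t = TotalSpace.mk' (Cn r) (γ t) (w t • P.f (γ t) u) :=
    hlw.self_of_nhds
  have hcov := A.toMetric.D_coord e hb (P.diff_f _ hk u) (vel γ t)
  rw [P.cov_f _ hk] at hcov
  have hext : (fun y => FiberBundle.extend (Cn r) (phaseLift (r := r) V μ t).2 y) =
      fun y => e.symm y (w t • coord e (P.f (γ t) u)) := by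
    funext y
    rw [← coord_smul e hb, hl]
    rfl
  have h5 : A.cov (fun y => FiberBundle.extend (Cn r) (phaseLift (r := r) V μ t).2 y)
      (phaseLift (r := r) V μ t).proj (mfderiv 𝓘(ℝ, ℝ) 𝓘(ℝ, ℂ)
        (fun t' => (phaseLift (r := r) V μ t').proj) t (1 : ℝ)) =
      w t • A.toMetric.D (fun y => e.symm y (coord e (P.f (γ t) u))) (γ t) (vel γ t) := by
    rw [hext, ← A.toMetric.D_symm_smul e hb]
    rfl
  rw [h5]
  change e.symm (γ t) (w t • mfd (fun y => coord e (P.f y u)) (γ t) (vel γ t) +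
    (-k / r * w t) • coord e (P.f (γ t) u)) + _ = _
  rw [symm_add e hb, symm_smul e hb, symm_smul e hb, symm_coord e hb]
  have h6 : ∀ {X Y Z : E (γ t)} {a b : ℂ}, a • X = Y + Z →
      b • Y + (-a * b) • X + b • Z = 0 := by
    intro X Y Z a b h
    rw [neg_mul, neg_smul, mul_comm, mul_smul, h, smul_add]
    abel
  rw [neg_div]
  exact h6 hcov

theorem mk_curve_congr {h : unitInterval → Seifert L} (V : ∀ t, E (h t).1.1)
    {t t' : unitInterval} (ht : t = t') :
    TotalSpace.mk' (Cn r) (h t).1.1 (V t) = TotalSpace.mk' (Cn r) (h t').1.1 (V t') := by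
  rw [ht]

/-- The phase relating the flat transport along a curve in `S(L)` to the parallel transport along
its projection to `M`. -/
theorem exists_transport_phase (hr : 0 < r) (hB : HasContinuousForms B)
    {h : unitInterval → Seifert L} (hh : Continuous h)
    (hγ : IsPiecewiseC1 fun t => (h (projIcc 0 1 zero_le_one t)).1.1) :
    ∃ ζ : Circle, ∀ (A : UnitaryConnection r E) (a b : TotalSpace (Cn r) E),
      Transports A.toMetric B h a b → ∃ l : ℝ → TotalSpace (Cn r) E,
        A.IsHorizontalLift (fun t => (h (projIcc 0 1 zero_le_one t)).1.1) l ∧ l 0 = a ∧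
        b = TotalSpace.mk' (Cn r) (l 1).1 ((ζ : ℂ) • (l 1).2) := by
  have hh' : Continuous fun t : ℝ => h (projIcc 0 1 zero_le_one t) := hh.comp continuous_projIcc
  obtain ⟨μ, h1, h2, h3, S, h4⟩ := exists_horizontalPhase hB hh' hγ
  -- The phase `μ` is built from `B` and `h` alone, which is why the scalar does not depend on `A`.
  have h5 : ‖Complex.exp (-(μ 1 / r))‖ = 1 := by
    have h6 : (μ 1 / r).re = 0 := by
      rw [Complex.div_natCast_re, h3 1 ⟨zero_le_one, le_rfl⟩, zero_div]
    rw [Complex.norm_exp, Complex.neg_re, h6, neg_zero, Real.exp_zero]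
  refine ⟨⟨Complex.exp (-(μ 1 / r)), mem_sphere_zero_iff_norm.2 h5⟩, fun A a b hab => ?_⟩
  obtain ⟨V, hV, rfl, rfl⟩ := hab
  have hV' : ∀ t : ℝ, IsFlatAt A.toMetric B (fun t : ℝ => h (projIcc 0 1 zero_le_one t))
      (fun t => V (projIcc 0 1 zero_le_one t)) t := fun t =>
    (hV _).comp continuous_projIcc.continuousAt
  refine ⟨phaseLift (r := r) (h := fun t : ℝ => h (projIcc 0 1 zero_le_one t))
    (fun t => V (projIcc 0 1 zero_le_one t)) μ, ⟨?_, fun t _ => rfl, S, ?_⟩, ?_, ?_⟩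
  · exact fun t ht => continuousWithinAt_phaseLift hh' (hV' t) (h1 t ht)
  · exact fun t ht htS => isHorizontalAt_phaseLift hr hh' (hV' t)
      (h1.continuousAt (Icc_mem_nhds ht.1 ht.2)) (h4 t ht htS)
  · rw [phaseLift, h2, zero_div, Complex.exp_zero, one_smul]
    exact mk_curve_congr V (projIcc_left _)
  · have h7 : projIcc (0 : ℝ) 1 zero_le_one 1 = 1 := projIcc_right _
    have h8 : ∀ {x : M} (v : E x), Complex.exp (-(μ 1 / r)) • Complex.exp (μ 1 / r) • v = v := by
      intro x v
      rw [smul_smul, ← Complex.exp_add, neg_add_cancel, Complex.exp_zero, one_smul]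
    exact (mk_curve_congr V h7).symm.trans (congrArg (TotalSpace.mk' (Cn r) _) (h8 _).symm)

end Lift

/-! ### The double covering of the homotopy quotient -/

section Covering

variable {X : Type*} (τ : X → X) (hτ : Function.Involutive τ)

theorem dist_neg_self_SInf (f : SInf) : dist f (-f) = 2 := by
  rw [Subtype.dist_eq, dist_eq_norm]
  change ‖(f : lp (fun _ : ℕ => ℝ) 2) - -f‖ = 2
  rw [sub_neg_eq_add, ← two_smul ℝ, norm_smul, mem_sphere_zero_iff_norm.1 f.2]
  norm_num

theorem neg_ne_self_SInf (f : SInf) : -f ≠ f := by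
  intro h
  have h1 := dist_neg_self_SInf f
  rw [h, dist_self] at h1
  norm_num at h1

theorem diagAct_diagAct (hτ : Function.Involutive τ) (s t : ℤˣ) (p : X × SInf) :
    diagAct τ t (diagAct τ s p) = diagAct τ (s * t) p := by
  rcases Int.units_eq_one_or s with rfl | rfl <;>
  rcases Int.units_eq_one_or t with rfl | rfl <;> simp [diagAct, hτ p.1]

theorem diagAct_injective {s t : ℤˣ} {p : X × SInf} (h : diagAct τ s p = diagAct τ t p) :
    s = t := by
  have h2 := congrArg Prod.snd h
  rcases Int.units_eq_one_or s with rfl | rfl <;>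
  rcases Int.units_eq_one_or t with rfl | rfl <;> simp [diagAct] at h2 ⊢
  · exact neg_ne_self_SInf _ h2.symm
  · exact neg_ne_self_SInf _ h2

variable [TopologicalSpace X]

theorem continuous_diagAct (hc : Continuous τ) (s : ℤˣ) : Continuous (diagAct τ s) := by
  rcases Int.units_eq_one_or s with rfl | rfl
  · have h : diagAct τ 1 = (id : X × SInf → X × SInf) := by
      funext p
      simp [diagAct]
    rw [h]
    exact continuous_id
  · have h : diagAct τ (-1) = fun p : X × SInf => (τ p.1, -p.2) := by
      funext p
      simp [diagAct]
    rw [h]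
    fun_prop

/-- The projection `X × EΣ → X_Σ` is a double covering. -/
theorem isCoveringMap_toQuot (hc : Continuous τ) : IsCoveringMap (toQuot τ hτ) := by
  letI : MulAction ℤˣ (X × SInf) :=
    { smul := diagAct τ
      one_smul := fun p => by
        change diagAct τ 1 p = p
        simp [diagAct]
      mul_smul := fun s t p => by
        change diagAct τ (s * t) p = diagAct τ s (diagAct τ t p)
        rw [diagAct_diagAct τ hτ, mul_comm] }
  have h : IsQuotientCoveringMap (toQuot τ hτ) ℤˣ :=
    { toIsQuotientMap := isQuotientMap_quotient_mk'
      continuous_const_smul := continuous_diagAct τ hc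
      apply_eq_iff_mem_orbit := by
        intro p q
        constructor
        · intro h
          obtain ⟨s, hs⟩ := (Quotient.exact h.symm : (orbitSetoid τ hτ).r q p)
          exact ⟨s, hs⟩
        · rintro ⟨s, rfl⟩
          exact toQuot_diagAct τ hτ s q
      disjoint := by
        intro p
        -- Antipodal points are at distance `2`, so open unit balls of the sphere are disjoint from
        -- their antipodes.
        refine ⟨Prod.snd ⁻¹' Metric.ball p.2 1,
          continuous_snd.continuousAt (Metric.ball_mem_nhds p.2 one_pos), ?_⟩
        rintro s ⟨_, ⟨q, hq, rfl⟩, hq2⟩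
        rcases Int.units_eq_one_or s with rfl | rfl
        · rfl
        · exfalso
          have h1 : dist q.2 p.2 < 1 := hq
          have h2 : dist (diagAct τ (-1) q).2 p.2 < 1 := hq2
          have h3 : (diagAct τ (-1) q).2 = -q.2 := by simp [diagAct]
          rw [h3] at h2
          have h4 := dist_triangle_right q.2 (-q.2) p.2
          rw [dist_neg_self_SInf] at h4
          linarith }
  exact h.isCoveringMap

/-- Lift a representing loop to the double covering; the end point of the lift lies in the orbit of
`p` and determines `s`. -/
theorem exists_orbClass_eq (hc : Continuous τ) {p : X × SInf} (a : OrbPi1 τ hτ p) :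
    ∃ (s : ℤˣ) (η : Path p (diagAct τ s p)), orbClass τ hτ η = a := by
  obtain ⟨γ, rfl⟩ : ∃ γ : Path (toQuot τ hτ p) (toQuot τ hτ p),
    FundamentalGroup.fromPath (Path.Homotopic.Quotient.mk γ) = a := Quotient.exists_rep a
  have cov := isCoveringMap_toQuot τ hτ hc
  set Γ := cov.liftPath (γ : C(unitInterval, HomotopyQuotient τ hτ)) p γ.source with hΓ
  have h0 : Γ 0 = p := cov.liftPath_zero _ _ _
  have hl : ∀ t, toQuot τ hτ (Γ t) = γ t := fun t =>
    congrFun (cov.liftPath_lifts (γ : C(unitInterval, HomotopyQuotient τ hτ)) p γ.source) t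
  have h1 : toQuot τ hτ (Γ 1) = toQuot τ hτ p := (hl 1).trans γ.target
  obtain ⟨s, hs⟩ := (Quotient.exact h1.symm : (orbitSetoid τ hτ).r p (Γ 1))
  refine ⟨s, ⟨Γ, h0, hs.symm⟩, ?_⟩
  have h2 : ((Path.map ⟨Γ, h0, hs.symm⟩ (toQuot τ hτ).continuous).cast rfl
      (toQuot_diagAct τ hτ s p).symm) = γ := by
    ext t
    exact hl t
  rw [orbClass, h2]

/-- Homotopies relative to the end points lift to the covering. In particular the two lifts have the
same end point, so no equality of `s` and `t` is assumed. -/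
theorem homotopicRel_of_orbClass_eq (hc : Continuous τ) {p : X × SInf} {s t : ℤˣ}
    {η : Path p (diagAct τ s p)} {η' : Path p (diagAct τ t p)}
    (h : orbClass τ hτ η = orbClass τ hτ η') :
    (η : C(unitInterval, X × SInf)).HomotopicRel η' {0, 1} := by
  have cov := isCoveringMap_toQuot τ hτ hc
  have h1 := Path.Homotopic.Quotient.exact h
  refine (cov.homotopicRel_iff_comp ⟨0, by simp, ?_⟩).2 h1
  exact η.source.trans η'.source.symm

theorem sgn_eq_of_orbClass_eq (hc : Continuous τ) {p : X × SInf} {s t : ℤˣ}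
    {η : Path p (diagAct τ s p)} {η' : Path p (diagAct τ t p)}
    (h : orbClass τ hτ η = orbClass τ hτ η') : s = t := by
  obtain ⟨H⟩ := homotopicRel_of_orbClass_eq τ hτ hc h
  have h1 : η 1 = η' 1 := H.fst_eq_snd (by simp)
  rw [η.target, η'.target] at h1
  exact diagAct_injective τ h1

theorem homotopic_of_orbClass_eq (hc : Continuous τ) {p : X × SInf} {s : ℤˣ}
    {η η' : Path p (diagAct τ s p)} (h : orbClass τ hτ η = orbClass τ hτ η') :
    η.Homotopic η' := homotopicRel_of_orbClass_eq τ hτ hc h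

/-- The translate of a path under the action of `Σ`. -/
def actPath (hc : Continuous τ) {p : X × SInf} {s : ℤˣ} (t : ℤˣ) (η : Path p (diagAct τ s p)) :
    Path (diagAct τ t p) (diagAct τ (s * t) p) :=
  (η.map (continuous_diagAct τ hc t)).cast rfl (diagAct_diagAct τ hτ s t p).symm

/-- The product runs through the right factor first, so `η` is translated by `t` to start where `η'`
ends. -/
theorem orbClass_mul (hc : Continuous τ) {p : X × SInf} {s t : ℤˣ} (η : Path p (diagAct τ s p))
    (η' : Path p (diagAct τ t p)) : orbClass τ hτ η * orbClass τ hτ η' =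
      orbClass τ hτ (η'.trans (actPath τ hτ hc t η)) := by
  refine congrArg (fun γ => FundamentalGroup.fromPath (Path.Homotopic.Quotient.mk γ))
    (?_ : Path.trans _ _ = _)
  ext u
  simp only [Path.cast_coe, Path.map_coe, Path.trans_apply, Function.comp_apply]
  split_ifs
  · rfl
  · exact (toQuot_diagAct τ hτ t _).symm

theorem augmentation_orbClass (hc : Continuous τ) {p : X × SInf} {s : ℤˣ}
    (η : Path p (diagAct τ s p)) : augmentation τ hτ (orbClass τ hτ η) = s := by
  rw [augmentation]
  split_ifs with h
  · obtain ⟨η', h'⟩ := h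
    exact sgn_eq_of_orbClass_eq τ hτ hc h'
  · rcases Int.units_eq_one_or s with rfl | rfl
    · exact absurd ⟨η, rfl⟩ h
    · rfl

end Covering

/-! ### The extended unitary group acting on `ℂ^r` -/

section Matrices

variable {r : ℕ} {c : ℤˣ}

/-- The unitary matrix of a linear isometry of `ℂ^r`. -/
def toU (T : Cn r →ₗᵢ[ℂ] Cn r) : U r :=
  ⟨Matrix.of fun i j => T (EuclideanSpace.single j 1) i, by
    rw [Matrix.mem_unitaryGroup_iff']
    ext i j
    have h := T.inner_map_map (EuclideanSpace.single i 1) (EuclideanSpace.single j 1)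
    rw [PiLp.inner_apply] at h
    simp only [Matrix.mul_apply, Matrix.star_apply, Matrix.of_apply]
    refine Eq.trans (Finset.sum_congr rfl fun k _ => ?_) (h.trans ?_)
    · exact mul_comm _ _
    · simp [Matrix.one_apply, EuclideanSpace.inner_single_left, Pi.single_apply]⟩

/-- The action of a unitary matrix on `ℂ^r`. -/
def actU (g : U r) (u : Cn r) : Cn r :=
  WithLp.toLp 2 ((g : Matrix (Fin r) (Fin r) ℂ).mulVec u.ofLp)

theorem actU_toU (T : Cn r →ₗᵢ[ℂ] Cn r) (u : Cn r) : actU (toU T) u = T u := by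
  have h : u = ∑ j, u j • (EuclideanSpace.single j 1 : Cn r) := by
    ext i
    simp [Finset.sum_apply, Pi.single_apply]
  conv_rhs => rw [h]
  rw [map_sum]
  ext i
  simp only [actU, toU, Matrix.mulVec, dotProduct, Matrix.of_apply, map_smul, WithLp.ofLp_sum,
    Finset.sum_apply, PiLp.smul_apply, smul_eq_mul]
  exact Finset.sum_congr rfl fun j _ => mul_comm _ _

theorem actU_mul (g h : U r) (u : Cn r) : actU (g * h) u = actU g (actU h u) := by
  simp [actU, Matrix.mulVec_mulVec]

theorem actU_neg (g : U r) (u : Cn r) : actU (-g) u = -actU g u := by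
  ext i
  have h : ((-g : U r) : Matrix (Fin r) (Fin r) ℂ) = -(g : Matrix (Fin r) (Fin r) ℂ) := rfl
  simp [actU, Matrix.neg_mulVec, h]

theorem actU_one (u : Cn r) : actU (1 : U r) u = u := by
  simp [actU]

theorem actU_scalarU (z : Circle) (u : Cn r) : actU (scalarU r z) u = (z : ℂ) • u := by
  ext i
  simp [actU, scalarU, Matrix.smul_mulVec]

theorem actU_injective {g h : U r} (H : ∀ u, actU g u = actU h u) : g = h := by
  ext i j
  have h1 := congrArg (fun v : Cn r => v i) (H (EuclideanSpace.single j 1))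
  simpa [actU] using h1

theorem conjV_actU (g : U r) (u : Cn r) : conjV (actU g u) = actU (conjU r g) (conjV u) := by
  ext i
  simp [actU, conjV, conjU, Matrix.mulVec, dotProduct]

/-- The map `ε_s` of `ℂ^r`: the identity or the complex conjugation. -/
def sgnV (s : ℤˣ) (u : Cn r) : Cn r := if s = 1 then u else conjV u

/-- The action of an element of the extended unitary group on `ℂ^r`. -/
def ExtUnitary.act (X : ExtUnitary r c) (u : Cn r) : Cn r := actU X.mat (sgnV X.sgn u)

/-- The values of the cocycle, as complex numbers. -/
def cocycleC (c s t : ℤˣ) : ℂ := if s = -1 ∧ t = -1 ∧ c = -1 then -1 else 1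

/-- The action is only projective: two conjugations compose up to the sign `c`, just as `τ² = c` on
`E`. -/
theorem ExtUnitary.act_mul (X Y : ExtUnitary r c) (u : Cn r) :
    (X * Y).act u = cocycleC c X.sgn Y.sgn • X.act (Y.act u) := by
  obtain ⟨g, s⟩ := X
  obtain ⟨h, t⟩ := Y
  have hn : (-1 : U r)⁻¹ = -1 := by rw [inv_eq_iff_mul_eq_one]; simp
  rcases Int.units_eq_one_or c with rfl | rfl <;>
  rcases Int.units_eq_one_or s with rfl | rfl <;>
  rcases Int.units_eq_one_or t with rfl | rfl <;>
  simp [mul_def, ExtUnitary.act, cocycle, cocycleC, galU, sgnV, actU_mul, actU_neg, hn,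
    conjV_actU, conjV_conjV, actU_one]

/-- With the component in `Σ` fixed, the action is faithful; identities in the group are checked on
vectors. -/
theorem ExtUnitary.ext_act {X Y : ExtUnitary r c} (hs : X.sgn = Y.sgn)
    (h : ∀ u, X.act u = Y.act u) : X = Y := by
  refine ExtUnitary.ext (actU_injective fun u => ?_) hs
  obtain ⟨g, s⟩ := X
  obtain ⟨h', t⟩ := Y
  obtain rfl : s = t := hs
  have h1 := h (sgnV s u)
  have h2 : sgnV s (sgnV s u) = u := by
    unfold sgnV
    split_ifs
    · rfl
    · exact conjV_conjV u
  simp only [ExtUnitary.act, h2] at h1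
  exact h1

end Matrices

/-- The action of `Σ` on `ℂ`. -/
def sgnC (s : ℤˣ) : ℂ →+* ℂ := if s = 1 then RingHom.id ℂ else starRingEnd ℂ

theorem sgnC_sgnC (s : ℤˣ) (z : ℂ) : sgnC s (sgnC s z) = z := by
  unfold sgnC
  split_ifs <;> simp

theorem sgnV_smul {r : ℕ} (s : ℤˣ) (z : ℂ) (u : Cn r) : sgnV s (z • u) = sgnC s z • sgnV s u := by
  unfold sgnV sgnC
  split_ifs
  · rfl
  · exact conjV_smul z u

theorem sgnV_add {r : ℕ} (s : ℤˣ) (u v : Cn r) : sgnV s (u + v) = sgnV s u + sgnV s v := by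
  unfold sgnV
  split_ifs
  · rfl
  · exact conjV_add u v

theorem norm_sgnV {r : ℕ} (s : ℤˣ) (u : Cn r) : ‖sgnV s u‖ = ‖u‖ := by
  unfold sgnV
  split_ifs
  · rfl
  · exact norm_conjV u

theorem sgnV_sgnV {r : ℕ} (s : ℤˣ) (u : Cn r) : sgnV s (sgnV s u) = u := by
  unfold sgnV
  split_ifs
  · rfl
  · exact conjV_conjV u

/-! ### Extended holonomy of the flat connection and the character -/

section Holonomy

variable {M : Type*} [TopologicalSpace M] [ChartedSpace ℂ M] [IsManifold 𝓘(ℂ, ℂ) ω M]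
  {r : ℕ} {E : M → Type*} [TopologicalSpace (TotalSpace (Cn r) E)]
  [∀ x, NormedAddCommGroup (E x)] [∀ x, InnerProductSpace ℂ (E x)]
  [FiberBundle (Cn r) E] [VectorBundle ℂ (Cn r) E] [VectorBundle ℝ (Cn r) E]
  [ContMDiffVectorBundle ∞ (Cn r) E 𝓘(ℝ, ℂ)] [IsSmoothHermitian r E]
  {L : M → Type*} [TopologicalSpace (TotalSpace (Cn 1) L)]
  [∀ x, NormedAddCommGroup (L x)] [∀ x, InnerProductSpace ℂ (L x)]
  [FiberBundle (Cn 1) L] [VectorBundle ℂ (Cn 1) L] [VectorBundle ℝ (Cn 1) L]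
  [ContMDiffVectorBundle ∞ (Cn 1) L 𝓘(ℝ, ℂ)] [IsSmoothHermitian 1 L]
  {A A' : MetricConnection r E} {B : MetricConnection 1 L}
  {σ : M → M} {c : ℤˣ} (hσ : IsRealStructure σ) (τ : RealQuatStructure r E σ c)
  (τL : RealQuatStructure 1 L σ 1)

/-- Fibrewise scalar multiplication. -/
def smulT (z : ℂ) (a : TotalSpace (Cn r) E) : TotalSpace (Cn r) E :=
  TotalSpace.mk' (Cn r) a.1 (z • a.2)

theorem smulT_smulT (z w : ℂ) (a : TotalSpace (Cn r) E) : smulT z (smulT w a) = smulT (z * w) a := by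
  exact congrArg (TotalSpace.mk' (Cn r) a.1) (smul_smul z w a.2)

theorem smulT_one (a : TotalSpace (Cn r) E) : smulT 1 a = a := by
  simp only [smulT, one_smul]

theorem Transports.smulT (hr : 0 < r) {h : unitInterval → Seifert L} (hh : Continuous h)
    {a b : TotalSpace (Cn r) E} (h1 : Transports A B h a b) (z : ℂ) :
    Transports A B h (smulT z a) (smulT z b) := by
  have h2 := Transports.add_smul hr hh (x := a.1) (y := b.1) h1 h1 (z - 1)
  have h3 : ∀ {x : M} (v : E x), v + (z - 1) • v = z • v := fun v => by
    rw [sub_smul, one_smul, add_sub_cancel]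
  rw [h3, h3] at h2
  exact h2

theorem act_one (a : TotalSpace (Cn r) E) : τ.act 1 a = a := by simp [RealQuatStructure.act]

theorem act_neg_one (a : TotalSpace (Cn r) E) : τ.act (-1) a = totalMap τ a := by
  simp [RealQuatStructure.act, totalMap]

theorem norm_act (s : ℤˣ) (a : TotalSpace (Cn r) E) : ‖(τ.act s a).2‖ = ‖a.2‖ := by
  rcases Int.units_eq_one_or s with rfl | rfl
  · rw [act_one]
  · rw [act_neg_one]
    exact (τ.map a.1).norm_map a.2

theorem act_smulT (s : ℤˣ) (z : ℂ) (a : TotalSpace (Cn r) E) :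
    τ.act s (smulT z a) = smulT (sgnC s z) (τ.act s a) := by
  rcases Int.units_eq_one_or s with rfl | rfl
  · simp [act_one, sgnC]
  · rw [act_neg_one, act_neg_one]
    simp only [totalMap, smulT, sgnC]
    exact congrArg (TotalSpace.mk' (Cn r) (σ a.1)) (map_smulₛₗ (τ.map a.1) z a.2)

theorem totalMap_totalMap_smulT (a : TotalSpace (Cn r) E) :
    totalMap τ (totalMap τ a) = smulT ((c : ℤ) : ℂ) a := totalMap_totalMap τ a.1 a.2

theorem sgn_mul_self : (((c : ℤ) : ℂ)) * ((c : ℤ) : ℂ) = 1 := by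
  rcases Int.units_eq_one_or c with rfl | rfl <;> simp

theorem act_add_smul (s : ℤˣ) {y : M} (v v' : E y) (z : ℂ) {x : M} {w w' : E x}
    (h : τ.act s (TotalSpace.mk' (Cn r) y v) = TotalSpace.mk' (Cn r) x w)
    (h' : τ.act s (TotalSpace.mk' (Cn r) y v') = TotalSpace.mk' (Cn r) x w') :
    τ.act s (TotalSpace.mk' (Cn r) y (v + z • v')) =
      TotalSpace.mk' (Cn r) x (w + sgnC s z • w') := by
  rcases Int.units_eq_one_or s with rfl | rfl
  · rw [act_one] at h h' ⊢
    obtain rfl : y = x := congrArg TotalSpace.proj h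
    rw [totalSpace_mk_inj r h, totalSpace_mk_inj r h']
    simp [sgnC]
  · rw [act_neg_one] at h h' ⊢
    obtain rfl : σ y = x := congrArg TotalSpace.proj h
    have h1 : τ.map y v = w := totalSpace_mk_inj r h
    have h1' : τ.map y v' = w' := totalSpace_mk_inj r h'
    rw [← h1, ← h1']
    refine congrArg (TotalSpace.mk' (Cn r) (σ y)) ((map_add (τ.map y) v (z • v')).trans ?_)
    exact congrArg _ (map_smulₛₗ (τ.map y) z v')

theorem exists_mk_eq {a : TotalSpace (Cn r) E} {x : M} (h : a.1 = x) :
    ∃ w, a = TotalSpace.mk' (Cn r) x w := by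
  subst h
  exact ⟨a.2, rfl⟩

variable {p : Seifert L} {e : SInf} {s t : ℤˣ}

variable (A B) in
/-- The extended holonomy of the flat connection `q^* A ⊗ (q^* B)^{-1/r}` along the path `η` maps
`v` to `w`. -/
def HolRel (η : Path (p, e) (diagAct (seifertInv τL) s (p, e))) (v w : E p.1.1) : Prop :=
  ∃ a, Transports A B (fun t => (η t).1) (TotalSpace.mk' (Cn r) p.1.1 v) a ∧
    τ.act s a = TotalSpace.mk' (Cn r) p.1.1 w

variable {τ τL} {η : Path (p, e) (diagAct (seifertInv τL) s (p, e))}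
  {η' : Path (p, e) (diagAct (seifertInv τL) t (p, e))}

theorem continuous_path_fst {q q' : Seifert L × SInf} (η : Path q q') :
    Continuous fun t => (η t).1 := continuous_fst.comp η.continuous

theorem exists_holRel (hσ : IsRealStructure σ) (D : FlatAtlas A B) (hr : 0 < r)
    (η : Path (p, e) (diagAct (seifertInv τL) s (p, e))) (v : E p.1.1) :
    ∃ w, HolRel A B τ τL η v w := by
  have h0 : p.1.1 = (η 0).1.1.1 := by rw [η.source]
  obtain ⟨w, hw⟩ := exists_transports D hr (continuous_path_fst η) (castE E h0 v)
  rw [mk_castE] at hw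
  have h1 : (τ.act s (TotalSpace.mk' (Cn r) (η 1).1.1.1 w)).1 = p.1.1 := by
    have h2 : (η 1).1.1.1 = (diagAct (seifertInv τL) s (p, e)).1.1.1 := by rw [η.target]
    rcases Int.units_eq_one_or s with rfl | rfl
    · rw [act_one]
      refine h2.trans ?_
      simp [diagAct]
    · rw [act_neg_one]
      change σ (η 1).1.1.1 = _
      rw [h2]
      simp only [diagAct, seifertInv]
      exact hσ.involutive _
  obtain ⟨w', hw'⟩ := exists_mk_eq h1
  exact ⟨w', _, hw, hw'⟩

theorem HolRel.unique (hr : 0 < r) {v w w' : E p.1.1} (h : HolRel A B τ τL η v w)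
    (h' : HolRel A B τ τL η v w') : w = w' := by
  obtain ⟨a, h1, h2⟩ := h
  obtain ⟨a', h1', h2'⟩ := h'
  rw [h1.unique hr (continuous_path_fst η) h1'] at h2
  exact totalSpace_mk_inj r (h2.symm.trans h2')

theorem HolRel.add_smul (hr : 0 < r) {v v' w w' : E p.1.1} (h : HolRel A B τ τL η v w)
    (h' : HolRel A B τ τL η v' w') (z : ℂ) :
    HolRel A B τ τL η (v + z • v') (w + sgnC s z • w') := by
  obtain ⟨a, h1, h2⟩ := h
  obtain ⟨a', h1', h2'⟩ := h'
  have h3 : a'.1 = a.1 := by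
    obtain ⟨V, -, -, rfl⟩ := h1
    obtain ⟨V', -, -, rfl⟩ := h1'
    rfl
  obtain ⟨u, rfl⟩ := exists_mk_eq h3
  exact ⟨_, Transports.add_smul hr (continuous_path_fst η) (y := a.1) h1 h1' z,
    act_add_smul τ s a.2 u z h2 h2'⟩

theorem HolRel.norm_eq (hr : 0 < r) {v w : E p.1.1} (h : HolRel A B τ τL η v w) : ‖w‖ = ‖v‖ := by
  obtain ⟨a, h1, h2⟩ := h
  have h3 := h1.norm_eq hr (continuous_path_fst η)
  have h4 := norm_act τ s a
  rw [h2] at h4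
  exact h4.trans h3.symm

theorem HolRel.homotopic (D : FlatAtlas A B) (hr : 0 < r)
    {η η' : Path (p, e) (diagAct (seifertInv τL) s (p, e))} (H : η.Homotopic η')
    {v w : E p.1.1} (h : HolRel A B τ τL η v w) : HolRel A B τ τL η' v w := by
  obtain ⟨a, h1, h2⟩ := h
  exact ⟨a, Transports.homotopic D hr (h := η.map continuous_fst) (h' := η'.map continuous_fst)
    (H.map ⟨Prod.fst, continuous_fst⟩) h1, h2⟩

/-- Transport along the translate of `η` is transport along `η` conjugated by `τ_t`. Combining
`τ_s`, `τ_t` and `τ_{st}` leaves the factor `c` exactly when `s = t = σ`, which is the cocycle. -/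
theorem HolRel.mul (hσ : IsRealStructure σ) (D : FlatAtlas A B) (hr : 0 < r)
    (hA : ConjRel hσ τ A A) (hB : ConjRel hσ τL B B)
    {v w w' : E p.1.1} (h' : HolRel A B τ τL η' v w) (h : HolRel A B τ τL η w w') :
    HolRel A B τ τL (η'.trans (actPath _ (seifertInv_involutive τL) (continuous_seifertInv τL) t η))
      v (cocycleC c s t • w') := by
  obtain ⟨a₁, h1, h2⟩ := h'
  obtain ⟨a₂, h3, h4⟩ := h
  set ξ := actPath _ (seifertInv_involutive τL) (continuous_seifertInv τL) t η with hξ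
  have htr : ∀ {a}, Transports A B (fun u => (ξ u).1) a₁ a →
      Transports A B (fun u => ((η'.trans ξ) u).1) (TotalSpace.mk' (Cn r) p.1.1 v) a := by
    intro a ha
    have h5 := Transports.trans D hr (h := η'.map continuous_fst) (h' := ξ.map continuous_fst)
      h1 ha
    rw [← Path.map_trans] at h5
    exact h5
  have hξu : ∀ u, ξ u = diagAct (seifertInv τL) t (η u) := fun u => rfl
  rcases Int.units_eq_one_or t with rfl | rfl
  · rw [act_one] at h2
    refine ⟨a₂, htr ?_, ?_⟩
    · rw [h2]
      have h6 : (fun u => (ξ u).1) = fun u => (η u).1 := by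
        funext u
        rw [hξu]
        simp [diagAct]
      rw [h6]
      exact h3
    · rw [mul_one, h4]
      simp [cocycleC]
  · rw [act_neg_one] at h2
    have h6 : (fun u => (ξ u).1) = fun u => seifertInv τL (η u).1 := by
      funext u
      rw [hξu]
      simp [diagAct]
    -- Conjugation yields a transport starting at `τ(τ a₁) = c a₁`; rescaling by `c`, whose square
    -- is `1`, makes it start at `a₁`.
    have h7 := (h3.conjugate hσ τ τL hA hB).smulT hr
      ((continuous_seifertInv τL).comp (continuous_path_fst η)) ((c : ℤ) : ℂ)
    rw [← h2, totalMap_totalMap_smulT, smulT_smulT, sgn_mul_self, smulT_one] at h7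
    refine ⟨_, htr (by rw [h6]; exact h7), ?_⟩
    rw [act_smulT, ← act_neg_one τ a₂]
    rcases Int.units_eq_one_or s with rfl | rfl
    · rw [act_one] at h4
      rw [one_mul, act_neg_one, act_neg_one, totalMap_totalMap_smulT, smulT_smulT, h4]
      have h8 : sgnC (-1) ((c : ℤ) : ℂ) * ((c : ℤ) : ℂ) = 1 := by
        rcases Int.units_eq_one_or c with rfl | rfl <;> simp
      rw [h8, smulT_one]
      simp [cocycleC]
    · rw [h4, neg_mul_neg, one_mul, act_one]
      rcases Int.units_eq_one_or c with rfl | rfl <;> simp [cocycleC, smulT]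

theorem HolRel.gauge {u : ∀ x, E x ≃ₗᵢ[ℂ] E x}
    (hu : ContMDiff (𝓘(ℝ, ℂ).prod 𝓘(ℝ, Cn r)) (𝓘(ℝ, ℂ).prod 𝓘(ℝ, Cn r)) ∞
      (fun p : TotalSpace (Cn r) E => TotalSpace.mk' (Cn r) p.1 (u p.1 p.2)))
    (huτ : ∀ x (v : E x), u (σ x) (τ.map x v) = τ.map x (u x v))
    (hA : ∀ (s : ∀ x, E x) (x : M), DiffAt (r := r) s x → ∀ v : ℂ,
      A'.D (fun y => u y (s y)) x v = u x (A.D s x v)) {v w : E p.1.1}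
    (h : HolRel A B τ τL η v w) : HolRel A' B τ τL η (u _ v) (u _ w) := by
  obtain ⟨a, h1, h2⟩ := h
  refine ⟨_, h1.gauge hu hA, ?_⟩
  have h3 : τ.act s (TotalSpace.mk' (Cn r) a.1 (u a.1 a.2)) =
      TotalSpace.mk' (Cn r) (τ.act s a).1 (u (τ.act s a).1 (τ.act s a).2) := by
    rcases Int.units_eq_one_or s with rfl | rfl
    · rw [act_one, act_one]
    · rw [act_neg_one, act_neg_one]
      exact congrArg (TotalSpace.mk' (Cn r) (σ a.1)) (huτ a.1 a.2).symm
  rw [h3, h2]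

variable (A B τ τL) in
/-- `X` is the extended holonomy of the class `a`, in the frame `b`. -/
def IsHol (b : E p.1.1 ≃ₗᵢ[ℂ] Cn r)
    (a : OrbPi1 (seifertInv τL) (seifertInv_involutive τL) (p, e)) (X : ExtUnitary r c) : Prop :=
  ∃ (s : ℤˣ) (η : Path (p, e) (diagAct (seifertInv τL) s (p, e))),
    orbClass _ (seifertInv_involutive τL) η = a ∧ X.sgn = s ∧
      ∀ v w, HolRel A B τ τL η v w → b w = X.act (b v)

variable {b b' : E p.1.1 ≃ₗᵢ[ℂ] Cn r}
  {a a' : OrbPi1 (seifertInv τL) (seifertInv_involutive τL) (p, e)} {X Y : ExtUnitary r c}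

theorem exists_isHol (hσ : IsRealStructure σ) (D : FlatAtlas A B) (hr : 0 < r)
    (b : E p.1.1 ≃ₗᵢ[ℂ] Cn r)
    (a : OrbPi1 (seifertInv τL) (seifertInv_involutive τL) (p, e)) :
    ∃ X : ExtUnitary r c, IsHol A B τ τL b a X := by
  obtain ⟨s, η, rfl⟩ := exists_orbClass_eq _ (seifertInv_involutive τL)
    (continuous_seifertInv τL) a
  choose f hf using exists_holRel (τ := τ) hσ D hr η
  have hadd : ∀ v v', f (v + v') = f v + f v' := by
    intro v v'
    have h := (hf v).add_smul hr (hf v') 1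
    rw [map_one, one_smul, one_smul] at h
    exact (hf _).unique hr h
  have hsmul : ∀ (z : ℂ) v, f (z • v) = sgnC s z • f v := by
    intro z v
    have h := (hf v).add_smul hr (hf v) (z - 1)
    rw [map_sub, map_one, sub_smul, sub_smul, one_smul, one_smul, add_sub_cancel,
      add_sub_cancel] at h
    exact (hf _).unique hr h
  -- The holonomy is linear or antilinear according to `s`; precomposing with `ε_s` makes it
  -- complex-linear, and `toU` gives the unitary component.
  refine ⟨⟨toU ⟨⟨⟨fun u => b (f (b.symm (sgnV s u))), ?_⟩, ?_⟩, ?_⟩, s⟩, s, η, rfl, rfl, ?_⟩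
  · intro u v
    rw [sgnV_add, map_add, hadd, map_add]
  · intro z u
    change b (f (b.symm (sgnV s (z • u)))) = z • b (f (b.symm (sgnV s u)))
    rw [sgnV_smul, map_smul, hsmul, sgnC_sgnC, map_smul]
  · intro u
    change ‖b (f (b.symm (sgnV s u)))‖ = ‖u‖
    rw [LinearIsometryEquiv.norm_map, (hf _).norm_eq hr, LinearIsometryEquiv.norm_map, norm_sgnV]
  · intro v w hw
    rw [ExtUnitary.act, actU_toU]
    change b w = b (f (b.symm (sgnV s (sgnV s (b v)))))
    rw [sgnV_sgnV, LinearIsometryEquiv.symm_apply_apply, hw.unique hr (hf v)]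

/-- The matrix may be evaluated on any representative of the class, since representatives share `s`
and are homotopic. -/
theorem IsHol.apply (D : FlatAtlas A B) (hr : 0 < r) (h : IsHol A B τ τL b a X)
    (hη : orbClass _ (seifertInv_involutive τL) η = a) :
    X.sgn = s ∧ ∀ v w, HolRel A B τ τL η v w → b w = X.act (b v) := by
  obtain ⟨s', η', h1, h2, h3⟩ := h
  obtain rfl := sgn_eq_of_orbClass_eq _ _ (continuous_seifertInv τL) (hη.trans h1.symm)
  exact ⟨h2, fun v w hw => h3 v w (hw.homotopic D hr
    (homotopic_of_orbClass_eq _ _ (continuous_seifertInv τL) (hη.trans h1.symm)))⟩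

theorem IsHol.eq_of_act (D : FlatAtlas A B) (hr : 0 < r) (hσ : IsRealStructure σ)
    (h : IsHol A B τ τL b a X) (hη : orbClass _ (seifertInv_involutive τL) η = a)
    (hs : Y.sgn = s) (hY : ∀ v w, HolRel A B τ τL η v w → b w = Y.act (b v)) : X = Y := by
  obtain ⟨h1, h2⟩ := h.apply D hr hη
  refine ExtUnitary.ext_act (h1.trans hs.symm) fun u => ?_
  obtain ⟨w, hw⟩ := exists_holRel (τ := τ) hσ D hr η (b.symm u)
  have h3 := h2 _ w hw
  have h4 := hY _ w hw
  rw [LinearIsometryEquiv.apply_symm_apply] at h3 h4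
  exact h3.symm.trans h4

variable (hA : ConjRel hσ τ A A) (hB : ConjRel hσ τL B B) (D : FlatAtlas A B) (hr : 0 < r)

/-- The homomorphism defined by the extended holonomy. -/
def character (b : E p.1.1 ≃ₗᵢ[ℂ] Cn r) :
    OrbPi1 (seifertInv τL) (seifertInv_involutive τL) (p, e) →* ExtUnitary r c :=
  MonoidHom.mk' (fun a => (exists_isHol (τ := τ) hσ D hr b a).choose) (by
    intro a a'
    have h1 := (exists_isHol (τ := τ) hσ D hr b a).choose_spec
    have h2 := (exists_isHol (τ := τ) hσ D hr b a').choose_spec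
    have h3 := (exists_isHol (τ := τ) hσ D hr b (a * a')).choose_spec
    set X := (exists_isHol (τ := τ) hσ D hr b a).choose
    set X' := (exists_isHol (τ := τ) hσ D hr b a').choose
    obtain ⟨s, η, rfl⟩ := exists_orbClass_eq _ (seifertInv_involutive τL)
      (continuous_seifertInv τL) a
    obtain ⟨t, η', rfl⟩ := exists_orbClass_eq _ (seifertInv_involutive τL)
      (continuous_seifertInv τL) a'
    obtain ⟨hs, h4⟩ := h1.apply D hr rfl
    obtain ⟨ht, h5⟩ := h2.apply D hr rfl
    refine h3.eq_of_act D hr hσ (orbClass_mul _ _ (continuous_seifertInv τL) η η').symm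
      (by rw [ExtUnitary.mul_def, hs, ht]) ?_
    intro v w hw
    obtain ⟨w₁, hw₁⟩ := exists_holRel (τ := τ) hσ D hr η' v
    obtain ⟨w₂, hw₂⟩ := exists_holRel (τ := τ) hσ D hr η w₁
    rw [hw.unique hr (hw₁.mul hσ D hr hA hB hw₂), ExtUnitary.act_mul, hs, ht, ← h5 v w₁ hw₁,
      ← h4 w₁ w₂ hw₂, map_smul])

theorem isHol_character (a : OrbPi1 (seifertInv τL) (seifertInv_involutive τL) (p, e)) :
    IsHol A B τ τL b a (character hσ hA hB D hr b a) :=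
  (exists_isHol (τ := τ) hσ D hr b a).choose_spec

theorem character_sgn (a : OrbPi1 (seifertInv τL) (seifertInv_involutive τL) (p, e)) :
    (character hσ hA hB D hr b a).sgn = augmentation _ (seifertInv_involutive τL) a := by
  obtain ⟨s, η, h1, h2, -⟩ := isHol_character (b := b) hσ hA hB D hr a
  rw [h2, ← h1, augmentation_orbClass _ _ (continuous_seifertInv τL)]

variable (c) in
/-- The embedding of `S¹` into the extended unitary group. -/
def scalarHom (r : ℕ) : Circle →* ExtUnitary r c where
  toFun z := ⟨scalarU r z, 1⟩
  map_one' := ExtUnitary.ext_act rfl fun u => by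
    simp [ExtUnitary.act, ExtUnitary.one_def, actU_scalarU, actU_one]
  map_mul' z w := ExtUnitary.ext_act (by simp [ExtUnitary.mul_def]) fun u => by
    rw [ExtUnitary.act_mul]
    simp [ExtUnitary.act, cocycleC, actU_scalarU, sgnV, mul_smul]

/-- Only the generator has to be computed; the scalars form a subgroup, so its powers follow from
`scalarHom`. -/
theorem character_fibreLoop (n : ℤ) : character hσ hA hB D hr b
    (orbClass _ (seifertInv_involutive τL) (fibreLoop τL p e) ^ n) =
      ⟨scalarU r (Circle.exp (2 * Real.pi * n / r)), 1⟩ := by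
  have h1 : character hσ hA hB D hr b (orbClass _ (seifertInv_involutive τL)
      (fibreLoop τL p e)) = scalarHom c r (Circle.exp (2 * Real.pi / r)) := by
    refine (isHol_character hσ hA hB D hr _).eq_of_act D hr hσ rfl rfl fun v w hw => ?_
    have h2 : HolRel A B τ τL (fibreLoop τL p e) v
        ((Circle.exp (2 * Real.pi / r) : ℂ) • v) :=
      ⟨_, transports_fibre D hr p (fun t => rfl) v, act_one τ _⟩
    rw [hw.unique hr h2, map_smul]
    change _ = actU (scalarU r _) (sgnV 1 (b v))
    rw [actU_scalarU]
    simp [sgnV]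
  rw [map_zpow, h1, ← map_zpow]
  have h3 : Circle.exp (2 * Real.pi / r) ^ n = Circle.exp (2 * Real.pi * n / r) := by
    rw [← Circle.exp_zsmul]
    congr 1
    simp only [zsmul_eq_mul]
    ring
  rw [h3]
  rfl

end Holonomy

/-! ### Comparison with parallel transport and gauge transformations -/

section Characters

variable {M : Type*} [TopologicalSpace M] [ChartedSpace ℂ M] [IsManifold 𝓘(ℂ, ℂ) ω M]
  {r : ℕ} {E : M → Type*} [TopologicalSpace (TotalSpace (Cn r) E)]
  [∀ x, NormedAddCommGroup (E x)] [∀ x, InnerProductSpace ℂ (E x)]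
  [FiberBundle (Cn r) E] [VectorBundle ℂ (Cn r) E] [VectorBundle ℝ (Cn r) E]
  [ContMDiffVectorBundle ∞ (Cn r) E 𝓘(ℝ, ℂ)] [IsSmoothHermitian r E]
  {L : M → Type*} [TopologicalSpace (TotalSpace (Cn 1) L)]
  [∀ x, NormedAddCommGroup (L x)] [∀ x, InnerProductSpace ℂ (L x)]
  [FiberBundle (Cn 1) L] [VectorBundle ℂ (Cn 1) L] [VectorBundle ℝ (Cn 1) L]
  [ContMDiffVectorBundle ∞ (Cn 1) L 𝓘(ℝ, ℂ)] [IsSmoothHermitian 1 L]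
  {B : MetricConnection 1 L} {σ : M → M} {c : ℤˣ} {τ : RealQuatStructure r E σ c}
  {τL : RealQuatStructure 1 L σ 1} {p : Seifert L} {e : SInf} {s : ℤˣ}
  {b b' : E p.1.1 ≃ₗᵢ[ℂ] Cn r}

theorem cocycleC_one_left (c s : ℤˣ) : cocycleC c 1 s = 1 := by simp [cocycleC]

theorem cocycleC_one_right (c s : ℤˣ) : cocycleC c s 1 = 1 := by simp [cocycleC]

/-- The character is induced by the extended holonomy of the connection. -/
theorem exists_isExtendedHolonomy (hσ : IsRealStructure σ) (hr : 0 < r)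
    {A : UnitaryConnection r E} (hA : ConjRel hσ τ A.toMetric A.toMetric)
    (hB : ConjRel hσ τL B B) (D : FlatAtlas A.toMetric B)
    (η : Path (p, e) (diagAct (seifertInv τL) s (p, e))) {ζ z : Circle}
    (hz : z = if s = 1 then ζ else ζ⁻¹)
    (hζ : ∀ a a' : TotalSpace (Cn r) E, Transports A.toMetric B (fun t => (η t).1) a a' →
      ∃ l : ℝ → TotalSpace (Cn r) E, A.IsHorizontalLift (baseCurve η) l ∧ l 0 = a ∧
        a' = TotalSpace.mk' (Cn r) (l 1).1 ((ζ : ℂ) • (l 1).2)) :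
    ∃ g : U r, A.IsExtendedHolonomy τ b (baseCurve η) s g ∧
      character hσ hA hB D hr b (orbClass _ (seifertInv_involutive τL) η) =
        ⟨scalarU r z * g, s⟩ := by
  set X := character hσ hA hB D hr b (orbClass _ (seifertInv_involutive τL) η) with hX
  obtain ⟨hs, hact⟩ := (isHol_character (b := b) hσ hA hB D hr
    (orbClass _ (seifertInv_involutive τL) η)).apply D hr rfl
  have hzz : ∀ u : Cn r, actU (scalarU r z) (actU (scalarU r z⁻¹) u) = u := by
    intro u
    rw [actU_scalarU, actU_scalarU, smul_smul, ← Circle.coe_mul, mul_inv_cancel, Circle.coe_one,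
      one_smul]
  -- Parallel transport is `ζ⁻¹` times flat transport, and moving this scalar past `τ_s` turns it
  -- into `z⁻¹`.
  refine ⟨scalarU r z⁻¹ * X.mat, fun v => ?_, ExtUnitary.ext (actU_injective fun u => ?_) hs⟩
  · obtain ⟨w, a, h1, h2⟩ := exists_holRel (τ := τ) hσ D hr η v
    have hw := hact v w ⟨a, h1, h2⟩
    obtain ⟨l, hl, hl0, hl1⟩ := hζ _ _ h1
    refine ⟨l, hl, hl0, ?_⟩
    have h3 : a = smulT (ζ : ℂ) (l 1) := hl1
    have h4 : l 1 = smulT ((ζ⁻¹ : Circle) : ℂ) a := by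
      rw [h3, smulT_smulT, ← Circle.coe_mul, inv_mul_cancel, Circle.coe_one, smulT_one]
    have h5 : sgnC s ((ζ⁻¹ : Circle) : ℂ) = ((z⁻¹ : Circle) : ℂ) := by
      rw [hz]
      unfold sgnC
      split_ifs
      · rfl
      · rw [← Circle.coe_inv_eq_conj]
    rw [h4, act_smulT, h5, h2]
    refine congrArg (TotalSpace.mk' (Cn r) p.1.1) ?_
    rw [LinearIsometryEquiv.eq_symm_apply]
    change b (((z⁻¹ : Circle) : ℂ) • w) = _
    rw [map_smul, hw, ExtUnitary.act, ← actU_scalarU, ← actU_mul, hs]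
    have h6 : (sgnV s (b v)).ofLp = fun i => if s = 1 then b v i else conj (b v i) := by
      unfold sgnV
      split_ifs <;> rfl
    rw [actU, h6]
  · change actU X.mat u = actU (scalarU r z * (scalarU r z⁻¹ * X.mat)) u
    rw [actU_mul, actU_mul, hzz]

/-- Gauge equivalent connections have conjugate characters. -/
theorem exists_conj_character (hσ : IsRealStructure σ) (hr : 0 < r)
    {A A' : UnitaryConnection r E} (hA : ConjRel hσ τ A.toMetric A.toMetric)
    (hA' : ConjRel hσ τ A'.toMetric A'.toMetric) (hB : ConjRel hσ τL B B)
    (D : FlatAtlas A.toMetric B) (D' : FlatAtlas A'.toMetric B) (hg : GaugeEquivalent τ A A') :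
    ∃ h : U r, ∀ a : OrbPi1 (seifertInv τL) (seifertInv_involutive τL) (p, e),
      character hσ hA' hB D' hr b' a =
        ⟨h, 1⟩ * character hσ hA hB D hr b a * (⟨h, 1⟩ : ExtUnitary r c)⁻¹ := by
  obtain ⟨u, hu, huτ, huA⟩ := hg
  refine ⟨toU ((b.symm.trans (u p.1.1)).trans b').toLinearIsometry, fun a => ?_⟩
  set h := toU ((b.symm.trans (u p.1.1)).trans b').toLinearIsometry with hh
  have hact : ∀ w, (⟨h, 1⟩ : ExtUnitary r c).act w = b' (u p.1.1 (b.symm w)) := fun w =>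
    actU_toU _ w
  rw [eq_mul_inv_iff_mul_eq]
  obtain ⟨s, η, hη⟩ := exists_orbClass_eq _ (seifertInv_involutive τL)
    (continuous_seifertInv τL) a
  obtain ⟨hs, h1⟩ := (isHol_character (b := b) hσ hA hB D hr a).apply D hr hη
  obtain ⟨hs', h1'⟩ := (isHol_character (b := b') hσ hA' hB D' hr a).apply D' hr hη
  refine ExtUnitary.ext_act ?_ fun w => ?_
  · rw [ExtUnitary.mul_def, ExtUnitary.mul_def, hs, hs', mul_one, one_mul]
  · obtain ⟨w', hw'⟩ := exists_holRel (τ := τ) hσ D hr η (b.symm w)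
    have h2 := h1 _ w' hw'
    have h3 := h1' _ _ (hw'.gauge (A := A.toMetric) (A' := A'.toMetric) hu huτ huA)
    rw [ExtUnitary.act_mul, ExtUnitary.act_mul, cocycleC_one_left, cocycleC_one_right, one_smul,
      one_smul, hact, ← h3, hact]
    rw [LinearIsometryEquiv.apply_symm_apply] at h2
    rw [← h2, LinearIsometryEquiv.symm_apply_apply]

/-- The characters of projectively flat connections, for a given auxiliary connection on `L`. -/
theorem exists_characters (hσ : IsRealStructure σ) (hr : 0 < r) (hB : ConjRel hσ τL B B)
    (hBf : HasContinuousForms B)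
    (κ : ∀ x : M, TangentSpace 𝓘(ℝ, ℂ) x → TangentSpace 𝓘(ℝ, ℂ) x → ℂ)
    (hD : ∀ A : UnitaryConnection r E, A.IsGaloisInvariant τ → A.HasCentralCurvature κ →
      Nonempty (FlatAtlas A.toMetric B)) :
    ∃ (z : ∀ s : ℤˣ, Path (p, e) (diagAct (seifertInv τL) s (p, e)) → Circle)
      (χ : (E p.1.proj ≃ₗᵢ[ℂ] Cn r) →
        {A : UnitaryConnection r E // A.IsGaloisInvariant τ ∧ A.HasCentralCurvature κ} →
        (OrbPi1 (seifertInv τL) (seifertInv_involutive τL) (p, e) →* ExtUnitary r c)),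
      (∀ b A,
        (∀ a, (χ b A a).sgn = augmentation (seifertInv τL) (seifertInv_involutive τL) a) ∧
        (∀ n : ℤ, χ b A (orbClass (seifertInv τL) (seifertInv_involutive τL)
            (fibreLoop τL p e) ^ n) =
          ⟨scalarU r (Circle.exp (2 * Real.pi * n / r)), 1⟩) ∧
        (∀ (s : ℤˣ) (η : Path (p, e) (diagAct (seifertInv τL) s (p, e))),
          IsPiecewiseC1 (baseCurve η) →
          ∃ g : U r, A.1.IsExtendedHolonomy τ b (baseCurve η) s g ∧
            χ b A (orbClass (seifertInv τL) (seifertInv_involutive τL) η) =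
              ⟨scalarU r (z s η) * g, s⟩)) ∧
      (∀ b b' A A', GaugeEquivalent τ A.1 A'.1 →
        ∃ h : U r, ∀ a, χ b' A' a = ⟨h, 1⟩ * χ b A a * (⟨h, 1⟩ : ExtUnitary r c)⁻¹) := by
  classical
  have hζ : ∀ (s : ℤˣ) (η : Path (p, e) (diagAct (seifertInv τL) s (p, e))), ∃ ζ : Circle,
      IsPiecewiseC1 (baseCurve η) → ∀ (A : UnitaryConnection r E) (a b : TotalSpace (Cn r) E),
        Transports A.toMetric B (fun t => (η t).1) a b → ∃ l : ℝ → TotalSpace (Cn r) E,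
          A.IsHorizontalLift (baseCurve η) l ∧ l 0 = a ∧
          b = TotalSpace.mk' (Cn r) (l 1).1 ((ζ : ℂ) • (l 1).2) := by
    intro s η
    by_cases h : IsPiecewiseC1 (baseCurve η)
    · obtain ⟨ζ, h1⟩ := exists_transport_phase (E := E) hr hBf (continuous_path_fst η) h
      exact ⟨ζ, fun _ => h1⟩
    -- Paths whose projection is not piecewise `C¹` receive the default value `1`.
    · exact ⟨1, fun h' => absurd h' h⟩
  choose ζ hζ using hζ
  -- For `s = σ` the antilinearity of `τ` conjugates the unit complex number, hence the inverse.
  refine ⟨fun s η => if s = 1 then ζ s η else (ζ s η)⁻¹, fun b A =>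
    character hσ (A.2.1.conjRel hσ τ) hB (hD A.1 A.2.1 A.2.2).some hr b, fun b A =>
    ⟨character_sgn hσ _ hB _ hr, character_fibreLoop hσ _ hB _ hr, fun s η hη =>
      exists_isExtendedHolonomy hσ hr _ hB _ η rfl (hζ s η hη A.1)⟩, fun b b' A A' hg =>
    exists_conj_character hσ hr _ _ hB _ _ hg⟩

end Characters

/-! ### Planar calculus with compact supports -/

section Planar

open MeasureTheory

/-- The primitive is a convolution with the indicator function of `[0, ∞)`, so joint smoothness
follows from smoothness of convolutions with parameters. -/
theorem contDiff_primitive {g : ℝ → ℝ → ℂ} (hg : ContDiff ℝ ∞ (fun q : ℝ × ℝ => g q.1 q.2))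
    {a b : ℝ} (h0 : ∀ y t, t ∉ Icc a b → g y t = 0) :
    ContDiff ℝ ∞ (fun q : ℝ × ℝ => ∫ t in Iic q.2, g q.1 t) := by
  have hf : LocallyIntegrable (indicator (Ici (0 : ℝ)) (fun _ => (1 : ℝ))) volume :=
    (locallyIntegrable_const 1).indicator measurableSet_Ici
  have h := contDiffOn_convolution_right_with_param (n := ⊤) (ContinuousLinearMap.lsmul ℝ ℝ)
    (g := g) (s := univ) (k := Icc a b) isOpen_univ isCompact_Icc (fun y t _ ht => h0 y t ht) hf
    (by simpa [Function.HasUncurry.uncurry] using hg.contDiffOn)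
  rw [univ_prod_univ, contDiffOn_univ] at h
  convert h using 2 with q
  rw [convolution_eq_swap, ← integral_indicator measurableSet_Iic]
  congr 1
  funext t
  by_cases ht : t ≤ q.2 <;> simp [indicator, ht]

theorem integrable_of_continuous_of_vanishing {f : ℝ → ℂ} (hf : Continuous f) {a b : ℝ}
    (h0 : ∀ t, t ∉ Icc a b → f t = 0) : Integrable f :=
  hf.integrable_of_hasCompactSupport (HasCompactSupport.intro isCompact_Icc h0)

theorem hasDerivAt_primitive {f : ℝ → ℂ} (hf : Continuous f) {a b : ℝ}
    (h0 : ∀ t, t ∉ Icc a b → f t = 0) (x : ℝ) :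
    HasDerivAt (fun x => ∫ t in Iic x, f t) (f x) x := by
  have hi := integrable_of_continuous_of_vanishing hf h0
  have h := (intervalIntegral.integral_hasDerivAt_right (hf.intervalIntegrable 0 x)
    hf.stronglyMeasurable.stronglyMeasurableAtFilter hf.continuousAt).add_const
      (∫ t in Iic (0 : ℝ), f t)
  refine h.congr_of_eventuallyEq (Filter.Eventually.of_forall fun y => ?_)
  beta_reduce
  rw [← intervalIntegral.integral_Iic_sub_Iic hi.integrableOn hi.integrableOn, sub_add_cancel]

theorem primitive_eq_zero {f : ℝ → ℂ} {a b : ℝ} (h0 : ∀ t, t ∉ Icc a b → f t = 0) {x : ℝ}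
    (hx : x < a) : ∫ t in Iic x, f t = 0 :=
  setIntegral_eq_zero_of_forall_eq_zero fun t ht => h0 t fun h => by
    linarith [h.1, mem_Iic.1 ht]

theorem primitive_eq_integral {f : ℝ → ℂ} {a b : ℝ} (h0 : ∀ t, t ∉ Icc a b → f t = 0) {x : ℝ}
    (hx : b ≤ x) : ∫ t in Iic x, f t = ∫ t, f t :=
  setIntegral_eq_integral_of_forall_compl_eq_zero fun t ht => h0 t fun h => by
    have := not_le.1 (fun h' => ht (mem_Iic.2 h'))
    linarith [h.2]

theorem integral_complex_eq_iterated {f : ℂ → ℂ} (hf : Integrable f) :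
    ∫ z, f z = ∫ y : ℝ, ∫ x : ℝ, f ⟨x, y⟩ := by
  have hm := Complex.volume_preserving_equiv_real_prod.symm
  rw [← hm.integral_comp Complex.measurableEquivRealProd.symm.measurableEmbedding]
  have hi : Integrable (fun p : ℝ × ℝ => f (Complex.measurableEquivRealProd.symm p)) :=
    (hm.integrable_comp_emb Complex.measurableEquivRealProd.symm.measurableEmbedding).2 hf
  rw [Measure.volume_eq_prod] at hi ⊢
  rw [integral_prod_symm _ hi]
  rfl

/-- The `1`-form `a · ℓ`, for a complex number `a` and a real-linear form `ℓ`. -/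
def scaleForm (l : ℂ →L[ℝ] ℂ) : ℂ →L[ℝ] (ℂ →L[ℝ] ℂ) :=
  ((ContinuousLinearMap.compL ℝ ℂ ℂ ℂ).flip l).comp (ContinuousLinearMap.mul ℝ ℂ)

theorem scaleForm_apply (l : ℂ →L[ℝ] ℂ) (a v : ℂ) : scaleForm l a v = a * l v := rfl

theorem curl_scaleForm {P Q : ℂ → ℂ} {z : ℂ} {P' Q' : ℂ →L[ℝ] ℂ} (hP : HasFDerivAt P P' z)
    (hQ : HasFDerivAt Q Q' z) :
    curl (fun z => scaleForm (Complex.ofRealCLM.comp Complex.reCLM) (P z) +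
      scaleForm (Complex.ofRealCLM.comp Complex.imCLM) (Q z)) z = Q' 1 - P' Complex.I := by
  have h1 := (scaleForm (Complex.ofRealCLM.comp Complex.reCLM)).hasFDerivAt.comp z hP
  have h2 := (scaleForm (Complex.ofRealCLM.comp Complex.imCLM)).hasFDerivAt.comp z hQ
  have h := HasFDerivAt.fun_add h1 h2
  rw [curl]
  simp only [Function.comp_def] at h
  rw [h.fderiv]
  simp [scaleForm_apply]

/-- Reads partial derivatives off one-variable derivatives along lines. -/
theorem fderiv_apply_eq_of_line {f : ℂ → ℂ} {z : ℂ} {f' : ℂ →L[ℝ] ℂ} {d : ℂ}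
    (hf : HasFDerivAt f f' z) (v : ℂ) (h : HasDerivAt (fun t : ℝ => f (z + t • v)) d 0) :
    f' v = d := by
  have hl : HasLineDerivAt ℝ f (f' v) z v := hf.hasLineDerivAt v
  exact HasDerivAt.unique hl h

/-- The Poincaré lemma with compact supports in degree two. Integrate in `x` after subtracting a
bump carrying the fibre integral, then integrate the fibre integral in `y`; vanishing of the total
integral keeps the second primitive supported in the box. -/
theorem exists_planar_primitive {h : ℂ → ℂ} (hh : ContDiff ℝ ∞ h) {a a' b b' : ℝ} (ha : a < a')
    (h0 : ∀ z, z ∉ Icc a a' ×ℂ Icc b b' → h z = 0) (hi : ∫ z, h z = 0) :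
    ∃ α : ℂ → ℂ →L[ℝ] ℂ, ContDiff ℝ ∞ α ∧ (∀ z, z ∉ Icc a a' ×ℂ Icc b b' → α z = 0) ∧
      ∀ z, curl α z = h z := by
  have hmk : ContDiff ℝ ∞ (fun q : ℝ × ℝ => (⟨q.2, q.1⟩ : ℂ)) :=
    Complex.equivRealProdCLM.symm.contDiff.comp (contDiff_snd.prodMk contDiff_fst)
  have hg : ContDiff ℝ ∞ (fun q : ℝ × ℝ => h ⟨q.2, q.1⟩) := hh.comp hmk
  have hg0 : ∀ y t : ℝ, t ∉ Icc a a' → h ⟨t, y⟩ = 0 := fun y t ht =>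
    h0 _ fun hm => ht (Complex.mem_reProdIm.1 hm).1
  have hg1 : ∀ y t : ℝ, y ∉ Icc b b' → h ⟨t, y⟩ = 0 := fun y t ht =>
    h0 _ fun hm => ht (Complex.mem_reProdIm.1 hm).2
  -- the fibre integral
  let H : ℝ → ℂ := fun y => ∫ t, h ⟨t, y⟩
  have hHs : ContDiff ℝ ∞ H := by
    have h1 := (contDiff_primitive (g := fun y t => h ⟨t, y⟩) hg hg0).comp
      (contDiff_id.prodMk (contDiff_const (c := a')) : ContDiff ℝ ∞ (fun y : ℝ => (y, a')))
    convert h1 using 1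
    funext y
    exact (primitive_eq_integral (hg0 y) le_rfl).symm
  have hH0 : ∀ y, y ∉ Icc b b' → H y = 0 := fun y hy => by
    simp only [H, hg1 y _ hy, integral_zero]
  have hHi : ∫ y, H y = 0 := by
    rw [← hi, integral_complex_eq_iterated]
    exact hh.continuous.integrable_of_hasCompactSupport
      (HasCompactSupport.intro (isCompact_Icc.reProdIm isCompact_Icc) h0)
  -- a bump function of integral one
  obtain ⟨ψ, hψ, hψ0, hψi⟩ : ∃ ψ : ℝ → ℂ, ContDiff ℝ ∞ ψ ∧ (∀ t, t ∉ Icc a a' → ψ t = 0) ∧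
      ∫ t, ψ t = 1 := by
    let f : ContDiffBump ((a + a') / 2) :=
      ⟨(a' - a) / 4, (a' - a) / 2, by linarith, by linarith⟩
    refine ⟨fun t => (f.normed volume t : ℂ), ?_, fun t ht => ?_, ?_⟩
    · exact Complex.ofRealCLM.contDiff.comp (f.contDiff_normed (n := ⊤))
    · have : t ∉ Function.support (f.normed volume) := by
        rw [f.support_normed_eq, Real.ball_eq_Ioo]
        intro h
        refine ht ⟨?_, ?_⟩
        · have := h.1; simp only [f] at this; linarith
        · have := h.2; simp only [f] at this; linarith
      simp [Function.notMem_support.1 this]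
    · rw [integral_complex_ofReal, f.integral_normed, Complex.ofReal_one]
  -- Each row of `k` has integral zero, so its primitive in `t` vanishes on both sides of the box.
  let k : ℝ → ℝ → ℂ := fun y t => h ⟨t, y⟩ - ψ t * H y
  have hk : ContDiff ℝ ∞ (fun q : ℝ × ℝ => k q.1 q.2) :=
    hg.sub ((hψ.comp contDiff_snd).mul (hHs.comp contDiff_fst))
  have hk0 : ∀ y t, t ∉ Icc a a' → k y t = 0 := fun y t ht => by
    simp only [k, hg0 y t ht, hψ0 t ht]; simp
  have hkc : ∀ y, Continuous (k y) := fun y =>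
    hk.continuous.comp (continuous_const.prodMk continuous_id)
  let Q : ℂ → ℂ := fun z => ∫ t in Iic z.re, k z.im t
  let K : ℝ → ℂ := fun y => ∫ t in Iic y, H t
  -- The form is `P dx + Q dy`: here `∂Q/∂x = h - ψ H` and `-∂P/∂y = ψ H`.
  let P : ℂ → ℂ := fun z => -(ψ z.re * K z.im)
  have hQ : ContDiff ℝ ∞ Q := (contDiff_primitive hk hk0).comp
    (Complex.imCLM.contDiff.prodMk Complex.reCLM.contDiff)
  have hK : ContDiff ℝ ∞ K :=
    (contDiff_primitive (g := fun _ t => H t) (hHs.comp contDiff_snd) (fun _ => hH0)).comp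
      ((contDiff_const (c := (0 : ℝ))).prodMk contDiff_id)
  have hP : ContDiff ℝ ∞ P :=
    ((hψ.comp Complex.reCLM.contDiff).mul (hK.comp Complex.imCLM.contDiff)).neg
  refine ⟨fun z => scaleForm (Complex.ofRealCLM.comp Complex.reCLM) (P z) +
      scaleForm (Complex.ofRealCLM.comp Complex.imCLM) (Q z),
    ((scaleForm _).contDiff.comp hP).add ((scaleForm _).contDiff.comp hQ), fun z hz => ?_,
    fun z => ?_⟩
  · have hPQ : P z = 0 ∧ Q z = 0 := by
      by_cases h1 : z.re ∈ Icc a a'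
      · have h2 : z.im ∉ Icc b b' := fun h2 => hz (Complex.mem_reProdIm.2 ⟨h1, h2⟩)
        constructor
        · have : K z.im = 0 := by
            by_cases h3 : z.im < b
            · exact primitive_eq_zero hH0 h3
            · have h4 : b' ≤ z.im := by
                by_contra h5
                exact h2 ⟨not_lt.1 h3, (not_le.1 h5).le⟩
              exact (primitive_eq_integral hH0 h4).trans hHi
          simp [P, this]
        · have : ∀ t, k z.im t = 0 := fun t => by
            simp only [k, hg1 _ t h2, hH0 _ h2]; simp
          simp [Q, this]
      · refine ⟨by simp [P, hψ0 _ h1], ?_⟩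
        by_cases h3 : z.re < a
        · exact primitive_eq_zero (hk0 _) h3
        · have h4 : a' ≤ z.re := by
            by_contra h5
            exact h1 ⟨not_lt.1 h3, (not_le.1 h5).le⟩
          refine (primitive_eq_integral (hk0 _) h4).trans ?_
          have hc : Continuous (fun t : ℝ => h ⟨t, z.im⟩) :=
            hg.continuous.comp ((continuous_const (y := z.im)).prodMk continuous_id)
          simp only [k]
          rw [integral_sub (integrable_of_continuous_of_vanishing hc (hg0 _))
            ((integrable_of_continuous_of_vanishing hψ.continuous hψ0).mul_const _),
            integral_mul_const, hψi, one_mul, sub_self]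
    simp [hPQ.1, hPQ.2]
  · have hPd := (hP.differentiable (by simp) z).hasFDerivAt
    have hQd := (hQ.differentiable (by simp) z).hasFDerivAt
    rw [curl_scaleForm hPd hQd]
    have e1 : fderiv ℝ Q z 1 = k z.im z.re := by
      refine fderiv_apply_eq_of_line hQd 1 ?_
      have h1 := hasDerivAt_primitive (hkc z.im) (hk0 z.im) (z.re + 0)
      have h2 := HasDerivAt.comp_const_add (f := fun x => ∫ t in Iic x, k z.im t) z.re 0 h1
      rw [add_zero] at h2
      simpa [Q] using h2
    have e2 : fderiv ℝ P z Complex.I = -(ψ z.re * H z.im) := by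
      refine fderiv_apply_eq_of_line hPd Complex.I ?_
      have h1 := hasDerivAt_primitive hHs.continuous hH0 (z.im + 0)
      have h2 := HasDerivAt.comp_const_add (f := fun x => ∫ t in Iic x, H t) z.im 0 h1
      rw [add_zero] at h2
      have h3 := (h2.const_mul (ψ z.re)).fun_neg
      simpa [P, K] using h3
    rw [e1, e2]
    simp only [k, sub_neg_eq_add, sub_add_cancel]

/-- Integration by parts against the constant function `1`. -/
theorem integral_fderiv_eq_zero {f : ℂ → ℂ} (hf : ContDiff ℝ ∞ f) (hc : HasCompactSupport f)
    (v : ℂ) : ∫ z, fderiv ℝ f z v = 0 := by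
  have hd : Continuous (fun z => fderiv ℝ f z v) :=
    (hf.continuous_fderiv (by simp)).clm_apply continuous_const
  have hi : Integrable (fun z => fderiv ℝ f z v) :=
    hd.integrable_of_hasCompactSupport (hc.fderiv_apply (𝕜 := ℝ) v)
  have h := integral_bilinear_hasFDerivAt_right_eq_neg_left_of_integrable (μ := volume)
    (f := fun _ : ℂ => (1 : ℂ)) (f' := fun _ => 0) (g := f) (g' := fderiv ℝ f) (v := v)
    (B := ContinuousLinearMap.mul ℝ ℂ) (by simp)
    (by simpa using hi) (by simpa using hf.continuous.integrable_of_hasCompactSupport hc)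
    (fun x _ => hasFDerivAt_const _ _)
    (fun x _ => (hf.differentiable (by simp) x).hasFDerivAt)
  simpa using h

theorem integral_curl_eq_zero {α : ℂ → ℂ →L[ℝ] ℂ} (hα : ContDiff ℝ ∞ α)
    (hc : HasCompactSupport α) : ∫ z, curl α z = 0 := by
  have key : ∀ u v : ℂ, ∫ z, fderiv ℝ α z u v = 0 ∧
      Integrable (fun z => fderiv ℝ α z u v) := by
    intro u v
    have h1 : ContDiff ℝ ∞ (fun z => α z v) := hα.clm_apply contDiff_const
    have h2 : HasCompactSupport (fun z => α z v) := hc.comp_left (g := fun l : ℂ →L[ℝ] ℂ => l v)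
      (by simp)
    have e : (fun z => fderiv ℝ α z u v) = fun z => fderiv ℝ (fun z => α z v) z u := by
      funext z
      rw [fderiv_clm_apply (hα.differentiable (by simp) z) (differentiableAt_const v)]
      simp
    rw [e]
    refine ⟨integral_fderiv_eq_zero h1 h2 u, ?_⟩
    exact ((h1.continuous_fderiv (by simp)).clm_apply
      continuous_const).integrable_of_hasCompactSupport (h2.fderiv_apply (𝕜 := ℝ) u)
  simp only [curl]
  rw [integral_sub (key _ _).2 (key _ _).2, (key _ _).1, (key _ _).1, sub_zero]

theorem integrableOn_of_vanishing {F : ℂ → ℂ} {T K : Set ℂ} (hF : ContinuousOn F T)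
    (hT : IsOpen T) (hK : IsCompact K) (hKT : K ⊆ T) (h0 : ∀ z ∈ T, z ∉ K → F z = 0) :
    IntegrableOn F T := by
  have h := (hF.mono hKT).integrableOn_compact (μ := volume) hK
  exact h.of_forall_sdiff_eq_zero hT.measurableSet fun z hz => h0 z hz.1 hz.2

theorem contDiff_indicator {F : Type*} [NormedAddCommGroup F] [NormedSpace ℝ F] {f : ℂ → F}
    {T K : Set ℂ} (hf : ContDiffOn ℝ ∞ f T) (hT : IsOpen T) (hK : IsClosed K) (hKT : K ⊆ T)
    (h0 : ∀ z ∈ T, z ∉ K → f z = 0) : ContDiff ℝ ∞ (T.indicator f) := by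
  rw [contDiff_iff_contDiffAt]
  intro z
  by_cases hz : z ∈ T
  · refine (hf.contDiffAt (hT.mem_nhds hz)).congr_of_eventuallyEq ?_
    filter_upwards [hT.mem_nhds hz] with w hw using indicator_of_mem hw f
  · refine (contDiffAt_const (c := (0 : F))).congr_of_eventuallyEq ?_
    filter_upwards [hK.isOpen_compl.mem_nhds (fun h => hz (hKT h))] with w hw
    by_cases hwT : w ∈ T
    · rw [indicator_of_mem hwT, h0 w hwT hw]
    · rw [indicator_of_notMem hwT]

/-- The Jacobian determinant of a real-linear endomorphism of the plane. -/
def jac (T : ℂ →L[ℝ] ℂ) : ℝ := area (T 1) (T Complex.I)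

theorem area_map (T : ℂ →L[ℝ] ℂ) (u v : ℂ) : area (T u) (T v) = jac T * area u v := by
  have h := eq_area_smul_of_alternating (fun u v => area (T u) (T v))
    (fun u u' v => by simp [area]; ring) (fun a u v => by
      rw [map_smul]; simp [area]; ring)
    (fun u v => by simp [area]; ring) u v
  simpa [jac, mul_comm] using h

theorem area_one_I : area 1 Complex.I = 1 := by simp [area]

theorem jac_comp (S T : ℂ →L[ℝ] ℂ) : jac (S.comp T) = jac S * jac T := by
  rw [jac, ContinuousLinearMap.comp_apply, ContinuousLinearMap.comp_apply, area_map]; rfl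

theorem jac_id : jac (ContinuousLinearMap.id ℝ ℂ) = 1 := area_one_I

theorem det_eq_jac (T : ℂ →L[ℝ] ℂ) : T.det = jac T := by
  rw [ContinuousLinearMap.det, ← LinearMap.det_toMatrix Complex.basisOneI, Matrix.det_fin_two]
  simp [LinearMap.toMatrix_apply, jac, area]
  ring

theorem jac_ne_zero {T : ℂ →L[ℝ] ℂ} (hT : T.IsInvertible) : jac T ≠ 0 := by
  obtain ⟨e, rfl⟩ := hT
  have h := jac_comp (e.symm : ℂ →L[ℝ] ℂ) (e : ℂ →L[ℝ] ℂ)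
  rw [ContinuousLinearEquiv.coe_symm_comp_coe, jac_id] at h
  exact right_ne_zero_of_mul (h ▸ one_ne_zero)

theorem contDiff_jac : ContDiff ℝ ∞ jac := by
  have h : ∀ (u : ℂ), ContDiff ℝ ∞ (fun T : ℂ →L[ℝ] ℂ => T u) := fun u =>
    contDiff_id.clm_apply contDiff_const
  exact ((Complex.reCLM.contDiff.comp (h 1)).mul (Complex.imCLM.contDiff.comp (h Complex.I))).sub
    ((Complex.imCLM.contDiff.comp (h 1)).mul (Complex.reCLM.contDiff.comp (h Complex.I)))

/-- The exterior derivative commutes with pull-back: the terms with second derivatives of `φ` cancel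
by symmetry. -/
theorem curl_pullback {α : ℂ → ℂ →L[ℝ] ℂ} {φ : ℂ → ℂ} {z : ℂ} (hα : DifferentiableAt ℝ α (φ z))
    (hφ : ContDiffAt ℝ ∞ φ z) :
    curl (fun w => (α (φ w)).comp (fderiv ℝ φ w)) z = curl α (φ z) * jac (fderiv ℝ φ z) := by
  have hφd := (hφ.differentiableAt (by simp)).hasFDerivAt
  have hφ2 : DifferentiableAt ℝ (fderiv ℝ φ) z :=
    (hφ.fderiv_right (m := 1) (by norm_cast)).differentiableAt (by simp)
  have hsymm : IsSymmSndFDerivAt ℝ φ z := by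
    refine hφ.isSymmSndFDerivAt ?_
    simp only [minSmoothness_of_isRCLikeNormedField]
    norm_cast
  have h : HasFDerivAt (fun w => (α (φ w)).comp (fderiv ℝ φ w)) _ z :=
    HasFDerivAt.clm_comp (hα.hasFDerivAt.comp z hφd) hφ2.hasFDerivAt
  have hs := hsymm 1 Complex.I
  have ha := fderiv_antisymm_eq_area α (φ z) (fderiv ℝ φ z 1) (fderiv ℝ φ z Complex.I)
  rw [curl, h.fderiv]
  simp only [add_apply, ContinuousLinearMap.comp_apply,
    ContinuousLinearMap.compL_apply, ContinuousLinearMap.flip_apply]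
  rw [hs]
  rw [jac, mul_comm, ← Complex.real_smul, ← ha]
  simp

end Planar

/-! ### Differential forms on a compact surface -/

section Forms

open MeasureTheory

variable {M : Type*} [TopologicalSpace M] [ChartedSpace ℂ M] [IsManifold 𝓘(ℂ, ℂ) ω M]

/-- The change of coordinates from the chart at `c` to the chart at `c'`. -/
def chartChange (c c' : M) (z : ℂ) : ℂ := chartAt ℂ c' ((chartAt ℂ c).symm z)

/-- The domain of the change of coordinates from the chart at `c` to the chart at `c'`. -/
def overlap (c c' : M) : Set ℂ :=
  (chartAt ℂ c).target ∩ (chartAt ℂ c).symm ⁻¹' (chartAt ℂ c').source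

theorem isOpen_overlap (c c' : M) : IsOpen (overlap c c') :=
  (chartAt ℂ c).isOpen_inter_preimage_symm (chartAt ℂ c').open_source

theorem contDiffOn_complex_chartChange (c c' : M) :
    ContDiffOn ℂ ω (chartChange c c') (overlap c c') := by
  have h := (contDiffGroupoid ω 𝓘(ℂ, ℂ)).compatible (chart_mem_atlas ℂ c) (chart_mem_atlas ℂ c')
  rw [contDiffGroupoid, mem_groupoid_of_pregroupoid] at h
  have h1 := h.1
  simp only [contDiffPregroupoid, modelWithCornersSelf_coe, modelWithCornersSelf_coe_symm,
    range_id, inter_univ, preimage_id, Function.id_comp, Function.comp_id,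
    OpenPartialHomeomorph.trans_source, OpenPartialHomeomorph.symm_source] at h1
  exact h1

theorem contDiffAt_chartChange {c c' : M} {z : ℂ} (hz : z ∈ overlap c c') :
    ContDiffAt ℝ ∞ (chartChange c c') z :=
  ((contDiffOn_complex_chartChange c c').restrict_scalars ℝ |>.of_le le_top).contDiffAt
    ((isOpen_overlap c c').mem_nhds hz)

theorem chartChange_mem_overlap {c c' : M} {z : ℂ} (hz : z ∈ overlap c c') :
    chartChange c c' z ∈ overlap c' c :=
  ⟨(chartAt ℂ c').map_source hz.2, by
    rw [mem_preimage, chartChange, (chartAt ℂ c').left_inv hz.2]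
    exact (chartAt ℂ c).map_target hz.1⟩

theorem chartAt_symm_chartChange {c c' : M} {z : ℂ} (hz : z ∈ overlap c c') :
    (chartAt ℂ c').symm (chartChange c c' z) = (chartAt ℂ c).symm z :=
  (chartAt ℂ c').left_inv hz.2

theorem chartChange_chartChange {c c' : M} {z : ℂ} (hz : z ∈ overlap c c') :
    chartChange c' c (chartChange c c' z) = z := by
  rw [chartChange, chartAt_symm_chartChange hz, (chartAt ℂ c).right_inv hz.1]

theorem image_chartChange (c c' : M) : chartChange c c' '' overlap c c' = overlap c' c := by
  refine Subset.antisymm (image_subset_iff.2 fun z hz => chartChange_mem_overlap hz) ?_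
  intro w hw
  exact ⟨chartChange c' c w, chartChange_mem_overlap hw, chartChange_chartChange hw⟩

theorem injOn_chartChange (c c' : M) : InjOn (chartChange c c') (overlap c c') := by
  intro z hz w hw h
  rw [← chartChange_chartChange hz, h, chartChange_chartChange hw]

theorem mfd_chart_comp_dchart (c : M) {z : ℂ} (hz : z ∈ (chartAt ℂ c).target) :
    (mfd (chartAt ℂ c) ((chartAt ℂ c).symm z)).comp (dchart c z) =
      ContinuousLinearMap.id ℝ ℂ := by
  have h := hasFDerivAt_mfd c hz (mdifferentiableAt_chart c ((chartAt ℂ c).map_target hz))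
  refine HasFDerivAt.unique h ((hasFDerivAt_id (𝕜 := ℝ) z).congr_of_eventuallyEq ?_)
  filter_upwards [(chartAt ℂ c).open_target.mem_nhds hz] with w hw using
    (chartAt ℂ c).right_inv hw

theorem dchart_comp_mfd_chart (c : M) {x : M} (hx : x ∈ (chartAt ℂ c).source) :
    (dchart c (chartAt ℂ c x)).comp (mfd (chartAt ℂ c) x) = ContinuousLinearMap.id ℝ ℂ := by
  have h := mfd_chart_comp_dchart c ((chartAt ℂ c).map_source hx)
  rw [(chartAt ℂ c).left_inv hx] at h
  obtain ⟨e, he⟩ := isInvertible_dchart c ((chartAt ℂ c).map_source hx)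
  rw [← he] at h ⊢
  ext1 v
  simpa using congrArg e (DFunLike.congr_fun h (e.symm v))

theorem fderiv_chartChange {c c' : M} {z : ℂ} (hz : z ∈ overlap c c') :
    fderiv ℝ (chartChange c c') z =
      (mfd (chartAt ℂ c') ((chartAt ℂ c).symm z)).comp (dchart c z) :=
  (hasFDerivAt_mfd c hz.1 (mdifferentiableAt_chart c' hz.2)).fderiv

theorem dchart_eq_comp {c c' : M} {z : ℂ} (hz : z ∈ overlap c c') :
    dchart c z = (dchart c' (chartChange c c' z)).comp (fderiv ℝ (chartChange c c') z) := by
  rw [fderiv_chartChange hz, ← ContinuousLinearMap.comp_assoc, chartChange,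
    dchart_comp_mfd_chart c' hz.2, ContinuousLinearMap.id_comp]

/-- Coordinate changes are holomorphic, and the Jacobian determinant of a holomorphic map is
`|φ'|²`. This orientation lets densities transform without absolute values. -/
theorem jac_chartChange_nonneg {c c' : M} {z : ℂ} (hz : z ∈ overlap c c') :
    0 ≤ jac (fderiv ℝ (chartChange c c') z) := by
  have h : DifferentiableAt ℂ (chartChange c c') z :=
    ((contDiffOn_complex_chartChange c c').contDiffAt
      ((isOpen_overlap c c').mem_nhds hz)).differentiableAt (by simp)
  rw [h.fderiv_restrictScalars ℝ, jac]
  have e : (fderiv ℂ (chartChange c c') z) Complex.I =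
      Complex.I * fderiv ℂ (chartChange c c') z 1 := by
    rw [← smul_eq_mul, ← map_smul, smul_eq_mul, mul_one]
  simp only [ContinuousLinearMap.coe_restrictScalars', e, area]
  simp only [Complex.mul_im, Complex.mul_re, Complex.I_re, Complex.I_im]
  nlinarith [sq_nonneg (fderiv ℂ (chartChange c c') z 1).re,
    sq_nonneg (fderiv ℂ (chartChange c c') z 1).im]

theorem pull_eq_comp (β : M → ℂ →L[ℝ] ℂ) {c c' : M} {z : ℂ} (hz : z ∈ overlap c c') :
    pull β c z =
      (pull β c' (chartChange c c' z)).comp (fderiv ℝ (chartChange c c') z) := by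
  rw [pull, pull, chartAt_symm_chartChange hz, ContinuousLinearMap.comp_assoc,
    ← dchart_eq_comp hz]

/-- The density, in the chart at `c`, of the `2`-form with coefficient `h`. -/
def dens (h : M → ℂ) (c : M) (z : ℂ) : ℂ := h ((chartAt ℂ c).symm z) * jac (dchart c z)

theorem dens_eq_mul (h : M → ℂ) {c c' : M} {z : ℂ} (hz : z ∈ overlap c c') :
    dens h c z = dens h c' (chartChange c c' z) * jac (fderiv ℝ (chartChange c c') z) := by
  rw [dens, dens, chartAt_symm_chartChange hz, dchart_eq_comp hz, jac_comp, Complex.ofReal_mul,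
    mul_assoc]

/-- Smooth complex-valued `2`-forms. -/
def SmoothDens (h : M → ℂ) : Prop := ∀ c : M, ContDiffOn ℝ ∞ (dens h c) (chartAt ℂ c).target

theorem contDiffAt_fderiv_chartChange {c c' : M} {z : ℂ} (hz : z ∈ overlap c c') :
    ContDiffAt ℝ ∞ (fderiv ℝ (chartChange c c')) z :=
  (contDiffAt_chartChange hz).fderiv_right (by simp)

/-- A coefficient `h` refers to the identification of each tangent space by the preferred chart, so
it need not be a smooth function; smoothness means smoothness of densities and can be tested in one
chart near each point. -/
theorem smoothDens_of_local {h : M → ℂ}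
    (H : ∀ y : M, ∃ c, y ∈ (chartAt ℂ c).source ∧ ContDiffAt ℝ ∞ (dens h c) (chartAt ℂ c y)) :
    SmoothDens h := by
  intro c z hz
  obtain ⟨c', hy, hs⟩ := H ((chartAt ℂ c).symm z)
  have hzo : z ∈ overlap c c' := ⟨hz, hy⟩
  refine ContDiffAt.contDiffWithinAt ?_
  have h2 : ContDiffAt ℝ ∞ (fun w => dens h c' (chartChange c c' w)) z :=
    ContDiffAt.comp (g := dens h c') z hs (contDiffAt_chartChange hzo)
  have h1 : ContDiffAt ℝ ∞ (fun w => dens h c' (chartChange c c' w) *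
      ((jac (fderiv ℝ (chartChange c c') w) : ℝ) : ℂ)) z :=
    h2.mul
      (Complex.ofRealCLM.contDiff.contDiffAt.comp z
        (contDiff_jac.contDiffAt.comp z (contDiffAt_fderiv_chartChange hzo)))
  refine h1.congr_of_eventuallyEq ?_
  filter_upwards [(isOpen_overlap c c').mem_nhds hzo] with w hw using dens_eq_mul h hw

theorem smoothForm_of_local {β : M → ℂ →L[ℝ] ℂ}
    (H : ∀ y : M, ∃ c, y ∈ (chartAt ℂ c).source ∧ ContDiffAt ℝ ∞ (pull β c) (chartAt ℂ c y)) :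
    SmoothForm β := by
  intro c z hz
  obtain ⟨c', hy, hs⟩ := H ((chartAt ℂ c).symm z)
  have hzo : z ∈ overlap c c' := ⟨hz, hy⟩
  refine ContDiffAt.contDiffWithinAt ?_
  have h2 : ContDiffAt ℝ ∞ (fun w => pull β c' (chartChange c c' w)) z :=
    ContDiffAt.comp (g := pull β c') z hs (contDiffAt_chartChange hzo)
  have h1 : ContDiffAt ℝ ∞ (fun w => (pull β c' (chartChange c c' w)).comp
      (fderiv ℝ (chartChange c c') w)) z :=
    h2.clm_comp (contDiffAt_fderiv_chartChange hzo)
  refine h1.congr_of_eventuallyEq ?_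
  filter_upwards [(isOpen_overlap c c').mem_nhds hzo] with w hw using pull_eq_comp β hw

theorem eventually_chart_symm {c y : M} (hy : y ∈ (chartAt ℂ c).source) {V : Set M}
    (hV : V ∈ 𝓝 y) : ∀ᶠ w in 𝓝 (chartAt ℂ c y), (chartAt ℂ c).symm w ∈ V := by
  have h := (chartAt ℂ c).continuousAt_symm ((chartAt ℂ c).map_source hy)
  rw [ContinuousAt, (chartAt ℂ c).left_inv hy] at h
  exact h hV

theorem smoothDens_of_chart {h : M → ℂ} {c : M} {K : Set M} (hK : IsClosed K)
    (hKc : K ⊆ (chartAt ℂ c).source) (h0 : ∀ y, y ∉ K → h y = 0)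
    (hs : ContDiffOn ℝ ∞ (dens h c) (chartAt ℂ c).target) : SmoothDens h := by
  refine smoothDens_of_local fun y => ?_
  by_cases hy : y ∈ (chartAt ℂ c).source
  · exact ⟨c, hy, hs.contDiffAt ((chartAt ℂ c).open_target.mem_nhds
      ((chartAt ℂ c).map_source hy))⟩
  · refine ⟨y, mem_chart_source ℂ y, (contDiffAt_const (c := (0 : ℂ))).congr_of_eventuallyEq ?_⟩
    filter_upwards [eventually_chart_symm (mem_chart_source ℂ y)
      (hK.isOpen_compl.mem_nhds fun h => hy (hKc h))] with w hw
    rw [dens, h0 _ hw, zero_mul]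

theorem smoothForm_of_chart {β : M → ℂ →L[ℝ] ℂ} {c : M} {K : Set M} (hK : IsClosed K)
    (hKc : K ⊆ (chartAt ℂ c).source) (h0 : ∀ y, y ∉ K → β y = 0)
    (hs : ContDiffOn ℝ ∞ (pull β c) (chartAt ℂ c).target) : SmoothForm β := by
  refine smoothForm_of_local fun y => ?_
  by_cases hy : y ∈ (chartAt ℂ c).source
  · exact ⟨c, hy, hs.contDiffAt ((chartAt ℂ c).open_target.mem_nhds
      ((chartAt ℂ c).map_source hy))⟩
  · refine ⟨y, mem_chart_source ℂ y,
      (contDiffAt_const (c := (0 : ℂ →L[ℝ] ℂ))).congr_of_eventuallyEq ?_⟩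
    filter_upwards [eventually_chart_symm (mem_chart_source ℂ y)
      (hK.isOpen_compl.mem_nhds fun h => hy (hKc h))] with w hw
    rw [pull, h0 _ hw, ContinuousLinearMap.zero_comp]

theorem contDiffOn_comp_chart_symm {f : M → ℂ} (hf : ContMDiff 𝓘(ℝ, ℂ) 𝓘(ℝ, ℂ) ∞ f) (c : M) :
    ContDiffOn ℝ ∞ (fun z => f ((chartAt ℂ c).symm z)) (chartAt ℂ c).target := fun z hz =>
  (contMDiffAt_iff_contDiffAt.1
    (hf.contMDiffAt.comp z (contMDiffAt_chart_symm c hz))).contDiffWithinAt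

theorem dens_mul (f h : M → ℂ) (c : M) (z : ℂ) :
    dens (fun y => f y * h y) c z = f ((chartAt ℂ c).symm z) * dens h c z := by
  rw [dens, dens, mul_assoc]

theorem SmoothDens.mul {f h : M → ℂ} (hf : ContMDiff 𝓘(ℝ, ℂ) 𝓘(ℝ, ℂ) ∞ f) (hh : SmoothDens h) :
    SmoothDens (fun y => f y * h y) := fun c => by
  simp only [funext (dens_mul f h c)]
  exact (contDiffOn_comp_chart_symm hf c).mul (hh c)

theorem dens_add (h k : M → ℂ) (c : M) (z : ℂ) :
    dens (fun y => h y + k y) c z = dens h c z + dens k c z := by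
  rw [dens, dens, dens, add_mul]

theorem SmoothDens.add {h k : M → ℂ} (hh : SmoothDens h) (hk : SmoothDens k) :
    SmoothDens (fun y => h y + k y) := fun c => by
  simp only [funext (dens_add h k c)]
  exact (hh c).add (hk c)

theorem SmoothDens.const_mul {h : M → ℂ} (a : ℂ) (hh : SmoothDens h) :
    SmoothDens (fun y => a * h y) :=
  SmoothDens.mul contMDiff_const hh

theorem pull_smul (f : M → ℂ) (β : M → ℂ →L[ℝ] ℂ) (c : M) (z : ℂ) :
    pull (fun y => f y • β y) c z = f ((chartAt ℂ c).symm z) • pull β c z := by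
  rw [pull, pull, ContinuousLinearMap.smul_comp]

theorem SmoothForm.smul {f : M → ℂ} {β : M → ℂ →L[ℝ] ℂ} (hf : ContMDiff 𝓘(ℝ, ℂ) 𝓘(ℝ, ℂ) ∞ f)
    (hβ : SmoothForm β) : SmoothForm (fun y => f y • β y) := fun c => by
  simp only [funext (pull_smul f β c)]
  exact (contDiffOn_comp_chart_symm hf c).smul (hβ c)

theorem pull_add (β γ : M → ℂ →L[ℝ] ℂ) (c : M) (z : ℂ) :
    pull (fun y => β y + γ y) c z = pull β c z + pull γ c z := by
  rw [pull, pull, pull, ContinuousLinearMap.add_comp]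

theorem SmoothForm.add {β γ : M → ℂ →L[ℝ] ℂ} (hβ : SmoothForm β) (hγ : SmoothForm γ) :
    SmoothForm (fun y => β y + γ y) := fun c => by
  simp only [funext (pull_add β γ c)]
  exact (hβ c).add (hγ c)

theorem smoothForm_zero : SmoothForm (fun _ : M => (0 : ℂ →L[ℝ] ℂ)) := fun c => by
  have h : pull (fun _ : M => (0 : ℂ →L[ℝ] ℂ)) c = fun _ => 0 := by
    funext z; rw [pull, ContinuousLinearMap.zero_comp]
  rw [h]
  exact contDiffOn_const

theorem curl_congr {α α' : ℂ → ℂ →L[ℝ] ℂ} {z : ℂ} (h : α =ᶠ[𝓝 z] α') : curl α z = curl α' z := by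
  rw [curl, curl, h.fderiv_eq]

theorem SmoothForm.differentiableAt {β : M → ℂ →L[ℝ] ℂ} (hβ : SmoothForm β) (c : M) {z : ℂ}
    (hz : z ∈ (chartAt ℂ c).target) : DifferentiableAt ℝ (pull β c) z :=
  ((hβ c).contDiffAt ((chartAt ℂ c).open_target.mem_nhds hz)).differentiableAt (by simp)

theorem SmoothForm.curl_pull {β : M → ℂ →L[ℝ] ℂ} (hβ : SmoothForm β) {c c' : M} {z : ℂ}
    (hz : z ∈ overlap c c') :
    curl (pull β c) z =
      curl (pull β c') (chartChange c c' z) * jac (fderiv ℝ (chartChange c c') z) := by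
  rw [← curl_pullback (hβ.differentiableAt c' (chartChange_mem_overlap hz).1)
    (contDiffAt_chartChange hz)]
  refine curl_congr ?_
  filter_upwards [(isOpen_overlap c c').mem_nhds hz] with w hw using pull_eq_comp β hw

/-- The exterior derivative of a `1`-form. -/
def dform (β : M → ℂ →L[ℝ] ℂ) (y : M) : ℂ :=
  curl (pull β y) (chartAt ℂ y y) / jac (dchart y (chartAt ℂ y y))

/-- `dform` is computed at each point in the preferred chart there; naturality of the curl shows
that it is right in every chart. -/
theorem SmoothForm.dens_dform {β : M → ℂ →L[ℝ] ℂ} (hβ : SmoothForm β) (c : M) {z : ℂ}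
    (hz : z ∈ (chartAt ℂ c).target) : dens (dform β) c z = curl (pull β c) z := by
  have hzo : z ∈ overlap c ((chartAt ℂ c).symm z) := ⟨hz, mem_chart_source ℂ _⟩
  rw [hβ.curl_pull hzo, dens, dchart_eq_comp hzo, jac_comp, dform, Complex.ofReal_mul, ← mul_assoc]
  have hj : jac (dchart ((chartAt ℂ c).symm z) (chartChange c ((chartAt ℂ c).symm z) z)) ≠ 0 :=
    jac_ne_zero (isInvertible_dchart _ (mem_chart_target ℂ _))
  congr 1
  exact div_mul_cancel₀ _ (Complex.ofReal_ne_zero.2 hj)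

theorem eq_of_dens_eq {h k : M → ℂ}
    (H : ∀ c, ∀ z ∈ (chartAt ℂ c).target, dens h c z = dens k c z) : h = k := by
  funext y
  have hj : jac (dchart y (chartAt ℂ y y)) ≠ 0 :=
    jac_ne_zero (isInvertible_dchart _ (mem_chart_target ℂ _))
  have h1 := H y _ (mem_chart_target ℂ y)
  simp only [dens, (chartAt ℂ y).left_inv (mem_chart_source ℂ y)] at h1
  exact mul_right_cancel₀ (Complex.ofReal_ne_zero.2 hj) h1

theorem contDiffOn_curl {α : ℂ → ℂ →L[ℝ] ℂ} {T : Set ℂ} (hT : IsOpen T)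
    (hα : ContDiffOn ℝ ∞ α T) : ContDiffOn ℝ ∞ (curl α) T := by
  have h := hα.fderiv_of_isOpen (m := ∞) hT (by simp)
  exact ((h.clm_apply contDiffOn_const).clm_apply contDiffOn_const).sub
    ((h.clm_apply contDiffOn_const).clm_apply contDiffOn_const)

theorem SmoothForm.smoothDens_dform {β : M → ℂ →L[ℝ] ℂ} (hβ : SmoothForm β) :
    SmoothDens (dform β) := by
  intro c
  exact (contDiffOn_curl (chartAt ℂ c).open_target (hβ c)).congr fun z hz => hβ.dens_dform c hz

theorem dform_add {β γ : M → ℂ →L[ℝ] ℂ} (hβ : SmoothForm β) (hγ : SmoothForm γ) :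
    dform (fun y => β y + γ y) = fun y => dform β y + dform γ y := by
  refine eq_of_dens_eq fun c z hz => ?_
  rw [dens_add, (hβ.add hγ).dens_dform c hz, hβ.dens_dform c hz, hγ.dens_dform c hz,
    funext (pull_add β γ c), curl, curl, curl,
    fderiv_fun_add (hβ.differentiableAt c hz) (hγ.differentiableAt c hz)]
  simp only [add_apply]
  ring

theorem dform_const_smul {β : M → ℂ →L[ℝ] ℂ} (hβ : SmoothForm β) (a : ℂ) :
    dform (fun y => a • β y) = fun y => a * dform β y := by
  refine eq_of_dens_eq fun c z hz => ?_
  have hs : SmoothForm (fun y => a • β y) := hβ.smul contMDiff_const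
  rw [dens_mul (fun _ => a), hs.dens_dform c hz, hβ.dens_dform c hz,
    funext (pull_smul (fun _ => a) β c), curl, curl,
    fderiv_fun_const_smul (hβ.differentiableAt c hz)]
  simp only [smul_apply, smul_eq_mul]
  ring

theorem dform_eq_zero {β : M → ℂ →L[ℝ] ℂ} {y : M} (h : ∀ᶠ x in 𝓝 y, β x = 0) :
    dform β y = 0 := by
  have h1 : pull β y =ᶠ[𝓝 (chartAt ℂ y y)] fun _ => 0 := by
    filter_upwards [eventually_chart_symm (mem_chart_source ℂ y) h] with w hw
    have hw' : β ((chartAt ℂ y).symm w) = 0 := hw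
    rw [pull, hw', ContinuousLinearMap.zero_comp]
  rw [dform, curl_congr h1]
  simp [curl]

theorem dform_zero : dform (fun _ : M => (0 : ℂ →L[ℝ] ℂ)) = fun _ => 0 :=
  funext fun _ => dform_eq_zero (Filter.Eventually.of_forall fun _ => rfl)

theorem SmoothForm.sum {ι : Type*} (F : Finset ι) {β : ι → M → ℂ →L[ℝ] ℂ}
    (hβ : ∀ i, SmoothForm (β i)) :
    SmoothForm (fun y => ∑ i ∈ F, β i y) ∧
      dform (fun y => ∑ i ∈ F, β i y) = fun y => ∑ i ∈ F, dform (β i) y := by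
  classical
  induction F using Finset.induction_on with
  | empty => simpa using ⟨smoothForm_zero, dform_zero⟩
  | insert i F hi ih =>
    simp only [Finset.sum_insert hi]
    exact ⟨(hβ i).add ih.1, by rw [dform_add (hβ i) ih.1, ih.2]⟩

theorem SmoothDens.sum {ι : Type*} (F : Finset ι) {h : ι → M → ℂ} (hh : ∀ i, SmoothDens (h i)) :
    SmoothDens (fun y => ∑ i ∈ F, h i y) := by
  classical
  induction F using Finset.induction_on with
  | empty =>
    have := smoothForm_zero (M := M).smoothDens_dform
    rw [dform_zero] at this
    simpa using this
  | insert i F hi ih =>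
    simp only [Finset.sum_insert hi]
    exact (hh i).add ih

/-! ### Extension by zero from a chart -/

open Classical in
/-- The `1`-form on `M` given by `α` in the chart at `c`, extended by zero. -/
def extendForm (c : M) (α : ℂ → ℂ →L[ℝ] ℂ) (y : M) : ℂ →L[ℝ] ℂ :=
  if y ∈ (chartAt ℂ c).source then (α (chartAt ℂ c y)).comp (mfd (chartAt ℂ c) y) else 0

open Classical in
/-- The `2`-form on `M` with density `k` in the chart at `c`, extended by zero. -/
def extendDens (c : M) (k : ℂ → ℂ) (y : M) : ℂ :=
  if y ∈ (chartAt ℂ c).source then k (chartAt ℂ c y) * jac (mfd (chartAt ℂ c) y) else 0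

theorem pull_extendForm (c : M) (α : ℂ → ℂ →L[ℝ] ℂ) {z : ℂ} (hz : z ∈ (chartAt ℂ c).target) :
    pull (extendForm c α) c z = α z := by
  rw [pull, extendForm, if_pos ((chartAt ℂ c).map_target hz), (chartAt ℂ c).right_inv hz,
    ContinuousLinearMap.comp_assoc, mfd_chart_comp_dchart c hz, ContinuousLinearMap.comp_id]

theorem dens_extendDens (c : M) (k : ℂ → ℂ) {z : ℂ} (hz : z ∈ (chartAt ℂ c).target) :
    dens (extendDens c k) c z = k z := by
  rw [dens, extendDens, if_pos ((chartAt ℂ c).map_target hz), (chartAt ℂ c).right_inv hz,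
    mul_assoc, ← Complex.ofReal_mul, ← jac_comp, mfd_chart_comp_dchart c hz, jac_id,
    Complex.ofReal_one, mul_one]

variable [T2Space M]

theorem isClosed_symm_image (c : M) {K : Set ℂ} (hK : IsCompact K)
    (hKc : K ⊆ (chartAt ℂ c).target) : IsClosed ((chartAt ℂ c).symm '' K) :=
  (hK.image_of_continuousOn ((chartAt ℂ c).continuousOn_symm.mono hKc)).isClosed

theorem symm_image_subset (c : M) {K : Set ℂ} (hKc : K ⊆ (chartAt ℂ c).target) :
    (chartAt ℂ c).symm '' K ⊆ (chartAt ℂ c).source :=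
  image_subset_iff.2 fun _ hz => (chartAt ℂ c).map_target (hKc hz)

theorem chart_notMem_of_notMem_symm_image {c : M} {K : Set ℂ} {y : M}
    (hy : y ∈ (chartAt ℂ c).source) (h : y ∉ (chartAt ℂ c).symm '' K) : chartAt ℂ c y ∉ K :=
  fun hk => h ⟨_, hk, (chartAt ℂ c).left_inv hy⟩

theorem extendForm_eq_zero {c : M} {α : ℂ → ℂ →L[ℝ] ℂ} {K : Set ℂ} (h0 : ∀ z, z ∉ K → α z = 0)
    {y : M} (hy : y ∉ (chartAt ℂ c).symm '' K) : extendForm c α y = 0 := by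
  by_cases h : y ∈ (chartAt ℂ c).source
  · rw [extendForm, if_pos h, h0 _ (chart_notMem_of_notMem_symm_image h hy),
      ContinuousLinearMap.zero_comp]
  · rw [extendForm, if_neg h]

theorem extendDens_eq_zero {c : M} {k : ℂ → ℂ} {K : Set ℂ} (h0 : ∀ z, z ∉ K → k z = 0)
    {y : M} (hy : y ∉ (chartAt ℂ c).symm '' K) : extendDens c k y = 0 := by
  by_cases h : y ∈ (chartAt ℂ c).source
  · rw [extendDens, if_pos h, h0 _ (chart_notMem_of_notMem_symm_image h hy), zero_mul]
  · rw [extendDens, if_neg h]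

theorem smoothForm_extendForm {c : M} {α : ℂ → ℂ →L[ℝ] ℂ} (hα : ContDiff ℝ ∞ α) {K : Set ℂ}
    (hK : IsCompact K) (hKc : K ⊆ (chartAt ℂ c).target) (h0 : ∀ z, z ∉ K → α z = 0) :
    SmoothForm (extendForm c α) :=
  smoothForm_of_chart (isClosed_symm_image c hK hKc) (symm_image_subset c hKc)
    (fun _ hy => extendForm_eq_zero h0 hy)
    (hα.contDiffOn.congr fun _ hz => pull_extendForm c α hz)

theorem smoothDens_extendDens {c : M} {k : ℂ → ℂ} (hk : ContDiff ℝ ∞ k) {K : Set ℂ}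
    (hK : IsCompact K) (hKc : K ⊆ (chartAt ℂ c).target) (h0 : ∀ z, z ∉ K → k z = 0) :
    SmoothDens (extendDens c k) :=
  smoothDens_of_chart (isClosed_symm_image c hK hKc) (symm_image_subset c hKc)
    (fun _ hy => extendDens_eq_zero h0 hy)
    (hk.contDiffOn.congr fun _ hz => dens_extendDens c k hz)

theorem eq_of_dens_eq_of_vanishing {h k : M → ℂ} (c : M)
    (hh : ∀ y, y ∉ (chartAt ℂ c).source → h y = 0) (hk : ∀ y, y ∉ (chartAt ℂ c).source → k y = 0)
    (H : ∀ z ∈ (chartAt ℂ c).target, dens h c z = dens k c z) : h = k := by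
  funext y
  by_cases hy : y ∈ (chartAt ℂ c).source
  · have hj : jac (dchart c (chartAt ℂ c y)) ≠ 0 :=
      jac_ne_zero (isInvertible_dchart _ ((chartAt ℂ c).map_source hy))
    have h1 := H _ ((chartAt ℂ c).map_source hy)
    simp only [dens, (chartAt ℂ c).left_inv hy] at h1
    exact mul_right_cancel₀ (Complex.ofReal_ne_zero.2 hj) h1
  · rw [hh y hy, hk y hy]

end Forms

/-! ### Integration and the second de Rham cohomology group -/

section DeRham

open MeasureTheory

variable {M : Type*} [TopologicalSpace M] [ChartedSpace ℂ M] [IsManifold 𝓘(ℂ, ℂ) ω M]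
  [T2Space M] [CompactSpace M]

/-- The integral of the `2`-form with coefficient `h`. -/
def surfInt (ρ : SmoothPartitionOfUnity M 𝓘(ℝ, ℂ) M univ) (h : M → ℂ) : ℂ :=
  ∑ᶠ c : M, ∫ z in (chartAt ℂ c).target, (ρ c ((chartAt ℂ c).symm z) : ℂ) * dens h c z

section Partition

variable (ρ : SmoothPartitionOfUnity M 𝓘(ℝ, ℂ) M univ)

theorem finite_nonempty_support : {c : M | (Function.support (ρ c)).Nonempty}.Finite :=
  ρ.locallyFinite.finite_nonempty_of_compact

/-- The indices of the nonzero functions of a partition of unity on a compact surface. -/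
def activeIndices : Finset M := (finite_nonempty_support ρ).toFinset

theorem apply_eq_zero_of_notMem {c : M} (hc : c ∉ activeIndices ρ) (x : M) : ρ c x = 0 := by
  by_contra h
  exact hc ((finite_nonempty_support ρ).mem_toFinset.2 ⟨x, h⟩)

theorem sum_activeIndices (x : M) : ∑ c ∈ activeIndices ρ, (ρ c x : ℂ) = 1 := by
  have h := ρ.sum_eq_one (mem_univ x)
  rw [finsum_eq_sum_of_support_subset (s := activeIndices ρ) _ ?_] at h
  · exact_mod_cast h
  · intro c hc
    by_contra h'
    exact hc (apply_eq_zero_of_notMem ρ h' x)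

theorem contMDiff_partition (c : M) :
    ContMDiff 𝓘(ℝ, ℂ) 𝓘(ℝ, ℂ) ∞ (fun x => (ρ c x : ℂ)) :=
  Complex.ofRealCLM.contDiff.contMDiff.comp (ρ c).contMDiff

theorem surfInt_eq_sum (h : M → ℂ) : surfInt ρ h = ∑ c ∈ activeIndices ρ,
    ∫ z in (chartAt ℂ c).target, (ρ c ((chartAt ℂ c).symm z) : ℂ) * dens h c z := by
  rw [surfInt]
  refine finsum_eq_sum_of_support_subset _ fun c hc => ?_
  by_contra h'
  refine hc ?_
  simp [apply_eq_zero_of_notMem ρ h']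

variable {ρ}

theorem isCompact_chart_image {c : M} {K : Set M} (hK : IsClosed K)
    (hKc : K ⊆ (chartAt ℂ c).source) : IsCompact (chartAt ℂ c '' K) :=
  hK.isCompact.image_of_continuousOn ((chartAt ℂ c).continuousOn.mono hKc)

theorem chart_image_subset {c : M} {K : Set M} (hKc : K ⊆ (chartAt ℂ c).source) :
    chartAt ℂ c '' K ⊆ (chartAt ℂ c).target :=
  image_subset_iff.2 fun _ hy => (chartAt ℂ c).map_source (hKc hy)

theorem symm_notMem_of_notMem_image {c : M} {K : Set M} {z : ℂ} (hz : z ∈ (chartAt ℂ c).target)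
    (h : z ∉ chartAt ℂ c '' K) : (chartAt ℂ c).symm z ∉ K :=
  fun hk => h ⟨_, hk, (chartAt ℂ c).right_inv hz⟩

theorem integrableOn_partition (hρ : ρ.IsSubordinate (fun c => (chartAt ℂ c).source))
    {h : M → ℂ} (hh : SmoothDens h) (c : M) :
    IntegrableOn (fun z => (ρ c ((chartAt ℂ c).symm z) : ℂ) * dens h c z)
      (chartAt ℂ c).target := by
  refine integrableOn_of_vanishing (K := chartAt ℂ c '' tsupport (ρ c))
    (((contDiffOn_comp_chart_symm (contMDiff_partition ρ c) c).mul (hh c)).continuousOn)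
    (chartAt ℂ c).open_target (isCompact_chart_image (isClosed_tsupport _) (hρ c))
    (chart_image_subset (hρ c)) fun z hz hzK => ?_
  rw [image_eq_zero_of_notMem_tsupport (symm_notMem_of_notMem_image hz hzK)]
  simp

theorem surfInt_add (hρ : ρ.IsSubordinate (fun c => (chartAt ℂ c).source)) {h k : M → ℂ}
    (hh : SmoothDens h) (hk : SmoothDens k) :
    surfInt ρ (fun y => h y + k y) = surfInt ρ h + surfInt ρ k := by
  rw [surfInt_eq_sum, surfInt_eq_sum, surfInt_eq_sum, ← Finset.sum_add_distrib]
  refine Finset.sum_congr rfl fun c _ => ?_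
  rw [← integral_add (integrableOn_partition hρ hh c) (integrableOn_partition hρ hk c)]
  simp only [dens_add, mul_add]

theorem surfInt_const_mul (a : ℂ) (h : M → ℂ) :
    surfInt ρ (fun y => a * h y) = a * surfInt ρ h := by
  rw [surfInt_eq_sum, surfInt_eq_sum, Finset.mul_sum]
  refine Finset.sum_congr rfl fun c _ => ?_
  rw [← integral_const_mul]
  simp only [dens_mul (fun _ => a), mul_left_comm]

theorem surfInt_sum (hρ : ρ.IsSubordinate (fun c => (chartAt ℂ c).source)) {ι : Type*}
    (F : Finset ι) {h : ι → M → ℂ} (hh : ∀ i, SmoothDens (h i)) :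
    surfInt ρ (fun y => ∑ i ∈ F, h i y) = ∑ i ∈ F, surfInt ρ (h i) := by
  classical
  induction F using Finset.induction_on with
  | empty => simpa using surfInt_const_mul (ρ := ρ) 0 0
  | insert i F hi ih =>
    simp only [Finset.sum_insert hi]
    rw [surfInt_add hρ (hh i) (SmoothDens.sum F hh), ih]

/-- Both integrands vanish off the overlap, where the change of variables formula applies with a
nonnegative Jacobian. -/
theorem integral_chart_eq {h : M → ℂ} {f : M → ℂ} {c c' : M}
    (hf : ∀ y, y ∉ (chartAt ℂ c).source → f y = 0)
    (hh : ∀ y, y ∉ (chartAt ℂ c').source → h y = 0) :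
    ∫ z in (chartAt ℂ c).target, f ((chartAt ℂ c).symm z) * dens h c z =
      ∫ z in (chartAt ℂ c').target, f ((chartAt ℂ c').symm z) * dens h c' z := by
  have h1 : ∫ z in (chartAt ℂ c).target, f ((chartAt ℂ c).symm z) * dens h c z =
      ∫ z in overlap c c', f ((chartAt ℂ c).symm z) * dens h c z := by
    refine setIntegral_eq_of_subset_of_forall_sdiff_eq_zero
      (chartAt ℂ c).open_target.measurableSet inter_subset_left fun z hz => ?_
    rw [dens, hh _ fun hm => hz.2 ⟨hz.1, hm⟩, zero_mul, mul_zero]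
  have h2 : ∫ z in (chartAt ℂ c').target, f ((chartAt ℂ c').symm z) * dens h c' z =
      ∫ z in overlap c' c, f ((chartAt ℂ c').symm z) * dens h c' z := by
    refine setIntegral_eq_of_subset_of_forall_sdiff_eq_zero
      (chartAt ℂ c').open_target.measurableSet inter_subset_left fun z hz => ?_
    rw [hf _ fun hm => hz.2 ⟨hz.1, hm⟩, zero_mul]
  rw [h1, h2, ← image_chartChange c c', integral_image_eq_integral_abs_det_fderiv_smul volume
    (isOpen_overlap c c').measurableSet (fun z hz =>
      ((contDiffAt_chartChange hz).differentiableAt (by simp)).hasFDerivAt.hasFDerivWithinAt)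
    (injOn_chartChange c c')]
  refine setIntegral_congr_fun (isOpen_overlap c c').measurableSet fun z hz => ?_
  rw [det_eq_jac, abs_of_nonneg (jac_chartChange_nonneg hz), chartAt_symm_chartChange hz,
    dens_eq_mul h hz, Complex.real_smul]
  ring

/-- The integral of a `2`-form supported in a coordinate domain. -/
theorem surfInt_eq_integral (hρ : ρ.IsSubordinate (fun c => (chartAt ℂ c).source)) {h : M → ℂ}
    (hh : SmoothDens h) {c : M} {K : Set M} (hK : IsClosed K) (hKc : K ⊆ (chartAt ℂ c).source)
    (h0 : ∀ y, y ∉ K → h y = 0) :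
    surfInt ρ h = ∫ z in (chartAt ℂ c).target, dens h c z := by
  have h1 : ∀ i : M, ∫ z in (chartAt ℂ i).target, (ρ i ((chartAt ℂ i).symm z) : ℂ) * dens h i z =
      ∫ z in (chartAt ℂ c).target, (ρ i ((chartAt ℂ c).symm z) : ℂ) * dens h c z := fun i =>
    integral_chart_eq (f := fun y => (ρ i y : ℂ)) (fun y hy => by
      rw [image_eq_zero_of_notMem_tsupport fun hm => hy (hρ i hm), Complex.ofReal_zero])
      fun y hy => h0 y fun hm => hy (hKc hm)
  rw [surfInt_eq_sum]
  simp only [h1]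
  rw [← integral_finsetSum]
  · simp only [← Finset.sum_mul, sum_activeIndices, one_mul]
  · intro i _
    refine integrableOn_of_vanishing (K := chartAt ℂ c '' K)
      (((contDiffOn_comp_chart_symm (contMDiff_partition ρ i) c).mul (hh c)).continuousOn)
      (chartAt ℂ c).open_target (isCompact_chart_image hK hKc)
      (chart_image_subset hKc) fun z hz hzK => ?_
    rw [dens, h0 _ (symm_notMem_of_notMem_image hz hzK)]
    simp

/-- **Stokes' theorem** on a compact surface. -/
theorem surfInt_dform (hρ : ρ.IsSubordinate (fun c => (chartAt ℂ c).source))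
    {β : M → ℂ →L[ℝ] ℂ} (hβ : SmoothForm β) : surfInt ρ (dform β) = 0 := by
  have hs : ∀ c, SmoothForm (fun y => (ρ c y : ℂ) • β y) := fun c =>
    hβ.smul (contMDiff_partition ρ c)
  -- A partition of unity reduces the theorem to forms with compact support in one chart, where it
  -- is the planar statement `integral_curl_eq_zero`.
  have e : β = fun y => ∑ c ∈ activeIndices ρ, (ρ c y : ℂ) • β y := by
    funext y
    rw [← Finset.sum_smul, sum_activeIndices, one_smul]
  rw [e, (SmoothForm.sum _ hs).2, surfInt_sum hρ _ fun c => (hs c).smoothDens_dform]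
  refine Finset.sum_eq_zero fun c _ => ?_
  have hcpt := isCompact_chart_image (isClosed_tsupport (ρ c)) (hρ c)
  have h0 : ∀ z ∈ (chartAt ℂ c).target, z ∉ chartAt ℂ c '' tsupport (ρ c) →
      pull (fun y => (ρ c y : ℂ) • β y) c z = 0 := fun z hz hzK => by
    rw [pull_smul, image_eq_zero_of_notMem_tsupport (symm_notMem_of_notMem_image hz hzK),
      Complex.ofReal_zero]
    ext1 v
    exact zero_mul _
  have hind := contDiff_indicator (hs c c) (chartAt ℂ c).open_target hcpt.isClosed
    (chart_image_subset (hρ c)) h0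
  have hvan : ∀ z, z ∉ chartAt ℂ c '' tsupport (ρ c) →
      (chartAt ℂ c).target.indicator (pull (fun y => (ρ c y : ℂ) • β y) c) z = 0 := fun z hz => by
    by_cases hzT : z ∈ (chartAt ℂ c).target
    · rw [indicator_of_mem hzT, h0 z hzT hz]
    · rw [indicator_of_notMem hzT]
  rw [surfInt_eq_integral hρ (hs c).smoothDens_dform (isClosed_tsupport (ρ c)) (hρ c) fun y hy =>
      dform_eq_zero ?_, ← integral_curl_eq_zero hind (HasCompactSupport.intro hcpt hvan),
    ← setIntegral_eq_integral_of_forall_compl_eq_zero (s := (chartAt ℂ c).target)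
      (f := curl ((chartAt ℂ c).target.indicator (pull (fun y => (ρ c y : ℂ) • β y) c)))]
  · refine setIntegral_congr_fun (chartAt ℂ c).open_target.measurableSet fun z hz => ?_
    rw [(hs c).dens_dform c hz]
    refine curl_congr ?_
    filter_upwards [(chartAt ℂ c).open_target.mem_nhds hz] with w hw
    rw [indicator_of_mem hw]
  · intro z hz
    have : (chartAt ℂ c).target.indicator (pull (fun y => (ρ c y : ℂ) • β y) c)
        =ᶠ[𝓝 z] fun _ => 0 := by
      filter_upwards [hcpt.isClosed.isOpen_compl.mem_nhds
        fun h => hz (chart_image_subset (hρ c) h)] with w hw using hvan w hw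
    rw [curl_congr this]
    simp [curl]
  · filter_upwards [(isClosed_tsupport (ρ c)).isOpen_compl.mem_nhds hy] with x hx
    rw [image_eq_zero_of_notMem_tsupport hx, Complex.ofReal_zero]
    ext1 v
    exact zero_mul _

end Partition

/-- Equality in the second de Rham cohomology group. -/
def Cohomologous (h k : M → ℂ) : Prop :=
  ∃ β : M → ℂ →L[ℝ] ℂ, SmoothForm β ∧ h = fun y => k y + dform β y

theorem Cohomologous.trans_const_mul {h k l : M → ℂ} {a b : ℂ}
    (h1 : Cohomologous h (fun y => a * k y)) (h2 : Cohomologous k (fun y => b * l y)) :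
    Cohomologous h (fun y => (a * b) * l y) := by
  obtain ⟨β, hβ, rfl⟩ := h1
  obtain ⟨γ, hγ, rfl⟩ := h2
  have hs : SmoothForm (fun y => a • γ y) := hγ.smul contMDiff_const
  refine ⟨_, hs.add hβ, ?_⟩
  rw [dform_add hs hβ, dform_const_smul hγ]
  funext y
  ring

theorem exists_cohomologous_sum {ι : Type*} (F : Finset ι) {h : ι → M → ℂ} {l : M → ℂ}
    (hh : ∀ i, ∃ a : ℂ, Cohomologous (h i) (fun y => a * l y)) :
    ∃ a : ℂ, Cohomologous (fun y => ∑ i ∈ F, h i y) (fun y => a * l y) := by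
  choose a β hβ e using hh
  refine ⟨∑ i ∈ F, a i, _, (SmoothForm.sum F hβ).1, ?_⟩
  rw [(SmoothForm.sum F hβ).2]
  funext y
  beta_reduce
  rw [Finset.sum_mul, ← Finset.sum_add_distrib]
  exact Finset.sum_congr rfl fun i _ => congrFun (e i) y

theorem exists_box {T : Set ℂ} (hT : IsOpen T) {z : ℂ} (hz : z ∈ T) :
    ∃ ε > 0, Icc (z.re - ε) (z.re + ε) ×ℂ Icc (z.im - ε) (z.im + ε) ⊆ T := by
  obtain ⟨δ, hδ, hb⟩ := Metric.isOpen_iff.1 hT z hz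
  refine ⟨δ / 4, by positivity, fun w hw => hb ?_⟩
  obtain ⟨h1, h2⟩ := Complex.mem_reProdIm.1 hw
  rw [Metric.mem_ball, dist_eq_norm]
  refine (Complex.norm_le_abs_re_add_abs_im _).trans_lt ?_
  have e1 : |(w - z).re| ≤ δ / 4 := by
    rw [Complex.sub_re, abs_le]; constructor <;> linarith [h1.1, h1.2]
  have e2 : |(w - z).im| ≤ δ / 4 := by
    rw [Complex.sub_im, abs_le]; constructor <;> linarith [h2.1, h2.2]
  linarith

/-- Near every point, each smooth `2`-form supported there is cohomologous to a multiple of a bump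
form of integral one, supported near an arbitrary nearby point. -/
theorem exists_local_cohomology (x : M) : ∃ U : Set M, IsOpen U ∧ x ∈ U ∧ ∀ y ∈ U, ∀ V ∈ 𝓝 y,
    ∃ l : M → ℂ, SmoothDens l ∧ (∀ w, w ∉ V → l w = 0) ∧
      (∀ ρ : SmoothPartitionOfUnity M 𝓘(ℝ, ℂ) M univ,
        ρ.IsSubordinate (fun c => (chartAt ℂ c).source) → surfInt ρ l = 1) ∧
      ∀ h : M → ℂ, SmoothDens h → (∀ w, w ∉ U → h w = 0) →
        ∃ a : ℂ, Cohomologous h (fun y => a * l y) := by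
  obtain ⟨ε, hε, hbox⟩ := exists_box (chartAt ℂ x).open_target (mem_chart_target ℂ x)
  set K : Set ℂ := Icc ((chartAt ℂ x x).re - ε) ((chartAt ℂ x x).re + ε) ×ℂ
    Icc ((chartAt ℂ x x).im - ε) ((chartAt ℂ x x).im + ε) with hKdef
  have hK : IsCompact K := isCompact_Icc.reProdIm isCompact_Icc
  have hKi : IsOpen (interior K) := isOpen_interior
  have hUs : ∀ w, w ∉ (chartAt ℂ x).source ∩ chartAt ℂ x ⁻¹' interior K →
      w ∈ (chartAt ℂ x).source → chartAt ℂ x w ∉ interior K := fun w hw hs hm => hw ⟨hs, hm⟩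
  refine ⟨(chartAt ℂ x).source ∩ chartAt ℂ x ⁻¹' interior K,
    (chartAt ℂ x).isOpen_inter_preimage hKi, ⟨mem_chart_source ℂ x, ?_⟩, ?_⟩
  · rw [mem_preimage, hKdef, Complex.interior_reProdIm, interior_Icc, interior_Icc]
    exact Complex.mem_reProdIm.2 ⟨⟨by linarith, by linarith⟩, ⟨by linarith, by linarith⟩⟩
  rintro y ⟨hyx, hyK⟩ V hV
  have hN : interior K ∩ (chartAt ℂ x).symm ⁻¹' V ∈ 𝓝 (chartAt ℂ x y) :=
    Filter.inter_mem (hKi.mem_nhds hyK) (eventually_chart_symm hyx hV)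
  obtain ⟨δ, hδ, hball⟩ := Metric.nhds_basis_closedBall.mem_iff.1 hN
  let f : ContDiffBump (chartAt ℂ x y) := ⟨δ / 2, δ, by positivity, by linarith⟩
  let k : ℂ → ℂ := fun z => (f.normed volume z : ℂ)
  have hk : ContDiff ℝ ∞ k := Complex.ofRealCLM.contDiff.comp (f.contDiff_normed (n := ⊤))
  have hk0 : ∀ z, z ∉ Metric.closedBall (chartAt ℂ x y) δ → k z = 0 := fun z hz => by
    have : z ∉ Function.support (f.normed volume) := by
      rw [f.support_normed_eq]
      exact fun h => hz (Metric.ball_subset_closedBall h)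
    simp [k, Function.notMem_support.1 this]
  have hkK : ∀ z, z ∉ K → k z = 0 := fun z hz =>
    hk0 z fun h => hz (interior_subset (hball h).1)
  have hki : ∫ z, k z = 1 := by
    simp only [k]
    rw [integral_complex_ofReal, f.integral_normed, Complex.ofReal_one]
  have hls := smoothDens_extendDens (c := x) hk hK hbox hkK
  have hoff : ∀ w, w ∉ (chartAt ℂ x).symm '' K → extendDens x k w = 0 := fun w hw =>
    extendDens_eq_zero hkK hw
  refine ⟨extendDens x k, hls, fun w hw => ?_, fun ρ hρ => ?_, fun h hh hhU => ?_⟩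
  · refine extendDens_eq_zero hk0 ?_
    rintro ⟨z, hz, rfl⟩
    exact hw (hball hz).2
  · rw [surfInt_eq_integral hρ hls (isClosed_symm_image x hK hbox) (symm_image_subset x hbox) hoff,
      ← hki, ← setIntegral_eq_integral_of_forall_compl_eq_zero (s := (chartAt ℂ x).target)
        fun z hz => hkK z fun h => hz (hbox h)]
    exact setIntegral_congr_fun (chartAt ℂ x).open_target.measurableSet
      fun z hz => dens_extendDens x k hz
  · have hh0 : ∀ z ∈ (chartAt ℂ x).target, z ∉ K → dens h x z = 0 := fun z hz hzK => by
      rw [dens, hhU _ fun hm => hzK ?_, zero_mul]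
      have := hm.2
      rw [mem_preimage, (chartAt ℂ x).right_inv hz] at this
      exact interior_subset this
    have hg := contDiff_indicator (hh x) (chartAt ℂ x).open_target hK.isClosed hbox hh0
    set g : ℂ → ℂ := (chartAt ℂ x).target.indicator (dens h x) with hgdef
    have hg0 : ∀ z, z ∉ K → g z = 0 := fun z hz => by
      by_cases hzT : z ∈ (chartAt ℂ x).target
      · rw [hgdef, indicator_of_mem hzT, hh0 z hzT hz]
      · rw [hgdef, indicator_of_notMem hzT]
    have hki' : Integrable k := hk.continuous.integrable_of_hasCompactSupport
      (HasCompactSupport.intro hK hkK)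
    have hgi : Integrable g := hg.continuous.integrable_of_hasCompactSupport
      (HasCompactSupport.intro hK hg0)
    -- Subtracting the multiple of the bump with the same integral leaves a form of integral zero in
    -- the box, which has a primitive supported there.
    obtain ⟨α, hα, hα0, hαc⟩ := exists_planar_primitive
      (h := fun z => g z - (∫ w, g w) * k z) (hg.sub (contDiff_const.mul hk))
      (by linarith : (chartAt ℂ x x).re - ε < (chartAt ℂ x x).re + ε)
      (fun z hz => by rw [hg0 z hz, hkK z hz, mul_zero, sub_zero])
      (by rw [integral_sub hgi (hki'.const_mul _), integral_const_mul, hki, mul_one, sub_self])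
    have hβ := smoothForm_extendForm (c := x) hα hK hbox hα0
    refine ⟨∫ w, g w, extendForm x α, hβ, ?_⟩
    have hsrc : ∀ w, w ∉ (chartAt ℂ x).source → w ∉ (chartAt ℂ x).symm '' K := fun w hw hm =>
      hw (symm_image_subset x hbox hm)
    refine eq_of_dens_eq_of_vanishing x (fun w hw => hhU w fun hm => hw hm.1) (fun w hw => ?_)
      fun z hz => ?_
    · beta_reduce
      rw [hoff w (hsrc w hw), mul_zero, zero_add]
      refine dform_eq_zero ?_
      filter_upwards [(isClosed_symm_image x hK hbox).isOpen_compl.mem_nhds (hsrc w hw)] with v hv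
      exact extendForm_eq_zero hα0 hv
    · have h1 : curl (pull (extendForm x α) x) z = curl α z := by
        refine curl_congr ?_
        filter_upwards [(chartAt ℂ x).open_target.mem_nhds hz] with w hw using
          pull_extendForm x α hw
      rw [dens_add, dens_mul (fun _ => _), dens_extendDens x k hz, hβ.dens_dform x hz, h1, hαc,
        hgdef, indicator_of_mem hz]
      ring

variable [ConnectedSpace M]

variable (M) in
/-- The second de Rham cohomology group of a compact connected surface is at most one-dimensional,
and integration is injective on it. -/
theorem exists_generator : ∃ l : M → ℂ, SmoothDens l ∧
    (∀ ρ : SmoothPartitionOfUnity M 𝓘(ℝ, ℂ) M univ,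
      ρ.IsSubordinate (fun c => (chartAt ℂ c).source) → surfInt ρ l = 1) ∧
    ∀ h : M → ℂ, SmoothDens h → ∃ a : ℂ, Cohomologous h (fun y => a * l y) := by
  obtain ⟨x₀⟩ : Nonempty M := inferInstance
  obtain ⟨U₀, hU₀, hx₀, H₀⟩ := exists_local_cohomology x₀
  obtain ⟨l, hl, -, hl1, hlc⟩ := H₀ x₀ hx₀ univ Filter.univ_mem
  refine ⟨l, hl, hl1, ?_⟩
  -- The points near which every supported form is a multiple of `l` in cohomology. The set is open
  -- by its form, nonempty by the choice of `l`, and closed by comparison with bumps.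
  let S : Set M := {x | ∃ U : Set M, IsOpen U ∧ x ∈ U ∧ ∀ h : M → ℂ, SmoothDens h →
    (∀ w, w ∉ U → h w = 0) → ∃ a : ℂ, Cohomologous h (fun y => a * l y)}
  have hSo : IsOpen S := by
    rw [isOpen_iff_mem_nhds]
    rintro x ⟨U, hU, hx, H⟩
    filter_upwards [hU.mem_nhds hx] with y hy using ⟨U, hU, hy, H⟩
  have hSc : IsClosed S := by
    refine isClosed_of_closure_subset fun x hx => ?_
    obtain ⟨U, hU, hxU, H⟩ := exists_local_cohomology x
    obtain ⟨y, hyU, ⟨V, hV, hyV, HV⟩⟩ := mem_closure_iff.1 hx U hU hxU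
    -- The bump form is placed in `U ∩ V`: forms supported in `U` reduce to it, and it reduces to
    -- `l` because its support lies in `V`.
    obtain ⟨l', hl', hl'0, -, H'⟩ := H y hyU V (hV.mem_nhds hyV)
    obtain ⟨b, hb⟩ := HV l' hl' hl'0
    refine ⟨U, hU, hxU, fun h hh hhU => ?_⟩
    obtain ⟨a, ha⟩ := H' h hh hhU
    exact ⟨a * b, ha.trans_const_mul hb⟩
  have hS : S = univ := IsClopen.eq_univ ⟨hSc, hSo⟩ ⟨x₀, U₀, hU₀, hx₀, hlc⟩
  have hall : ∀ x : M, x ∈ S := fun x => hS ▸ mem_univ x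
  choose U hU hxU HU using hall
  obtain ⟨ρ, hρ⟩ := SmoothPartitionOfUnity.exists_isSubordinate 𝓘(ℝ, ℂ) (isClosed_univ (X := M)) U
    hU (fun x _ => mem_iUnion.2 ⟨x, hxU x⟩)
  intro h hh
  have e : h = fun y => ∑ c ∈ activeIndices ρ, (ρ c y : ℂ) * h y := by
    funext y
    rw [← Finset.sum_mul, sum_activeIndices, one_mul]
  rw [e]
  refine exists_cohomologous_sum _ fun c => ?_
  refine HU c _ (hh.mul (contMDiff_partition ρ c)) fun w hw => ?_
  rw [image_eq_zero_of_notMem_tsupport fun hm => hw (hρ c hm), Complex.ofReal_zero, zero_mul]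

/-- By Stokes' theorem the coefficient of the generator is the integral. Two partitions of unity
occur because the two degrees may be computed with different ones. -/
theorem cohomologous_of_surfInt_eq {h k : M → ℂ} (hh : SmoothDens h) (hk : SmoothDens k)
    {ρ ρ' : SmoothPartitionOfUnity M 𝓘(ℝ, ℂ) M univ}
    (hρ : ρ.IsSubordinate (fun c => (chartAt ℂ c).source))
    (hρ' : ρ'.IsSubordinate (fun c => (chartAt ℂ c).source))
    (heq : surfInt ρ h = surfInt ρ' k) : Cohomologous h k := by
  obtain ⟨l, hl, hl1, H⟩ := exists_generator M
  have key : ∀ (f : M → ℂ) (ρ : SmoothPartitionOfUnity M 𝓘(ℝ, ℂ) M univ),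
      ρ.IsSubordinate (fun c => (chartAt ℂ c).source) → SmoothDens f →
      Cohomologous f (fun y => surfInt ρ f * l y) := by
    intro f ρ hρ hf
    obtain ⟨a, β, hβ, rfl⟩ := H f hf
    refine ⟨β, hβ, ?_⟩
    rw [surfInt_add hρ (hl.const_mul a) hβ.smoothDens_dform, surfInt_const_mul, hl1 ρ hρ,
      surfInt_dform hρ hβ, mul_one, add_zero]
  obtain ⟨β, hβ, e1⟩ := key h ρ hρ hh
  obtain ⟨γ, hγ, e2⟩ := key k ρ' hρ' hk
  have hs : SmoothForm (fun y => (-1 : ℂ) • γ y) := hγ.smul contMDiff_const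
  refine ⟨_, hβ.add hs, ?_⟩
  rw [dform_add hβ hs, dform_const_smul hγ]
  funext y
  have h1 := congrFun e1 y
  have h2 := congrFun e2 y
  beta_reduce at h1 h2 ⊢
  rw [h1, h2, heq]
  ring

end DeRham

/-! ### Curvature forms of connections of the same degree -/

section Degree

open MeasureTheory

variable {M : Type*} [TopologicalSpace M] [ChartedSpace ℂ M] [IsManifold 𝓘(ℂ, ℂ) ω M]
  [T2Space M] [CompactSpace M]
  {r : ℕ} {E : M → Type*} [TopologicalSpace (TotalSpace (Cn r) E)]
  [∀ x, NormedAddCommGroup (E x)] [∀ x, InnerProductSpace ℂ (E x)]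
  [FiberBundle (Cn r) E] [VectorBundle ℂ (Cn r) E] [VectorBundle ℝ (Cn r) E]
  [ContMDiffVectorBundle ∞ (Cn r) E 𝓘(ℝ, ℂ)]
  {L : M → Type*} [TopologicalSpace (TotalSpace (Cn 1) L)]
  [∀ x, NormedAddCommGroup (L x)] [∀ x, InnerProductSpace ℂ (L x)]
  [FiberBundle (Cn 1) L] [VectorBundle ℂ (Cn 1) L] [VectorBundle ℝ (Cn 1) L]
  [ContMDiffVectorBundle ∞ (Cn 1) L 𝓘(ℝ, ℂ)]

/-- The coefficient of the `2`-form `tr F_A`. -/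
def UnitaryConnection.curvCoef (A : UnitaryConnection r E) (y : M) : ℂ :=
  A.traceCurvature y (1 : ℂ) Complex.I

/-- The curvature is alternating, so evaluating on the images of `1` and `I` under `dchart`
multiplies the coefficient by the Jacobian. -/
theorem UnitaryConnection.dens_curvCoef (A : UnitaryConnection r E) (c : M) {z : ℂ}
    (hz : z ∈ (chartAt ℂ c).target) :
    dens A.curvCoef c z = chartDensity A.traceCurvature c z := by
  have hz' := mem_chartDom_trivializationAt (r := r) E c hz
  have h1 := A.traceCurvature_eq c _ hz'
  obtain ⟨D, hD⟩ := isInvertible_dchart c hz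
  have h2 := area_map (dchart c z) (D.symm 1) (D.symm Complex.I)
  have h3 := h1 (D.symm 1) (D.symm Complex.I)
  have e1 : dchart c z (D.symm 1) = 1 := by rw [← hD]; simp
  have e2 : dchart c z (D.symm Complex.I) = Complex.I := by rw [← hD]; simp
  rw [e1, e2, area_one_I] at h2
  rw [e1, e2, planarCurv_eq_area, map_smul, ← h1] at h3
  rw [dens, UnitaryConnection.curvCoef, h3, Complex.real_smul, mul_right_comm,
    ← Complex.ofReal_mul, mul_comm (area _ _), ← h2, Complex.ofReal_one, one_mul]
  rfl

theorem UnitaryConnection.smoothDens_curvCoef (A : UnitaryConnection r E) :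
    SmoothDens A.curvCoef := by
  intro c z hz
  have hz' := mem_chartDom_trivializationAt (r := r) E c hz
  have ho := isOpen_chartDom c (trivializationAt (Cn r) E ((chartAt ℂ c).symm z))
  have h := (contDiffOn_curl ho (A.contDiffOn_trR_connForm c _)).contDiffAt (ho.mem_nhds hz')
  refine (h.congr_of_eventuallyEq ?_).contDiffWithinAt
  filter_upwards [ho.mem_nhds hz'] with w hw
  rw [A.dens_curvCoef c hw.1, A.chartDensity_traceCurvature_eq c _ hw]

theorem UnitaryConnection.surfaceIntegral_traceCurvature (A : UnitaryConnection r E)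
    (ρ : SmoothPartitionOfUnity M 𝓘(ℝ, ℂ) M univ) :
    surfaceIntegral ρ A.traceCurvature = surfInt ρ A.curvCoef := by
  refine finsum_congr fun c => ?_
  refine setIntegral_congr_fun (chartAt ℂ c).open_target.measurableSet fun z hz => ?_
  rw [A.dens_curvCoef c hz]

/-- The curvatures of connections on bundles of the same degree differ by an exact form. -/
theorem exists_primitive_of_degree_eq [ConnectedSpace M] {d : ℤ} (hE : HasDegree r E d)
    (hL : HasDegree 1 L d) : ∃ B : UnitaryConnection 1 L, ∀ A : UnitaryConnection r E,
      ∃ β : M → ℂ →L[ℝ] ℂ, SmoothForm β ∧ ∀ c, ∀ z ∈ (chartAt ℂ c).target,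
        chartDensity A.traceCurvature c z =
          chartDensity B.traceCurvature c z + curl (pull β c) z := by
  obtain ⟨A₀, ρ, hρ, h1⟩ := hE
  obtain ⟨B, ρ', hρ', h2⟩ := hL
  have hc : Complex.I / (2 * (Real.pi : ℂ)) ≠ 0 :=
    div_ne_zero Complex.I_ne_zero (mul_ne_zero two_ne_zero (by exact_mod_cast Real.pi_ne_zero))
  have h3 := mul_left_cancel₀ hc (h1.trans h2.symm)
  rw [A₀.surfaceIntegral_traceCurvature, B.surfaceIntegral_traceCurvature] at h3
  obtain ⟨γ, hγ, e⟩ := cohomologous_of_surfInt_eq A₀.smoothDens_curvCoef B.smoothDens_curvCoef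
    hρ hρ' h3
  -- The degree of `E` is given by some connection `A₀`; the passage to an arbitrary `A` costs the
  -- exact form `d tr (A - A₀)`.
  refine ⟨B, fun A => ⟨_, (UnitaryConnection.smoothForm_traceDiff A A₀).add hγ, fun c z hz => ?_⟩⟩
  have hs := UnitaryConnection.smoothForm_traceDiff A A₀
  rw [← (hs.add hγ).dens_dform c hz, dform_add hs hγ, dens_add, hs.dens_dform c hz,
    ← UnitaryConnection.chartDensity_traceCurvature_sub A A₀ c hz, ← A₀.dens_curvCoef c hz, e,
    dens_add, B.dens_curvCoef c hz]
  ring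

/-- The projection of the complex numbers to the imaginary axis. -/
def imagPart : ℂ →L[ℝ] ℂ := (scaleForm (Complex.ofRealCLM.comp Complex.imCLM)) Complex.I

theorem imagPart_apply (w : ℂ) : imagPart w = Complex.I * w.im := rfl

theorem imagPart_eq_self {w : ℂ} (hw : w.re = 0) : imagPart w = w := by
  rw [imagPart_apply]
  apply Complex.ext <;> simp [hw]

theorem pull_imagPart (β : M → ℂ →L[ℝ] ℂ) (c : M) (z : ℂ) :
    pull (fun y => imagPart.comp (β y)) c z = imagPart.comp (pull β c z) := by
  rw [pull, pull, ContinuousLinearMap.comp_assoc]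

theorem SmoothForm.imagPart {β : M → ℂ →L[ℝ] ℂ} (hβ : SmoothForm β) :
    SmoothForm (fun y => imagPart.comp (β y)) := fun c => by
  simp only [funext (pull_imagPart β c)]
  exact contDiffOn_const.clm_comp (hβ c)

theorem SmoothForm.curl_imagPart {β : M → ℂ →L[ℝ] ℂ} (hβ : SmoothForm β) (c : M) {z : ℂ}
    (hz : z ∈ (chartAt ℂ c).target) :
    curl (pull (fun y => RealNS.imagPart.comp (β y)) c) z =
      RealNS.imagPart (curl (pull β c) z) := by
  have h1 : HasFDerivAt (fun z => RealNS.imagPart.comp (pull β c z)) _ z :=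
    (ContinuousLinearMap.compL ℝ ℂ ℂ ℂ RealNS.imagPart).hasFDerivAt.comp z
      (hβ.differentiableAt c hz).hasFDerivAt
  rw [funext (pull_imagPart β c), curl, curl, h1.fderiv, map_sub]
  rfl

/-- An imaginary `1`-form correcting the curvature of a connection on `L` to `r κ`. -/
theorem exists_imaginary_form [ConnectedSpace M] [IsSmoothHermitian r E] [IsSmoothHermitian 1 L]
    (hr : 0 < r) {d : ℤ} (hE : HasDegree r E d) (hL : HasDegree 1 L d)
    {κ : ∀ x : M, TangentSpace 𝓘(ℝ, ℂ) x → TangentSpace 𝓘(ℝ, ℂ) x → ℂ}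
    {A : UnitaryConnection r E} (hA : A.HasCentralCurvature κ) :
    ∃ (B : UnitaryConnection 1 L) (β : M → ℂ →L[ℝ] ℂ), SmoothForm β ∧
      (∀ x v, (β x v).re = 0) ∧ ∀ c, ∀ z ∈ (chartAt ℂ c).target,
        r * chartDensity κ c z = chartDensity B.traceCurvature c z + curl (pull β c) z := by
  obtain ⟨B, hB⟩ := exists_primitive_of_degree_eq hE hL
  obtain ⟨β, hβ, e⟩ := hB A
  -- Both curvatures are imaginary, so `dβ` is too, and replacing `β` by its imaginary part does not
  -- change it. An imaginary form is needed to keep the connection on `L` metric.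
  refine ⟨B, fun y => imagPart.comp (β y), hβ.imagPart, fun x v => ?_, fun c z hz => ?_⟩
  · rw [ContinuousLinearMap.comp_apply, imagPart_apply]
    simp
  · have h1 : chartDensity A.traceCurvature c z = r * chartDensity κ c z :=
      hA.traceCurvature_eq _ _ _
    have h2 : (chartDensity κ c z).re = 0 :=
      A.re_eq_zero_of_central hr c _ (UnitaryConnection.mem_chartDom_trivializationAt (r := r) E c hz)
        fun u => hA.planarCurv_apply c _ (UnitaryConnection.mem_chartDom_trivializationAt (r := r) E c hz) 1
          Complex.I u
    have h3 : (chartDensity B.traceCurvature c z).re = 0 :=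
      B.re_eq_zero_of_central one_pos c _ (UnitaryConnection.mem_chartDom_trivializationAt (r := 1) L c hz)
        fun u => B.hasCentralCurvature_of_rank_one c _
          (UnitaryConnection.mem_chartDom_trivializationAt (r := 1) L c hz) u
    have h4 := e c z hz
    rw [h1] at h4
    rw [hβ.curl_imagPart c hz, imagPart_eq_self, h4]
    have h5 := congrArg Complex.re h4
    rw [Complex.add_re, h3, Complex.mul_re, h2] at h5
    simpa using h5.symm

/-- An auxiliary Real connection on `L`, which trivializes all Galois-invariant connections with
central curvature `κ` locally. -/
theorem exists_auxiliary_connection [ConnectedSpace M] [IsSmoothHermitian r E]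
    [IsSmoothHermitian 1 L] {σ : M → M} (hσ : IsRealStructure σ) (hr : 0 < r) {c : ℤˣ}
    (τ : RealQuatStructure r E σ c) (τL : RealQuatStructure 1 L σ 1)
    {d : ℤ} (hE : HasDegree r E d) (hL : HasDegree 1 L d)
    {κ : ∀ x : M, TangentSpace 𝓘(ℝ, ℂ) x → TangentSpace 𝓘(ℝ, ℂ) x → ℂ}
    {A₀ : UnitaryConnection r E} (hA₀ : A₀.IsGaloisInvariant τ)
    (hκ₀ : A₀.HasCentralCurvature κ) :
    ∃ B : MetricConnection 1 L, ConjRel hσ τL B B ∧ HasContinuousForms B ∧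
      ∀ A : UnitaryConnection r E, A.IsGaloisInvariant τ → A.HasCentralCurvature κ →
        Nonempty (FlatAtlas A.toMetric B) := by
  obtain ⟨B₀, β, hβs, hβ, e⟩ := exists_imaginary_form hr hE hL hκ₀
  have hrC : (r : ℂ) ≠ 0 := by exact_mod_cast hr.ne'
  set B' := B₀.toMetric.addForm β hβ with hB'
  -- The curvature identity involves `κ` only, so the connection built from `A₀` serves every `A`
  -- with the same central curvature.
  have hpair : ∀ A : UnitaryConnection r E, A.HasCentralCurvature κ → ∀ x : M, ∃ O : Set M,
      IsOpen O ∧ x ∈ O ∧ O ⊆ (chartAt ℂ x).source ∧ ∃ P : FlatPair A.toMetric B' O,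
        ∃ Θ : ℂ → ℂ →L[ℝ] ℂ,
          ContinuousOn Θ ((chartAt ℂ x).target ∩ (chartAt ℂ x).symm ⁻¹' O) ∧
          ∀ z ∈ (chartAt ℂ x).target ∩ (chartAt ℂ x).symm ⁻¹' O, ∀ a,
            B'.form P.s ((chartAt ℂ x).symm z) (dchart x z a) = Θ z a := by
    intro A hA x
    refine exists_flatPair hr A B₀ hβs hβ x fun z hz u => ?_
    rw [hA.planarCurv_apply x _ hz, ← e x z hz.1, mul_div_cancel_left₀ _ hrC]
    rfl
  have havg : ∀ A : UnitaryConnection r E, A.IsGaloisInvariant τ → A.HasCentralCurvature κ →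
      ∀ x : M, ∃ O : Set M, IsOpen O ∧ x ∈ O ∧ O ⊆ (chartAt ℂ x).source ∧
        ∃ P : FlatPair A.toMetric (B'.average (B'.conjugate hσ τL)) O, ∃ Θ : ℂ → ℂ →L[ℝ] ℂ,
          ContinuousOn Θ ((chartAt ℂ x).target ∩ (chartAt ℂ x).symm ⁻¹' O) ∧
          ∀ z ∈ (chartAt ℂ x).target ∩ (chartAt ℂ x).symm ⁻¹' O, ∀ a,
            (B'.average (B'.conjugate hσ τL)).form P.s ((chartAt ℂ x).symm z) (dchart x z a) =
              Θ z a := by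
    intro A hA hκ x
    obtain ⟨O₁, hO₁, hx₁, hs₁, P₁, Θ, hΘ, hΘs⟩ := hpair A hκ x
    obtain ⟨O₂, hO₂, hx₂, -, P₂, -⟩ := hpair A hκ (σ x)
    -- A pair at `σ x`, conjugated, is a pair at `x` for the conjugate connection; Galois invariance
    -- of `A` is used here. The averaged pair has the connection form of `P₁`, so its continuity is
    -- inherited.
    obtain ⟨O, hO, hx, hsub, P, hP⟩ := FlatPair.exists_average hr P₁
      (P₂.conjugate hσ τ τL (hA.conjRel hσ τ) (B'.conjRel_conjugate hσ τL)) hO₁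
      (hO₂.preimage hσ.smooth.continuous) hx₁ hx₂
    refine ⟨O, hO, hx, hsub.trans hs₁, P, Θ,
      hΘ.mono (inter_subset_inter_right _ (preimage_mono hsub)), fun z hz a => ?_⟩
    rw [hP _ hz.2]
    exact hΘs z ⟨hz.1, hsub hz.2⟩ a
  refine ⟨B'.average (B'.conjugate hσ τL), B'.conjRel_average hσ τL, fun x => ?_,
    fun A hA hκ => ?_⟩
  · obtain ⟨O, hO, hx, hs, P, H⟩ := havg A₀ hA₀ hκ₀ x
    exact ⟨O, hO, hx, hs, P.s, P.diff_s, P.norm_s, H⟩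
  · choose O hO hx _ P _ using havg A hA hκ
    exact ⟨⟨O, hO, hx, P⟩⟩

end Degree

end RealNS

end

theorem mainTheorem7
    -- a compact connected Klein surface `(M, σ)`
    {M : Type*} [TopologicalSpace M] [T2Space M] [CompactSpace M] [ConnectedSpace M]
    [ChartedSpace ℂ M] [IsManifold 𝓘(ℂ, ℂ) ω M]
    (σ : M → M) (hσ : IsRealStructure σ)
    -- a Real (`c = 1`) or Quaternionic (`c = -1`) Hermitian vector bundle `(E, τ)` of rank `r`
    (r : ℕ) (hr : 0 < r) (c : ℤˣ)
    (E : M → Type*) [TopologicalSpace (TotalSpace (Cn r) E)]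
    [∀ x, NormedAddCommGroup (E x)] [∀ x, InnerProductSpace ℂ (E x)]
    [FiberBundle (Cn r) E] [VectorBundle ℂ (Cn r) E] [VectorBundle ℝ (Cn r) E]
    [ContMDiffVectorBundle ∞ (Cn r) E 𝓘(ℝ, ℂ)] [IsSmoothHermitian r E]
    (τ : RealQuatStructure r E σ c)
    -- a Real line bundle `(L, τ_L)`, with a `τ_L`-invariant Hermitian metric
    (L : M → Type*) [TopologicalSpace (TotalSpace (Cn 1) L)]
    [∀ x, NormedAddCommGroup (L x)] [∀ x, InnerProductSpace ℂ (L x)]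
    [FiberBundle (Cn 1) L] [VectorBundle ℂ (Cn 1) L] [VectorBundle ℝ (Cn 1) L]
    [ContMDiffVectorBundle ∞ (Cn 1) L 𝓘(ℝ, ℂ)] [IsSmoothHermitian 1 L]
    (τL : RealQuatStructure 1 L σ 1)
    -- of the same degree
    (d : ℤ) (hE : HasDegree r E d) (hL : HasDegree 1 L d)
    -- a base point of `S(L) × EΣ`
    (p : Seifert L) (e : SInf)
    -- the central curvature of the projectively flat connections under consideration
    (κ : ∀ x : M, TangentSpace 𝓘(ℝ, ℂ) x → TangentSpace 𝓘(ℝ, ℂ) x → ℂ) :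
    ∃ (z : ∀ s : ℤˣ, Path (p, e) (diagAct (seifertInv τL) s (p, e)) → Circle)
      (χ : (E p.1.proj ≃ₗᵢ[ℂ] Cn r) →
        {A : UnitaryConnection r E // A.IsGaloisInvariant τ ∧ A.HasCentralCurvature κ} →
        (OrbPi1 (seifertInv τL) (seifertInv_involutive τL) (p, e) →* ExtUnitary r c)),
      (∀ b A,
        -- `χ_A` is a homomorphism of `Σ`-augmentations
        (∀ a, (χ b A a).sgn = augmentation (seifertInv τL) (seifertInv_involutive τL) a) ∧
        -- `n ∈ ℤ = π₁(fibre)` acts by `exp(2πin/r)`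
        (∀ n : ℤ, χ b A (orbClass (seifertInv τL) (seifertInv_involutive τL)
            (fibreLoop τL p e) ^ n) =
          ⟨scalarU r (Circle.exp (2 * Real.pi * n / r)), 1⟩) ∧
        -- `χ_A` is induced by the extended holonomy of `A`
        (∀ (s : ℤˣ) (η : Path (p, e) (diagAct (seifertInv τL) s (p, e))),
          IsPiecewiseC1 (baseCurve η) →
          ∃ g : U r, A.1.IsExtendedHolonomy τ b (baseCurve η) s g ∧
            χ b A (orbClass (seifertInv τL) (seifertInv_involutive τL) η) =
              ⟨scalarU r (z s η) * g, s⟩)) ∧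
      -- the conjugacy class of `χ_A` only depends on the gauge orbit of `A`
      (∀ b b' A A', GaugeEquivalent τ A.1 A'.1 →
        ∃ h : U r, ∀ a, χ b' A' a = ⟨h, 1⟩ * χ b A a * (⟨h, 1⟩ : ExtUnitary r c)⁻¹) := by
  -- The auxiliary connection on `L` is built from one connection `A₀` with curvature `κ`. If there
  -- is none, all conditions on `χ` are vacuous and any choice of `z` will do.
  by_cases hne : ∃ A : UnitaryConnection r E, A.IsGaloisInvariant τ ∧ A.HasCentralCurvature κ
  · obtain ⟨A₀, hA₀, hκ₀⟩ := hne
    obtain ⟨B, hB, hBf, hD⟩ := exists_auxiliary_connection hσ hr τ τL hE hL hA₀ hκ₀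
    exact exists_characters hσ hr hB hBf κ hD
  · exact ⟨fun _ _ => 1, fun _ _ => 1, fun _ A => (hne ⟨A.1, A.2⟩).elim,
      fun _ _ A => (hne ⟨A.1, A.2⟩).elim⟩
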